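/- Let $p,q\ge 2$ and let $M$ be a (Hausdorff, second countable) complex manifold of dimension $pq$ with a $(p,q)$ paraconformal structure, i.e. holomorphic vector bundles $U,V$ on $M$ of ranks $p,q$ and a holomorphic isomorphism $\alpha:TM\to U\otimes V$. Assume given a holomorphic isomorphism $\Lambda^pU\cong\Lambda^qV$ and a scale, i.e. a non-vanishing holomorphic section $\epsilon$ of $\Lambda^pU$, with corresponding section $\epsilon'$ of $\Lambda^qV$. Let $\nabla$ be the holomorphic connections on $U$ and $V$ determined by the scale: $\nabla\epsilon=\nabla\epsilon'=0$, and all traces (over one $U$-index or over one $V$-index) of the torsion $\mathbf T$ of the induced connection on $TM$ vanish. Let $\mathbf T^+$ be the component of $\mathbf T$ in $TM\otimes\Lambda^2U^*\otimes S^2V^*$, and let $W^+$ be the trace-free part of the total symmetrization in the three covariant $V$-indices of the curvature of $\nabla$ on $V$, a section of $\Lambda^2U^*\otimes V\otimes S^3V^*$. Suppose that the structure is right-flat: $\mathbf T^+=0$ if $p>2$, and $W^+=0$ if $p=2$. Let $P(V)\to M$ be the projectivised bundle, and let $T\subset T(P(V))$ be the distribution which at a line $[\pi]\in P(V_x)$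 is spanned by the horizontal lifts, for the connection on $V$, of the tangent vectors $\alpha^{-1}(u\otimes\pi)$, $u\in U_x$. Let $Z$ be the quotient of $P(V)$ by the leaves of $T$ (points joined by chains of holomorphic discs tangent to $T$ are identified), with the quotient topology. Then: 1. $T$ is an integrable distribution of $p$-planes: locally it is the kernel of the differential of a holomorphic submersion to $\mathbb C^{(p+1)(q-1)}$. 2. Assume that there is nothing globally pathological about this quotient, in the following sense: (a) each point of $P(V)$ has arbitrarily small open neighbourhoods $S$ such that each leaf of $T$ meets $S$ in at most one leaf of $T|_S$; (b) $Z$ is Hausdorff; (c) no leaf meets a fibre of $P(V)\to M$ in more than one point. Then $Z$ carries the structure of a (Hausdorff, second countable) complex manifold of dimension $(p+1)(q-1)$ for which $P(V)\to Z$ is a holomorphic submersion whose differential has kernel $T$. For each $x\in M$ the map $P_{q-1}\cong P(V_x)\to Z$ is a holomorphic embedding, and its normal bundle $N$ and conormal bundle $N^*$ satisfy, as holomorphic vector bundles on $P_{q-1}$, $$N\cong\Bigl(\bigoplus_1^pH^{-1}\Bigr)\otimes T(P_{q-1}),\qquad N^*\cong\bigoplus_1^p\Omega^1(1),$$ where $H^{-1}$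 is the tautological line bundle, $H$ its dual, and $\Omega^1(1)=\Omega^1\otimes H$. -/

import Mathlib

open Set Filter Topology Bundle TensorProduct
open scoped Manifold ContDiff LinearAlgebra.Projectivization

noncomputable section

set_option linter.unusedSectionVars false
set_option linter.unusedVariables false

/-! ### Affine coordinates on projective spaces -/

/-- An enumeration of the `q - 1` indices different from `i`. -/
def otherIndex {q : ℕ} (i : Fin q) : Fin (q - 1) ≃ {j : Fin q // j ≠ i} :=
  Fintype.equivOfCardEq (by simp)

/-- The affine coordinates `(w_j / w_i)_{j ≠ i}` of the line spanned by `w`. -/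
def affCoord {q : ℕ} (i : Fin q) (w : Fin q → ℂ) : Fin (q - 1) → ℂ :=
  fun k => w (otherIndex i k) / w i

/-- The vector with `i`-th entry `1` and remaining entries `l`. -/
def affVec {q : ℕ} (i : Fin q) (l : Fin (q - 1) → ℂ) : Fin q → ℂ :=
  fun j => if h : j = i then 1 else l ((otherIndex i).symm ⟨j, h⟩)

lemma affVec_self {q : ℕ} (i : Fin q) (l : Fin (q - 1) → ℂ) : affVec i l i = 1 := by
  simp [affVec]

lemma affVec_ne_zero {q : ℕ} (i : Fin q) (l : Fin (q - 1) → ℂ) : affVec i l ≠ 0 := by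
  intro h
  have := congrFun h i
  simp [affVec_self] at this

lemma affCoord_affVec {q : ℕ} (i : Fin q) (l : Fin (q - 1) → ℂ) :
    affCoord i (affVec i l) = l := by
  funext k
  have h : ((otherIndex i k : {j : Fin q // j ≠ i}) : Fin q) ≠ i := (otherIndex i k).2
  simp [affCoord, affVec, h]

lemma affVec_affCoord {q : ℕ} (i : Fin q) (w : Fin q → ℂ) (hw : w i ≠ 0) :
    affVec i (affCoord i w) = (w i)⁻¹ • w := by
  funext j
  by_cases h : j = i
  · subst h; simp [affVec, hw]
  · simp [affVec, affCoord, h, div_eq_inv_mul]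

lemma affCoord_smul {q : ℕ} (i : Fin q) (w : Fin q → ℂ) {c : ℂ} (hc : c ≠ 0) :
    affCoord i (c • w) = affCoord i w := by
  funext k
  simp [affCoord, mul_div_mul_left _ _ hc]

lemma contDiff_affVec {q : ℕ} (i : Fin q) : ContDiff ℂ ω (affVec i) := by
  rw [contDiff_pi]
  intro j
  by_cases h : j = i
  · simp only [affVec, h, dite_true]; exact contDiff_const
  · simp only [affVec, h, dite_false]; exact contDiff_apply _ _ _

lemma contDiffOn_affCoord {q : ℕ} (i : Fin q) :
    ContDiffOn ℂ ω (affCoord i) {w | w i ≠ 0} := by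
  rw [contDiffOn_pi]
  intro k
  exact ((contDiff_apply _ _ _).contDiffOn).div ((contDiff_apply _ _ _).contDiffOn) (fun w hw => hw)

lemma exists_smul_rep {W : Type*} [AddCommGroup W] [Module ℂ W] (v : W) (hv : v ≠ 0) :
    ∃ c : ℂ, c ≠ 0 ∧ (Projectivization.mk ℂ v hv).rep = c • v := by
  obtain ⟨a, ha⟩ := Projectivization.exists_smul_eq_mk_rep ℂ v hv
  exact ⟨a, a.ne_zero, by rw [← ha]; rfl⟩

lemma exists_coord_ne_zero {q : ℕ} {w : Fin q → ℂ} (hw : w ≠ 0) : ∃ i, w i ≠ 0 :=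
  Function.ne_iff.mp hw

/-! ### The complex projective space `P_{q-1}` -/

/-- The standard affine chart `{w_i ≠ 0}` of `P_{q-1}`. -/
def affChart {q : ℕ} (i : Fin q) : PartialEquiv (ℙ ℂ (Fin q → ℂ)) (Fin (q - 1) → ℂ) where
  toFun z := affCoord i z.rep
  invFun l := Projectivization.mk ℂ (affVec i l) (affVec_ne_zero i l)
  source := {z | z.rep i ≠ 0}
  target := univ
  map_source' _ _ := mem_univ _
  map_target' l _ := by
    obtain ⟨c, hc, h⟩ := exists_smul_rep _ (affVec_ne_zero i l)
    simp [h, hc, affVec_self]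
  left_inv' z hz := by
    conv_rhs => rw [← z.mk_rep]
    rw [Projectivization.mk_eq_mk_iff']
    exact ⟨(z.rep i)⁻¹, (affVec_affCoord i _ hz).symm⟩
  right_inv' l _ := by
    obtain ⟨c, hc, h⟩ := exists_smul_rep _ (affVec_ne_zero i l)
    rw [h, affCoord_smul _ _ hc, affCoord_affVec]

lemma affChart_trans_source {q : ℕ} (i j : Fin q) :
    ((affChart i).symm.trans (affChart j)).source = {l | affVec i l j ≠ 0} := by
  ext l
  obtain ⟨c, hc, h⟩ := exists_smul_rep _ (affVec_ne_zero i l)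
  simp [PartialEquiv.trans_source, affChart, h, hc]

lemma affChart_trans_apply {q : ℕ} (i j : Fin q) (l : Fin (q - 1) → ℂ) :
    (affChart i).symm.trans (affChart j) l = affCoord j (affVec i l) := by
  obtain ⟨c, hc, h⟩ := exists_smul_rep _ (affVec_ne_zero i l)
  simp [affChart, h, affCoord_smul _ _ hc]

lemma contDiffOn_affChart_trans {q : ℕ} (i j : Fin q) :
    ContDiffOn ℂ ω ((affChart i).symm.trans (affChart j))
      ((affChart i).symm.trans (affChart j)).source := by
  rw [affChart_trans_source]
  exact ((contDiffOn_affCoord j).comp (contDiff_affVec i).contDiffOn (fun l hl => hl)).congr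
    (fun l _ => affChart_trans_apply i j l)

def projSpaceCore (q : ℕ) : ChartedSpaceCore (Fin (q - 1) → ℂ) (ℙ ℂ (Fin q → ℂ)) where
  atlas := range affChart
  chartAt z := affChart (exists_coord_ne_zero z.rep_nonzero).choose
  mem_chart_source z := (exists_coord_ne_zero z.rep_nonzero).choose_spec
  chart_mem_atlas z := mem_range_self _
  open_source := by
    rintro _ _ ⟨i, rfl⟩ ⟨j, rfl⟩
    rw [affChart_trans_source]
    exact isOpen_ne_fun ((continuous_apply j).comp (contDiff_affVec i).continuous) continuous_const
  continuousOn_toFun := by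
    rintro _ _ ⟨i, rfl⟩ ⟨j, rfl⟩
    exact (contDiffOn_affChart_trans i j).continuousOn

instance instTopologicalSpaceProjSpace (q : ℕ) : TopologicalSpace (ℙ ℂ (Fin q → ℂ)) :=
  (projSpaceCore q).toTopologicalSpace

instance instChartedSpaceProjSpace (q : ℕ) :
    ChartedSpace (Fin (q - 1) → ℂ) (ℙ ℂ (Fin q → ℂ)) :=
  (projSpaceCore q).toChartedSpace

instance instIsManifoldProjSpace (q : ℕ) :
    IsManifold 𝓘(ℂ, Fin (q - 1) → ℂ) ω (ℙ ℂ (Fin q → ℂ)) := by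
  apply isManifold_of_contDiffOn
  intro e e' he he'
  obtain ⟨_, ⟨_, rfl⟩, _, ⟨⟨i, rfl⟩, rfl⟩, rfl⟩ := he
  obtain ⟨_, ⟨_, rfl⟩, _, ⟨⟨j, rfl⟩, rfl⟩, rfl⟩ := he'
  have := contDiffOn_affChart_trans i j
  simp only [modelWithCornersSelf_coe, modelWithCornersSelf_coe_symm, range_id, inter_univ,
    preimage_id, Function.comp_id, Function.id_comp]
  exact this

/-! ### The projectivised bundle `P(V)` -/

/-- The total space of the projectivisation of a family `V` of vector spaces over `M`.
The numbers `n` and `q` record the dimension of `M` and the rank of `V`. -/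
@[ext]
structure ProjBundle (n q : ℕ) {M : Type*} (V : M → Type*)
    [∀ x, AddCommGroup (V x)] [∀ x, Module ℂ (V x)] where
  base : M
  line : ℙ ℂ (V base)

namespace ProjBundle

variable {n q : ℕ} {M : Type*} [TopologicalSpace M] [ChartedSpace (Fin n → ℂ) M]
  {V : M → Type*} [TopologicalSpace (TotalSpace (Fin q → ℂ) V)]
  [∀ x, AddCommGroup (V x)] [∀ x, Module ℂ (V x)] [∀ x, TopologicalSpace (V x)]
  [FiberBundle (Fin q → ℂ) V] [VectorBundle ℂ (Fin q → ℂ) V]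


lemma symm_affVec_ne_zero (e : Trivialization (Fin q → ℂ) (π (Fin q → ℂ) V)) [e.IsLinear ℂ]
    {x : M} (hx : x ∈ e.baseSet) (i : Fin q) (l : Fin (q - 1) → ℂ) :
    e.symmₗ ℂ x (affVec i l) ≠ 0 := by
  intro h
  have h' := e.linearMapAt_symmₗ (R := ℂ) hx (affVec i l)
  rw [h, map_zero] at h'
  exact affVec_ne_zero i l h'.symm

lemma linearMapAt_rep (e : Trivialization (Fin q → ℂ) (π (Fin q → ℂ) V)) [e.IsLinear ℂ]
    (e' : Trivialization (Fin q → ℂ) (π (Fin q → ℂ) V)) [e'.IsLinear ℂ]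
    {x : M} (w : Fin q → ℂ) (h : e.symmₗ ℂ x w ≠ 0) :
    ∃ c : ℂ, c ≠ 0 ∧ e'.linearMapAt ℂ x (Projectivization.mk ℂ _ h).rep =
      c • e'.linearMapAt ℂ x (e.symmₗ ℂ x w) := by
  obtain ⟨c, hc, hr⟩ := exists_smul_rep _ h
  exact ⟨c, hc, by rw [hr, map_smul]⟩

open Classical in
/-- The chart of `P(V)` given by the preferred chart of `M` and the preferred trivialisation of `V`
at the base point of `z₀`, and the affine chart `{w_i ≠ 0}` of `P_{q-1}`. -/
def chart (z₀ : ProjBundle n q V) (i : Fin q) :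
    PartialEquiv (ProjBundle n q V) ((Fin n → ℂ) × (Fin (q - 1) → ℂ)) where
  toFun z := (chartAt (Fin n → ℂ) z₀.base z.base,
    affCoord i ((trivializationAt (Fin q → ℂ) V z₀.base).linearMapAt ℂ z.base z.line.rep))
  invFun a :=
    if h : (trivializationAt (Fin q → ℂ) V z₀.base).symmₗ ℂ
        ((chartAt (Fin n → ℂ) z₀.base).symm a.1) (affVec i a.2) ≠ 0
    then ⟨(chartAt (Fin n → ℂ) z₀.base).symm a.1, Projectivization.mk ℂ _ h⟩
    else z₀
  source := {z | z.base ∈ (chartAt (Fin n → ℂ) z₀.base).source ∧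
    z.base ∈ (trivializationAt (Fin q → ℂ) V z₀.base).baseSet ∧
    (trivializationAt (Fin q → ℂ) V z₀.base).linearMapAt ℂ z.base z.line.rep i ≠ 0}
  target := {a | a.1 ∈ (chartAt (Fin n → ℂ) z₀.base).target ∧
    (chartAt (Fin n → ℂ) z₀.base).symm a.1 ∈ (trivializationAt (Fin q → ℂ) V z₀.base).baseSet}
  map_source' := by
    rintro ⟨x, z⟩ ⟨h1, h2, h3⟩
    refine ⟨(chartAt (Fin n → ℂ) z₀.base).map_source h1, ?_⟩
    change (chartAt (Fin n → ℂ) z₀.base).symm (chartAt (Fin n → ℂ) z₀.base x) ∈ _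
    rwa [(chartAt (Fin n → ℂ) z₀.base).left_inv h1]
  map_target' := by
    rintro ⟨a, l⟩ ⟨h1, h2⟩
    have h := symm_affVec_ne_zero (trivializationAt (Fin q → ℂ) V z₀.base) h2 i l
    obtain ⟨c, hc, hr⟩ := linearMapAt_rep (trivializationAt (Fin q → ℂ) V z₀.base)
      (trivializationAt (Fin q → ℂ) V z₀.base) (affVec i l) h
    rw [dif_pos h]
    refine ⟨(chartAt (Fin n → ℂ) z₀.base).map_target h1, h2, ?_⟩
    rw [hr, Trivialization.linearMapAt_symmₗ _ h2]
    simp [hc, affVec_self]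
  left_inv' := by
    rintro ⟨x, z⟩ ⟨h1, h2, h3⟩
    dsimp only at h1 h2 h3 ⊢
    have key : (trivializationAt (Fin q → ℂ) V z₀.base).symmₗ ℂ x (affVec i (affCoord i
        ((trivializationAt (Fin q → ℂ) V z₀.base).linearMapAt ℂ x z.rep))) =
        ((trivializationAt (Fin q → ℂ) V z₀.base).linearMapAt ℂ x z.rep i)⁻¹ • z.rep := by
      rw [affVec_affCoord i _ h3, map_smul, Trivialization.symmₗ_linearMapAt _ h2]
    have hx : (chartAt (Fin n → ℂ) z₀.base).symm (chartAt (Fin n → ℂ) z₀.base x) = x :=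
      (chartAt (Fin n → ℂ) z₀.base).left_inv h1
    generalize (chartAt (Fin n → ℂ) z₀.base).symm (chartAt (Fin n → ℂ) z₀.base x) = y at hx ⊢
    subst hx
    rw [dif_pos (symm_affVec_ne_zero _ h2 i _)]
    congr 1
    conv_rhs => rw [← z.mk_rep]
    rw [Projectivization.mk_eq_mk_iff']
    exact ⟨_, key.symm⟩
  right_inv' := by
    rintro ⟨a, l⟩ ⟨h1, h2⟩
    have h := symm_affVec_ne_zero (trivializationAt (Fin q → ℂ) V z₀.base) h2 i l
    obtain ⟨c, hc, hr⟩ := linearMapAt_rep (trivializationAt (Fin q → ℂ) V z₀.base)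
      (trivializationAt (Fin q → ℂ) V z₀.base) (affVec i l) h
    dsimp only at h1 h2 h hr ⊢
    rw [dif_pos h]
    dsimp only
    rw [hr, affCoord_smul _ _ hc, Trivialization.linearMapAt_symmₗ _ h2, affCoord_affVec,
      (chartAt (Fin n → ℂ) z₀.base).right_inv h1]

/-- The domain of the transition map between two charts of `P(V)`. -/
def transDomain (z₀ z₁ : ProjBundle n q V) : Set (Fin n → ℂ) :=
  ((chartAt (Fin n → ℂ) z₀.base).symm.trans (chartAt (Fin n → ℂ) z₁.base)).source ∩
  ((chartAt (Fin n → ℂ) z₀.base).target ∩ (chartAt (Fin n → ℂ) z₀.base).symm ⁻¹'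
    ((trivializationAt (Fin q → ℂ) V z₀.base).baseSet ∩
      (trivializationAt (Fin q → ℂ) V z₁.base).baseSet))

/-- The transition function of `V` between two preferred trivialisations, in a chart of `M`. -/
def transMat (z₀ z₁ : ProjBundle n q V) (a : Fin n → ℂ) : (Fin q → ℂ) →L[ℂ] (Fin q → ℂ) :=
  (trivializationAt (Fin q → ℂ) V z₀.base).coordChangeL ℂ
    (trivializationAt (Fin q → ℂ) V z₁.base) ((chartAt (Fin n → ℂ) z₀.base).symm a)

lemma isOpen_transDomain (z₀ z₁ : ProjBundle n q V) : IsOpen (transDomain z₀ z₁) :=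
  ((chartAt (Fin n → ℂ) z₀.base).symm.trans (chartAt (Fin n → ℂ) z₁.base)).open_source.inter
    ((chartAt (Fin n → ℂ) z₀.base).symm.isOpen_inter_preimage
      ((trivializationAt (Fin q → ℂ) V z₀.base).open_baseSet.inter
        (trivializationAt (Fin q → ℂ) V z₁.base).open_baseSet))

lemma transMat_apply (z₀ z₁ : ProjBundle n q V) {a : Fin n → ℂ} (ha : a ∈ transDomain z₀ z₁)
    (w : Fin q → ℂ) : transMat z₀ z₁ a w =
      (trivializationAt (Fin q → ℂ) V z₁.base).linearMapAt ℂ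
        ((chartAt (Fin n → ℂ) z₀.base).symm a)
        ((trivializationAt (Fin q → ℂ) V z₀.base).symmₗ ℂ
          ((chartAt (Fin n → ℂ) z₀.base).symm a) w) := by
  obtain ⟨-, -, h0, h1⟩ := ha
  rw [Trivialization.coe_linearMapAt_of_mem _ h1]
  simp only [transMat, ContinuousLinearEquiv.coe_coe]
  rw [Trivialization.coordChangeL_apply _ _ ⟨h0, h1⟩, Trivialization.symmₗ_apply _ h0]

lemma chart_symm (z₀ : ProjBundle n q V) (i : Fin q)
    {a : (Fin n → ℂ) × (Fin (q - 1) → ℂ)}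
    (ha : (chartAt (Fin n → ℂ) z₀.base).symm a.1 ∈
      (trivializationAt (Fin q → ℂ) V z₀.base).baseSet) :
    (chart z₀ i).symm a = ⟨(chartAt (Fin n → ℂ) z₀.base).symm a.1,
      Projectivization.mk ℂ _ (symm_affVec_ne_zero _ ha i a.2)⟩ :=
  dif_pos (symm_affVec_ne_zero _ ha i a.2)

lemma chart_trans_source (z₀ z₁ : ProjBundle n q V) (i j : Fin q) :
    ((chart z₀ i).symm.trans (chart z₁ j)).source =
      {a | a.1 ∈ transDomain z₀ z₁ ∧ transMat z₀ z₁ a.1 (affVec i a.2) j ≠ 0} := by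
  ext a
  rw [PartialEquiv.trans_source]
  constructor
  · rintro ⟨⟨h1, h2⟩, h3⟩
    rw [mem_preimage, chart_symm z₀ i h2] at h3
    obtain ⟨h4, h5, h6⟩ := h3
    dsimp only at h4 h5 h6
    have hd : a.1 ∈ transDomain z₀ z₁ := ⟨by
      rw [OpenPartialHomeomorph.trans_source]; exact ⟨h1, h4⟩, h1, h2, h5⟩
    refine ⟨hd, ?_⟩
    obtain ⟨c, hc, hr⟩ := linearMapAt_rep _ (trivializationAt (Fin q → ℂ) V z₁.base) (affVec i a.2)
      (symm_affVec_ne_zero (trivializationAt (Fin q → ℂ) V z₀.base) h2 i a.2)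
    rw [hr] at h6
    rw [transMat_apply _ _ hd]
    intro h0
    apply h6
    rw [Pi.smul_apply, h0, smul_zero]
  · rintro ⟨hd, h6⟩
    have hd' := hd
    obtain ⟨h4, h1, h2, h5⟩ := hd'
    rw [OpenPartialHomeomorph.trans_source] at h4
    refine ⟨⟨h1, h2⟩, ?_⟩
    rw [mem_preimage, chart_symm z₀ i h2]
    refine ⟨h4.2, h5, ?_⟩
    obtain ⟨c, hc, hr⟩ := linearMapAt_rep _ (trivializationAt (Fin q → ℂ) V z₁.base) (affVec i a.2)
      (symm_affVec_ne_zero (trivializationAt (Fin q → ℂ) V z₀.base) h2 i a.2)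
    rw [hr, Pi.smul_apply, smul_eq_mul]
    rw [transMat_apply _ _ hd] at h6
    exact mul_ne_zero hc h6

lemma chart_trans_apply (z₀ z₁ : ProjBundle n q V) (i j : Fin q)
    {a : (Fin n → ℂ) × (Fin (q - 1) → ℂ)} (hd : a.1 ∈ transDomain z₀ z₁) :
    (chart z₀ i).symm.trans (chart z₁ j) a =
      ((chartAt (Fin n → ℂ) z₀.base).symm.trans (chartAt (Fin n → ℂ) z₁.base) a.1,
        affCoord j (transMat z₀ z₁ a.1 (affVec i a.2))) := by
  have h2 := hd.2.2.1
  obtain ⟨c, hc, hr⟩ := linearMapAt_rep _ (trivializationAt (Fin q → ℂ) V z₁.base) (affVec i a.2)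
      (symm_affVec_ne_zero (trivializationAt (Fin q → ℂ) V z₀.base) h2 i a.2)
  change chart z₁ j ((chart z₀ i).symm a) = _
  rw [chart_symm z₀ i h2, transMat_apply _ _ hd]
  refine Prod.ext rfl ?_
  change affCoord j ((trivializationAt (Fin q → ℂ) V z₁.base).linearMapAt ℂ _
    (Projectivization.mk ℂ _ _).rep) = _
  rw [hr, affCoord_smul _ _ hc]

section

variable [IsManifold 𝓘(ℂ, Fin n → ℂ) ω M]
  [ContMDiffVectorBundle ω (Fin q → ℂ) V 𝓘(ℂ, Fin n → ℂ)]

lemma contDiffOn_transMat (z₀ z₁ : ProjBundle n q V) :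
    ContDiffOn ℂ ω (transMat z₀ z₁) (transDomain z₀ z₁) := by
  rw [← contMDiffOn_iff_contDiffOn]
  have h1 := contMDiffOn_coordChangeL (𝕜 := ℂ) (n := ω) (IB := 𝓘(ℂ, Fin n → ℂ))
    (trivializationAt (Fin q → ℂ) V z₀.base) (trivializationAt (Fin q → ℂ) V z₁.base)
  have h2 := contMDiffOn_chart_symm (I := 𝓘(ℂ, Fin n → ℂ)) (n := ω) (x := z₀.base)
  exact h1.comp (h2.mono fun a ha => ha.2.1) fun a ha => ha.2.2

lemma contDiffOn_transChart (z₀ z₁ : ProjBundle n q V) :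
    ContDiffOn ℂ ω ((chartAt (Fin n → ℂ) z₀.base).symm.trans (chartAt (Fin n → ℂ) z₁.base))
      (transDomain z₀ z₁) := by
  rw [← contMDiffOn_iff_contDiffOn]
  have h1 := contMDiffOn_chart (I := 𝓘(ℂ, Fin n → ℂ)) (n := ω) (x := z₁.base)
  have h2 := contMDiffOn_chart_symm (I := 𝓘(ℂ, Fin n → ℂ)) (n := ω) (x := z₀.base)
  exact h1.comp (h2.mono fun a ha => ha.2.1) fun a ha => by
    have := ha.1
    rw [OpenPartialHomeomorph.trans_source] at this
    exact this.2

lemma contDiffOn_transVec (z₀ z₁ : ProjBundle n q V) (i : Fin q) :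
    ContDiffOn ℂ ω (fun a : (Fin n → ℂ) × (Fin (q - 1) → ℂ) =>
      transMat z₀ z₁ a.1 (affVec i a.2)) {a | a.1 ∈ transDomain z₀ z₁} :=
  ((contDiffOn_transMat z₀ z₁).comp contDiffOn_fst (fun a ha => ha)).clm_apply
    ((contDiff_affVec i).comp contDiff_snd).contDiffOn

lemma contDiffOn_chart_trans (z₀ z₁ : ProjBundle n q V) (i j : Fin q) :
    ContDiffOn ℂ ω ((chart z₀ i).symm.trans (chart z₁ j))
      ((chart z₀ i).symm.trans (chart z₁ j)).source := by
  rw [chart_trans_source]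
  refine ContDiffOn.congr (f := fun a => ((chartAt (Fin n → ℂ) z₀.base).symm.trans
    (chartAt (Fin n → ℂ) z₁.base) a.1, affCoord j (transMat z₀ z₁ a.1 (affVec i a.2)))) ?_
    fun a ha => chart_trans_apply z₀ z₁ i j ha.1
  refine ContDiffOn.prodMk
    ((contDiffOn_transChart z₀ z₁).comp contDiffOn_fst (fun a ha => ha.1)) ?_
  exact (contDiffOn_affCoord j).comp ((contDiffOn_transVec z₀ z₁ i).mono fun a ha => ha.1)
    fun a ha => ha.2

lemma isOpen_chart_trans_source (z₀ z₁ : ProjBundle n q V) (i j : Fin q) :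
    IsOpen ((chart z₀ i).symm.trans (chart z₁ j)).source := by
  rw [chart_trans_source]
  have hc : ContinuousOn (fun a : (Fin n → ℂ) × (Fin (q - 1) → ℂ) =>
      transMat z₀ z₁ a.1 (affVec i a.2) j) {a | a.1 ∈ transDomain z₀ z₁} :=
    (continuous_apply j).comp_continuousOn (contDiffOn_transVec z₀ z₁ i).continuousOn
  exact hc.isOpen_inter_preimage ((isOpen_transDomain z₀ z₁).preimage continuous_fst)
    (isOpen_ne (x := (0 : ℂ)))

lemma exists_mem_chart_source (z : ProjBundle n q V) : ∃ i, z ∈ (chart z i).source := by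
  have hx := FiberBundle.mem_baseSet_trivializationAt' (F := Fin q → ℂ) (E := V) z.base
  have h : (trivializationAt (Fin q → ℂ) V z.base).linearMapAt ℂ z.base z.line.rep ≠ 0 := by
    intro h0
    apply z.line.rep_nonzero
    rw [← (trivializationAt (Fin q → ℂ) V z.base).symmₗ_linearMapAt (R := ℂ) hx z.line.rep, h0,
      map_zero]
  obtain ⟨i, hi⟩ := exists_coord_ne_zero h
  exact ⟨i, mem_chart_source _ _, hx, hi⟩

variable (n q V) in
def core : ChartedSpaceCore ((Fin n → ℂ) × (Fin (q - 1) → ℂ)) (ProjBundle n q V) where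
  atlas := range fun a : ProjBundle n q V × Fin q => chart a.1 a.2
  chartAt z := chart z (exists_mem_chart_source z).choose
  mem_chart_source z := (exists_mem_chart_source z).choose_spec
  chart_mem_atlas z := ⟨(z, _), rfl⟩
  open_source := by
    rintro _ _ ⟨⟨z₀, i⟩, rfl⟩ ⟨⟨z₁, j⟩, rfl⟩
    exact isOpen_chart_trans_source z₀ z₁ i j
  continuousOn_toFun := by
    rintro _ _ ⟨⟨z₀, i⟩, rfl⟩ ⟨⟨z₁, j⟩, rfl⟩
    exact (contDiffOn_chart_trans z₀ z₁ i j).continuousOn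

instance : TopologicalSpace (ProjBundle n q V) := (core n q V).toTopologicalSpace

instance : ChartedSpace ((Fin n → ℂ) × (Fin (q - 1) → ℂ)) (ProjBundle n q V) :=
  (core n q V).toChartedSpace

instance : IsManifold 𝓘(ℂ, (Fin n → ℂ) × (Fin (q - 1) → ℂ)) ω (ProjBundle n q V) := by
  apply isManifold_of_contDiffOn
  intro e e' he he'
  obtain ⟨_, ⟨_, rfl⟩, _, ⟨⟨⟨z₀, i⟩, rfl⟩, rfl⟩, rfl⟩ := he
  obtain ⟨_, ⟨_, rfl⟩, _, ⟨⟨⟨z₁, j⟩, rfl⟩, rfl⟩, rfl⟩ := he'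
  have := contDiffOn_chart_trans z₀ z₁ i j
  simp only [modelWithCornersSelf_coe, modelWithCornersSelf_coe_symm, range_id, inter_univ,
    preimage_id, Function.comp_id, Function.id_comp]
  exact this

end

end ProjBundle

/-! ### Holomorphic sections and connections -/

section Connections

variable {n r : ℕ} {M : Type*} [TopologicalSpace M] [ChartedSpace (Fin n → ℂ) M]

/-- The section `s` of the vector bundle `W` is holomorphic near `x`. -/
def HolAt (n r : ℕ) {M : Type*} [TopologicalSpace M] [ChartedSpace (Fin n → ℂ) M]
    {W : M → Type*} [TopologicalSpace (TotalSpace (Fin r → ℂ) W)]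
    [∀ x, TopologicalSpace (W x)] [FiberBundle (Fin r → ℂ) W] (s : ∀ x, W x) (x : M) : Prop :=
  ContMDiffAt 𝓘(ℂ, Fin n → ℂ) (𝓘(ℂ, Fin n → ℂ).prod 𝓘(ℂ, Fin r → ℂ)) ω
    (fun y => TotalSpace.mk' (Fin r → ℂ) y (s y)) x

variable {W : M → Type*} [TopologicalSpace (TotalSpace (Fin r → ℂ) W)]
  [∀ x, AddCommGroup (W x)] [∀ x, Module ℂ (W x)] [∀ x, TopologicalSpace (W x)]
  [∀ x, IsTopologicalAddGroup (W x)] [∀ x, ContinuousSMul ℂ (W x)]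
  [FiberBundle (Fin r → ℂ) W] [VectorBundle ℂ (Fin r → ℂ) W]

/-- A connection is holomorphic if `∇_X s` is holomorphic wherever `X` and `s` are. -/
def IsHolomorphicConnection [IsManifold 𝓘(ℂ, Fin n → ℂ) ω M]
    (cov : CovariantDerivative 𝓘(ℂ, Fin n → ℂ) (Fin r → ℂ) W) : Prop :=
  ∀ (x : M) (X : ∀ y, TangentSpace 𝓘(ℂ, Fin n → ℂ) y) (s : ∀ y, W y),
    HolAt n n X x → HolAt n r s x → HolAt n r (fun y => cov s y (X y)) x

/-- The curvature `R(a, b) w = ([∇_A, ∇_B] - ∇_[A, B]) w`, computed with local holomorphic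
extensions of the vectors `a`, `b`, `w`. -/
def curvatureAt [IsManifold 𝓘(ℂ, Fin n → ℂ) ω M]
    (cov : CovariantDerivative 𝓘(ℂ, Fin n → ℂ) (Fin r → ℂ) W) (x : M)
    (a b : TangentSpace 𝓘(ℂ, Fin n → ℂ) x) (w : W x) : W x :=
  cov (fun y => cov (FiberBundle.extend (Fin r → ℂ) w) y (FiberBundle.extend (Fin n → ℂ) b y)) x a
  - cov (fun y => cov (FiberBundle.extend (Fin r → ℂ) w) y (FiberBundle.extend (Fin n → ℂ) a y)) x b
  - cov (FiberBundle.extend (Fin r → ℂ) w) x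
      (VectorField.mlieBracket 𝓘(ℂ, Fin n → ℂ) (FiberBundle.extend (Fin n → ℂ) a)
        (FiberBundle.extend (Fin n → ℂ) b) x)

variable (r W) in
/-- A basis of the fibre of a vector bundle of rank `r`. -/
def fibreBasis (x : M) : Module.Basis (Fin r) ℂ (W x) :=
  (Pi.basisFun ℂ (Fin r)).map
    (VectorBundle.continuousLinearEquivAt ℂ (Fin r → ℂ) W x).toLinearEquiv.symm

variable (r) in
/-- The trace of a linear endomorphism `f` of a fibre. -/
def fibreTrace {x : M} (f : W x → W x) : ℂ :=
  ∑ i, (fibreBasis r W x).repr (f (fibreBasis r W x i)) i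

variable (n) in
/-- The section `e` of the top exterior power `Λ^r W` is holomorphic near `x`. -/
def HolTopAt (e : ∀ x, ⋀[ℂ]^r (W x)) (x : M) : Prop :=
  ∃ w : Fin r → ∀ y, W y, (∀ i, HolAt n r (w i) x) ∧
    ∀ᶠ y in 𝓝 x, e y = exteriorPower.ιMulti ℂ r (fun i => w i y)

/-- `∇ e = 0` for a section `e` of `Λ^r W`, where
`∇ (w_1 ∧ ... ∧ w_r) = ∑ w_1 ∧ ... ∧ ∇ w_i ∧ ... ∧ w_r`. -/
def Annihilates (cov : CovariantDerivative 𝓘(ℂ, Fin n → ℂ) (Fin r → ℂ) W)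
    (e : ∀ x, ⋀[ℂ]^r (W x)) : Prop :=
  ∀ (x : M) (w : Fin r → ∀ y, W y), (∀ i, HolAt n r (w i) x) →
    (∀ᶠ y in 𝓝 x, e y = exteriorPower.ιMulti ℂ r (fun i => w i y)) →
    ∀ X : TangentSpace 𝓘(ℂ, Fin n → ℂ) x,
      ∑ i, exteriorPower.ιMulti ℂ r
        (Function.update (fun j => w j x) i (cov (w i) x X)) = 0

end Connections

/-! ### Paraconformal structures -/

section Paraconformal

variable (p q : ℕ) {M : Type*} [TopologicalSpace M] [ChartedSpace (Fin (p * q) → ℂ) M]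
  [IsManifold 𝓘(ℂ, Fin (p * q) → ℂ) ω M]
  (U V : M → Type*)
  [TopologicalSpace (TotalSpace (Fin p → ℂ) U)]
  [∀ x, AddCommGroup (U x)] [∀ x, Module ℂ (U x)] [∀ x, TopologicalSpace (U x)]
  [∀ x, IsTopologicalAddGroup (U x)] [∀ x, ContinuousSMul ℂ (U x)]
  [FiberBundle (Fin p → ℂ) U] [VectorBundle ℂ (Fin p → ℂ) U]
  [TopologicalSpace (TotalSpace (Fin q → ℂ) V)]
  [∀ x, AddCommGroup (V x)] [∀ x, Module ℂ (V x)] [∀ x, TopologicalSpace (V x)]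
  [∀ x, IsTopologicalAddGroup (V x)] [∀ x, ContinuousSMul ℂ (V x)]
  [FiberBundle (Fin q → ℂ) V] [VectorBundle ℂ (Fin q → ℂ) V]

/-- A `(p, q)` paraconformal structure on the complex manifold `M` of dimension `p q`: a holomorphic
isomorphism `α : TM → U ⊗ V`, with `U` of rank `p` and `V` of rank `q`. -/
structure ParaconformalStructure where
  iso : ∀ x : M, TangentSpace 𝓘(ℂ, Fin (p * q) → ℂ) x ≃ₗ[ℂ] U x ⊗[ℂ] V x
  holomorphic : ∀ (x : M) (u : ∀ y, U y) (v : ∀ y, V y), HolAt (p * q) p u x → HolAt (p * q) q v x →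
    HolAt (p * q) (p * q) (W := TangentSpace 𝓘(ℂ, Fin (p * q) → ℂ))
      (fun y => (iso y).symm (u y ⊗ₜ[ℂ] v y)) x

/-- A holomorphic isomorphism `Λ^p U ≅ Λ^q V`, with a scale: a non-vanishing holomorphic section of
`Λ^p U`. -/
structure Scale where
  detIso : ∀ x : M, (⋀[ℂ]^p (U x)) ≃ₗ[ℂ] (⋀[ℂ]^q (V x))
  holomorphic_detIso : ∀ (x : M) (e : ∀ y, ⋀[ℂ]^p (U y)), HolTopAt (p * q) e x →
    HolTopAt (p * q) (fun y => detIso y (e y)) x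
  eps : ∀ x : M, ⋀[ℂ]^p (U x)
  eps_ne_zero : ∀ x, eps x ≠ 0
  holomorphic_eps : ∀ x, HolTopAt (p * q) eps x

variable {p q U V}

/-- The corresponding section of `Λ^q V`. -/
def Scale.eps' (S : Scale p q U V) (x : M) : ⋀[ℂ]^q (V x) := S.detIso x (S.eps x)

namespace ParaconformalStructure

variable (P : ParaconformalStructure p q U V)
  (covU : CovariantDerivative 𝓘(ℂ, Fin (p * q) → ℂ) (Fin p → ℂ) U)
  (covV : CovariantDerivative 𝓘(ℂ, Fin (p * q) → ℂ) (Fin q → ℂ) V)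

/-- The tangent vector `u ⊗ v`. -/
def vec {x : M} (u : U x) (v : V x) : TangentSpace 𝓘(ℂ, Fin (p * q) → ℂ) x :=
  (P.iso x).symm (u ⊗ₜ[ℂ] v)

/-- The induced connection on `TM`, on vector fields of the form `u ⊗ v`:
`∇_X (u ⊗ v) = ∇_X u ⊗ v + u ⊗ ∇_X v`. -/
def inducedCov (u : ∀ y, U y) (v : ∀ y, V y) (x : M)
    (X : TangentSpace 𝓘(ℂ, Fin (p * q) → ℂ) x) : TangentSpace 𝓘(ℂ, Fin (p * q) → ℂ) x :=
  P.vec (covU u x X) (v x) + P.vec (u x) (covV v x X)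

/-- The torsion `T(u ⊗ v, u' ⊗ v') = ∇_X Y - ∇_Y X - [X, Y]` of the induced connection, where `X`
and `Y` are the vector fields `u ⊗ v` and `u' ⊗ v'` for local holomorphic extensions of the vectors
`u`, `v`, `u'`, `v'`. -/
def torsionAt {x : M} (u : U x) (v : V x) (u' : U x) (v' : V x) :
    TangentSpace 𝓘(ℂ, Fin (p * q) → ℂ) x :=
  P.inducedCov covU covV (FiberBundle.extend (Fin p → ℂ) u') (FiberBundle.extend (Fin q → ℂ) v') x
      (P.vec u v)
  - P.inducedCov covU covV (FiberBundle.extend (Fin p → ℂ) u) (FiberBundle.extend (Fin q → ℂ) v) x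
      (P.vec u' v')
  - VectorField.mlieBracket 𝓘(ℂ, Fin (p * q) → ℂ)
      (fun y => P.vec (FiberBundle.extend (Fin p → ℂ) u y) (FiberBundle.extend (Fin q → ℂ) v y))
      (fun y => P.vec (FiberBundle.extend (Fin p → ℂ) u' y) (FiberBundle.extend (Fin q → ℂ) v' y)) x

/-- The contraction of the `V`-index of a tangent vector with `f ∈ V^*`. -/
def contractV {x : M} (f : Module.Dual ℂ (V x)) (X : TangentSpace 𝓘(ℂ, Fin (p * q) → ℂ) x) : U x :=
  TensorProduct.rid ℂ (U x) (f.lTensor (U x) (P.iso x X))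

/-- The contraction of the `U`-index of a tangent vector with `f ∈ U^*`. -/
def contractU {x : M} (f : Module.Dual ℂ (U x)) (X : TangentSpace 𝓘(ℂ, Fin (p * q) → ℂ) x) : V x :=
  TensorProduct.lid ℂ (V x) (f.rTensor (V x) (P.iso x X))

/-- All the traces of the torsion vanish: those over a `U`-index and those over a `V`-index. -/
def TorsionTraceFree : Prop :=
  (∀ (x : M) (v : V x) (u' : U x) (v' : V x) (f : Module.Dual ℂ (V x)),
    fibreTrace p (fun u : U x => P.contractV f (P.torsionAt covU covV u v u' v')) = 0) ∧
  (∀ (x : M) (u : U x) (u' : U x) (v' : V x) (f : Module.Dual ℂ (U x)),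
    fibreTrace q (fun v : V x => P.contractU f (P.torsionAt covU covV u v u' v')) = 0)

/-- The connections on `U` and `V` determined by the scale: they are holomorphic, annihilate
`ε` and `ε'`, and the torsion of the induced connection on `TM` is trace-free. -/
structure IsScaleConnection (S : Scale p q U V) : Prop where
  holomorphic_U : IsHolomorphicConnection covU
  holomorphic_V : IsHolomorphicConnection covV
  annihilates_eps : Annihilates covU S.eps
  annihilates_eps' : Annihilates covV S.eps'
  traceFree : P.TorsionTraceFree covU covV

/-- The component `T⁺` of the torsion in `TM ⊗ (Λ² U^* ⊗ S² V^*)`. -/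
def torsionPlus {x : M} (u u' : U x) (v v' : V x) : TangentSpace 𝓘(ℂ, Fin (p * q) → ℂ) x :=
  (1 / 2 : ℂ) • (P.torsionAt covU covV u v u' v' + P.torsionAt covU covV u v' u' v)

/-- The curvature of the connection on `V`, symmetrised in its three arguments in `V`: a section of
`Λ² U^* ⊗ (V ⊗ S³ V^*)`. -/
def symCurvature {x : M} (u u' : U x) (w : Fin 3 → V x) : V x :=
  (1 / 6 : ℂ) • ∑ σ : Equiv.Perm (Fin 3),
    curvatureAt covV x (P.vec u (w (σ 0))) (P.vec u' (w (σ 1))) (w (σ 2))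

/-- The trace of `symCurvature`. -/
def symCurvatureTrace {x : M} (u u' : U x) (b c : V x) : ℂ :=
  fibreTrace q (fun a : V x => P.symCurvature covV u u' ![a, b, c])

/-- The positive part `W⁺` of the Weyl tensor: the trace-free part of `symCurvature`. -/
def weylPlus {x : M} (u u' : U x) (a b c : V x) : V x :=
  P.symCurvature covV u u' ![a, b, c] - (1 / (q + 2) : ℂ) •
    (P.symCurvatureTrace covV u u' b c • a + P.symCurvatureTrace covV u u' a c • b +
      P.symCurvatureTrace covV u u' a b • c)

/-- A paraconformal structure is right-flat if `T⁺ = 0` (for `p > 2`) or `W⁺ = 0` (for `p = 2`). -/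
def IsRightFlat : Prop :=
  (2 < p → ∀ (x : M) (u u' : U x) (v v' : V x), P.torsionPlus covU covV u u' v v' = 0) ∧
  (p = 2 → ∀ (x : M) (u u' : U x) (a b c : V x), P.weylPlus covV u u' a b c = 0)

end ParaconformalStructure

end Paraconformal

/-! ### Distributions and their leaf spaces -/

section Distributions

variable {E : Type*} [NormedAddCommGroup E] [NormedSpace ℂ E] {X : Type*} [TopologicalSpace X]
  [ChartedSpace E X]

/-- `z` and `w` lie on a holomorphic disc in `S` tangent to the distribution `D`. -/
def OnTangentDisc (D : ∀ z : X, Submodule ℂ (TangentSpace 𝓘(ℂ, E) z)) (S : Set X) (z w : X) :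
    Prop :=
  ∃ c : ℂ → X,
    (∀ t ∈ Metric.ball (0 : ℂ) 1, c t ∈ S ∧ ContMDiffAt 𝓘(ℂ, ℂ) 𝓘(ℂ, E) ω c t ∧
      mfderiv 𝓘(ℂ, ℂ) 𝓘(ℂ, E) c t (1 : ℂ) ∈ D (c t)) ∧
    (∃ a ∈ Metric.ball (0 : ℂ) 1, c a = z) ∧ (∃ b ∈ Metric.ball (0 : ℂ) 1, c b = w)

/-- `z` and `w` lie on the same leaf of the restriction of `D` to `S`: they are joined by a chain of
holomorphic discs in `S` tangent to `D`. -/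
def SameLeafIn (D : ∀ z : X, Submodule ℂ (TangentSpace 𝓘(ℂ, E) z)) (S : Set X) : X → X → Prop :=
  Relation.EqvGen (OnTangentDisc D S)

/-- The equivalence relation of lying on the same leaf of `D`. -/
def leafSetoid (D : ∀ z : X, Submodule ℂ (TangentSpace 𝓘(ℂ, E) z)) : Setoid X :=
  Relation.EqvGen.setoid (OnTangentDisc D univ)

/-- The quotient of `X` by the leaves of the distribution `D`, with the quotient topology. -/
abbrev LeafSpace (D : ∀ z : X, Submodule ℂ (TangentSpace 𝓘(ℂ, E) z)) : Type _ :=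
  Quotient (leafSetoid D)

/-- The point of the leaf space given by the leaf through `z`. -/
def leafOf (D : ∀ z : X, Submodule ℂ (TangentSpace 𝓘(ℂ, E) z)) (z : X) : LeafSpace D :=
  Quotient.mk (leafSetoid D) z

/-- `D` is an integrable distribution of `p`-planes: locally, it consists of the tangent spaces to
the level sets of a holomorphic submersion to `ℂ^m`. -/
def IsIntegrableDistribution (p m : ℕ) (D : ∀ z : X, Submodule ℂ (TangentSpace 𝓘(ℂ, E) z)) : Prop :=
  ∀ z : X, Module.finrank ℂ (D z) = p ∧
    ∃ f : X → (Fin m → ℂ), ∀ᶠ w in 𝓝 z, ContMDiffAt 𝓘(ℂ, E) 𝓘(ℂ, Fin m → ℂ) ω f w ∧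
      Function.Surjective (mfderiv 𝓘(ℂ, E) 𝓘(ℂ, Fin m → ℂ) f w) ∧
      LinearMap.ker (mfderiv 𝓘(ℂ, E) 𝓘(ℂ, Fin m → ℂ) f w).toLinearMap = D w

/-- The foliation defined by `D` is regular: each point has arbitrarily small open neighbourhoods
`S` such that each leaf of `D` meets `S` in at most one leaf of the restriction of `D` to `S`. -/
def IsRegularFoliation (D : ∀ z : X, Submodule ℂ (TangentSpace 𝓘(ℂ, E) z)) : Prop :=
  ∀ z : X, ∀ N ∈ 𝓝 z, ∃ S ⊆ N, IsOpen S ∧ z ∈ S ∧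
    ∀ a ∈ S, ∀ b ∈ S, leafOf D a = leafOf D b → SameLeafIn D S a b

end Distributions

/-! ### The twistor distribution on `P(V)` -/

section Twistor

variable {p q : ℕ} {M : Type*} [TopologicalSpace M] [ChartedSpace (Fin (p * q) → ℂ) M]
  [IsManifold 𝓘(ℂ, Fin (p * q) → ℂ) ω M]
  {U V : M → Type*}
  [TopologicalSpace (TotalSpace (Fin p → ℂ) U)]
  [∀ x, AddCommGroup (U x)] [∀ x, Module ℂ (U x)] [∀ x, TopologicalSpace (U x)]
  [∀ x, IsTopologicalAddGroup (U x)] [∀ x, ContinuousSMul ℂ (U x)]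
  [FiberBundle (Fin p → ℂ) U] [VectorBundle ℂ (Fin p → ℂ) U]
  [TopologicalSpace (TotalSpace (Fin q → ℂ) V)]
  [∀ x, AddCommGroup (V x)] [∀ x, Module ℂ (V x)] [∀ x, TopologicalSpace (V x)]
  [∀ x, IsTopologicalAddGroup (V x)] [∀ x, ContinuousSMul ℂ (V x)]
  [FiberBundle (Fin q → ℂ) V] [VectorBundle ℂ (Fin q → ℂ) V]
  [ContMDiffVectorBundle ω (Fin q → ℂ) V 𝓘(ℂ, Fin (p * q) → ℂ)]

/-- The section of `P(V)` defined by a nowhere vanishing section of `V`. -/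
def projSection (s : ∀ x : M, V x) (hs : ∀ x, s x ≠ 0) (x : M) : ProjBundle (p * q) q V :=
  ⟨x, Projectivization.mk ℂ (s x) (hs x)⟩

/-- The distribution `T` on `P(V)`, spanned at the line `[π]` over `x` by the horizontal lifts of the
tangent vectors `u ⊗ π`, `u ∈ U_x`. The horizontal lift of `X` at `[π]` is `d[s](X)` for a section
`s` of `V` with `s(x) = π` and `(∇ s)(x) = 0`. -/
def twistorDistribution (P : ParaconformalStructure p q U V)
    (covV : CovariantDerivative 𝓘(ℂ, Fin (p * q) → ℂ) (Fin q → ℂ) V)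
    (z : ProjBundle (p * q) q V) :
    Submodule ℂ (TangentSpace 𝓘(ℂ, (Fin (p * q) → ℂ) × (Fin (q - 1) → ℂ)) z) :=
  Submodule.span ℂ {w | ∃ (s : ∀ x : M, V x) (hs : ∀ x, s x ≠ 0) (u : U z.base),
    HolAt (p * q) q s z.base ∧ Projectivization.mk ℂ (s z.base) (hs z.base) = z.line ∧
    covV s z.base = 0 ∧
    w = mfderiv 𝓘(ℂ, Fin (p * q) → ℂ) 𝓘(ℂ, (Fin (p * q) → ℂ) × (Fin (q - 1) → ℂ))
      (projSection (p := p) (q := q) s hs) z.base (P.vec u (s z.base))}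

/-- There is nothing globally pathological about the quotient of `P(V)` by the leaves of `D`: the
foliation is regular, the quotient is Hausdorff, and no leaf meets a fibre of `P(V) → M` in more
than one point. -/
structure HasGoodQuotient
    (D : ∀ z : ProjBundle (p * q) q V,
      Submodule ℂ (TangentSpace 𝓘(ℂ, (Fin (p * q) → ℂ) × (Fin (q - 1) → ℂ)) z)) : Prop where
  regular : IsRegularFoliation D
  hausdorff : T2Space (LeafSpace D)
  fibre_injective : ∀ z w : ProjBundle (p * q) q V, leafOf D z = leafOf D w → z.base = w.base →
    z = w

/-- The map `P_{q-1} ≅ P(V_x) → P(V) → Z`, for a basis `b` of `V_x`. -/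
def twistorLine
    (D : ∀ z : ProjBundle (p * q) q V,
      Submodule ℂ (TangentSpace 𝓘(ℂ, (Fin (p * q) → ℂ) × (Fin (q - 1) → ℂ)) z))
    (x : M) (b : (Fin q → ℂ) ≃ₗ[ℂ] V x) (c : ℙ ℂ (Fin q → ℂ)) : LeafSpace D :=
  leafOf D ⟨x, Projectivization.map b.toLinearMap b.injective c⟩

end Twistor

/-! ### Holomorphic vector bundles through their sheaves of sections -/

/-- A family of complex vector spaces over `X`, with its sheaf of holomorphic sections: `holAt s x`
means that `s` is a holomorphic section near `x`. -/
structure HolFamily (X : Type*) where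
  fib : X → Type
  [addCommGroup : ∀ x, AddCommGroup (fib x)]
  [module : ∀ x, Module ℂ (fib x)]
  holAt : (∀ x, fib x) → X → Prop

attribute [instance] HolFamily.addCommGroup HolFamily.module

/-- An isomorphism of holomorphic vector bundles: linear on fibres, and it identifies the
holomorphic sections. -/
structure HolFamily.Iso {X : Type*} (A B : HolFamily X) where
  equiv : ∀ x, A.fib x ≃ₗ[ℂ] B.fib x
  holAt_iff : ∀ (s : ∀ x, A.fib x) (x : X), B.holAt (fun y => equiv y (s y)) x ↔ A.holAt s x

section Families

variable {m : ℕ} {X : Type*} [TopologicalSpace X] [ChartedSpace (Fin m → ℂ) X]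

/-- The direct sum of `p` copies of `A`. -/
def HolFamily.directSum (p : ℕ) (A : HolFamily X) : HolFamily X where
  fib x := Fin p → A.fib x
  holAt s x := ∀ i, A.holAt (fun y => s y i) x

/-- The tensor product; its holomorphic sections are locally the finite sums `∑ a_k ⊗ b_k` with
`a_k`, `b_k` holomorphic. -/
def HolFamily.tensor (A B : HolFamily X) : HolFamily X where
  fib x := A.fib x ⊗[ℂ] B.fib x
  holAt s x := ∃ (N : ℕ) (a : Fin N → ∀ y, A.fib y) (b : Fin N → ∀ y, B.fib y),
    (∀ k, A.holAt (a k) x) ∧ (∀ k, B.holAt (b k) x) ∧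
    ∀ᶠ y in 𝓝 x, s y = ∑ k, a k y ⊗ₜ[ℂ] b k y

variable (m) in
/-- The dual; its holomorphic sections are those whose pairing with each holomorphic section of `A`
is a holomorphic function. -/
def HolFamily.dual (A : HolFamily X) : HolFamily X where
  fib x := Module.Dual ℂ (A.fib x)
  holAt s x := ∀ a : ∀ y, A.fib y, A.holAt a x →
    ContMDiffAt 𝓘(ℂ, Fin m → ℂ) 𝓘(ℂ, ℂ) ω (fun y => s y (a y)) x

variable (m X) in
/-- The holomorphic tangent bundle `TX`. -/
def tangentFamily [IsManifold 𝓘(ℂ, Fin m → ℂ) ω X] : HolFamily X where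
  fib x := TangentSpace 𝓘(ℂ, Fin m → ℂ) x
  addCommGroup x := inferInstanceAs (AddCommGroup (TangentSpace 𝓘(ℂ, Fin m → ℂ) x))
  module x := inferInstanceAs (Module ℂ (TangentSpace 𝓘(ℂ, Fin m → ℂ) x))
  holAt s x := ContMDiffAt 𝓘(ℂ, Fin m → ℂ) 𝓘(ℂ, Fin m → ℂ).tangent ω
    (fun y => (⟨y, s y⟩ : TangentBundle 𝓘(ℂ, Fin m → ℂ) X)) x

/-- The normal bundle `N = f^* TY / TX` of an immersion `f : X → Y`; its holomorphic sections are
locally the classes of the holomorphic sections of `f^* TY`. -/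
def normalFamily {k : ℕ} {Y : Type*} [TopologicalSpace Y] [ChartedSpace (Fin k → ℂ) Y]
    [IsManifold 𝓘(ℂ, Fin k → ℂ) ω Y] (f : X → Y) : HolFamily X where
  fib x := TangentSpace 𝓘(ℂ, Fin k → ℂ) (f x) ⧸
    LinearMap.range (mfderiv 𝓘(ℂ, Fin m → ℂ) 𝓘(ℂ, Fin k → ℂ) f x).toLinearMap
  holAt s x := ∃ t : ∀ y, TangentSpace 𝓘(ℂ, Fin k → ℂ) (f y),
    ContMDiffAt 𝓘(ℂ, Fin m → ℂ) 𝓘(ℂ, Fin k → ℂ).tangent ω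
      (fun y => (⟨f y, t y⟩ : TangentBundle 𝓘(ℂ, Fin k → ℂ) Y)) x ∧
    ∀ᶠ y in 𝓝 x, s y = Submodule.Quotient.mk (t y)

/-- The tautological line bundle `H^{-1}` of `P_{q-1}`, whose fibre at a point is the corresponding
line in `ℂ^q`. -/
def tautologicalFamily (q : ℕ) : HolFamily (ℙ ℂ (Fin q → ℂ)) where
  fib z := z.submodule
  holAt s z := ContMDiffAt 𝓘(ℂ, Fin (q - 1) → ℂ) 𝓘(ℂ, Fin q → ℂ) ω
    (fun y => (s y : Fin q → ℂ)) z

/-- The hyperplane bundle `H` of `P_{q-1}`. -/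
def hyperplaneFamily (q : ℕ) : HolFamily (ℙ ℂ (Fin q → ℂ)) :=
  (tautologicalFamily q).dual (q - 1)

/-- `Ω¹(1) = Ω¹ ⊗ H` on `P_{q-1}`. -/
def twistedCotangentFamily (q : ℕ) : HolFamily (ℙ ℂ (Fin q → ℂ)) :=
  ((tangentFamily (q - 1) (ℙ ℂ (Fin q → ℂ))).dual (q - 1)).tensor (hyperplaneFamily q)

end Families

end

noncomputable section

set_option linter.unusedSectionVars false
set_option linter.unusedVariables false

/-! Integrability is proved on the total space of `V`, in homogeneous coordinates. There the
connection on `V` is `d + A`, and the horizontal lifts `X_u` of the vectors `u ⊗ π`, together with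
the Euler field, span a distribution of rank `p + 1` (`liftField`). The bracket `[X_u, X_u']` has
base component `b ⊗ π - T(u ⊗ π, u' ⊗ π)` for some `b`, and it is the horizontal lift of that
component minus the vertical vector `R(u ⊗ π, u' ⊗ π) π`. So the distribution is involutive
(`involutive_liftField`) as soon as `T(u ⊗ π, u' ⊗ π) = 0` and `R(u ⊗ π, u' ⊗ π) π` is a multiple of
`π`.

The torsion condition is `T⁺ = 0` when `2 < p`. When `p = 2` it follows from trace-freeness, because
`Λ² U^*` is a line (`torsionAt_same_eq_zero`). The curvature condition is `W⁺ = 0` on the diagonal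
when `p = 2`. When `2 < p` it follows from the torsion condition: the base component of the Jacobi
identity for three lifts says that an alternating sum of terms `u'' ⊗ R(u ⊗ π, u' ⊗ π) π` lies in `U
⊗ π`, and with three independent vectors of `U` each term must do so (`exists_connCurv_eq_smul`).

The holomorphic Frobenius theorem (`exists_firstIntegral`) then gives first integrals. They are
constant in the Euler direction, so they restrict to submersions on the slice `w_i = 1`, which is an
affine chart of `P(V)`.

For the quotient, a regular neighbourhood is one in which the leaves are exactly the level sets of a
first integral, and such first integrals are the charts of `Z`. Germs of holomorphic maps that
preserve leaves (`Transports`) connect any two points of a leaf. They make the projection to `Z`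
open, and they express the transition maps as composites of holomorphic maps.

A fibre `P(V_x)` is compact, is transverse to the distribution and meets each leaf at most once, so
it embeds in `Z`. Its normal space at `[π]` is `T_x M` modulo the projection `U_x ⊗ π` of the
distribution. The normal bundle is therefore the trivial bundle with fibre `ℂ^p ⊗ ℂ^q` modulo `ℂ^p`
tensor the tautological line (`isQuotientOf_normalFamily`, `normalMap_eq_zero_iff`). By the Euler
sequence, `η ↦ w ⊗ dπ_w(η)` identifies `ℂ^q` modulo the line with `H^{-1} ⊗ T`, independently of the
vector `w` on the line, so the model bundle is the same quotient (`isQuotientOf_normalModel`).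
Dually, the conormal bundle and the sum of copies of `Ω¹(1)` are the same subbundle of the trivial
bundle of linear forms. -/

/-! ### Analytic Frobenius theorem -/

section Frobenius

variable {T : Type*} [TopologicalSpace T] [CompactSpace T]
  {E F G K : Type*} [NormedAddCommGroup E] [NormedSpace ℂ E] [NormedAddCommGroup F]
  [NormedSpace ℂ F] [NormedAddCommGroup G] [NormedSpace ℂ G] [NormedAddCommGroup K]
  [NormedSpace ℂ K]

/-- The pointwise application of a continuous multilinear map to continuous functions. -/
def mapMultilinear (T : Type*) [TopologicalSpace T] [CompactSpace T] {n : ℕ}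
    (p : E [×n]→L[ℂ] F) : C(T, E) [×n]→L[ℂ] C(T, F) :=
  MultilinearMap.mkContinuous
    { toFun := fun h => ⟨fun t => p fun i => h i t, by fun_prop⟩
      map_update_add' := by
        intro _ m i x y
        ext t
        have h (z : C(T, E)) : (fun j => (Function.update m i z) j t) =
            Function.update (fun j => m j t) i (z t) := by
          funext j
          by_cases hj : j = i
          · subst hj; simp
          · simp [hj]
        simp only [ContinuousMap.coe_mk, ContinuousMap.add_apply, h]
        exact p.map_update_add _ _ _ _
      map_update_smul' := by
        intro _ m i c x
        ext t
        have h (z : C(T, E)) : (fun j => (Function.update m i z) j t) =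
            Function.update (fun j => m j t) i (z t) := by
          funext j
          by_cases hj : j = i
          · subst hj; simp
          · simp [hj]
        simp only [ContinuousMap.coe_mk, ContinuousMap.smul_apply, h]
        exact p.map_update_smul _ _ _ _ } ‖p‖ (by
      intro m
      refine (ContinuousMap.norm_le _ (by positivity)).2 fun t => ?_
      refine (p.le_opNorm _).trans ?_
      gcongr with i
      exact (m i).norm_coe_le_norm t)

/-- The sup norm over `T` costs nothing, so a power series applied pointwise has at least the radius
of convergence of the original one. -/
lemma norm_mapMultilinear_le {n : ℕ} (p : E [×n]→L[ℂ] F) : ‖mapMultilinear T p‖ ≤ ‖p‖ :=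
  MultilinearMap.mkContinuous_norm_le _ (norm_nonneg _) _

/-- The superposition operator of an analytic map is analytic at constant functions. -/
lemma exists_superposition [CompleteSpace F] {f : E → F} {z : E} (hf : AnalyticAt ℂ f z) :
    ∃ N : C(T, E) → C(T, F), AnalyticAt ℂ N (ContinuousMap.const T z) ∧
      ∀ᶠ h in 𝓝 (ContinuousMap.const T z), ∀ t, N h t = f (h t) := by
  obtain ⟨p, r, hp⟩ := hf
  let P : FormalMultilinearSeries ℂ C(T, E) C(T, F) := fun n => mapMultilinear T (p n)
  have hr : r ≤ P.radius := hp.r_le.trans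
    (FormalMultilinearSeries.radius_le_of_le fun n => norm_mapMultilinear_le (p n))
  have hP := P.hasFPowerSeriesOnBall (hp.r_pos.trans_le hr)
  refine ⟨fun h => P.sum (h - ContinuousMap.const T z), ?_, ?_⟩
  · refine AnalyticAt.fun_comp (g := P.sum) ?_ (analyticAt_id.sub analyticAt_const)
    simpa using hP.analyticAt
  · have hb : Metric.eball (ContinuousMap.const T z) r ∈ 𝓝 (ContinuousMap.const T z) :=
      Metric.eball_mem_nhds _ hp.r_pos
    filter_upwards [hb] with h hh t
    have hh0 : h - ContinuousMap.const T z ∈ Metric.eball (0 : C(T, E)) P.radius := by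
      rw [mem_eball_zero_iff]
      rw [Metric.mem_eball, edist_eq_enorm_sub] at hh
      exact hh.trans_le hr
    have h1 := hP.hasSum hh0
    -- Evaluation at `t` is continuous and linear, so it carries the series in `C(T, F)` to the
    -- series of `f` at `h t`.
    have h2 := h1.mapL ((ContinuousMap.evalCLM ℂ t : C(T, F) →L[ℂ] F))
    have hht : h t - z ∈ Metric.eball (0 : E) r := by
      rw [mem_eball_zero_iff]
      rw [Metric.mem_eball, edist_eq_enorm_sub] at hh
      refine lt_of_le_of_lt ?_ hh
      rw [enorm_le_iff_norm_le]
      exact (h - ContinuousMap.const T z).norm_coe_le_norm t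
    have h3 := hp.hasSum hht
    rw [add_sub_cancel] at h3
    refine HasSum.unique ?_ h3
    rw [zero_add] at h2
    exact h2

/-- Integration from `0`, as an operator on continuous functions on the unit interval. -/
def primitive (E : Type*) [NormedAddCommGroup E] [NormedSpace ℂ E] [CompleteSpace E] :
    C(unitInterval, E) →L[ℂ] C(unitInterval, E) :=
  LinearMap.mkContinuous
    { toFun := fun h => ⟨fun t => ∫ s in (0 : ℝ)..t, h (projIcc 0 1 zero_le_one s), by
        have hc : Continuous fun t : ℝ => ∫ s in (0 : ℝ)..t, h (projIcc 0 1 zero_le_one s) :=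
          intervalIntegral.continuous_primitive
            (fun a b => (h.continuous.comp continuous_projIcc).intervalIntegrable _ _) 0
        exact hc.comp continuous_subtype_val⟩
      map_add' := by
        intro x y
        ext t
        exact intervalIntegral.integral_add
          ((x.continuous.comp continuous_projIcc).intervalIntegrable _ _)
          ((y.continuous.comp continuous_projIcc).intervalIntegrable _ _)
      map_smul' := by
        intro c x
        ext t
        exact intervalIntegral.integral_smul c _ } 1 (by
      intro h
      rw [one_mul]
      refine (ContinuousMap.norm_le _ (norm_nonneg _)).2 fun t => ?_
      refine (intervalIntegral.norm_integral_le_of_norm_le_const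
        (C := ‖h‖) fun s _ => h.norm_coe_le_norm _).trans ?_
      rw [sub_zero, abs_of_nonneg t.2.1]
      exact mul_le_of_le_one_right (norm_nonneg _) t.2.2)

variable [CompleteSpace E]

lemma primitive_apply (h : C(unitInterval, E)) (t : unitInterval) :
    primitive E h t = ∫ s in (0 : ℝ)..t, h (projIcc 0 1 zero_le_one s) := rfl

/-- The interval has length one. This is the estimate that makes the linearised flow equation
contractive in `eventually_fderiv_flow`. -/
lemma norm_primitive_le (h : C(unitInterval, E)) : ‖primitive E h‖ ≤ ‖h‖ := by
  have := (primitive E).le_of_opNorm_le (LinearMap.mkContinuous_norm_le _ zero_le_one _) h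
  rwa [one_mul] at this

/-- A function vanishing at `0` is the primitive of its derivative. -/
lemma eq_primitive (k : C(unitInterval, E)) (k' : C(unitInterval, E)) (h0 : k 0 = 0)
    (h : ∀ t : unitInterval, HasDerivWithinAt (fun s : ℝ => k (projIcc 0 1 zero_le_one s)) (k' t)
      (Icc 0 1) t) : k = primitive E k' := by
  ext t
  rw [primitive_apply]
  have := intervalIntegral.integral_eq_sub_of_hasDeriv_right_of_le (a := 0) (b := t)
    (f := fun s : ℝ => k (projIcc 0 1 zero_le_one s))
    (f' := fun s : ℝ => k' (projIcc 0 1 zero_le_one s)) t.2.1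
    (k.continuous.comp continuous_projIcc).continuousOn
    (fun s hs => by
      have hs' : s ∈ Icc (0 : ℝ) 1 := ⟨hs.1.le, hs.2.le.trans t.2.2⟩
      have h1 := h ⟨s, hs'⟩
      rw [projIcc_of_mem _ hs']
      exact (h1.hasDerivAt (Icc_mem_nhds hs.1 (hs.2.trans_le t.2.2))).hasDerivWithinAt)
    ((k'.continuous.comp continuous_projIcc).intervalIntegrable _ _)
  rw [this]
  simp [h0]

/-- A primitive is differentiable. -/
lemma hasDerivWithinAt_primitive (k : C(unitInterval, E)) (t : unitInterval) :
    HasDerivWithinAt (fun s : ℝ => primitive E k (projIcc 0 1 zero_le_one s)) (k t)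
      (Icc 0 1) t := by
  have hc : Continuous fun s : ℝ => k (projIcc 0 1 zero_le_one s) :=
    k.continuous.comp continuous_projIcc
  have h1 : HasDerivAt (fun u : ℝ => ∫ s in (0 : ℝ)..u, k (projIcc 0 1 zero_le_one s))
      (k (projIcc 0 1 zero_le_one t)) t :=
    intervalIntegral.integral_hasDerivAt_right (hc.intervalIntegrable _ _)
      (hc.stronglyMeasurableAtFilter _ _) hc.continuousAt
  rw [projIcc_val] at h1
  refine h1.hasDerivWithinAt.congr (fun s hs => ?_) ?_
  · rw [primitive_apply, projIcc_of_mem _ hs]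
  · rw [projIcc_val, primitive_apply]

end Frobenius

/-! ### Flows of vector fields through an integral equation -/

section Frobenius

variable {E K W : Type*} [NormedAddCommGroup E] [NormedSpace ℂ E] [NormedAddCommGroup K]
  [NormedSpace ℂ K] [NormedAddCommGroup W] [NormedSpace ℂ W]

/-- Pointwise evaluation, through the bilinear map `β`, of a continuous function at a vector. -/
def pointwiseApply (β : W →L[ℂ] K →L[ℂ] E) (h : C(unitInterval, W)) (x : K) :
    C(unitInterval, E) := ⟨fun t => β (h t) x, by fun_prop⟩

lemma isBoundedBilinearMap_pointwiseApply (β : W →L[ℂ] K →L[ℂ] E) :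
    IsBoundedBilinearMap ℂ fun w : C(unitInterval, W) × K => pointwiseApply β w.1 w.2 where
  add_left _ _ _ := by ext; simp [pointwiseApply]
  smul_left _ _ _ := by ext; simp [pointwiseApply]
  add_right _ _ _ := by ext; simp [pointwiseApply]
  smul_right _ _ _ := by ext; simp [pointwiseApply]
  bound := by
    -- The bound must be strictly positive, hence `+ 1`.
    refine ⟨‖β‖ + 1, by positivity, fun h x => ?_⟩
    refine (ContinuousMap.norm_le _ (by positivity)).2 fun t => ?_
    refine (β.le_opNorm₂ (h t) x).trans ?_
    gcongr
    · linarith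
    · exact h.norm_coe_le_norm t

@[simp] lemma pointwiseApply_apply (β : W →L[ℂ] K →L[ℂ] E) (h : C(unitInterval, W)) (x : K)
    (t : unitInterval) : pointwiseApply β h x t = β (h t) x := rfl

lemma pointwiseApply_zero (β : W →L[ℂ] K →L[ℂ] E) (h : C(unitInterval, W)) :
    pointwiseApply β h 0 = 0 := by ext; simp

variable [CompleteSpace E] [CompleteSpace K] [CompleteSpace W]

/-- The time-one flows of the vector fields `Y(·) x`, together with their trajectories, solve an
integral equation, whose solution depends analytically on `x` and on the initial value. -/
lemma exists_flow (β : W →L[ℂ] K →L[ℂ] E) {Y : E → W} {z : E} (hY : ContDiffAt ℂ ω Y z) :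
    ∃ (N : C(unitInterval, E) → C(unitInterval, W)) (v : K × E → C(unitInterval, E)),
      ContDiffAt ℂ ω N (ContinuousMap.const _ z) ∧
      (∀ᶠ h in 𝓝 (ContinuousMap.const _ z), ∀ t, N h t = Y (h t)) ∧
      ContDiffAt ℂ ω v (0, z) ∧ v (0, z) = ContinuousMap.const _ z ∧
      ∀ᶠ w in 𝓝 ((0, z) : K × E), v w = ContinuousMap.const _ w.2 +
        primitive E (pointwiseApply β (N (v w)) w.1) := by
  obtain ⟨N, hN, hNY⟩ := exists_superposition (T := unitInterval) hY.analyticAt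
  have hN' : ContDiffAt ℂ ω N (ContinuousMap.const _ z) := hN.contDiffAt
  -- Zeros of `Φ` are the trajectories `h(t) = y + ∫₀ᵗ Y(h) x`. Time is absorbed into the parameter
  -- `x`, so all flows run over one fixed interval, and a single implicit function theorem in
  -- `C([0,1], E)` gives analytic dependence on `x` and `y`.
  let Φ : (K × E) × C(unitInterval, E) → C(unitInterval, E) := fun w =>
    w.2 - ContinuousLinearMap.const ℂ unitInterval w.1.2 -
      primitive E (pointwiseApply β (N w.2) w.1.1)
  let u : (K × E) × C(unitInterval, E) := ((0, z), ContinuousMap.const _ z)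
  have hN2 : ContDiffAt ℂ ω (fun w : (K × E) × C(unitInterval, E) => N w.2) u :=
    ContDiffAt.comp (g := N) u hN' contDiffAt_snd
  have hB := isBoundedBilinearMap_pointwiseApply β
  have hPA : ContDiffAt ℂ ω (fun w : (K × E) × C(unitInterval, E) =>
      pointwiseApply β (N w.2) w.1.1) u :=
    ContDiffAt.comp u hB.contDiff.contDiffAt
      (hN2.prodMk (contDiffAt_fst.comp u contDiffAt_fst))
  have hΦ : ContDiffAt ℂ ω Φ u := by
    refine (contDiffAt_snd.sub ?_).sub ?_
    · exact (ContinuousLinearMap.const ℂ unitInterval).contDiff.contDiffAt.comp u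
        (contDiffAt_snd.comp u contDiffAt_fst)
    · exact (primitive E).contDiff.contDiffAt.comp u hPA
  -- At `x = 0` the integral term vanishes identically, so the derivative in the path variable is
  -- the identity.
  have hd : fderiv ℂ Φ u ∘L .inr ℂ (K × E) C(unitInterval, E) = ContinuousLinearMap.id ℂ _ := by
    have h1 : HasFDerivAt (fun h : C(unitInterval, E) => Φ ((0, z), h))
        (fderiv ℂ Φ u ∘L .inr ℂ (K × E) C(unitInterval, E)) (ContinuousMap.const _ z) :=
      HasFDerivAt.comp (g := Φ) _ (hΦ.differentiableAt (by simp)).hasFDerivAt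
        (hasFDerivAt_prodMk_right _ _)
    have h2 : (fun h : C(unitInterval, E) => Φ ((0, z), h)) =
        fun h => h - ContinuousLinearMap.const ℂ unitInterval z := by
      funext h
      simp [Φ, pointwiseApply_zero]
    rw [h2] at h1
    exact h1.unique ((hasFDerivAt_id _).sub_const _)
  have hinv : (fderiv ℂ Φ u ∘L .inr ℂ (K × E) C(unitInterval, E)).IsInvertible := by
    rw [hd]
    exact ⟨ContinuousLinearEquiv.refl ℂ _, rfl⟩
  have hω : (ω : WithTop ℕ∞) ≠ 0 := by simp
  refine ⟨N, hΦ.implicitFunction hω hinv, hN', hNY, hΦ.contDiffAt_implicitFunction hω hinv,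
    hΦ.implicitFunction_apply_self hω hinv, ?_⟩
  filter_upwards [hΦ.eventually_apply_implicitFunction hω hinv] with w hw
  have h0 : Φ u = 0 := by
    ext t
    simp [Φ, u, pointwiseApply_zero]
  rw [h0] at hw
  simp only [Φ] at hw
  rw [sub_sub, sub_eq_zero] at hw
  exact hw

set_option maxHeartbeats 1000000 in
/-- If the vector fields `Y(·) x` commute, then the derivative of their flow with respect to `x`
is `Y`. -/
lemma eventually_fderiv_flow (β : W →L[ℂ] K →L[ℂ] E) {Y : E → W} {z : E} (hY : ContDiffAt ℂ ω Y z)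
    (hcomm : ∀ᶠ y in 𝓝 z, ∀ a b, β (fderiv ℂ Y y (β (Y y) a)) b = β (fderiv ℂ Y y (β (Y y) b)) a)
    {N : C(unitInterval, E) → C(unitInterval, W)} {v : K × E → C(unitInterval, E)}
    (hN : ContDiffAt ℂ ω N (ContinuousMap.const _ z))
    (hNY : ∀ᶠ h in 𝓝 (ContinuousMap.const _ z), ∀ t, N h t = Y (h t))
    (hv : ContDiffAt ℂ ω v (0, z)) (hv0 : v (0, z) = ContinuousMap.const _ z)
    (hint : ∀ᶠ w in 𝓝 ((0, z) : K × E), v w = ContinuousMap.const _ w.2 +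
        primitive E (pointwiseApply β (N (v w)) w.1)) :
    ∀ᶠ w in 𝓝 ((0, z) : K × E), ∀ a t, fderiv ℂ v w (a, 0) t = (t : ℂ) • β (Y (v w t)) a := by
  have hω : (ω : WithTop ℕ∞) ≠ 0 := by simp
  obtain ⟨C, hC0, hC⟩ : ∃ C > 0, ∀ᶠ y in 𝓝 z, ‖fderiv ℂ Y y‖ < C := by
    have hc : ContinuousAt (fun y => ‖fderiv ℂ Y y‖) z :=
      ((hY.fderiv_right (m := 0) (by simp)).continuousAt).norm
    exact ⟨‖fderiv ℂ Y z‖ + 1, by positivity, hc.eventually_lt_const (lt_add_one _)⟩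
  have hYd : ∀ᶠ y in 𝓝 z, DifferentiableAt ℂ Y y :=
    (hY.eventually (by simp)).mono fun y hy => hy.differentiableAt hω
  -- A path close to the constant path in the sup norm stays near `z` throughout, so conditions
  -- valid near `z` hold at all times at once.
  have hgood : ∀ᶠ h in 𝓝 (ContinuousMap.const unitInterval z), ∀ t : unitInterval,
      (∀ a b, β (fderiv ℂ Y (h t) (β (Y (h t)) a)) b =
        β (fderiv ℂ Y (h t) (β (Y (h t)) b)) a) ∧
      ‖fderiv ℂ Y (h t)‖ < C ∧ DifferentiableAt ℂ Y (h t) := by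
    obtain ⟨ε, hε, hb⟩ := Metric.eventually_nhds_iff.1 (hcomm.and (hC.and hYd))
    refine Metric.eventually_nhds_iff.2 ⟨ε, hε, fun h hh t => hb ?_⟩
    exact (ContinuousMap.dist_apply_le_dist (g := ContinuousMap.const _ z) t).trans_lt hh
  have hvc : Tendsto v (𝓝 (0, z)) (𝓝 (ContinuousMap.const _ z)) := by
    rw [← hv0]; exact hv.continuousAt
  -- For such `x` the operator `ζ ↦ ∫ β(DY ζ) x` has norm less than one, so the homogeneous
  -- linearised equation has only the zero solution.
  have hsmall : ∀ᶠ w in 𝓝 ((0, z) : K × E), ‖β‖ * C * ‖w.1‖ < 1 := by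
    have hc : ContinuousAt (fun w : K × E => ‖β‖ * C * ‖w.1‖) (0, z) := by fun_prop
    exact hc.eventually_lt_const (by simp)
  filter_upwards [hint.eventually_nhds, hvc.eventually hgood, hvc.eventually hNY.eventually_nhds,
    hvc.eventually (hN.eventually (by simp)), hv.eventually (by simp), hsmall]
    with w hw hg hNw hNd hvd hs a
  obtain ⟨x, y⟩ := w
  have hvd' := (hvd.differentiableAt hω).hasFDerivAt
  have hNd' := (hNd.differentiableAt hω).hasFDerivAt
  set V := v (x, y) with hV
  set DN := fderiv ℂ N V with hDN
  have hNV : ∀ t, N V t = Y (V t) := hNw.self_of_nhds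
  -- the derivative of the superposition operator
  have hDNt : ∀ (k : C(unitInterval, E)) t, DN k t = fderiv ℂ Y (V t) (k t) := by
    intro k t
    let ev : C(unitInterval, E) →L[ℂ] E := ContinuousMap.evalCLM ℂ t
    let ev' : C(unitInterval, W) →L[ℂ] W := ContinuousMap.evalCLM ℂ t
    have h1 : HasFDerivAt (fun h => ev' (N h)) (ev' ∘L DN) V := ev'.hasFDerivAt.comp V hNd'
    have h2 : HasFDerivAt (fun h => Y (ev h)) (fderiv ℂ Y (V t) ∘L ev) V :=
      HasFDerivAt.comp (g := Y) V (hg t).2.2.hasFDerivAt ev.hasFDerivAt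
    have h3 := h1.unique (h2.congr_of_eventuallyEq (hNw.mono fun h hh => hh t))
    exact congrArg (fun L : C(unitInterval, E) →L[ℂ] W => L k) h3
  set H : C(unitInterval, E) := pointwiseApply β (N V) x with hH
  have hVint : V = ContinuousMap.const _ y + primitive E H := hw.self_of_nhds
  set D : C(unitInterval, E) := fderiv ℂ v (x, y) (a, 0) with hD
  -- Differentiating the integral equation in the direction `a` gives an inhomogeneous linear
  -- equation for `D`.
  have hDint : D = primitive E (pointwiseApply β (DN D) x + pointwiseApply β (N V) a) := by
    have h1 : HasFDerivAt (fun w : K × E => N (v w)) (DN ∘L fderiv ℂ v (x, y)) (x, y) :=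
      HasFDerivAt.comp (g := N) (x, y) hNd' hvd'
    have hB := isBoundedBilinearMap_pointwiseApply β
    have h3 := HasFDerivAt.comp (x, y) (hB.hasFDerivAt (N V, x))
      (h1.prodMk (hasFDerivAt_fst (𝕜 := ℂ) (E := K) (F := E) (p := (x, y))))
    have h4 := (primitive E).hasFDerivAt.comp (x, y) h3
    have h5 := (((ContinuousLinearMap.const ℂ unitInterval).hasFDerivAt (x := y)).comp (x, y)
      (hasFDerivAt_snd (𝕜 := ℂ) (E := K) (F := E) (p := (x, y)))).add h4
    have h6 := hvd'.unique (h5.congr_of_eventuallyEq hw)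
    have h7 := congrArg (fun L : K × E →L[ℂ] C(unitInterval, E) => L (a, 0)) h6
    refine h7.trans ?_
    simp [add_comm]
    rfl
  -- the expected derivative
  let τ : C(unitInterval, ℂ) := ⟨fun t => ((t : ℝ) : ℂ), by fun_prop⟩
  let k : C(unitInterval, E) := τ • pointwiseApply β (N V) a
  let k' : C(unitInterval, E) := pointwiseApply β (N V) a + τ • pointwiseApply β (DN H) a
  have hk : k = primitive E k' := by
    refine eq_primitive k k' (by simp [k, τ]) fun t => ?_
    have hVt : HasDerivWithinAt (fun s : ℝ => V (projIcc 0 1 zero_le_one s)) (H t) (Icc 0 1) t := by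
      rw [hVint]
      simpa using (hasDerivWithinAt_primitive H t).const_add y
    have hYt : HasFDerivAt (fun e => β (Y e) a)
        (((β.flip a).comp (fderiv ℂ Y (V t))).restrictScalars ℝ) (V t) :=
      ((β.flip a).hasFDerivAt.comp (V t)
        (hg t).2.2.hasFDerivAt).restrictScalars ℝ
    have hYt' : HasFDerivAt (fun e => β (Y e) a)
        (((β.flip a).comp (fderiv ℂ Y (V t))).restrictScalars ℝ)
        ((fun s : ℝ => V (projIcc 0 1 zero_le_one s)) t) := by simpa using hYt
    have h1 := hYt'.comp_hasDerivWithinAt (t : ℝ) hVt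
    have h2 : HasDerivWithinAt (fun s : ℝ => (s : ℂ)) 1 (Icc 0 1) (t : ℝ) :=
      (Complex.ofRealCLM.hasDerivAt).hasDerivWithinAt
    have h3 := h2.smul h1
    refine (h3.congr_of_mem (fun s hs => ?_) t.2).congr_deriv ?_
    · simp [k, τ, hNV, projIcc_of_mem _ hs]
    · simp [k', τ, hDNt, hNV, add_comm]
  -- Commutation enters here: `DY(Y x) a = DY(Y a) x` turns the derivative of `k = t Y(V) a` along
  -- the trajectory into `Y a + DY(k) x`. So `k` solves the same inhomogeneous equation as `D`, and
  -- the difference solves the homogeneous one.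
  have hζ : D - k = primitive E (pointwiseApply β (DN (D - k)) x) := by
    conv_lhs => rw [hDint, hk, ← map_sub]
    congr 1
    ext t
    have := (hg t).1 a x
    simp only [ContinuousMap.sub_apply, ContinuousMap.add_apply, pointwiseApply_apply, hDNt, k', k,
      ContinuousMap.smul_apply', hNV, map_sub, map_smul, smul_apply,
      sub_apply, H, this]
    abel
  have hbound : ‖D - k‖ ≤ ‖β‖ * C * ‖x‖ * ‖D - k‖ := by
    conv_lhs => rw [hζ]
    refine (norm_primitive_le _).trans ((ContinuousMap.norm_le _ (by positivity)).2 fun t => ?_)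
    rw [pointwiseApply_apply, hDNt]
    calc ‖β (fderiv ℂ Y (V t) ((D - k) t)) x‖ ≤ ‖β‖ * ‖fderiv ℂ Y (V t) ((D - k) t)‖ * ‖x‖ :=
          β.le_opNorm₂ _ _
      _ ≤ ‖β‖ * (‖fderiv ℂ Y (V t)‖ * ‖(D - k) t‖) * ‖x‖ := by
          gcongr; exact ContinuousLinearMap.le_opNorm _ _
      _ ≤ ‖β‖ * (C * ‖D - k‖) * ‖x‖ := by
          gcongr
          · exact (hg t).2.1.le
          · exact (D - k).norm_coe_le_norm t
      _ = ‖β‖ * C * ‖x‖ * ‖D - k‖ := by ring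
  have hzero : D - k = 0 := by
    rw [← norm_eq_zero]
    by_contra hne
    have hpos : 0 < ‖D - k‖ := lt_of_le_of_ne (norm_nonneg _) (Ne.symm hne)
    have hs' : ‖β‖ * C * ‖x‖ < 1 := hs
    exact absurd hbound (not_le.2 (mul_lt_of_lt_one_left hpos hs'))
  intro t
  rw [sub_eq_zero.1 hzero]
  simp [k, τ, hNV]

end Frobenius

/-! ### First integrals of commuting and of involutive frames -/

section Frobenius

variable {E K : Type*} [NormedAddCommGroup E] [NormedSpace ℂ E] [NormedAddCommGroup K]
  [NormedSpace ℂ K] [FiniteDimensional ℂ E] [FiniteDimensional ℂ K]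

set_option maxHeartbeats 1000000 in
/-- The Frobenius theorem for commuting vector fields `Y(·) a` such that `L (Y(·) a) = a`. -/
lemma exists_firstIntegral_of_commute {Y : E → (K →L[ℂ] E)} {z : E} (hY : ContDiffAt ℂ ω Y z)
    (L : E →L[ℂ] K) (hL : ∀ᶠ y in 𝓝 z, ∀ a, L (Y y a) = a)
    (hcomm : ∀ᶠ y in 𝓝 z, ∀ a b, fderiv ℂ Y y (Y y a) b = fderiv ℂ Y y (Y y b) a) :
    ∃ g : E → LinearMap.ker L.toLinearMap, ∀ᶠ y in 𝓝 z, ContDiffAt ℂ ω g y ∧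
      Function.Surjective (fderiv ℂ g y) ∧
      LinearMap.ker (fderiv ℂ g y).toLinearMap = LinearMap.range (Y y).toLinearMap := by
  have : CompleteSpace E := FiniteDimensional.complete ℂ E
  have : CompleteSpace K := FiniteDimensional.complete ℂ K
  have hω : (ω : WithTop ℕ∞) ≠ 0 := by simp
  let β : (K →L[ℂ] E) →L[ℂ] K →L[ℂ] E := ContinuousLinearMap.id ℂ _
  obtain ⟨N, v, hN, hNY, hv, hv0, hint⟩ := exists_flow β hY
  have hder := eventually_fderiv_flow β hY hcomm hN hNY hv hv0 hint
  -- The zero field leaves every point fixed.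
  have hvy : ∀ᶠ y in 𝓝 z, v (0, y) = ContinuousMap.const _ y := by
    have hc : Tendsto (fun y : E => ((0, y) : K × E)) (𝓝 z) (𝓝 (0, z)) := by
      exact (Continuous.prodMk_right (0 : K)).tendsto z
    filter_upwards [hc.eventually hint] with y hy
    rw [hy, pointwiseApply_zero, map_zero, add_zero]
  let ev : C(unitInterval, E) →L[ℂ] E := ContinuousMap.evalCLM ℂ 1
  let Q := LinearMap.ker L.toLinearMap
  let ι : K × Q →L[ℂ] K × E := (ContinuousLinearMap.id ℂ K).prodMap Q.subtypeL
  let s : K × Q → K × E := fun w => ι w + (0, z)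
  have hs0 : s 0 = (0, z) := by simp [s]
  have hsd : ∀ w, HasFDerivAt s ι w := fun w => ι.hasFDerivAt.add_const _
  have hsc : Tendsto s (𝓝 0) (𝓝 (0, z)) := by rw [← hs0]; exact (hsd 0).continuousAt
  -- `Ψ (a, q)` starts at `z + q` with `q ∈ ker L` and follows the field `Y(·) a` up to time one:
  -- points of the transversal label the leaves, and `a` moves along them. The first integral is the
  -- second component of the local inverse.
  let Ψ : K × Q → E := fun w => ev (v (s w))
  have hv' : ContDiffAt ℂ ω v (s 0) := by rw [hs0]; exact hv
  have hΨ : ContDiffAt ℂ ω Ψ 0 :=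
    ev.contDiff.contDiffAt.comp 0 (hv'.comp (f := s) 0 (ι.contDiff.add contDiff_const).contDiffAt)
  have hΨ0 : Ψ 0 = z := by simp [Ψ, hs0, hv0, ev]
  have hLz := hL.self_of_nhds
  have hΨd : ∀ᶠ w in 𝓝 (0 : K × Q), ∀ a, fderiv ℂ Ψ w (a, 0) = Y (Ψ w) a := by
    filter_upwards [hsc.eventually hder, hsc.eventually (hv.eventually (by simp))] with w h1 h2 a
    have h3 : HasFDerivAt Ψ (ev ∘L fderiv ℂ v (s w) ∘L ι) w :=
      ev.hasFDerivAt.comp w ((h2.differentiableAt hω).hasFDerivAt.comp w (hsd w))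
    rw [h3.fderiv]
    have h4 := h1 a 1
    simp only [Set.Icc.coe_one, Complex.ofReal_one, one_smul] at h4
    have h5 : ι (a, 0) = (a, 0) := by simp [ι]
    calc _ = fderiv ℂ v (s w) (ι (a, 0)) 1 := rfl
      _ = _ := by rw [h5, h4]; rfl
  have hΨq : ∀ b : Q, fderiv ℂ Ψ 0 (0, b) = b := by
    intro b
    have h1 : HasFDerivAt (fun q : Q => Ψ (0, q)) (fderiv ℂ Ψ 0 ∘L .inr ℂ K Q) 0 :=
      HasFDerivAt.comp (g := Ψ) (0 : Q) (hΨ.differentiableAt hω).hasFDerivAt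
        (hasFDerivAt_prodMk_right _ _)
    have h2 : HasFDerivAt (fun q : Q => (q : E) + z) Q.subtypeL 0 :=
      Q.subtypeL.hasFDerivAt.add_const z
    have h3 : (fun q : Q => Ψ (0, q)) =ᶠ[𝓝 0] fun q => (q : E) + z := by
      have hc : Tendsto (fun q : Q => (q : E) + z) (𝓝 0) (𝓝 z) := by
        have := h2.continuousAt
        simpa [ContinuousAt] using this
      filter_upwards [hc.eventually hvy] with q hq
      have : s (0, q) = (0, (q : E) + z) := by simp [s, ι]
      simp [Ψ, this, hq, ev]
    exact congrArg (fun T : Q →L[ℂ] E => T b) ((h1.congr_of_eventuallyEq h3.symm).unique h2)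
  have hlin : ∀ w : K × Q, fderiv ℂ Ψ 0 w = Y z w.1 + w.2 := by
    rintro ⟨a, b⟩
    have : ((a, b) : K × Q) = (a, 0) + (0, b) := by simp
    rw [this, map_add, hΨd.self_of_nhds, hΨq, hΨ0]
    simp
  let e : (K × Q) ≃L[ℂ] E := LinearEquiv.toContinuousLinearEquiv
    (LinearEquiv.ofBijective (fderiv ℂ Ψ 0).toLinearMap ⟨by
      rw [injective_iff_map_eq_zero]
      rintro ⟨a, b⟩ hab
      have hab' : Y z a + (b : E) = 0 := by rw [← hlin (a, b)]; exact hab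
      have ha : a = 0 := by
        have := congrArg L hab'
        rw [map_add, hLz, map_zero] at this
        have hb : L (b : E) = 0 := b.2
        rwa [hb, add_zero] at this
      subst ha
      simp at hab'
      simp [hab'], fun y => by
      refine ⟨(L y, ⟨y - Y z (L y), show L (y - Y z (L y)) = 0 by rw [map_sub, hLz, sub_self]⟩), ?_⟩
      exact (hlin _).trans (by simp)⟩)
  have he : HasFDerivAt Ψ (e : K × Q →L[ℂ] E) 0 := by
    have : (e : K × Q →L[ℂ] E) = fderiv ℂ Ψ 0 := by ext w <;> rfl
    rw [this]
    exact (hΨ.differentiableAt hω).hasFDerivAt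
  let R := hΨ.toOpenPartialHomeomorph Ψ he hω
  have hR0 : (0 : K × Q) ∈ R.source := hΨ.mem_toOpenPartialHomeomorph_source he hω
  have hRz : z ∈ R.target := by
    have := R.map_source hR0
    rwa [show R 0 = z from hΨ0] at this
  have hRsz : R.symm z = 0 := by
    have := R.left_inv hR0
    rwa [show R 0 = z from hΨ0] at this
  have hRs : ContDiffAt ℂ ω R.symm z :=
    R.contDiffAt_symm (f₀' := e) hRz (by rw [hRsz]; exact he) (by rw [hRsz]; exact hΨ)
  refine ⟨fun y => (R.symm y).2, ?_⟩
  have hRst : Tendsto R.symm (𝓝 z) (𝓝 0) := by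
    have := hRs.continuousAt
    rwa [ContinuousAt, hRsz] at this
  filter_upwards [hRs.eventually (by simp), R.open_target.mem_nhds hRz, hRst.eventually hΨd,
    hRst.eventually (hΨ.eventually (by simp)), hL] with y hy hyt hyd hyΨ hLy
  have hgy : ContDiffAt ℂ ω (fun y => (R.symm y).2) y := contDiffAt_snd.comp y hy
  have hΨy : Ψ (R.symm y) = y := R.right_inv hyt
  -- In the coordinates `Ψ` the first integral is the projection to `ker L`, so it is a submersion,
  -- and its differential kills `dΨ(a, 0) = Y y a`.
  have hcomp : fderiv ℂ (fun y => (R.symm y).2) y ∘L fderiv ℂ Ψ (R.symm y) =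
      ContinuousLinearMap.snd ℂ K Q := by
    have h1 : HasFDerivAt (fun w => (R.symm (Ψ w)).2)
        (fderiv ℂ (fun y => (R.symm y).2) y ∘L fderiv ℂ Ψ (R.symm y)) (R.symm y) := by
      refine HasFDerivAt.comp (g := fun y => (R.symm y).2) (R.symm y) ?_
        (hyΨ.differentiableAt hω).hasFDerivAt
      rw [hΨy]
      exact (hgy.differentiableAt hω).hasFDerivAt
    have h2 : (fun w => (R.symm (Ψ w)).2) =ᶠ[𝓝 (R.symm y)] fun w => w.2 := by
      filter_upwards [R.open_source.mem_nhds (R.map_target hyt)] with w hw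
      exact congrArg Prod.snd (R.left_inv hw)
    exact (h1.congr_of_eventuallyEq h2.symm).unique hasFDerivAt_snd
  have hsurj : Function.Surjective (fderiv ℂ (fun y => (R.symm y).2) y) := by
    intro b
    exact ⟨fderiv ℂ Ψ (R.symm y) (0, b), congrArg (fun T : K × Q →L[ℂ] Q => T (0, b)) hcomp⟩
  refine ⟨hgy, hsurj, ?_⟩
  symm
  -- The range of `Y y` lies in the kernel, and both have the dimension of `K`.
  have hinj : Function.Injective (Y y) := Function.LeftInverse.injective hLy
  refine Submodule.eq_of_le_of_finrank_eq ?_ ?_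
  · rintro _ ⟨a, rfl⟩
    have := congrArg (fun T : K × Q →L[ℂ] Q => T (a, 0)) hcomp
    simp only [ContinuousLinearMap.comp_apply, hyd, hΨy] at this
    exact this
  · have h1 := LinearMap.finrank_range_add_finrank_ker
      (fderiv ℂ (fun y => (R.symm y).2) y).toLinearMap
    have h2 : LinearMap.range (fderiv ℂ (fun y => (R.symm y).2) y).toLinearMap = ⊤ :=
      LinearMap.range_eq_top.2 hsurj
    rw [h2, finrank_top] at h1
    have h3 := LinearMap.finrank_range_add_finrank_ker L.toLinearMap
    have h4 : LinearMap.range L.toLinearMap = ⊤ :=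
      LinearMap.range_eq_top.2 fun a => ⟨Y y a, hLy a⟩
    rw [h4, finrank_top] at h3
    have h5 : Module.finrank ℂ (LinearMap.range (Y y).toLinearMap) = Module.finrank ℂ K :=
      LinearMap.finrank_range_of_inj hinj
    have h6 : Module.finrank ℂ Q = Module.finrank ℂ (LinearMap.ker L.toLinearMap) := rfl
    omega

set_option maxHeartbeats 1000000 in
/-- The analytic Frobenius theorem: an involutive distribution is locally the kernel of the
differential of a submersion. -/
theorem exists_firstIntegral {Y : E → (K →L[ℂ] E)} {z : E} (hY : ContDiffAt ℂ ω Y z)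
    (hinj : Function.Injective (Y z))
    (hinv : ∀ᶠ y in 𝓝 z, ∀ a b, fderiv ℂ Y y (Y y a) b - fderiv ℂ Y y (Y y b) a ∈
      LinearMap.range (Y y).toLinearMap) {m : ℕ}
    (hm : Module.finrank ℂ E = Module.finrank ℂ K + m) :
    ∃ g : E → (Fin m → ℂ), ∀ᶠ y in 𝓝 z, ContDiffAt ℂ ω g y ∧
      Function.Surjective (fderiv ℂ g y) ∧
      LinearMap.ker (fderiv ℂ g y).toLinearMap = LinearMap.range (Y y).toLinearMap := by
  have : CompleteSpace E := FiniteDimensional.complete ℂ E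
  have : CompleteSpace K := FiniteDimensional.complete ℂ K
  have hω : (ω : WithTop ℕ∞) ≠ 0 := by simp
  obtain ⟨l, hl⟩ := LinearMap.exists_leftInverse_of_injective (Y z).toLinearMap
    (LinearMap.ker_eq_bot.2 hinj)
  let L : E →L[ℂ] K := LinearMap.toContinuousLinearMap l
  have hLz : ∀ a, L (Y z a) = a := fun a => congrArg (fun T : K →ₗ[ℂ] K => T a) hl
  let A : E → (K →L[ℂ] K) := fun y => L ∘L Y y
  have hA : ContDiffAt ℂ ω A z :=
    (ContinuousLinearMap.compL ℂ K E K L).contDiff.contDiffAt.comp z hY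
  have hAz : A z = 1 := by ext a; exact hLz a
  have hunit : ∀ᶠ y in 𝓝 z, IsUnit (A y) := by
    have h1 : {T : K →L[ℂ] K | IsUnit T} ∈ 𝓝 (A z) := by
      rw [hAz]; exact Units.isOpen.mem_nhds isUnit_one
    exact hA.continuousAt h1
  let B : E → (K →L[ℂ] K) := fun y => Ring.inverse (A y)
  have hB : ContDiffAt ℂ ω B z := by
    have h1 : ContDiffAt ℂ ω Ring.inverse (A z) := by
      rw [hAz]; exact contDiffAt_ringInverse ℂ (1 : (K →L[ℂ] K)ˣ)
    exact ContDiffAt.comp (g := Ring.inverse) z h1 hA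
  -- The frame `Y' = Y (L Y)⁻¹` spans the same planes and satisfies `L Y' = id`. For such a frame
  -- involutive implies commuting: brackets lie in the span of `Y'`, where `L` is injective, and `L`
  -- kills the derivatives of `Y'` because `L Y'` is constant.
  let Y' : E → (K →L[ℂ] E) := fun y => Y y ∘L B y
  have hY' : ContDiffAt ℂ ω Y' z := hY.clm_comp hB
  have hAB : ∀ᶠ y in 𝓝 z, (∀ a, A y (B y a) = a) ∧ ∀ a, B y (A y a) = a := by
    filter_upwards [hunit] with y hy
    exact ⟨fun a => congrArg (fun T : K →L[ℂ] K => T a) (Ring.mul_inverse_cancel _ hy),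
      fun a => congrArg (fun T : K →L[ℂ] K => T a) (Ring.inverse_mul_cancel _ hy)⟩
  have hL' : ∀ᶠ y in 𝓝 z, ∀ a, L (Y' y a) = a := hAB.mono fun y hy => hy.1
  have hrange : ∀ᶠ y in 𝓝 z, LinearMap.range (Y y).toLinearMap =
      LinearMap.range (Y' y).toLinearMap := by
    filter_upwards [hAB] with y hy
    apply le_antisymm
    · rintro _ ⟨a, rfl⟩
      exact ⟨A y a, congrArg (Y y) (hy.2 a)⟩
    · rintro _ ⟨a, rfl⟩
      exact ⟨B y a, rfl⟩
  have hcomm : ∀ᶠ y in 𝓝 z, ∀ a b, fderiv ℂ Y' y (Y' y a) b = fderiv ℂ Y' y (Y' y b) a := by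
    filter_upwards [hinv, hrange, hAB.eventually_nhds, hL'.eventually_nhds,
      hA.eventually (by simp), hY'.eventually (by simp)] with y hy1 hy2 hy3 hy4 hy5 hy6 a b
    have hA' := (hy5.differentiableAt hω).hasFDerivAt
    have hY'd := (hy6.differentiableAt hω).hasFDerivAt
    -- Leibniz rule for `Y = Y' A`. The term with `dA` lies in the span of `Y'`, so it does not
    -- affect the involutivity condition.
    have hYd : ∀ w u, fderiv ℂ Y y w u =
        fderiv ℂ Y' y w (A y u) + Y' y (fderiv ℂ A y w u) := by
      intro w u
      have h1 : Y =ᶠ[𝓝 y] fun y => Y' y ∘L A y := by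
        filter_upwards [hy3] with x hx
        ext u
        exact (congrArg (Y x) (hx.2 u)).symm
      rw [h1.fderiv_eq, (hY'd.clm_comp hA').fderiv]
      simp [add_comm]
    have hLd : ∀ w u, L (fderiv ℂ Y' y w u) = 0 := by
      intro w u
      have h1 : HasFDerivAt (fun x => L (Y' x u)) _ y :=
        L.hasFDerivAt.comp y (hY'd.clm_apply (hasFDerivAt_const u y))
      have h2 : (fun x => L (Y' x u)) =ᶠ[𝓝 y] fun _ => u := hy4.mono fun x hx => hx u
      have h3 := (h1.congr_of_eventuallyEq h2.symm).unique (hasFDerivAt_const u y)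
      have h4 := congrArg (fun T : E →L[ℂ] K => T w) h3
      simpa using h4
    have hAB' := hy3.self_of_nhds
    have hYB : ∀ a, Y y (B y a) = Y' y a := fun a => rfl
    have h1 := hy1 (B y a) (B y b)
    rw [hy2, hYd, hYd, hYB, hYB, hAB'.1, hAB'.1] at h1
    have h2 : fderiv ℂ Y' y (Y' y a) b - fderiv ℂ Y' y (Y' y b) a ∈
        LinearMap.range (Y' y).toLinearMap := by
      have h3 : Y' y (fderiv ℂ A y (Y' y a) (B y b)) - Y' y (fderiv ℂ A y (Y' y b) (B y a)) ∈
          LinearMap.range (Y' y).toLinearMap := ⟨_, map_sub (Y' y) _ _⟩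
      have h4 := Submodule.sub_mem _ h1 h3
      convert h4 using 1
      abel
    obtain ⟨k, hk⟩ := h2
    have hk' : Y' y k = fderiv ℂ Y' y (Y' y a) b - fderiv ℂ Y' y (Y' y b) a := hk
    have h5 := congrArg L hk'
    rw [hy4.self_of_nhds, map_sub, hLd, hLd, sub_zero] at h5
    rw [h5, map_zero] at hk'
    exact sub_eq_zero.1 hk'.symm
  obtain ⟨g, hg⟩ := exists_firstIntegral_of_commute hY' L hL' hcomm
  have hQ : Module.finrank ℂ (LinearMap.ker L.toLinearMap) = m := by
    have h3 := LinearMap.finrank_range_add_finrank_ker L.toLinearMap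
    have h4 : LinearMap.range L.toLinearMap = ⊤ :=
      LinearMap.range_eq_top.2 fun a => ⟨Y z a, hLz a⟩
    rw [h4, finrank_top] at h3
    omega
  let e : LinearMap.ker L.toLinearMap ≃L[ℂ] (Fin m → ℂ) :=
    ContinuousLinearEquiv.ofFinrankEq (by simp [hQ])
  refine ⟨fun y => e (g y), ?_⟩
  filter_upwards [hg, hrange] with y hy1 hy2
  have hd : fderiv ℂ (fun y => e (g y)) y = (e : _ →L[ℂ] (Fin m → ℂ)) ∘L fderiv ℂ g y :=
    e.comp_fderiv
  refine ⟨e.contDiff.contDiffAt.comp y hy1.1, ?_, ?_⟩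
  · rw [hd]
    exact e.surjective.comp hy1.2.1
  · rw [hy2, ← hy1.2.2, hd]
    ext w
    simp

end Frobenius

/-! ### The lifted distribution in coordinates -/

section Flip

variable {F G H : Type*} [NormedAddCommGroup F] [NormedSpace ℂ F] [NormedAddCommGroup G]
  [NormedSpace ℂ G] [NormedAddCommGroup H] [NormedSpace ℂ H]

/-- A shortcut for instance search. -/
instance instNormedAddCommGroupComplexCLM : NormedAddCommGroup (F →L[ℂ] G) :=
  ContinuousLinearMap.toNormedAddCommGroup

/-- A shortcut for instance search. -/
instance instNormedSpaceComplexCLM : NormedSpace ℂ (F →L[ℂ] G) :=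
  ContinuousLinearMap.toNormedSpace

lemma isBoundedLinearMap_flip :
    IsBoundedLinearMap ℂ (fun T : F →L[ℂ] G →L[ℂ] H => T.flip) :=
  ⟨⟨fun _ _ => rfl, fun _ _ => rfl⟩, 1, one_pos, fun T => by
    simp [ContinuousLinearMap.opNorm_flip]⟩

lemma contDiff_flip : ContDiff ℂ ω (fun T : F →L[ℂ] G →L[ℂ] H => T.flip) :=
  isBoundedLinearMap_flip.contDiff

end Flip

section LocalModel


variable {E P Q : Type*} [NormedAddCommGroup E] [NormedSpace ℂ E] [NormedAddCommGroup P]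
  [NormedSpace ℂ P] [NormedAddCommGroup Q] [NormedSpace ℂ Q]
  (θ : E → P →L[ℂ] Q →L[ℂ] E) (A : E → E →L[ℂ] Q →L[ℂ] Q) (B : E → E →L[ℂ] P →L[ℂ] P)

/-- The vectors spanning, together with the Euler vector field, the lift of the twistor
distribution: `(u, c) ↦ (θ(u ⊗ π), -A(θ(u ⊗ π)) π + c π)` at the point `(x, π)`. -/
def liftField (z : E × Q) : P × ℂ →L[ℂ] E × Q :=
  (.inl ℂ E Q ∘L (θ z.1).flip z.2 - .inr ℂ E Q ∘L (A z.1).flip z.2 ∘L (θ z.1).flip z.2) ∘L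
    .fst ℂ P ℂ + (ContinuousLinearMap.snd ℂ P ℂ).smulRight ((0, z.2) : E × Q)

@[simp] lemma liftField_apply (z : E × Q) (k : P × ℂ) :
    liftField θ A z k =
      (θ z.1 k.1 z.2, -A z.1 (θ z.1 k.1 z.2) z.2 + k.2 • z.2) := by
  simp [liftField]

variable {θ A B}

lemma contDiffAt_liftField {z : E × Q} (hθ : ContDiffAt ℂ ω θ z.1) (hA : ContDiffAt ℂ ω A z.1) :
    ContDiffAt ℂ ω (liftField θ A) z := by
  have h1 : ContDiffAt ℂ ω (fun z : E × Q => (θ z.1).flip z.2) z :=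
    (contDiff_flip.contDiffAt.comp z (ContDiffAt.comp (g := θ) z hθ contDiffAt_fst)).clm_apply
      contDiffAt_snd
  have h2 : ContDiffAt ℂ ω (fun z : E × Q => (A z.1).flip z.2) z :=
    (contDiff_flip.contDiffAt.comp z (ContDiffAt.comp (g := A) z hA contDiffAt_fst)).clm_apply
      contDiffAt_snd
  have h3 : ContDiffAt ℂ ω (fun z : E × Q => (A z.1).flip z.2 ∘L (θ z.1).flip z.2) z :=
    h2.clm_comp h1
  have h5 : ContDiffAt ℂ ω (fun z : E × Q => ((0, z.2) : E × Q)) z := by fun_prop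
  exact (((contDiffAt_const.clm_comp h1).sub (contDiffAt_const.clm_comp h3)).clm_comp
    contDiffAt_const).add
    ((ContinuousLinearMap.smulRightL ℂ (P × ℂ) (E × Q) (.snd ℂ P ℂ)).contDiff.contDiffAt.comp z h5)

lemma fderiv_liftField {z : E × Q} (hθ : ContDiffAt ℂ ω θ z.1) (hA : ContDiffAt ℂ ω A z.1)
    (w : E × Q) (k : P × ℂ) :
    fderiv ℂ (liftField θ A) z w k =
      (fderiv ℂ θ z.1 w.1 k.1 z.2 + θ z.1 k.1 w.2,
        -(fderiv ℂ A z.1 w.1 (θ z.1 k.1 z.2) z.2 +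
          A z.1 (fderiv ℂ θ z.1 w.1 k.1 z.2 + θ z.1 k.1 w.2) z.2 +
          A z.1 (θ z.1 k.1 z.2) w.2) + k.2 • w.2) := by
  have hω : (ω : WithTop ℕ∞) ≠ 0 := by simp
  have h1 : HasFDerivAt (fun z => liftField θ A z k) _ z :=
    ((contDiffAt_liftField hθ hA).differentiableAt hω).hasFDerivAt.clm_apply
      (hasFDerivAt_const k z)
  have hθ' : HasFDerivAt (fun z : E × Q => θ z.1) (fderiv ℂ θ z.1 ∘L .fst ℂ E Q) z :=
    HasFDerivAt.comp (g := θ) z (hθ.differentiableAt hω).hasFDerivAt hasFDerivAt_fst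
  have hA' : HasFDerivAt (fun z : E × Q => A z.1) (fderiv ℂ A z.1 ∘L .fst ℂ E Q) z :=
    HasFDerivAt.comp (g := A) z (hA.differentiableAt hω).hasFDerivAt hasFDerivAt_fst
  have hs := hasFDerivAt_snd (𝕜 := ℂ) (E := E) (F := Q) (p := z)
  have h2 := (hθ'.clm_apply (hasFDerivAt_const k.1 z)).clm_apply hs
  have h3 := (hA'.clm_apply h2).clm_apply hs
  have h4 := h2.prodMk (h3.neg.add (hs.const_smul k.2))
  have h5 : (fun z => liftField θ A z k) = fun z : E × Q =>
      (θ z.1 k.1 z.2, -A z.1 (θ z.1 k.1 z.2) z.2 + k.2 • z.2) := by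
    funext z; simp
  rw [h5] at h1
  have h6 := congrArg (fun T : E × Q →L[ℂ] E × Q => T w) (h1.unique h4)
  simp only [add_apply, ContinuousLinearMap.flip_apply,
    ContinuousLinearMap.comp_apply, ContinuousLinearMap.prod_apply, neg_apply,
    smul_apply, zero_apply, map_zero, zero_add,
    ContinuousLinearMap.coe_fst', ContinuousLinearMap.coe_snd'] at h6
  rw [h6]
  refine Prod.ext ?_ ?_
  · simp [add_comm]
  · simp only [map_add]
    abel_nf

/-- The antisymmetric part of `horizontal` computes brackets of horizontal lifts. -/
def horizontalDeriv (θ : E → P →L[ℂ] Q →L[ℂ] E) (A : E → E →L[ℂ] Q →L[ℂ] Q) (z : E × Q)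
    (u u' : P) : E :=
  fderiv ℂ θ z.1 (θ z.1 u z.2) u' z.2 - θ z.1 u' (A z.1 (θ z.1 u z.2) z.2)

/-- The curvature of the connection `d + A`. -/
def connCurv (A : E → E →L[ℂ] Q →L[ℂ] Q) (x a b : E) (w : Q) : Q :=
  fderiv ℂ A x a b w - fderiv ℂ A x b a w + (A x a (A x b w) - A x b (A x a w))

/-- The left side is the Lie bracket of the fields with constant coefficients `k` and `k'`.
Derivatives of `A` enter only antisymmetrised, as curvature, so the bracket is the horizontal lift
of its base component minus a vertical curvature term. The terms with `k.2` and `k'.2` come from the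
Euler field `e`, for which `[e, X_u] = X_u`. -/
lemma fderiv_liftField_sub {z : E × Q} (hθ : ContDiffAt ℂ ω θ z.1) (hA : ContDiffAt ℂ ω A z.1)
    (k k' : P × ℂ) :
    fderiv ℂ (liftField θ A) z (liftField θ A z k) k' -
      fderiv ℂ (liftField θ A) z (liftField θ A z k') k =
    ((horizontalDeriv θ A z k.1 k'.1 - horizontalDeriv θ A z k'.1 k.1 +
        θ z.1 (k.2 • k'.1 - k'.2 • k.1) z.2),
      -A z.1 (horizontalDeriv θ A z k.1 k'.1 - horizontalDeriv θ A z k'.1 k.1 +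
        θ z.1 (k.2 • k'.1 - k'.2 • k.1) z.2) z.2 -
        connCurv A z.1 (θ z.1 k.1 z.2) (θ z.1 k'.1 z.2) z.2) := by
  rw [fderiv_liftField hθ hA, fderiv_liftField hθ hA]
  refine Prod.ext ?_ ?_
  · simp only [liftField_apply, Prod.fst_sub, horizontalDeriv, map_add, map_neg, map_smul, map_sub,
      sub_apply, smul_apply]
    module
  · simp only [liftField_apply, Prod.snd_sub, horizontalDeriv, connCurv, map_add, map_neg, map_smul,
      map_sub, add_apply, sub_apply,
      smul_apply, neg_apply]
    module

/-- The torsion of the connection `(d + B) ⊗ (d + A)`, transported by `θ`, evaluated at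
`u ⊗ v`, `u' ⊗ v'`. -/
def connTorsion (θ : E → P →L[ℂ] Q →L[ℂ] E) (A : E → E →L[ℂ] Q →L[ℂ] Q)
    (B : E → E →L[ℂ] P →L[ℂ] P) (x : E) (u : P) (v : Q) (u' : P) (v' : Q) : E :=
  θ x (B x (θ x u v) u') v' + θ x u' (A x (θ x u v) v') -
    (θ x (B x (θ x u' v') u) v + θ x u (A x (θ x u' v') v)) -
    (fderiv ℂ θ x (θ x u v) u' v' - fderiv ℂ θ x (θ x u' v') u v)

/-- The difference of `U`-components of the bracket of two horizontal lifts. -/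
def bracketU (θ : E → P →L[ℂ] Q →L[ℂ] E) (B : E → E →L[ℂ] P →L[ℂ] P) (z : E × Q) (u u' : P) : P :=
  B z.1 (θ z.1 u z.2) u' - B z.1 (θ z.1 u' z.2) u

/-- In `T(u ⊗ π, u' ⊗ π)` the terms with `A` and `dθ` make up the antisymmetrised `horizontalDeriv`,
and the terms with `B` are what remains. Zero torsion thus makes the base component of a bracket of
lifts again decomposable with factor `π`. -/
lemma horizontalDeriv_sub {z : E × Q} {u u' : P}
    (hT : connTorsion θ A B z.1 u z.2 u' z.2 = 0) :
    horizontalDeriv θ A z u u' - horizontalDeriv θ A z u' u =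
      θ z.1 (bracketU θ B z u u') z.2 := by
  rw [← sub_eq_zero, ← neg_eq_zero, ← hT]
  simp only [connTorsion, horizontalDeriv, bracketU, map_sub, sub_apply]
  abel

/-- The twistor distribution is involutive if the torsion and the curvature vanish suitably. -/
lemma involutive_liftField {z : E × Q} (hθ : ContDiffAt ℂ ω θ z.1) (hA : ContDiffAt ℂ ω A z.1)
    (hT : ∀ u u', connTorsion θ A B z.1 u z.2 u' z.2 = 0)
    (hR : ∀ u u', ∃ c : ℂ, connCurv A z.1 (θ z.1 u z.2) (θ z.1 u' z.2) z.2 = c • z.2)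
    (k k' : P × ℂ) :
    fderiv ℂ (liftField θ A) z (liftField θ A z k) k' -
      fderiv ℂ (liftField θ A) z (liftField θ A z k') k ∈
      LinearMap.range (liftField θ A z).toLinearMap := by
  obtain ⟨c, hc⟩ := hR k.1 k'.1
  rw [fderiv_liftField_sub hθ hA, horizontalDeriv_sub (hT _ _), hc]
  -- The Euler coefficient `-c` absorbs the curvature term.
  refine ⟨(bracketU θ B z k.1 k'.1 + (k.2 • k'.1 - k'.2 • k.1), -c), ?_⟩
  refine (liftField_apply θ A z _).trans ?_
  simp only [map_add, add_apply, neg_smul, sub_eq_add_neg]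

/-- The inner bracket is a horizontal lift minus a vertical field `R π`. Two lifts bracket to a base
vector `b ⊗ π`, while bracketing the lift of `u''` with the vertical field differentiates `u'' ⊗ π`
in `π` and leaves `u'' ⊗ R π`. The torsion must vanish near the point, since the inner bracket is
differentiated. -/
lemma exists_fst_lieBracket_lieBracket {z : E × Q}
    (hθ : ∀ᶠ y in 𝓝 z.1, ContDiffAt ℂ ω θ y) (hA : ∀ᶠ y in 𝓝 z.1, ContDiffAt ℂ ω A y)
    (hB : ContDiffAt ℂ ω B z.1)
    (hT : ∀ᶠ y in 𝓝 z.1, ∀ u u' w, connTorsion θ A B y u w u' w = 0) (u u' u'' : P) :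
    ∃ b, (VectorField.lieBracket ℂ (fun y => liftField θ A y (u'', 0))
      (VectorField.lieBracket ℂ (fun y => liftField θ A y (u, 0))
        (fun y => liftField θ A y (u', 0))) z).1 =
      θ z.1 b z.2 + θ z.1 u'' (connCurv A z.1 (θ z.1 u z.2) (θ z.1 u' z.2) z.2) := by
  have hω : (ω : WithTop ℕ∞) ≠ 0 := by simp
  have hfst : Tendsto (fun y : E × Q => y.1) (𝓝 z) (𝓝 z.1) := continuous_fst.tendsto z
  have hbr : ∀ᶠ y in 𝓝 z, VectorField.lieBracket ℂ (fun y => liftField θ A y (u, 0))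
        (fun y => liftField θ A y (u', 0)) y = liftField θ A y (bracketU θ B y u u', 0) -
        (0, connCurv A y.1 (θ y.1 u y.2) (θ y.1 u' y.2) y.2) := by
    filter_upwards [hfst.eventually hθ, hfst.eventually hA, hfst.eventually hT] with y h1 h2 h3
    have hd (k : P × ℂ) (w : E × Q) : fderiv ℂ (fun y => liftField θ A y k) y w =
        fderiv ℂ (liftField θ A) y w k := by
      have := ((contDiffAt_liftField h1 h2).differentiableAt hω).hasFDerivAt.clm_apply
        (hasFDerivAt_const k y)
      rw [this.fderiv]
      simp
    rw [VectorField.lieBracket_eq]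
    beta_reduce
    rw [hd, hd, fderiv_liftField_sub h1 h2,
      horizontalDeriv_sub (h3 _ _ _)]
    simp
  have hz1 := hθ.self_of_nhds
  have hz2 := hA.self_of_nhds
  have hL := (contDiffAt_liftField hz1 hz2).differentiableAt hω
  have hd (k : P × ℂ) (w : E × Q) : fderiv ℂ (fun y => liftField θ A y k) z w =
      fderiv ℂ (liftField θ A) z w k := by
    have := hL.hasFDerivAt.clm_apply (hasFDerivAt_const k z)
    rw [this.fderiv]
    simp
  set br := VectorField.lieBracket ℂ (fun y => liftField θ A y (u, 0))
        (fun y => liftField θ A y (u', 0)) with hbrdef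
  have hdiff : DifferentiableAt ℂ br z :=
    ((ContDiffAt.lieBracket_vectorField (m := ω) (n := ω)
      ((contDiffAt_liftField hz1 hz2).clm_apply contDiffAt_const)
      ((contDiffAt_liftField hz1 hz2).clm_apply contDiffAt_const) (by simp))).differentiableAt hω
  have hθz : ContDiffAt ℂ ω (fun y : E × Q => θ y.1) z := hz1.comp (g := θ) z contDiffAt_fst
  have hBz : ContDiffAt ℂ ω (fun y : E × Q => B y.1) z := hB.comp (g := B) z contDiffAt_fst
  have hbU : ContDiffAt ℂ ω (fun y => bracketU θ B y u u') z := by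
    have h (u : P) : ContDiffAt ℂ ω (fun y : E × Q => θ y.1 u y.2) z :=
      (hθz.clm_apply contDiffAt_const).clm_apply contDiffAt_snd
    exact ((hBz.clm_apply (h u)).clm_apply contDiffAt_const).sub
      ((hBz.clm_apply (h u')).clm_apply contDiffAt_const)
  have hbUd := (hbU.differentiableAt hω).hasFDerivAt
  -- the derivative of the first component of the inner bracket
  have h1 (w : E × Q) : (fderiv ℂ br z w).1 =
      fderiv ℂ θ z.1 w.1 (bracketU θ B z u u') z.2 + θ z.1 (bracketU θ B z u u') w.2 +
      θ z.1 (fderiv ℂ (fun y => bracketU θ B y u u') z w) z.2 := by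
    have e1 : HasFDerivAt (fun y => (br y).1) (.fst ℂ E Q ∘L fderiv ℂ br z) z :=
      (ContinuousLinearMap.fst ℂ E Q).hasFDerivAt.comp z hdiff.hasFDerivAt
    have hθ' : HasFDerivAt (fun y : E × Q => θ y.1) (fderiv ℂ θ z.1 ∘L .fst ℂ E Q) z :=
      HasFDerivAt.comp (g := θ) z (hz1.differentiableAt hω).hasFDerivAt hasFDerivAt_fst
    have e2 := (hθ'.clm_apply hbUd).clm_apply (hasFDerivAt_snd (𝕜 := ℂ) (E := E) (F := Q) (p := z))
    have e3 : (fun y => (br y).1) =ᶠ[𝓝 z] fun y => θ y.1 (bracketU θ B y u u') y.2 := by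
      filter_upwards [hbr] with y hy
      rw [hy]
      simp
    have e4 := congrArg (fun T : E × Q →L[ℂ] E => T w)
      ((e1.congr_of_eventuallyEq e3.symm).unique e2)
    simp only [add_apply, ContinuousLinearMap.flip_apply, ContinuousLinearMap.comp_apply,
      ContinuousLinearMap.coe_fst', ContinuousLinearMap.coe_snd'] at e4
    rw [e4]
    abel
  have hbrz := hbr.self_of_nhds
  set ρ := connCurv A z.1 (θ z.1 u z.2) (θ z.1 u' z.2) z.2
  set b := bracketU θ B z u u'
  have hmain : (VectorField.lieBracket ℂ (fun y => liftField θ A y (u'', 0)) br z).1 =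
      horizontalDeriv θ A z u'' b - horizontalDeriv θ A z b u'' +
      θ z.1 (fderiv ℂ (fun y => bracketU θ B y u u') z (liftField θ A z (u'', 0))) z.2 +
      θ z.1 u'' ρ := by
    rw [VectorField.lieBracket_eq]
    beta_reduce
    rw [Prod.fst_sub, h1, hd, fderiv_liftField hz1 hz2, hbrz]
    simp only [horizontalDeriv, liftField_apply, zero_smul, add_zero, map_neg, Prod.fst_sub,
      Prod.snd_sub, map_sub, sub_zero]
    abel
  rw [hmain, horizontalDeriv_sub (hT.self_of_nhds _ _ _)]
  exact ⟨bracketU θ B z u'' b +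
    fderiv ℂ (fun y => bracketU θ B y u u') z (liftField θ A z (u'', 0)), by simp⟩

end LocalModel

/-! ### The curvature condition when `2 < p` -/

section LocalModel

variable {E Q : Type*} [NormedAddCommGroup E] [NormedSpace ℂ E] [NormedAddCommGroup Q]
  [NormedSpace ℂ Q] {p : ℕ}
  {θ : E → (Fin p → ℂ) →L[ℂ] Q →L[ℂ] E} {A : E → E →L[ℂ] Q →L[ℂ] Q}
  {B : E → E →L[ℂ] (Fin p → ℂ) →L[ℂ] (Fin p → ℂ)}

lemma apply_eq_sum_single (T : (Fin p → ℂ) →L[ℂ] Q →L[ℂ] E) (b : Fin p → ℂ) (w : Q) :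
    T b w = ∑ i, T (Pi.single i 1) (b i • w) := by
  conv_lhs => rw [pi_eq_sum_univ' b]
  simp [map_sum, map_smul]

lemma sum_apply_single (T : (Fin p → ℂ) →L[ℂ] Q →L[ℂ] E) (k : Fin p) (w : Q) :
    ∑ i, T (Pi.single i 1) ((Pi.single k w : Fin p → Q) i) = T (Pi.single k 1) w := by
  rw [Finset.sum_eq_single k (fun i _ hi => by simp [hi]) (by simp)]
  simp

lemma connCurv_self (x a : E) (w : Q) : connCurv A x a a w = 0 := by simp [connCurv]

lemma connCurv_add_left (x a a' b : E) (w : Q) :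
    connCurv A x (a + a') b w = connCurv A x a b w + connCurv A x a' b w := by
  simp only [connCurv, map_add, add_apply]
  abel

lemma connCurv_smul_left (x a b : E) (w : Q) (c : ℂ) :
    connCurv A x (c • a) b w = c • connCurv A x a b w := by
  simp only [connCurv, map_smul, smul_apply]
  module

lemma connCurv_swap (x a b : E) (w : Q) : connCurv A x a b w = -connCurv A x b a w := by
  simp only [connCurv]
  abel

/-- If `p > 2`, then the curvature condition for involutivity follows from the vanishing of the
torsion, by the Jacobi identity for three horizontal lifts. -/
lemma exists_connCurv_eq_smul (hp : 2 < p) {z : E × Q} [CompleteSpace E] [CompleteSpace Q]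
    (hθ : ∀ᶠ y in 𝓝 z.1, ContDiffAt ℂ ω θ y) (hA : ∀ᶠ y in 𝓝 z.1, ContDiffAt ℂ ω A y)
    (hB : ContDiffAt ℂ ω B z.1)
    (hT : ∀ᶠ y in 𝓝 z.1, ∀ u u' w, connTorsion θ A B y u w u' w = 0)
    (hinj : ∀ ξ : Fin p → Q, ∑ i, θ z.1 (Pi.single i 1) (ξ i) = 0 → ξ = 0) (u u' : Fin p → ℂ) :
    ∃ c : ℂ, connCurv A z.1 (θ z.1 u z.2) (θ z.1 u' z.2) z.2 = c • z.2 := by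
  have hbasis (i j : Fin p) : ∃ c : ℂ, connCurv A z.1 (θ z.1 (Pi.single i 1) z.2)
      (θ z.1 (Pi.single j 1) z.2) z.2 = c • z.2 := by
    rcases eq_or_ne i j with rfl | hij
    · exact ⟨0, by rw [connCurv_self, zero_smul]⟩
    -- A third index exists because `2 < p`.
    obtain ⟨k, hk⟩ : ∃ k, k ∉ ({i, j} : Finset (Fin p)) := by
      by_contra! h
      have h1 := Finset.card_le_card (s := Finset.univ) (t := {i, j}) (fun k _ => h k)
      have h2 := Finset.card_le_two (a := i) (b := j)
      rw [Finset.card_univ, Fintype.card_fin] at h1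
      omega
    simp only [Finset.mem_insert, Finset.mem_singleton, not_or] at hk
    have hX (l : Fin p) : ContDiffAt ℂ ω
        (fun y => liftField θ A y ((Pi.single l 1 : Fin p → ℂ), (0 : ℂ))) z :=
      (contDiffAt_liftField hθ.self_of_nhds hA.self_of_nhds).clm_apply contDiffAt_const
    have hJ := VectorField.leibniz_identity_lieBracket (n := ω) (by simp) (hX k) (hX i) (hX j)
    rw [VectorField.lieBracket_swap (V := VectorField.lieBracket ℂ _ _)] at hJ
    obtain ⟨b1, h1⟩ := exists_fst_lieBracket_lieBracket hθ hA hB hT (Pi.single i 1)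
      (Pi.single j 1) (Pi.single k 1)
    obtain ⟨b2, h2⟩ := exists_fst_lieBracket_lieBracket hθ hA hB hT (Pi.single k 1)
      (Pi.single i 1) (Pi.single j 1)
    obtain ⟨b3, h3⟩ := exists_fst_lieBracket_lieBracket hθ hA hB hT (Pi.single k 1)
      (Pi.single j 1) (Pi.single i 1)
    have h4 := congrArg Prod.fst hJ
    rw [Prod.fst_add, Prod.fst_neg, h1, h2, h3] at h4
    set ρ := fun i j : Fin p => connCurv A z.1 (θ z.1 (Pi.single i 1) z.2)
      (θ z.1 (Pi.single j 1) z.2) z.2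
    change ∃ c : ℂ, ρ i j = c • z.2
    -- The base component of the Jacobi identity says that `e_k ⊗ ρ i j + e_j ⊗ ρ k i - e_i ⊗ ρ k j`
    -- lies in `U ⊗ π`. Its `k`-th component makes `ρ i j` a multiple of `π`.
    have h5 := congrFun (hinj (fun l => (b1 + b2 - b3) l • z.2 +
      (Pi.single k (ρ i j) : Fin p → Q) l +
      (Pi.single j (ρ k i) : Fin p → Q) l - (Pi.single i (ρ k j) : Fin p → Q) l) (by
        simp only [map_sub, map_add, Finset.sum_add_distrib, Finset.sum_sub_distrib,
          ← apply_eq_sum_single, sum_apply_single, add_apply, sub_apply]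
        rw [← sub_eq_zero] at h4
        rw [← h4]
        simp only [ρ]
        abel)) k
    simp only [Pi.single_eq_same, Pi.single_eq_of_ne hk.1, Pi.single_eq_of_ne hk.2, add_zero,
      sub_zero, Pi.zero_apply] at h5
    exact ⟨-(b1 + b2 - b3) k, by
      rw [neg_smul]; exact eq_neg_of_add_eq_zero_right h5⟩
  -- For fixed `π` the expression is bilinear in `u` and `u'`, so membership in the line of `π` need
  -- only be known on basis vectors.
  let R : (Fin p → ℂ) →ₗ[ℂ] (Fin p → ℂ) →ₗ[ℂ] Q := LinearMap.mk₂ ℂ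
    (fun u u' => connCurv A z.1 (θ z.1 u z.2) (θ z.1 u' z.2) z.2)
    (fun _ _ _ => by rw [map_add, add_apply, connCurv_add_left])
    (fun _ _ _ => by rw [map_smul, smul_apply, connCurv_smul_left])
    (fun _ _ _ => by rw [map_add, add_apply, connCurv_swap, connCurv_add_left, neg_add,
      ← connCurv_swap, ← connCurv_swap])
    (fun _ _ _ => by rw [map_smul, smul_apply, connCurv_swap, connCurv_smul_left, ← smul_neg,
      ← connCurv_swap])
  have hR : R u u' ∈ Submodule.span ℂ {z.2} := by
    rw [pi_eq_sum_univ' u, pi_eq_sum_univ' u']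
    simp only [map_sum, LinearMap.sum_apply, map_smul, LinearMap.smul_apply]
    refine Submodule.sum_mem _ fun i _ => Submodule.smul_mem _ _ (Submodule.sum_mem _ fun j _ =>
      Submodule.smul_mem _ _ (Submodule.mem_span_singleton.mpr ?_))
    obtain ⟨c, hc⟩ := hbasis j i
    exact ⟨c, hc.symm⟩
  obtain ⟨c, hc⟩ := Submodule.mem_span_singleton.mp hR
  exact ⟨c, hc.symm⟩

end LocalModel

/-! ### Sections and connections in coordinates -/

section Coordinates

variable {n r : ℕ} {M : Type*} [TopologicalSpace M] [ChartedSpace (Fin n → ℂ) M]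

section Basic

variable {W : M → Type*} [TopologicalSpace (TotalSpace (Fin r → ℂ) W)]
  [∀ x, AddCommGroup (W x)] [∀ x, Module ℂ (W x)] [∀ x, TopologicalSpace (W x)]
  [FiberBundle (Fin r → ℂ) W] [VectorBundle ℂ (Fin r → ℂ) W]

/-- The coordinates of a vector in the fibre at `x`, in the preferred trivialisation at `x₀`. -/
def fibCoord (x₀ x : M) : W x →ₗ[ℂ] (Fin r → ℂ) :=
  (trivializationAt (Fin r → ℂ) W x₀).linearMapAt ℂ x

/-- The vector in the fibre at `x` with given coordinates in the preferred trivialisation at `x₀`. -/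
def fibVec (x₀ x : M) : (Fin r → ℂ) →ₗ[ℂ] W x :=
  (trivializationAt (Fin r → ℂ) W x₀).symmₗ ℂ x

lemma fibCoord_fibVec {x₀ x : M} (hx : x ∈ (trivializationAt (Fin r → ℂ) W x₀).baseSet)
    (w : Fin r → ℂ) : fibCoord x₀ x (fibVec x₀ x w : W x) = w :=
  (trivializationAt (Fin r → ℂ) W x₀).linearMapAt_symmₗ hx w

lemma fibVec_fibCoord {x₀ x : M} (hx : x ∈ (trivializationAt (Fin r → ℂ) W x₀).baseSet)
    (w : W x) : fibVec x₀ x (fibCoord x₀ x w : Fin r → ℂ) = w :=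
  (trivializationAt (Fin r → ℂ) W x₀).symmₗ_linearMapAt hx w

lemma fibCoord_injective {x₀ x : M} (hx : x ∈ (trivializationAt (Fin r → ℂ) W x₀).baseSet) :
    Function.Injective (fibCoord (r := r) (W := W) x₀ x) :=
  Function.LeftInverse.injective (fibVec_fibCoord hx)

lemma fibCoord_apply {x₀ x : M} (hx : x ∈ (trivializationAt (Fin r → ℂ) W x₀).baseSet)
    (w : W x) : fibCoord x₀ x w = (trivializationAt (Fin r → ℂ) W x₀ ⟨x, w⟩).2 := by
  rw [fibCoord, Trivialization.coe_linearMapAt_of_mem _ hx]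

/-- A section in the preferred coordinates at `x₀`. -/
def secCoord (x₀ : M) (s : ∀ x, W x) (a : Fin n → ℂ) : Fin r → ℂ :=
  fibCoord x₀ ((chartAt (Fin n → ℂ) x₀).symm a) (s ((chartAt (Fin n → ℂ) x₀).symm a))

lemma secCoord_chart {x₀ x : M} (hx : x ∈ (chartAt (Fin n → ℂ) x₀).source) (s : ∀ x, W x) :
    (secCoord x₀ s (chartAt (Fin n → ℂ) x₀ x) : Fin r → ℂ) = fibCoord x₀ x (s x) := by
  rw [secCoord, (chartAt (Fin n → ℂ) x₀).left_inv hx]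

variable [IsManifold 𝓘(ℂ, Fin n → ℂ) ω M]

lemma tendsto_chart_symm {x₀ x : M} (hx : x ∈ (chartAt (Fin n → ℂ) x₀).source) :
    Tendsto (chartAt (Fin n → ℂ) x₀).symm (𝓝 (chartAt (Fin n → ℂ) x₀ x)) (𝓝 x) := by
  have := (chartAt (Fin n → ℂ) x₀).tendsto_symm hx
  exact this

lemma contMDiffAt_iff_contDiffAt_chart {F : Type*} [NormedAddCommGroup F] [NormedSpace ℂ F]
    {f : M → F} {x₀ x : M} (hx : x ∈ (chartAt (Fin n → ℂ) x₀).source) :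
    ContMDiffAt 𝓘(ℂ, Fin n → ℂ) 𝓘(ℂ, F) ω f x ↔
      ContDiffAt ℂ ω (f ∘ (chartAt (Fin n → ℂ) x₀).symm) (chartAt (Fin n → ℂ) x₀ x) := by
  constructor
  · intro h
    rw [← contMDiffAt_iff_contDiffAt]
    have h1 : ContMDiffAt 𝓘(ℂ, Fin n → ℂ) 𝓘(ℂ, Fin n → ℂ) ω (chartAt (Fin n → ℂ) x₀).symm
        (chartAt (Fin n → ℂ) x₀ x) :=
      contMDiffOn_chart_symm.contMDiffAt
        ((chartAt (Fin n → ℂ) x₀).open_target.mem_nhds ((chartAt (Fin n → ℂ) x₀).map_source hx))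
    refine ContMDiffAt.comp _ ?_ h1
    rwa [(chartAt (Fin n → ℂ) x₀).left_inv hx]
  · intro h
    have h1 : ContMDiffAt 𝓘(ℂ, Fin n → ℂ) 𝓘(ℂ, Fin n → ℂ) ω (chartAt (Fin n → ℂ) x₀) x :=
      contMDiffOn_chart.contMDiffAt ((chartAt (Fin n → ℂ) x₀).open_source.mem_nhds hx)
    refine (ContMDiffAt.comp x h.contMDiffAt h1).congr_of_eventuallyEq ?_
    filter_upwards [(chartAt (Fin n → ℂ) x₀).open_source.mem_nhds hx] with y hy
    simp [(chartAt (Fin n → ℂ) x₀).left_inv hy]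

variable [ContMDiffVectorBundle ω (Fin r → ℂ) W 𝓘(ℂ, Fin n → ℂ)]

lemma holAt_iff {s : ∀ x, W x} {x₀ x : M} (hx : x ∈ (chartAt (Fin n → ℂ) x₀).source)
    (hx' : x ∈ (trivializationAt (Fin r → ℂ) W x₀).baseSet) :
    HolAt n r s x ↔ ContDiffAt ℂ ω (secCoord x₀ s : _ → Fin r → ℂ)
      (chartAt (Fin n → ℂ) x₀ x) := by
  rw [HolAt, Trivialization.contMDiffAt_section_iff (trivializationAt (Fin r → ℂ) W x₀) hx',
    contMDiffAt_iff_contDiffAt_chart hx]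
  have h : (fun y => (trivializationAt (Fin r → ℂ) W x₀ ⟨y, s y⟩).2) ∘
      (chartAt (Fin n → ℂ) x₀).symm =ᶠ[𝓝 (chartAt (Fin n → ℂ) x₀ x)] secCoord x₀ s := by
    filter_upwards [(tendsto_chart_symm hx).eventually
      ((trivializationAt (Fin r → ℂ) W x₀).open_baseSet.mem_nhds hx')] with a ha
    rw [secCoord, fibCoord_apply ha]
    rfl
  exact ⟨fun h1 => h1.congr_of_eventuallyEq h.symm, fun h1 => h1.congr_of_eventuallyEq h⟩

lemma holAt_fibVec {w : M → Fin r → ℂ} {x₀ x : M}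
    (hx' : x ∈ (trivializationAt (Fin r → ℂ) W x₀).baseSet)
    (hw : ContMDiffAt 𝓘(ℂ, Fin n → ℂ) 𝓘(ℂ, Fin r → ℂ) ω w x) :
    HolAt n r (fun x => (fibVec x₀ x (w x) : W x)) x := by
  rw [HolAt, Trivialization.contMDiffAt_section_iff (trivializationAt (Fin r → ℂ) W x₀) hx']
  refine hw.congr_of_eventuallyEq ?_
  filter_upwards [(trivializationAt (Fin r → ℂ) W x₀).open_baseSet.mem_nhds hx'] with y hy
  rw [← fibCoord_apply hy, fibCoord_fibVec hy]

end Basic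

section Tangent

variable [IsManifold 𝓘(ℂ, Fin n → ℂ) ω M]

/-- The preferred trivialisation of the tangent bundle is the differential of the chart; this ties
bundle coordinates of vectors to derivatives in the chart. -/
lemma fibCoord_tangent {x₀ x : M} (hx : x ∈ (chartAt (Fin n → ℂ) x₀).source)
    (X : TangentSpace 𝓘(ℂ, Fin n → ℂ) x) :
    (fibCoord (W := TangentSpace 𝓘(ℂ, Fin n → ℂ)) x₀ x X : Fin n → ℂ) =
      mfderiv 𝓘(ℂ, Fin n → ℂ) 𝓘(ℂ, Fin n → ℂ) (chartAt (Fin n → ℂ) x₀) x X := by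
  have := TangentBundle.continuousLinearMapAt_trivializationAt (I := 𝓘(ℂ, Fin n → ℂ)) hx
  exact congrArg (fun T : _ →L[ℂ] (Fin n → ℂ) => T X) this

instance : ContMDiffVectorBundle ω (Fin n → ℂ) (TangentSpace 𝓘(ℂ, Fin n → ℂ) : M → Type _)
  𝓘(ℂ, Fin n → ℂ) := inferInstance

lemma mfderiv_apply_chart {F : Type*} [NormedAddCommGroup F] [NormedSpace ℂ F]
    {g : (Fin n → ℂ) → F} {f : M → F} {x₀ x : M} (hx : x ∈ (chartAt (Fin n → ℂ) x₀).source)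
    (hg : DifferentiableAt ℂ g (chartAt (Fin n → ℂ) x₀ x))
    (hf : ∀ᶠ y in 𝓝 x, f y = g (chartAt (Fin n → ℂ) x₀ y))
    (X : TangentSpace 𝓘(ℂ, Fin n → ℂ) x) :
    mfderiv 𝓘(ℂ, Fin n → ℂ) 𝓘(ℂ, F) f x X =
      fderiv ℂ g (chartAt (Fin n → ℂ) x₀ x)
        (fibCoord (W := TangentSpace 𝓘(ℂ, Fin n → ℂ)) x₀ x X) := by
  have h1 : MDifferentiableAt 𝓘(ℂ, Fin n → ℂ) 𝓘(ℂ, Fin n → ℂ) (chartAt (Fin n → ℂ) x₀) x :=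
    mdifferentiableAt_atlas (chart_mem_atlas _ _) hx
  rw [fibCoord_tangent hx, Filter.EventuallyEq.mfderiv_eq hf]
  have h2 := mfderiv_comp (I' := 𝓘(ℂ, Fin n → ℂ)) x hg.mdifferentiableAt h1
  rw [mfderiv_eq_fderiv] at h2
  exact congrArg (fun T : _ →L[ℂ] F => T X) h2

end Tangent

end Coordinates

/-! ### Connections in coordinates -/

section Connection

variable {n r : ℕ} {M : Type*} [TopologicalSpace M] [ChartedSpace (Fin n → ℂ) M]
  [IsManifold 𝓘(ℂ, Fin n → ℂ) ω M]
  {W : M → Type*} [TopologicalSpace (TotalSpace (Fin r → ℂ) W)]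
  [∀ x, AddCommGroup (W x)] [∀ x, Module ℂ (W x)] [∀ x, TopologicalSpace (W x)]
  [∀ x, IsTopologicalAddGroup (W x)] [∀ x, ContinuousSMul ℂ (W x)]
  [FiberBundle (Fin r → ℂ) W] [VectorBundle ℂ (Fin r → ℂ) W]
  [ContMDiffVectorBundle ω (Fin r → ℂ) W 𝓘(ℂ, Fin n → ℂ)]

lemma HolAt.mdifferentiableAt {s : ∀ x, W x} {x : M} (h : HolAt n r s x) :
    MDifferentiableAt 𝓘(ℂ, Fin n → ℂ) (𝓘(ℂ, Fin n → ℂ).prod 𝓘(ℂ, Fin r → ℂ))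
      (fun y => TotalSpace.mk' (Fin r → ℂ) y (s y)) x :=
  ContMDiffAt.mdifferentiableAt h (by simp)

lemma HolAt.eventually {s : ∀ x, W x} {x : M} (h : HolAt n r s x) :
    ∀ᶠ y in 𝓝 x, HolAt n r s y :=
  (contMDiffAt_iff_contMDiffAt_nhds (by simp)).1 h

lemma holAt_extend {x : M} (w : W x) : HolAt n r (FiberBundle.extend (Fin r → ℂ) w) x :=
  FiberBundle.contMDiffAt_extend 𝓘(ℂ, Fin n → ℂ) (Fin r → ℂ) w

lemma covariantDerivative_sum (cov : CovariantDerivative 𝓘(ℂ, Fin n → ℂ) (Fin r → ℂ) W)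
    {ι : Type*} (t : Finset ι) (σ : ι → ∀ x, W x) (x : M)
    (hσ : ∀ i, MDifferentiableAt 𝓘(ℂ, Fin n → ℂ) (𝓘(ℂ, Fin n → ℂ).prod 𝓘(ℂ, Fin r → ℂ))
      (fun y => TotalSpace.mk' (Fin r → ℂ) y (σ i y)) x) :
    cov (fun y => ∑ i ∈ t, σ i y) x = ∑ i ∈ t, cov (σ i) x := by
  classical
  induction t using Finset.induction_on with
  | empty =>
    simp only [Finset.sum_empty]
    exact congrFun cov.zero x
  | insert a t ha ih =>
    simp only [Finset.sum_insert ha]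
    rw [← ih]
    exact cov.isCovariantDerivativeOnUniv.add (hσ a) (MDifferentiableAt.sum_section fun i _ => hσ i)

variable {cov : CovariantDerivative 𝓘(ℂ, Fin n → ℂ) (Fin r → ℂ) W} {x₀ x : M}

variable (x₀) in
/-- The frame of the bundle given by the preferred trivialisation at `x₀`. -/
def fibFrame (i : Fin r) (x : M) : W x := fibVec x₀ x (Pi.single i 1 : Fin r → ℂ)

lemma holAt_fibFrame (hx' : x ∈ (trivializationAt (Fin r → ℂ) W x₀).baseSet) (i : Fin r) :
    HolAt n r (fibFrame (W := W) x₀ i) x :=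
  holAt_fibVec hx' contMDiffAt_const

lemma sum_fibFrame (hx' : x ∈ (trivializationAt (Fin r → ℂ) W x₀).baseSet) (w : W x) :
    ∑ i, (fibCoord x₀ x w : Fin r → ℂ) i • (fibFrame x₀ i x : W x) = w := by
  conv_rhs => rw [← fibVec_fibCoord hx' w, pi_eq_sum_univ' (fibCoord x₀ x w)]
  simp [fibFrame, map_sum]

/-- The connection form in the preferred coordinates at `x₀`. -/
def connForm (cov : CovariantDerivative 𝓘(ℂ, Fin n → ℂ) (Fin r → ℂ) W) (x₀ : M) (a : Fin n → ℂ) :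
    (Fin n → ℂ) →L[ℂ] (Fin r → ℂ) →L[ℂ] (Fin r → ℂ) :=
  ∑ k : Fin n, ∑ i : Fin r, (ContinuousLinearMap.proj (R := ℂ) (φ := fun _ : Fin n => ℂ) k).smulRight
    ((ContinuousLinearMap.proj (R := ℂ) (φ := fun _ : Fin r => ℂ) i).smulRight
    (secCoord x₀ (fun x => cov (fibFrame x₀ i) x
      (fibFrame (W := TangentSpace 𝓘(ℂ, Fin n → ℂ)) x₀ k x)) a))

lemma connForm_apply (hx : x ∈ (chartAt (Fin n → ℂ) x₀).source)
    (X : TangentSpace 𝓘(ℂ, Fin n → ℂ) x) (w : Fin r → ℂ) :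
    connForm cov x₀ (chartAt (Fin n → ℂ) x₀ x)
      (fibCoord (W := TangentSpace 𝓘(ℂ, Fin n → ℂ)) x₀ x X) w =
      ∑ i : Fin r, w i • (fibCoord x₀ x (cov (fibFrame x₀ i) x X) : Fin r → ℂ) := by
  have h : ∀ i : Fin r, (fibCoord x₀ x (cov (fibFrame x₀ i) x X) : Fin r → ℂ) =
      ∑ k, (fibCoord (W := TangentSpace 𝓘(ℂ, Fin n → ℂ)) x₀ x X : Fin n → ℂ) k •
        (fibCoord x₀ x (cov (fibFrame x₀ i) x
          (fibFrame (W := TangentSpace 𝓘(ℂ, Fin n → ℂ)) x₀ k x)) : Fin r → ℂ) := by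
    intro i
    conv_lhs => rw [← sum_fibFrame (r := n) (W := TangentSpace 𝓘(ℂ, Fin n → ℂ)) (x₀ := x₀) hx X]
    simp only [map_sum, map_smul]
  simp only [h, connForm, sum_apply, ContinuousLinearMap.smulRight_apply, smul_apply,
    ContinuousLinearMap.proj_apply, secCoord_chart hx, Finset.smul_sum]
  rw [Finset.sum_comm]
  exact Finset.sum_congr rfl fun i _ => Finset.sum_congr rfl fun k _ => smul_comm _ _ _

/-- The entries of the form are covariant derivatives of frame sections along frame fields, and both
frames are holomorphic. -/
lemma contDiffAt_connForm (hcov : IsHolomorphicConnection cov)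
    (hx : x ∈ (chartAt (Fin n → ℂ) x₀).source)
    (hx' : x ∈ (trivializationAt (Fin r → ℂ) W x₀).baseSet) :
    ContDiffAt ℂ ω (connForm cov x₀) (chartAt (Fin n → ℂ) x₀ x) := by
  refine ContDiffAt.sum fun k _ => ContDiffAt.sum fun i _ => ?_
  have h := (holAt_iff hx hx').1 (hcov x _ _
    (holAt_fibFrame (W := TangentSpace 𝓘(ℂ, Fin n → ℂ)) (x₀ := x₀) hx k) (holAt_fibFrame hx' i))
  exact contDiffAt_const.smulRight (contDiffAt_const.smulRight h)

/-- A connection is `d + A` in coordinates. -/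
lemma fibCoord_cov (hx : x ∈ (chartAt (Fin n → ℂ) x₀).source)
    (hx' : x ∈ (trivializationAt (Fin r → ℂ) W x₀).baseSet) {s : ∀ x, W x} (hs : HolAt n r s x)
    (X : TangentSpace 𝓘(ℂ, Fin n → ℂ) x) :
    fibCoord x₀ x (cov s x X) =
      fderiv ℂ (secCoord x₀ s : _ → Fin r → ℂ) (chartAt (Fin n → ℂ) x₀ x)
        (fibCoord (W := TangentSpace 𝓘(ℂ, Fin n → ℂ)) x₀ x X) +
      connForm cov x₀ (chartAt (Fin n → ℂ) x₀ x)
        (fibCoord (W := TangentSpace 𝓘(ℂ, Fin n → ℂ)) x₀ x X) (fibCoord x₀ x (s x)) := by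
  have hω : (ω : WithTop ℕ∞) ≠ 0 := by simp
  have hs' := ((holAt_iff hx hx').1 hs).differentiableAt hω
  have hsi (i : Fin r) : DifferentiableAt ℂ (fun a => (secCoord x₀ s a : Fin r → ℂ) i)
      (chartAt (Fin n → ℂ) x₀ x) := differentiableAt_pi.1 hs' i
  let g (i : Fin r) (y : M) : ℂ := (fibCoord x₀ y (s y) : Fin r → ℂ) i
  have hg (i : Fin r) : ∀ᶠ y in 𝓝 x, g i y =
      (fun a => (secCoord x₀ s a : Fin r → ℂ) i) (chartAt (Fin n → ℂ) x₀ y) := by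
    filter_upwards [(chartAt (Fin n → ℂ) x₀).open_source.mem_nhds hx] with y hy
    simp only [g, secCoord_chart hy]
  have hgd (i : Fin r) : MDifferentiableAt 𝓘(ℂ, Fin n → ℂ) 𝓘(ℂ, ℂ) (g i) x :=
    ((hsi i).mdifferentiableAt.comp x (mdifferentiableAt_atlas (chart_mem_atlas _ _) hx)
      ).congr_of_eventuallyEq (hg i)
  have hf (i : Fin r) := (holAt_fibFrame (n := n) (W := W) hx' i).mdifferentiableAt
  have hgf (i : Fin r) : MDifferentiableAt 𝓘(ℂ, Fin n → ℂ) (𝓘(ℂ, Fin n → ℂ).prod 𝓘(ℂ, Fin r → ℂ))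
      (fun y => TotalSpace.mk' (Fin r → ℂ) y (g i y • (fibFrame x₀ i y : W y))) x :=
    MDifferentiableAt.smul_section (hgd i) (hf i)
  -- Near `x` the section is a combination of the frame with its coordinates as coefficients; the
  -- Leibniz rule separates the derivative of the coefficients from the connection form.
  have h1 : cov s x = cov (fun y => ∑ i, g i y • fibFrame x₀ i y) x := by
    refine cov.isCovariantDerivativeOnUniv.congr_of_eventuallyEq hs.mdifferentiableAt
      (MDifferentiableAt.sum_section fun i _ => hgf i) univ_mem ?_
    filter_upwards [(trivializationAt (Fin r → ℂ) W x₀).open_baseSet.mem_nhds hx'] with y hy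
    exact (sum_fibFrame hy (s y)).symm
  have h2 (i : Fin r) : cov (fun y => g i y • fibFrame x₀ i y) x X =
      g i x • cov (fibFrame x₀ i) x X + (fderiv ℂ (secCoord x₀ s : _ → Fin r → ℂ)
        (chartAt (Fin n → ℂ) x₀ x)
        (fibCoord (W := TangentSpace 𝓘(ℂ, Fin n → ℂ)) x₀ x X)) i • fibFrame x₀ i x := by
    have := congrArg (fun T => T X)
      (cov.isCovariantDerivativeOnUniv.leibniz (hf i) (hgd i) (mem_univ x))
    refine this.trans ?_
    have h3 := mfderiv_apply_chart hx (hsi i) (hg i) X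
    rw [fderiv_apply hs' i] at h3
    exact congrArg (fun c : ℂ => g i x • cov (fibFrame x₀ i) x X + c • (fibFrame x₀ i x : W x)) h3
  rw [h1, covariantDerivative_sum _ _ _ _ hgf, sum_apply, map_sum, connForm_apply hx]
  simp only [h2, map_add, map_smul, Finset.sum_add_distrib]
  rw [add_comm]
  congr 1
  simp only [fibFrame, fibCoord_fibVec hx']
  exact (pi_eq_sum_univ' _).symm

end Connection

/-! ### Lie brackets in a chart -/

section LieBracket

variable {n r : ℕ} {M : Type*} [TopologicalSpace M] [ChartedSpace (Fin n → ℂ) M]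
  [IsManifold 𝓘(ℂ, Fin n → ℂ) ω M] {x₀ x : M}

lemma isInvertible_mfderiv_chart (hx : x ∈ (chartAt (Fin n → ℂ) x₀).source) :
    (mfderiv 𝓘(ℂ, Fin n → ℂ) 𝓘(ℂ, Fin n → ℂ) (chartAt (Fin n → ℂ) x₀) x).IsInvertible := by
  have := isInvertible_mfderiv_extChartAt (I := 𝓘(ℂ, Fin n → ℂ)) (x := x₀) (y := x)
    (by rwa [extChartAt_source])
  exact this

lemma mlieBracket_vectorSpace {E : Type*} [NormedAddCommGroup E] [NormedSpace ℂ E]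
    (X Y : ∀ a : E, TangentSpace 𝓘(ℂ, E) a) (a : E) :
    VectorField.mlieBracket 𝓘(ℂ, E) X Y a = VectorField.lieBracket ℂ X Y a := by
  rw [← VectorField.mlieBracketWithin_univ, VectorField.mlieBracketWithin_eq_lieBracketWithin]
  exact congrFun VectorField.lieBracketWithin_univ a

/-- Near `x` each field is the pullback by the chart of its coordinate expression, and pullback by a
local biholomorphism commutes with brackets. -/
lemma fibCoord_mlieBracket (hx : x ∈ (chartAt (Fin n → ℂ) x₀).source)
    {X Y : ∀ y : M, TangentSpace 𝓘(ℂ, Fin n → ℂ) y} (hX : HolAt n n X x) (hY : HolAt n n Y x) :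
    (fibCoord (W := TangentSpace 𝓘(ℂ, Fin n → ℂ)) x₀ x
      (VectorField.mlieBracket 𝓘(ℂ, Fin n → ℂ) X Y x) : Fin n → ℂ) =
      VectorField.lieBracket ℂ (secCoord x₀ X) (secCoord x₀ Y) (chartAt (Fin n → ℂ) x₀ x) := by
  have hω : (ω : WithTop ℕ∞) ≠ 0 := by simp
  set φ := chartAt (Fin n → ℂ) x₀ with hφ
  have key {X : ∀ y : M, TangentSpace 𝓘(ℂ, Fin n → ℂ) y} :
      ∀ᶠ y in 𝓝 x, VectorField.mpullback 𝓘(ℂ, Fin n → ℂ) 𝓘(ℂ, Fin n → ℂ) φ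
        (fun a => (secCoord x₀ X a : Fin n → ℂ)) y = X y := by
    filter_upwards [φ.open_source.mem_nhds hx] with y hy
    change (mfderiv 𝓘(ℂ, Fin n → ℂ) 𝓘(ℂ, Fin n → ℂ) φ y).inverse (secCoord x₀ X (φ y)) = X y
    rw [secCoord_chart hy, fibCoord_tangent hy]
    exact (isInvertible_mfderiv_chart hy).inverse_apply_self _
  have hd {X : ∀ y : M, TangentSpace 𝓘(ℂ, Fin n → ℂ) y} (hX : HolAt n n X x) :
      MDifferentiableAt 𝓘(ℂ, Fin n → ℂ) 𝓘(ℂ, Fin n → ℂ).tangent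
        (fun a => (⟨a, (secCoord x₀ X a : Fin n → ℂ)⟩ :
          TangentBundle 𝓘(ℂ, Fin n → ℂ) (Fin n → ℂ))) (φ x) := by
    have h1 := (holAt_iff (r := n) (W := TangentSpace 𝓘(ℂ, Fin n → ℂ)) hx hx).1 hX
    exact (contMDiffAt_vectorSpace_iff_contDiffAt.2 h1).mdifferentiableAt hω
  have h := VectorField.mpullback_mlieBracket (n := ω) (f := φ) (x₀ := x) (hd hX) (hd hY)
    (contMDiffOn_chart.contMDiffAt (φ.open_source.mem_nhds hx)) (by simp)
  rw [Filter.EventuallyEq.mlieBracket_vectorField_eq key key] at h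
  rw [← h, fibCoord_tangent hx]
  refine ((isInvertible_mfderiv_chart hx).self_apply_inverse _).trans ?_
  exact mlieBracket_vectorSpace _ _ _

end LieBracket

/-! ### Curvature in coordinates -/

section Curvature

variable {n r : ℕ} {M : Type*} [TopologicalSpace M] [ChartedSpace (Fin n → ℂ) M]
  [IsManifold 𝓘(ℂ, Fin n → ℂ) ω M]
  {W : M → Type*} [TopologicalSpace (TotalSpace (Fin r → ℂ) W)]
  [∀ x, AddCommGroup (W x)] [∀ x, Module ℂ (W x)] [∀ x, TopologicalSpace (W x)]
  [∀ x, IsTopologicalAddGroup (W x)] [∀ x, ContinuousSMul ℂ (W x)]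
  [FiberBundle (Fin r → ℂ) W] [VectorBundle ℂ (Fin r → ℂ) W]
  [ContMDiffVectorBundle ω (Fin r → ℂ) W 𝓘(ℂ, Fin n → ℂ)]
  {cov : CovariantDerivative 𝓘(ℂ, Fin n → ℂ) (Fin r → ℂ) W} {x₀ x : M}

/-- The coordinates of a tangent vector at `x` in the preferred chart at `x₀`. -/
abbrev tanCoord (x₀ x : M) : TangentSpace 𝓘(ℂ, Fin n → ℂ) x →ₗ[ℂ] (Fin n → ℂ) :=
  fibCoord (W := TangentSpace 𝓘(ℂ, Fin n → ℂ)) x₀ x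

/-- The curvature differentiates `∇ s` once more, so the formula `d + A` is needed on a
neighbourhood and not only at `x`. -/
lemma secCoord_cov_eventuallyEq (hx : x ∈ (chartAt (Fin n → ℂ) x₀).source)
    (hx' : x ∈ (trivializationAt (Fin r → ℂ) W x₀).baseSet) {s : ∀ x, W x} (hs : HolAt n r s x)
    (X : ∀ y, TangentSpace 𝓘(ℂ, Fin n → ℂ) y) :
    (secCoord x₀ (fun y => cov s y (X y)) : _ → Fin r → ℂ) =ᶠ[𝓝 (chartAt (Fin n → ℂ) x₀ x)]
      fun a => fderiv ℂ (secCoord x₀ s : _ → Fin r → ℂ) a (secCoord x₀ X a) +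
        connForm cov x₀ a (secCoord x₀ X a) (secCoord x₀ s a) := by
  filter_upwards [(tendsto_chart_symm hx).eventually hs.eventually,
    (chartAt (Fin n → ℂ) x₀).open_target.mem_nhds ((chartAt (Fin n → ℂ) x₀).map_source hx),
    (tendsto_chart_symm hx).eventually
      ((trivializationAt (Fin r → ℂ) W x₀).open_baseSet.mem_nhds hx')] with a h1 h2 h3
  have h4 := (chartAt (Fin n → ℂ) x₀).map_target h2
  have h := fibCoord_cov (cov := cov) h4 h3 h1 (X _)
  rw [(chartAt (Fin n → ℂ) x₀).right_inv h2] at h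
  exact h

/-- Second derivatives of the extension of `w` cancel by symmetry, and derivatives of the extensions
of `a` and `b` cancel against the bracket term. What remains is `dA` antisymmetrised and the
commutator of `A`, independent of all extensions. -/
lemma fibCoord_curvatureAt (hcov : IsHolomorphicConnection cov)
    (hx : x ∈ (chartAt (Fin n → ℂ) x₀).source)
    (hx' : x ∈ (trivializationAt (Fin r → ℂ) W x₀).baseSet)
    (a b : TangentSpace 𝓘(ℂ, Fin n → ℂ) x) (w : W x) :
    (fibCoord x₀ x (curvatureAt cov x a b w) : Fin r → ℂ) =
      connCurv (connForm cov x₀) (chartAt (Fin n → ℂ) x₀ x) (tanCoord x₀ x a) (tanCoord x₀ x b)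
        (fibCoord x₀ x w) := by
  have hω : (ω : WithTop ℕ∞) ≠ 0 := by simp
  have hw := holAt_extend (n := n) (r := r) w
  have hA := (contDiffAt_connForm hcov hx hx').differentiableAt hω
  have hwc := (holAt_iff hx hx').1 hw
  have hw' := hwc.differentiableAt hω
  have hDw : DifferentiableAt ℂ (fderiv ℂ (secCoord x₀ (FiberBundle.extend (Fin r → ℂ) w)))
      (chartAt (Fin n → ℂ) x₀ x) :=
    (hwc.fderiv_right (m := 1) (by simp)).differentiableAt (by simp)
  have hsymm : IsSymmSndFDerivAt ℂ (secCoord x₀ (FiberBundle.extend (Fin r → ℂ) w) : _ → Fin r → ℂ)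
      (chartAt (Fin n → ℂ) x₀ x) := hwc.isSymmSndFDerivAt (by simp)
  have hT (a : TangentSpace 𝓘(ℂ, Fin n → ℂ) x) :
      HolAt n n (W := TangentSpace 𝓘(ℂ, Fin n → ℂ)) (FiberBundle.extend (Fin n → ℂ) a) x :=
    holAt_extend (n := n) (r := n) a
  have hTd (a : TangentSpace 𝓘(ℂ, Fin n → ℂ) x) := ((holAt_iff (r := n)
    (W := TangentSpace 𝓘(ℂ, Fin n → ℂ)) (x₀ := x₀) hx hx).1 (hT a)).differentiableAt hω
  have hT1 (a : TangentSpace 𝓘(ℂ, Fin n → ℂ) x) :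
      (secCoord x₀ (FiberBundle.extend (Fin n → ℂ) a) (chartAt (Fin n → ℂ) x₀ x) : Fin n → ℂ) =
        tanCoord x₀ x a := by
    rw [secCoord_chart hx, FiberBundle.extend_apply_self]
  have hw1 : (secCoord x₀ (FiberBundle.extend (Fin r → ℂ) w) (chartAt (Fin n → ℂ) x₀ x) :
      Fin r → ℂ) = fibCoord x₀ x w := by
    rw [secCoord_chart hx, FiberBundle.extend_apply_self]
  have main (a b : TangentSpace 𝓘(ℂ, Fin n → ℂ) x) :
      (fibCoord x₀ x (cov (fun y => cov (FiberBundle.extend (Fin r → ℂ) w) y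
        (FiberBundle.extend (Fin n → ℂ) b y)) x a) : Fin r → ℂ) = _ :=
    fibCoord_cov hx hx' (hcov x _ _ (hT b) hw) a
  have hder (b : TangentSpace 𝓘(ℂ, Fin n → ℂ) x) :=
    (hDw.hasFDerivAt.clm_apply (hTd b).hasFDerivAt).add
      ((hA.hasFDerivAt.clm_apply (hTd b).hasFDerivAt).clm_apply hw'.hasFDerivAt)
  have hder' (b : TangentSpace 𝓘(ℂ, Fin n → ℂ) x) := ((hder b).congr_of_eventuallyEq
    (secCoord_cov_eventuallyEq (cov := cov) hx hx' hw (FiberBundle.extend (Fin n → ℂ) b))).fderiv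
  have hpt (b : TangentSpace 𝓘(ℂ, Fin n → ℂ) x) :
      (fibCoord x₀ x (cov (FiberBundle.extend (Fin r → ℂ) w) x
        (FiberBundle.extend (Fin n → ℂ) b x)) : Fin r → ℂ) = _ :=
    fibCoord_cov hx hx' hw (FiberBundle.extend (Fin n → ℂ) b x)
  have hbr : (fibCoord x₀ x (cov (FiberBundle.extend (Fin r → ℂ) w) x
      (VectorField.mlieBracket 𝓘(ℂ, Fin n → ℂ) (FiberBundle.extend (Fin n → ℂ) a)
        (FiberBundle.extend (Fin n → ℂ) b) x)) : Fin r → ℂ) = _ :=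
    fibCoord_cov hx hx' hw _
  rw [fibCoord_mlieBracket hx (hT a) (hT b), VectorField.lieBracket_eq] at hbr
  rw [curvatureAt, map_sub, map_sub, main, main, hbr, hpt, hpt, hder', hder']
  simp only [add_apply, ContinuousLinearMap.flip_apply, ContinuousLinearMap.comp_apply,
    FiberBundle.extend_apply_self, hT1, hw1, map_sub, map_add, sub_apply, connCurv]
  rw [hsymm.eq (tanCoord x₀ x a) (tanCoord x₀ x b)]
  abel

end Curvature

/-! ### Paraconformal structures in coordinates -/

section ParaconformalCoordinates

variable {p q : ℕ} {M : Type*} [TopologicalSpace M] [ChartedSpace (Fin (p * q) → ℂ) M]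
  [IsManifold 𝓘(ℂ, Fin (p * q) → ℂ) ω M]
  {U V : M → Type*}
  [TopologicalSpace (TotalSpace (Fin p → ℂ) U)]
  [∀ x, AddCommGroup (U x)] [∀ x, Module ℂ (U x)] [∀ x, TopologicalSpace (U x)]
  [∀ x, IsTopologicalAddGroup (U x)] [∀ x, ContinuousSMul ℂ (U x)]
  [FiberBundle (Fin p → ℂ) U] [VectorBundle ℂ (Fin p → ℂ) U]
  [ContMDiffVectorBundle ω (Fin p → ℂ) U 𝓘(ℂ, Fin (p * q) → ℂ)]
  [TopologicalSpace (TotalSpace (Fin q → ℂ) V)]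
  [∀ x, AddCommGroup (V x)] [∀ x, Module ℂ (V x)] [∀ x, TopologicalSpace (V x)]
  [∀ x, IsTopologicalAddGroup (V x)] [∀ x, ContinuousSMul ℂ (V x)]
  [FiberBundle (Fin q → ℂ) V] [VectorBundle ℂ (Fin q → ℂ) V]
  [ContMDiffVectorBundle ω (Fin q → ℂ) V 𝓘(ℂ, Fin (p * q) → ℂ)]
  (P : ParaconformalStructure p q U V)
  {covU : CovariantDerivative 𝓘(ℂ, Fin (p * q) → ℂ) (Fin p → ℂ) U}
  {covV : CovariantDerivative 𝓘(ℂ, Fin (p * q) → ℂ) (Fin q → ℂ) V}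
  {x₀ x : M}

namespace ParaconformalStructure

/-- The linear map `u ↦ v ↦ u ⊗ v`. -/
def vecLin (x : M) : U x →ₗ[ℂ] V x →ₗ[ℂ] TangentSpace 𝓘(ℂ, Fin (p * q) → ℂ) x :=
  (TensorProduct.mk ℂ (U x) (V x)).compr₂ (P.iso x).symm.toLinearMap

lemma vecLin_apply (u : U x) (v : V x) : P.vecLin x u v = P.vec u v := rfl

/-- The map `(u, v) ↦ u ⊗ v` in the preferred coordinates at `x₀`. -/
def coordVec (x₀ : M) (a : Fin (p * q) → ℂ) :
    (Fin p → ℂ) →L[ℂ] (Fin q → ℂ) →L[ℂ] (Fin (p * q) → ℂ) :=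
  ∑ i : Fin p, ∑ j : Fin q,
    (ContinuousLinearMap.proj (R := ℂ) (φ := fun _ : Fin p => ℂ) i).smulRight
    ((ContinuousLinearMap.proj (R := ℂ) (φ := fun _ : Fin q => ℂ) j).smulRight
    (secCoord x₀ (fun x => P.vec (fibFrame x₀ i x : U x) (fibFrame x₀ j x : V x)) a))

lemma coordVec_apply (hx : x ∈ (chartAt (Fin (p * q) → ℂ) x₀).source)
    (hU : x ∈ (trivializationAt (Fin p → ℂ) U x₀).baseSet)
    (hV : x ∈ (trivializationAt (Fin q → ℂ) V x₀).baseSet) (u : U x) (v : V x) :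
    P.coordVec x₀ (chartAt (Fin (p * q) → ℂ) x₀ x) (fibCoord x₀ x u) (fibCoord x₀ x v) =
      tanCoord x₀ x (P.vec u v) := by
  conv_rhs => rw [← vecLin_apply, ← sum_fibFrame hU u, ← sum_fibFrame hV v]
  simp only [map_sum, LinearMap.sum_apply, map_smul, LinearMap.smul_apply, vecLin_apply]
  simp only [coordVec, sum_apply, ContinuousLinearMap.smulRight_apply, smul_apply,
    ContinuousLinearMap.proj_apply, secCoord_chart hx, Finset.smul_sum]
  rw [Finset.sum_comm]
  exact Finset.sum_congr rfl fun i _ => Finset.sum_congr rfl fun k _ => smul_comm _ _ _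

lemma contDiffAt_coordVec (hx : x ∈ (chartAt (Fin (p * q) → ℂ) x₀).source)
    (hU : x ∈ (trivializationAt (Fin p → ℂ) U x₀).baseSet)
    (hV : x ∈ (trivializationAt (Fin q → ℂ) V x₀).baseSet) :
    ContDiffAt ℂ ω (P.coordVec x₀) (chartAt (Fin (p * q) → ℂ) x₀ x) := by
  refine ContDiffAt.sum fun i _ => ContDiffAt.sum fun j _ => ?_
  have h := (holAt_iff (r := p * q) (W := TangentSpace 𝓘(ℂ, Fin (p * q) → ℂ)) hx hx).1
    (P.holomorphic x _ _ (holAt_fibFrame hU i) (holAt_fibFrame hV j))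
  exact contDiffAt_const.smulRight (contDiffAt_const.smulRight h)

/-- Tensors against a basis of `U_x` sum to zero only if every coefficient vanishes; `P.iso` and the
coordinate maps are injective. -/
lemma coordVec_injective (hx : x ∈ (chartAt (Fin (p * q) → ℂ) x₀).source)
    (hU : x ∈ (trivializationAt (Fin p → ℂ) U x₀).baseSet)
    (hV : x ∈ (trivializationAt (Fin q → ℂ) V x₀).baseSet) (ξ : Fin p → Fin q → ℂ)
    (hξ : ∑ i, P.coordVec x₀ (chartAt (Fin (p * q) → ℂ) x₀ x) (Pi.single i 1) (ξ i) = 0) :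
    ξ = 0 := by
  have e1 (i : Fin p) : P.coordVec x₀ (chartAt (Fin (p * q) → ℂ) x₀ x) (Pi.single i 1) (ξ i) =
      tanCoord x₀ x (P.vec (fibFrame x₀ i x : U x) (fibVec x₀ x (ξ i) : V x)) := by
    rw [← P.coordVec_apply hx hU hV, fibFrame, fibCoord_fibVec hU, fibCoord_fibVec hV]
  simp only [e1] at hξ
  rw [← map_sum] at hξ
  have h2 := (map_eq_zero_iff _ (fibCoord_injective (r := p * q)
    (W := TangentSpace 𝓘(ℂ, Fin (p * q) → ℂ)) (x₀ := x₀) hx)).1 hξ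
  simp only [vec, ← map_sum, EmbeddingLike.map_eq_zero_iff] at h2
  let b : Module.Basis (Fin p) ℂ (U x) := (Pi.basisFun ℂ (Fin p)).map
    (LinearEquiv.ofLinearMap (fibCoord x₀ x) (fibVec x₀ x)
      (LinearMap.ext fun w => fibCoord_fibVec hU w)
      (LinearMap.ext fun w => fibVec_fibCoord hU w)).symm
  have h3 := TensorProduct.sum_tmul_basis_left_eq_zero b
    (Finsupp.equivFunOnFinite.symm fun i => (fibVec x₀ x (ξ i) : V x)) (by
      rw [Finsupp.sum_fintype _ _ (by simp), ← h2]
      exact Finset.sum_congr rfl fun i _ => by simp [b, fibFrame])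
  funext i
  have h4 := DFunLike.congr_fun h3 i
  rw [← fibCoord_fibVec hV (ξ i)]
  have h5 : (fibVec x₀ x (ξ i) : V x) = 0 := h4
  rw [h5, map_zero]
  rfl

/-- The torsion in coordinates. -/
lemma tanCoord_torsionAt (hcU : IsHolomorphicConnection covU) (hcV : IsHolomorphicConnection covV)
    (hx : x ∈ (chartAt (Fin (p * q) → ℂ) x₀).source)
    (hU : x ∈ (trivializationAt (Fin p → ℂ) U x₀).baseSet)
    (hV : x ∈ (trivializationAt (Fin q → ℂ) V x₀).baseSet) (u : U x) (v : V x) (u' : U x)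
    (v' : V x) :
    tanCoord x₀ x (P.torsionAt covU covV u v u' v') =
      connTorsion (P.coordVec x₀) (connForm covV x₀) (connForm covU x₀)
        (chartAt (Fin (p * q) → ℂ) x₀ x) (fibCoord x₀ x u) (fibCoord x₀ x v)
        (fibCoord x₀ x u') (fibCoord x₀ x v') := by
  have hω : (ω : WithTop ℕ∞) ≠ 0 := by simp
  have hθ := (P.contDiffAt_coordVec hx hU hV).differentiableAt hω
  have hu (u : U x) : HolAt (p * q) p (FiberBundle.extend (Fin p → ℂ) u) x := holAt_extend u
  have hv (v : V x) : HolAt (p * q) q (FiberBundle.extend (Fin q → ℂ) v) x := holAt_extend v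
  have hu1 (u : U x) : (secCoord x₀ (FiberBundle.extend (Fin p → ℂ) u)
      (chartAt (Fin (p * q) → ℂ) x₀ x) : Fin p → ℂ) = fibCoord x₀ x u := by
    rw [secCoord_chart hx, FiberBundle.extend_apply_self]
  have hv1 (v : V x) : (secCoord x₀ (FiberBundle.extend (Fin q → ℂ) v)
      (chartAt (Fin (p * q) → ℂ) x₀ x) : Fin q → ℂ) = fibCoord x₀ x v := by
    rw [secCoord_chart hx, FiberBundle.extend_apply_self]
  have hud (u : U x) := ((holAt_iff hx hU).1 (hu u)).differentiableAt hω
  have hvd (v : V x) := ((holAt_iff hx hV).1 (hv v)).differentiableAt hω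
  have hvec (u : U x) (v : V x) : HolAt (p * q) (p * q) (W := TangentSpace 𝓘(ℂ, Fin (p * q) → ℂ))
      (fun y => P.vec (FiberBundle.extend (Fin p → ℂ) u y) (FiberBundle.extend (Fin q → ℂ) v y)) x :=
    P.holomorphic x _ _ (hu u) (hv v)
  -- The field `u ⊗ v` has a product form in coordinates on a whole neighbourhood, so the bracket
  -- can be computed by the product rule.
  have hvec1 (u : U x) (v : V x) : (secCoord x₀ (fun y => P.vec
        (FiberBundle.extend (Fin p → ℂ) u y) (FiberBundle.extend (Fin q → ℂ) v y)) : _ → _)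
      =ᶠ[𝓝 (chartAt (Fin (p * q) → ℂ) x₀ x)] fun a => P.coordVec x₀ a
        (secCoord x₀ (FiberBundle.extend (Fin p → ℂ) u) a)
        (secCoord x₀ (FiberBundle.extend (Fin q → ℂ) v) a) := by
    filter_upwards [(chartAt (Fin (p * q) → ℂ) x₀).open_target.mem_nhds
        ((chartAt (Fin (p * q) → ℂ) x₀).map_source hx),
      (tendsto_chart_symm hx).eventually
        ((trivializationAt (Fin p → ℂ) U x₀).open_baseSet.mem_nhds hU),
      (tendsto_chart_symm hx).eventually
        ((trivializationAt (Fin q → ℂ) V x₀).open_baseSet.mem_nhds hV)] with a h1 h2 h3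
    have h4 := P.coordVec_apply ((chartAt (Fin (p * q) → ℂ) x₀).map_target h1) h2 h3
      (FiberBundle.extend (Fin p → ℂ) u _) (FiberBundle.extend (Fin q → ℂ) v _)
    rw [(chartAt (Fin (p * q) → ℂ) x₀).right_inv h1] at h4
    exact h4.symm
  have hder (u : U x) (v : V x) := ((((hθ.hasFDerivAt.clm_apply (hud u).hasFDerivAt).clm_apply
    (hvd v).hasFDerivAt)).congr_of_eventuallyEq (hvec1 u v)).fderiv
  rw [torsionAt, map_sub, map_sub, fibCoord_mlieBracket hx (hvec u v) (hvec u' v'),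
    VectorField.lieBracket_eq, inducedCov, inducedCov, map_add, map_add,
    ← P.coordVec_apply hx hU hV, ← P.coordVec_apply hx hU hV, ← P.coordVec_apply hx hU hV,
    ← P.coordVec_apply hx hU hV]
  beta_reduce
  rw [hder, hder, (hvec1 u v).eq_of_nhds, (hvec1 u' v').eq_of_nhds,
    fibCoord_cov hx hU (hu u), fibCoord_cov hx hU (hu u'), fibCoord_cov hx hV (hv v),
    fibCoord_cov hx hV (hv v')]
  simp only [FiberBundle.extend_apply_self, ← P.coordVec_apply hx hU hV, hu1, hv1,
    add_apply, ContinuousLinearMap.flip_apply, ContinuousLinearMap.comp_apply, connTorsion, map_add]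
  abel

end ParaconformalStructure

end ParaconformalCoordinates

/-! ### Consequences of right-flatness for vectors with a common `V`-factor -/

section Flatness

variable {p q : ℕ} {M : Type*} [TopologicalSpace M] [ChartedSpace (Fin (p * q) → ℂ) M]
  [IsManifold 𝓘(ℂ, Fin (p * q) → ℂ) ω M]
  {U V : M → Type*}
  [TopologicalSpace (TotalSpace (Fin p → ℂ) U)]
  [∀ x, AddCommGroup (U x)] [∀ x, Module ℂ (U x)] [∀ x, TopologicalSpace (U x)]
  [∀ x, IsTopologicalAddGroup (U x)] [∀ x, ContinuousSMul ℂ (U x)]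
  [FiberBundle (Fin p → ℂ) U] [VectorBundle ℂ (Fin p → ℂ) U]
  [ContMDiffVectorBundle ω (Fin p → ℂ) U 𝓘(ℂ, Fin (p * q) → ℂ)]
  [TopologicalSpace (TotalSpace (Fin q → ℂ) V)]
  [∀ x, AddCommGroup (V x)] [∀ x, Module ℂ (V x)] [∀ x, TopologicalSpace (V x)]
  [∀ x, IsTopologicalAddGroup (V x)] [∀ x, ContinuousSMul ℂ (V x)]
  [FiberBundle (Fin q → ℂ) V] [VectorBundle ℂ (Fin q → ℂ) V]
  [ContMDiffVectorBundle ω (Fin q → ℂ) V 𝓘(ℂ, Fin (p * q) → ℂ)]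
  (P : ParaconformalStructure p q U V)
  {covU : CovariantDerivative 𝓘(ℂ, Fin (p * q) → ℂ) (Fin p → ℂ) U}
  {covV : CovariantDerivative 𝓘(ℂ, Fin (p * q) → ℂ) (Fin q → ℂ) V}
  {x₀ x : M}

namespace ParaconformalStructure

/-- Contraction with the dual basis of `B` reads off the coefficients of `t`. -/
lemma tensor_eq_zero_of_lTensor {A B : Type*} [AddCommGroup A] [Module ℂ A] [AddCommGroup B]
    [Module ℂ B] {ι : Type*} (b : Module.Basis ι ℂ B) {t : A ⊗[ℂ] B}
    (h : ∀ f : Module.Dual ℂ B, TensorProduct.rid ℂ A (f.lTensor A t) = 0) : t = 0 := by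
  classical
  obtain ⟨m, rfl⟩ := TensorProduct.eq_repr_basis_right b t
  have hm : m = 0 := by
    ext j
    have h1 := h (b.coord j)
    rw [Finsupp.sum, map_sum, map_sum] at h1
    simp only [LinearMap.lTensor_tmul, TensorProduct.rid_tmul, Module.Basis.coord_apply,
      Module.Basis.repr_self, Finsupp.single_apply, ite_smul, one_smul, zero_smul,
      Finset.sum_ite_eq', Finsupp.mem_support_iff] at h1
    simpa using h1
  simp [hm]

/-- For `2 < p` this is `T⁺` with both `V`-arguments equal. For `p = 2` the expression is skew in
`u` and `u'`, so it is determined by its value on the two basis vectors of `U_x`. In the trace over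
the `U`-index with second argument `b 1` only `b 0` contributes, which kills the component of that
value along `b 0`; exchanging the two vectors kills the other component. -/
lemma torsionAt_same_eq_zero (hcU : IsHolomorphicConnection covU)
    (hcV : IsHolomorphicConnection covV) (hp : 2 ≤ p) (htr : P.TorsionTraceFree covU covV)
    (hflat : P.IsRightFlat covU covV) (u u' : U x) (v : V x) :
    P.torsionAt covU covV u v u' v = 0 := by
  rcases hp.lt_or_eq with hp | hp
  · have := hflat.1 hp x u u' v v
    rw [torsionPlus, ← two_smul ℂ, smul_smul] at this
    simpa using this
  subst hp
  have hx := mem_chart_source (Fin (2 * q) → ℂ) x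
  have hU := FiberBundle.mem_baseSet_trivializationAt' (F := Fin 2 → ℂ) (E := U) x
  have hV := FiberBundle.mem_baseSet_trivializationAt' (F := Fin q → ℂ) (E := V) x
  have hinj := fibCoord_injective (r := 2 * q) (W := TangentSpace 𝓘(ℂ, Fin (2 * q) → ℂ))
    (x₀ := x) hx
  have hco := P.tanCoord_torsionAt hcU hcV hx hU hV
  -- `torsionAt` is defined through extensions; its linearity in the vectors at `x` is read off the
  -- coordinate formula.
  have hadd (u1 u2 w : U x) : P.torsionAt covU covV (u1 + u2) v w v =
      P.torsionAt covU covV u1 v w v + P.torsionAt covU covV u2 v w v := by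
    refine hinj ?_
    rw [map_add, hco, hco, hco]
    simp only [connTorsion, map_add, add_apply]
    abel
  have hsmul (c : ℂ) (u w : U x) : P.torsionAt covU covV (c • u) v w v =
      c • P.torsionAt covU covV u v w v := by
    refine hinj ?_
    rw [map_smul, hco, hco]
    simp only [connTorsion, map_smul, smul_apply, smul_add, smul_sub]
  have hskew (u w : U x) : P.torsionAt covU covV u v w v = -P.torsionAt covU covV w v u v := by
    refine hinj ?_
    rw [map_neg, hco, hco]
    simp only [connTorsion]
    abel
  have hself (u : U x) : P.torsionAt covU covV u v u v = 0 := by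
    refine hinj ?_
    rw [map_zero, hco]
    simp only [connTorsion, sub_self]
  set b := fibreBasis 2 U x with hb
  have hz : P.torsionAt covU covV (b 0) v (b 1) v = 0 := by
    rw [← (P.iso x).map_eq_zero_iff]
    refine tensor_eq_zero_of_lTensor (fibreBasis q V x) fun f => ?_
    have h0 := htr.1 x v (b 1) v f
    have h1 := htr.1 x v (b 0) v f
    simp only [fibreTrace, Fin.sum_univ_two, ← hb, hself] at h0 h1
    rw [hskew (b 1) (b 0)] at h1
    simp only [contractV, map_zero, map_neg, Finsupp.coe_zero, Pi.zero_apply, add_zero,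
      zero_add, Finsupp.coe_neg, Pi.neg_apply, neg_eq_zero] at h0 h1
    refine b.ext_elem fun i => ?_
    fin_cases i
    · simpa using h0
    · simpa using h1
  have hb2 (u : U x) : u = b.repr u 0 • b 0 + b.repr u 1 • b 1 := by
    conv_lhs => rw [← b.sum_repr u, Fin.sum_univ_two]
  rw [hb2 u, hadd, hsmul, hsmul, hskew (b 0), hskew (b 1), hb2 u', hadd, hadd, hsmul, hsmul,
    hsmul, hsmul, hself, hself, hskew (b 1) (b 0), hz]
  simp

/-- On three equal arguments the symmetrisation is the curvature itself, and the trace part that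
`W⁺` removes is a multiple of `v`. -/
lemma exists_curvatureAt_eq_smul (hp : p = 2) (hflat : P.IsRightFlat covU covV) (u u' : U x)
    (v : V x) : ∃ c : ℂ, curvatureAt covV x (P.vec u v) (P.vec u' v) v = c • v := by
  have h := hflat.2 hp x u u' v v v
  have h1 : P.symCurvature covV u u' ![v, v, v] =
      curvatureAt covV x (P.vec u v) (P.vec u' v) v := by
    have h2 (i : Fin 3) : (![v, v, v] : Fin 3 → V x) i = v := by fin_cases i <;> rfl
    simp only [symCurvature, h2, Finset.sum_const, Finset.card_univ, Fintype.card_perm,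
      Fintype.card_fin]
    rw [← Nat.cast_smul_eq_nsmul ℂ, smul_smul]
    norm_num [Nat.factorial]
  rw [weylPlus, h1, sub_eq_zero, ← add_smul, ← add_smul, smul_smul] at h
  exact ⟨_, h⟩

lemma connTorsion_same_eq_zero (hcU : IsHolomorphicConnection covU)
    (hcV : IsHolomorphicConnection covV) (hp : 2 ≤ p) (htr : P.TorsionTraceFree covU covV)
    (hflat : P.IsRightFlat covU covV) (hx : x ∈ (chartAt (Fin (p * q) → ℂ) x₀).source)
    (hU : x ∈ (trivializationAt (Fin p → ℂ) U x₀).baseSet)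
    (hV : x ∈ (trivializationAt (Fin q → ℂ) V x₀).baseSet) (u u' : Fin p → ℂ) (w : Fin q → ℂ) :
    connTorsion (P.coordVec x₀) (connForm covV x₀) (connForm covU x₀)
      (chartAt (Fin (p * q) → ℂ) x₀ x) u w u' w = 0 := by
  rw [← fibCoord_fibVec hU u, ← fibCoord_fibVec hU u', ← fibCoord_fibVec hV w,
    ← P.tanCoord_torsionAt hcU hcV hx hU hV,
    P.torsionAt_same_eq_zero hcU hcV hp htr hflat, map_zero]

/-- The two halves of right-flatness meet here: for `2 < p` the Jacobi identity derives the
condition from the torsion, and for `p = 2` it is the vanishing of `W⁺` on the diagonal. -/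
lemma exists_connCurv_coordVec (hcU : IsHolomorphicConnection covU)
    (hcV : IsHolomorphicConnection covV) (hp : 2 ≤ p) (htr : P.TorsionTraceFree covU covV)
    (hflat : P.IsRightFlat covU covV) (hx : x ∈ (chartAt (Fin (p * q) → ℂ) x₀).source)
    (hU : x ∈ (trivializationAt (Fin p → ℂ) U x₀).baseSet)
    (hV : x ∈ (trivializationAt (Fin q → ℂ) V x₀).baseSet) (u u' : Fin p → ℂ) (w : Fin q → ℂ) :
    ∃ c : ℂ, connCurv (connForm covV x₀) (chartAt (Fin (p * q) → ℂ) x₀ x)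
      (P.coordVec x₀ (chartAt (Fin (p * q) → ℂ) x₀ x) u w)
      (P.coordVec x₀ (chartAt (Fin (p * q) → ℂ) x₀ x) u' w) w = c • w := by
  -- Points near the image of `x` are themselves images of points of `M`, so pointwise facts on `M`
  -- become facts on a neighbourhood in the model space.
  have hev : ∀ᶠ a in 𝓝 (chartAt (Fin (p * q) → ℂ) x₀ x), ∃ y, chartAt (Fin (p * q) → ℂ) x₀ y = a ∧
      y ∈ (chartAt (Fin (p * q) → ℂ) x₀).source ∧
      y ∈ (trivializationAt (Fin p → ℂ) U x₀).baseSet ∧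
      y ∈ (trivializationAt (Fin q → ℂ) V x₀).baseSet := by
    filter_upwards [(chartAt (Fin (p * q) → ℂ) x₀).open_target.mem_nhds
        ((chartAt (Fin (p * q) → ℂ) x₀).map_source hx),
      (tendsto_chart_symm hx).eventually
        ((trivializationAt (Fin p → ℂ) U x₀).open_baseSet.mem_nhds hU),
      (tendsto_chart_symm hx).eventually
        ((trivializationAt (Fin q → ℂ) V x₀).open_baseSet.mem_nhds hV)] with a h1 h2 h3
    exact ⟨_, (chartAt (Fin (p * q) → ℂ) x₀).right_inv h1,
      (chartAt (Fin (p * q) → ℂ) x₀).map_target h1, h2, h3⟩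
  rcases hp.lt_or_eq with hp' | hp'
  · refine exists_connCurv_eq_smul (z := (chartAt (Fin (p * q) → ℂ) x₀ x, w)) hp' ?_ ?_
      (contDiffAt_connForm hcU hx hU) ?_ (P.coordVec_injective hx hU hV) u u'
    · filter_upwards [hev] with a ⟨y, hy, h1, h2, h3⟩
      exact hy ▸ P.contDiffAt_coordVec h1 h2 h3
    · filter_upwards [hev] with a ⟨y, hy, h1, h2, h3⟩
      exact hy ▸ contDiffAt_connForm hcV h1 h3
    · filter_upwards [hev] with a ⟨y, hy, h1, h2, h3⟩
      exact hy ▸ P.connTorsion_same_eq_zero hcU hcV hp htr hflat h1 h2 h3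
  · obtain ⟨c, hc⟩ := P.exists_curvatureAt_eq_smul hp'.symm hflat (fibVec x₀ x u : U x)
      (fibVec x₀ x u' : U x) (fibVec x₀ x w : V x)
    have h := congrArg (fibCoord x₀ x : V x →ₗ[ℂ] (Fin q → ℂ)) hc
    rw [fibCoord_curvatureAt hcV hx hV, ← P.coordVec_apply hx hU hV, ← P.coordVec_apply hx hU hV,
      map_smul, fibCoord_fibVec hU, fibCoord_fibVec hU, fibCoord_fibVec hV] at h
    exact ⟨c, h⟩

end ParaconformalStructure

end Flatness

/-! ### Charts of the projectivised bundle -/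

section AtlasCharts

variable {E : Type*} [NormedAddCommGroup E] [NormedSpace ℂ E] {X : Type*} [TopologicalSpace X]
  [ChartedSpace E X] [IsManifold 𝓘(ℂ, E) ω X] {F : Type*} [NormedAddCommGroup F] [NormedSpace ℂ F]
  {e : OpenPartialHomeomorph X E} {z : X}

lemma contMDiffAt_of_mem_atlas_source (he : e ∈ atlas E X) (hz : z ∈ e.source) :
    ContMDiffAt 𝓘(ℂ, E) 𝓘(ℂ, E) ω e z :=
  (contMDiffOn_of_mem_maximalAtlas (IsManifold.subset_maximalAtlas he)).contMDiffAt
    (e.open_source.mem_nhds hz)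

lemma contMDiffAt_symm_of_mem_atlas_target (he : e ∈ atlas E X) {a : E} (ha : a ∈ e.target) :
    ContMDiffAt 𝓘(ℂ, E) 𝓘(ℂ, E) ω e.symm a :=
  (contMDiffOn_symm_of_mem_maximalAtlas (IsManifold.subset_maximalAtlas he)).contMDiffAt
    (e.open_target.mem_nhds ha)

lemma contMDiffAt_iff_atlas (he : e ∈ atlas E X) (hz : z ∈ e.source) {f : X → F} :
    ContMDiffAt 𝓘(ℂ, E) 𝓘(ℂ, F) ω f z ↔ ContDiffAt ℂ ω (f ∘ e.symm) (e z) := by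
  constructor
  · intro h
    rw [← contMDiffAt_iff_contDiffAt]
    refine ContMDiffAt.comp _ ?_ (contMDiffAt_symm_of_mem_atlas_target he (e.map_source hz))
    rwa [e.left_inv hz]
  · intro h
    refine (ContMDiffAt.comp z h.contMDiffAt
      (contMDiffAt_of_mem_atlas_source he hz)).congr_of_eventuallyEq ?_
    filter_upwards [e.open_source.mem_nhds hz] with y hy
    simp [e.left_inv hy]

lemma mfderiv_apply_of_eventuallyEq_comp (he : e ∈ atlas E X) (hz : z ∈ e.source) {f : X → F}
    {g : E → F} (hg : DifferentiableAt ℂ g (e z)) (hf : ∀ᶠ y in 𝓝 z, f y = g (e y))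
    (v : TangentSpace 𝓘(ℂ, E) z) :
    mfderiv 𝓘(ℂ, E) 𝓘(ℂ, F) f z v = fderiv ℂ g (e z) (mfderiv 𝓘(ℂ, E) 𝓘(ℂ, E) e z v) := by
  have h1 : MDifferentiableAt 𝓘(ℂ, E) 𝓘(ℂ, E) e z := mdifferentiableAt_atlas he hz
  rw [Filter.EventuallyEq.mfderiv_eq hf]
  have h2 := mfderiv_comp (I' := 𝓘(ℂ, E)) z hg.mdifferentiableAt h1
  rw [mfderiv_eq_fderiv] at h2
  exact congrArg (fun T : _ →L[ℂ] F => T v) h2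

/-- The differential of a chart. -/
def chartDeriv (he : e ∈ atlas E X) (hz : z ∈ e.source) : TangentSpace 𝓘(ℂ, E) z ≃ₗ[ℂ] E :=
  LinearEquiv.ofBijective (mfderiv 𝓘(ℂ, E) 𝓘(ℂ, E) e z).toLinearMap
    ((mdifferentiable_of_mem_atlas he).mfderiv_bijective hz)

lemma chartDeriv_apply (he : e ∈ atlas E X) (hz : z ∈ e.source) (v : TangentSpace 𝓘(ℂ, E) z) :
    chartDeriv he hz v = mfderiv 𝓘(ℂ, E) 𝓘(ℂ, E) e z v := rfl

lemma contMDiffAt_iff_comp_atlas {Z : Type*} [TopologicalSpace Z] [ChartedSpace F Z]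
    [IsManifold 𝓘(ℂ, F) ω Z] (he : e ∈ atlas E X) {f : Z → X} {c : Z}
    (h : ∀ᶠ y in 𝓝 c, f y ∈ e.source) (hf : ContMDiffAt 𝓘(ℂ, F) 𝓘(ℂ, E) ω (fun y => e (f y)) c) :
    ContMDiffAt 𝓘(ℂ, F) 𝓘(ℂ, E) ω f c := by
  have h1 := ContMDiffAt.comp c
    (contMDiffAt_symm_of_mem_atlas_target he (e.map_source h.self_of_nhds)) hf
  refine h1.congr_of_eventuallyEq ?_
  filter_upwards [h] with y hy
  simp [e.left_inv hy]

end AtlasCharts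

namespace ProjBundle

variable {n q : ℕ} {M : Type*} [TopologicalSpace M] [ChartedSpace (Fin n → ℂ) M]
  [IsManifold 𝓘(ℂ, Fin n → ℂ) ω M]
  {V : M → Type*} [TopologicalSpace (TotalSpace (Fin q → ℂ) V)]
  [∀ x, AddCommGroup (V x)] [∀ x, Module ℂ (V x)] [∀ x, TopologicalSpace (V x)]
  [FiberBundle (Fin q → ℂ) V] [VectorBundle ℂ (Fin q → ℂ) V]
  [ContMDiffVectorBundle ω (Fin q → ℂ) V 𝓘(ℂ, Fin n → ℂ)]

/-- The chart of `P(V)` as an open partial homeomorphism. -/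
def projChart (z₀ : ProjBundle n q V) (i : Fin q) :
    OpenPartialHomeomorph (ProjBundle n q V) ((Fin n → ℂ) × (Fin (q - 1) → ℂ)) :=
  (core n q V).openPartialHomeomorph (chart z₀ i) ⟨(z₀, i), rfl⟩

lemma projChart_mem_atlas (z₀ : ProjBundle n q V) (i : Fin q) :
    projChart z₀ i ∈ atlas ((Fin n → ℂ) × (Fin (q - 1) → ℂ)) (ProjBundle n q V) := by
  change _ ∈ ⋃ (e) (he), _
  exact mem_iUnion₂.2 ⟨chart z₀ i, ⟨(z₀, i), rfl⟩, rfl⟩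

lemma mem_projChart_source {z₀ z : ProjBundle n q V} {i : Fin q} :
    z ∈ (projChart z₀ i).source ↔ z.base ∈ (chartAt (Fin n → ℂ) z₀.base).source ∧
      z.base ∈ (trivializationAt (Fin q → ℂ) V z₀.base).baseSet ∧
      (fibCoord z₀.base z.base z.line.rep : Fin q → ℂ) i ≠ 0 := Iff.rfl

lemma projChart_apply (z₀ z : ProjBundle n q V) (i : Fin q) :
    projChart z₀ i z = (chartAt (Fin n → ℂ) z₀.base z.base,
      affCoord i (fibCoord z₀.base z.base z.line.rep)) := rfl

lemma exists_fibCoord_rep (x₀ : M) {x : M} {v : V x} (hv : v ≠ 0) : ∃ c : ℂ, c ≠ 0 ∧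
    (fibCoord x₀ x (Projectivization.mk ℂ v hv).rep : Fin q → ℂ) = c • fibCoord x₀ x v := by
  obtain ⟨c, hc, h⟩ := exists_smul_rep v hv
  exact ⟨c, hc, by rw [h, map_smul]⟩

/-- The charts use the chosen representative `rep`. Their conditions are invariant under scaling, so
any vector on the line may replace it. -/
lemma mk_mem_projChart_source {z₀ : ProjBundle n q V} {x : M} {v : V x} (hv : v ≠ 0) {i : Fin q} :
    (⟨x, Projectivization.mk ℂ v hv⟩ : ProjBundle n q V) ∈ (projChart z₀ i).source ↔
      x ∈ (chartAt (Fin n → ℂ) z₀.base).source ∧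
      x ∈ (trivializationAt (Fin q → ℂ) V z₀.base).baseSet ∧
      (fibCoord z₀.base x v : Fin q → ℂ) i ≠ 0 := by
  obtain ⟨c, hc, h⟩ := exists_fibCoord_rep (q := q) z₀.base hv
  rw [mem_projChart_source]
  dsimp only
  rw [h, Pi.smul_apply, smul_eq_mul, mul_ne_zero_iff_left hc]

lemma projChart_mk (z₀ : ProjBundle n q V) {x : M} {v : V x} (hv : v ≠ 0) (i : Fin q) :
    projChart z₀ i ⟨x, Projectivization.mk ℂ v hv⟩ =
      (chartAt (Fin n → ℂ) z₀.base x, affCoord i (fibCoord z₀.base x v)) := by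
  obtain ⟨c, hc, h⟩ := exists_fibCoord_rep (q := q) z₀.base hv
  rw [projChart_apply]
  dsimp only
  rw [h, affCoord_smul _ _ hc]

end ProjBundle

/-! ### Integrability of the twistor distribution -/

section AffineSlice

variable {q : ℕ}

/-- The linear part of `affVec`. -/
def affLin (i : Fin q) : (Fin (q - 1) → ℂ) →L[ℂ] (Fin q → ℂ) :=
  ContinuousLinearMap.pi fun j => if h : j = i then 0 else
    ContinuousLinearMap.proj (R := ℂ) (φ := fun _ : Fin (q - 1) => ℂ) ((otherIndex i).symm ⟨j, h⟩)

lemma hasFDerivAt_affVec (i : Fin q) (l : Fin (q - 1) → ℂ) :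
    HasFDerivAt (affVec i) (affLin i) l := by
  rw [hasFDerivAt_pi']
  intro j
  by_cases h : j = i
  · have : ContinuousLinearMap.proj (R := ℂ) (φ := fun _ : Fin q => ℂ) j ∘L affLin i = 0 := by
      ext; simp [affLin, h]
    rw [this]
    simp only [affVec, h, dite_true]
    exact hasFDerivAt_const _ _
  · have : ContinuousLinearMap.proj (R := ℂ) (φ := fun _ : Fin q => ℂ) j ∘L affLin i =
        ContinuousLinearMap.proj (R := ℂ) (φ := fun _ : Fin (q - 1) => ℂ)
          ((otherIndex i).symm ⟨j, h⟩) := by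
      ext; simp [affLin, h]
    rw [this]
    simp only [affVec, h, dite_false]
    exact (ContinuousLinearMap.proj (R := ℂ) (φ := fun _ : Fin (q - 1) => ℂ) _).hasFDerivAt

lemma exists_affLin_eq (i : Fin q) (β : Fin q → ℂ) (hβ : β i = 0) : ∃ l, affLin i l = β := by
  refine ⟨fun k => β (otherIndex i k), ?_⟩
  funext j
  by_cases h : j = i
  · subst h; simp [affLin, hβ]
  · simp [affLin, h]

variable {E P : Type*} [NormedAddCommGroup E] [NormedSpace ℂ E] [NormedAddCommGroup P]
  [NormedSpace ℂ P] {θ : E → P →L[ℂ] (Fin q → ℂ) →L[ℂ] E}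
  {A : E → E →L[ℂ] (Fin q → ℂ) →L[ℂ] (Fin q → ℂ)} {m : ℕ}

lemma hasFDerivAt_comp_affVec {i : Fin q} {g : E × (Fin q → ℂ) → (Fin m → ℂ)}
    {c : E × (Fin (q - 1) → ℂ)} (hg : DifferentiableAt ℂ g (c.1, affVec i c.2)) :
    HasFDerivAt (fun c : E × (Fin (q - 1) → ℂ) => g (c.1, affVec i c.2))
      (fderiv ℂ g (c.1, affVec i c.2) ∘L
        (ContinuousLinearMap.id ℂ E).prodMap (affLin i)) c :=
  HasFDerivAt.comp (g := g) c hg.hasFDerivAt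
    (HasFDerivAt.prodMap c (hasFDerivAt_id c.1) (hasFDerivAt_affVec i c.2))

/-- The restriction of a first integral to the slice `w_i = 1` is a submersion, since the slice is
transverse to the Euler vector field. -/
lemma surjective_fderiv_comp_affVec {i : Fin q} {g : E × (Fin q → ℂ) → (Fin m → ℂ)}
    {c : E × (Fin (q - 1) → ℂ)} (hg : Function.Surjective (fderiv ℂ g (c.1, affVec i c.2)))
    (hker : LinearMap.ker (fderiv ℂ g (c.1, affVec i c.2)).toLinearMap =
      LinearMap.range (liftField θ A (c.1, affVec i c.2)).toLinearMap) :
    Function.Surjective (fderiv ℂ g (c.1, affVec i c.2) ∘L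
        (ContinuousLinearMap.id ℂ E).prodMap (affLin i)) := by
  intro t
  obtain ⟨⟨α, β⟩, h⟩ := hg t
  -- Subtracting a multiple of the Euler vector, which `dg` kills, moves the vector into the tangent
  -- space of the slice.
  obtain ⟨l, hl⟩ := exists_affLin_eq i (β - β i • affVec i c.2) (by simp [affVec_self])
  have h0 : ((0, affVec i c.2) : E × (Fin q → ℂ)) ∈
      LinearMap.ker (fderiv ℂ g (c.1, affVec i c.2)).toLinearMap := by
    rw [hker]
    exact ⟨(0, 1), by simp⟩
  refine ⟨(α, l), ?_⟩
  have h2 : ((α, β - β i • affVec i c.2) : E × (Fin q → ℂ)) =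
      (α, β) - β i • (0, affVec i c.2) := by simp
  have h3 : fderiv ℂ g (c.1, affVec i c.2) (0, affVec i c.2) = 0 := h0
  change fderiv ℂ g (c.1, affVec i c.2) (α, affLin i l) = t
  rw [hl, h2, map_sub, map_smul, h3, smul_zero, sub_zero, h]

end AffineSlice

section Integrability

variable {p q : ℕ} {M : Type*} [TopologicalSpace M] [ChartedSpace (Fin (p * q) → ℂ) M]
  [IsManifold 𝓘(ℂ, Fin (p * q) → ℂ) ω M]
  {U V : M → Type*}
  [TopologicalSpace (TotalSpace (Fin p → ℂ) U)]
  [∀ x, AddCommGroup (U x)] [∀ x, Module ℂ (U x)] [∀ x, TopologicalSpace (U x)]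
  [∀ x, IsTopologicalAddGroup (U x)] [∀ x, ContinuousSMul ℂ (U x)]
  [FiberBundle (Fin p → ℂ) U] [VectorBundle ℂ (Fin p → ℂ) U]
  [ContMDiffVectorBundle ω (Fin p → ℂ) U 𝓘(ℂ, Fin (p * q) → ℂ)]
  [TopologicalSpace (TotalSpace (Fin q → ℂ) V)]
  [∀ x, AddCommGroup (V x)] [∀ x, Module ℂ (V x)] [∀ x, TopologicalSpace (V x)]
  [∀ x, IsTopologicalAddGroup (V x)] [∀ x, ContinuousSMul ℂ (V x)]
  [FiberBundle (Fin q → ℂ) V] [VectorBundle ℂ (Fin q → ℂ) V]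
  [ContMDiffVectorBundle ω (Fin q → ℂ) V 𝓘(ℂ, Fin (p * q) → ℂ)]
  (P : ParaconformalStructure p q U V)
  {covU : CovariantDerivative 𝓘(ℂ, Fin (p * q) → ℂ) (Fin p → ℂ) U}
  {covV : CovariantDerivative 𝓘(ℂ, Fin (p * q) → ℂ) (Fin q → ℂ) V}
  {x₀ x : M}

/-- Only the first jet at `x` matters: in coordinates the section is `w - A(a - a₀) w`, whose
derivative cancels the connection form at `a₀`. Where this vanishes it is replaced by some non-zero
vector, since `projSection` needs a section without zeros; near `x` nothing changes. -/
lemma exists_parallel_section (hcV : IsHolomorphicConnection covV) (v : V x) (hv : v ≠ 0) :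
    ∃ s : ∀ y, V y, (∀ y, s y ≠ 0) ∧ HolAt (p * q) q s x ∧ s x = v ∧ covV s x = 0 := by
  classical
  have hx := mem_chart_source (Fin (p * q) → ℂ) x
  have hV (y : M) := FiberBundle.mem_baseSet_trivializationAt' (F := Fin q → ℂ) (E := V) y
  set a₀ := chartAt (Fin (p * q) → ℂ) x x
  set w : Fin q → ℂ := fibCoord x x v
  have hw : w ≠ 0 := fun h => hv ((map_eq_zero_iff _ (fibCoord_injective (hV x))).1 h)
  obtain ⟨i, hi⟩ := exists_coord_ne_zero hw
  let h (a : Fin (p * q) → ℂ) : Fin q → ℂ := w - connForm covV x a₀ (a - a₀) w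
  let s (y : M) : V y := if fibVec x y (h (chartAt (Fin (p * q) → ℂ) x y)) = (0 : V y) then
    fibVec y y (Pi.single i 1 : Fin q → ℂ) else fibVec x y (h (chartAt (Fin (p * q) → ℂ) x y))
  have hd : ContDiff ℂ ω h := contDiff_const.sub
    (((connForm covV x a₀).contDiff.comp (contDiff_id.sub contDiff_const)).clm_apply contDiff_const)
  have hh : h a₀ = w := by simp [h]
  have hs : ∀ᶠ y in 𝓝 x, s y = fibVec x y (h (chartAt (Fin (p * q) → ℂ) x y)) := by
    have h1 : ContinuousAt (fun y => h (chartAt (Fin (p * q) → ℂ) x y)) x :=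
      ContinuousAt.comp (g := h) hd.continuous.continuousAt
        ((chartAt (Fin (p * q) → ℂ) x).continuousAt hx)
    filter_upwards [h1.eventually_ne (hh ▸ hw : h a₀ ≠ 0),
      (trivializationAt (Fin q → ℂ) V x).open_baseSet.mem_nhds (hV x)] with y h2 h3
    refine if_neg fun h4 => h2 ?_
    rw [← fibCoord_fibVec h3 (h (chartAt (Fin (p * q) → ℂ) x y)), h4, map_zero]
  have hhol : HolAt (p * q) q s x := by
    have h1 : HolAt (p * q) q (fun y => (fibVec x y (h (chartAt (Fin (p * q) → ℂ) x y)) : V y)) x :=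
      holAt_fibVec (hV x) (hd.contMDiff.contMDiffAt.comp x
        (contMDiffAt_of_mem_atlas_source (chart_mem_atlas _ x) hx))
    refine ContMDiffAt.congr_of_eventuallyEq h1 ?_
    filter_upwards [hs] with y hy
    rw [hy]
  have hsx : s x = v := by
    rw [hs.self_of_nhds]
    change fibVec x x (h a₀) = v
    rw [hh, fibVec_fibCoord (hV x)]
  refine ⟨s, fun y h0 => ?_, hhol, hsx, ?_⟩
  · by_cases h1 : fibVec x y (h (chartAt (Fin (p * q) → ℂ) x y)) = (0 : V y)
    · have h2 : (fibVec y y (Pi.single i 1 : Fin q → ℂ) : V y) = 0 := by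
        exact (if_pos h1).symm.trans h0
      have h3 := fibCoord_fibVec (hV y) (Pi.single i 1)
      rw [h2, map_zero] at h3
      simpa using congrFun h3 i
    · exact h1 ((if_neg h1).symm.trans h0)
  · ext X
    refine fibCoord_injective (hV x) ?_
    rw [fibCoord_cov hx (hV x) hhol, hsx]
    have h1 : (secCoord x s : _ → Fin q → ℂ) =ᶠ[𝓝 a₀] h := by
      filter_upwards [(tendsto_chart_symm hx).eventually hs,
        (chartAt (Fin (p * q) → ℂ) x).open_target.mem_nhds
          ((chartAt (Fin (p * q) → ℂ) x).map_source hx),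
        (tendsto_chart_symm hx).eventually
          ((trivializationAt (Fin q → ℂ) V x).open_baseSet.mem_nhds (hV x))] with a h1 h2 h3
      rw [secCoord, h1, fibCoord_fibVec h3, (chartAt (Fin (p * q) → ℂ) x).right_inv h2]
    have h2 : HasFDerivAt h (-((connForm covV x a₀).flip w)) a₀ := by
      have h3 := (((connForm covV x a₀).flip w).hasFDerivAt.comp a₀
        ((hasFDerivAt_id a₀).sub_const a₀)).const_sub w
      exact h3
    rw [h1.fderiv_eq, h2.fderiv]
    simp only [neg_apply, ContinuousLinearMap.flip_apply, zero_apply, map_zero]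
    exact neg_add_cancel _

variable {z₀ : ProjBundle (p * q) q V} {i : Fin q} {s : ∀ y, V y} (hs : ∀ y, s y ≠ 0)

lemma projChart_projSection (y : M) : ProjBundle.projChart z₀ i (projSection (p := p) (q := q) s hs y) =
    (chartAt (Fin (p * q) → ℂ) z₀.base y, affCoord i (fibCoord z₀.base y (s y))) :=
  ProjBundle.projChart_mk z₀ (hs y) i

lemma eventually_projSection_mem (hhol : HolAt (p * q) q s x)
    (hz : projSection (p := p) (q := q) s hs x ∈ (ProjBundle.projChart z₀ i).source) :
    ∀ᶠ y in 𝓝 x, projSection (p := p) (q := q) s hs y ∈ (ProjBundle.projChart z₀ i).source := by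
  obtain ⟨h1, h2, h3⟩ := (ProjBundle.mk_mem_projChart_source (hs x)).1 hz
  have h4 : ContinuousAt (fun y => (fibCoord z₀.base y (s y) : Fin q → ℂ)) x := by
    have h5 := ((holAt_iff h1 h2).1 hhol).continuousAt
    refine (ContinuousAt.comp (g := (secCoord z₀.base s : _ → Fin q → ℂ)) h5
      ((chartAt (Fin (p * q) → ℂ) z₀.base).continuousAt h1)).congr ?_
    filter_upwards [(chartAt (Fin (p * q) → ℂ) z₀.base).open_source.mem_nhds h1] with y hy
    exact secCoord_chart hy s
  filter_upwards [(chartAt (Fin (p * q) → ℂ) z₀.base).open_source.mem_nhds h1,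
    (trivializationAt (Fin q → ℂ) V z₀.base).open_baseSet.mem_nhds h2,
    (((continuous_apply i).continuousAt.comp h4).eventually_ne h3)] with y hy1 hy2 hy3
  exact (ProjBundle.mk_mem_projChart_source (hs y)).2 ⟨hy1, hy2, hy3⟩

lemma contDiffAt_affCoord {i : Fin q} {w : Fin q → ℂ} (hw : w i ≠ 0) :
    ContDiffAt ℂ ω (affCoord i) w :=
  (contDiffOn_affCoord i).contDiffAt
    ((isOpen_ne_fun (continuous_apply i) continuous_const).mem_nhds hw)

lemma contMDiffAt_projSection (hhol : HolAt (p * q) q s x) :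
    ContMDiffAt 𝓘(ℂ, Fin (p * q) → ℂ) 𝓘(ℂ, (Fin (p * q) → ℂ) × (Fin (q - 1) → ℂ)) ω
      (projSection (p := p) (q := q) s hs) x := by
  obtain ⟨i, hi⟩ := ProjBundle.exists_mem_chart_source
    (projSection (p := p) (q := q) s hs x)
  obtain ⟨h1, h2, h3⟩ := (ProjBundle.mk_mem_projChart_source (hs x)).1 hi
  refine contMDiffAt_iff_comp_atlas (ProjBundle.projChart_mem_atlas (n := p * q) (q := q) _ i)
    (eventually_projSection_mem hs hhol hi) ?_
  simp only [projChart_projSection]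
  rw [contMDiffAt_iff_contDiffAt_chart (mem_chart_source _ x)]
  have h4 := (holAt_iff h1 h2).1 hhol
  have h5 : ContDiffAt ℂ ω (fun a => (a, affCoord i (secCoord x s a : Fin q → ℂ)))
      (chartAt (Fin (p * q) → ℂ) x x) :=
    contDiffAt_id.prodMk (ContDiffAt.comp _ (contDiffAt_affCoord
      (by rw [secCoord_chart (mem_chart_source _ x)]; exact h3)) h4)
  refine h5.congr_of_eventuallyEq ?_
  filter_upwards [(chartAt (Fin (p * q) → ℂ) x).open_target.mem_nhds
    ((chartAt (Fin (p * q) → ℂ) x).map_source (mem_chart_source _ x))] with a ha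
  exact Prod.ext ((chartAt (Fin (p * q) → ℂ) x).right_inv ha) rfl

lemma mfderiv_projChart_projSection (hhol : HolAt (p * q) q s x)
    (hz : projSection (p := p) (q := q) s hs x ∈ (ProjBundle.projChart z₀ i).source)
    (X : TangentSpace 𝓘(ℂ, Fin (p * q) → ℂ) x) :
    mfderiv 𝓘(ℂ, (Fin (p * q) → ℂ) × (Fin (q - 1) → ℂ))
      𝓘(ℂ, (Fin (p * q) → ℂ) × (Fin (q - 1) → ℂ)) (ProjBundle.projChart z₀ i)
      (projSection (p := p) (q := q) s hs x) (mfderiv 𝓘(ℂ, Fin (p * q) → ℂ)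
        𝓘(ℂ, (Fin (p * q) → ℂ) × (Fin (q - 1) → ℂ)) (projSection (p := p) (q := q) s hs) x X) =
      (tanCoord z₀.base x X, fderiv ℂ (affCoord i) (fibCoord z₀.base x (s x))
        (fderiv ℂ (secCoord z₀.base s : _ → Fin q → ℂ) (chartAt (Fin (p * q) → ℂ) z₀.base x)
          (tanCoord z₀.base x X))) := by
  have hω : (ω : WithTop ℕ∞) ≠ 0 := by simp
  obtain ⟨h1, h2, h3⟩ := (ProjBundle.mk_mem_projChart_source (hs x)).1 hz
  have h4 := ((holAt_iff h1 h2).1 hhol).differentiableAt hω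
  have h5 : HasFDerivAt (fun a => (a, affCoord i (secCoord z₀.base s a : Fin q → ℂ))) _
      (chartAt (Fin (p * q) → ℂ) z₀.base x) :=
    (hasFDerivAt_id _).prodMk (HasFDerivAt.comp _ ((contDiffAt_affCoord
      (by rw [secCoord_chart h1]; exact h3)).differentiableAt hω).hasFDerivAt h4.hasFDerivAt)
  have h6 := mfderiv_comp (I' := 𝓘(ℂ, (Fin (p * q) → ℂ) × (Fin (q - 1) → ℂ))) x
    (mdifferentiableAt_atlas (ProjBundle.projChart_mem_atlas z₀ i) hz)
    ((contMDiffAt_projSection hs hhol).mdifferentiableAt hω)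
  have h7 := mfderiv_apply_chart h1 h5.differentiableAt
    (f := ProjBundle.projChart z₀ i ∘ projSection (p := p) (q := q) s hs) (by
      filter_upwards [(chartAt (Fin (p * q) → ℂ) z₀.base).open_source.mem_nhds h1] with y hy
      rw [secCoord_chart hy]
      exact projChart_projSection hs y) X
  rw [h6, h5.fderiv, secCoord_chart h1] at h7
  exact h7

end Integrability

/-! ### From the lifted distribution on `V` to the distribution on `P(V)` -/

section Integrability

variable {p q : ℕ} {M : Type*} [TopologicalSpace M] [ChartedSpace (Fin (p * q) → ℂ) M]
  [IsManifold 𝓘(ℂ, Fin (p * q) → ℂ) ω M]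
  {U V : M → Type*}
  [TopologicalSpace (TotalSpace (Fin p → ℂ) U)]
  [∀ x, AddCommGroup (U x)] [∀ x, Module ℂ (U x)] [∀ x, TopologicalSpace (U x)]
  [∀ x, IsTopologicalAddGroup (U x)] [∀ x, ContinuousSMul ℂ (U x)]
  [FiberBundle (Fin p → ℂ) U] [VectorBundle ℂ (Fin p → ℂ) U]
  [ContMDiffVectorBundle ω (Fin p → ℂ) U 𝓘(ℂ, Fin (p * q) → ℂ)]
  [TopologicalSpace (TotalSpace (Fin q → ℂ) V)]
  [∀ x, AddCommGroup (V x)] [∀ x, Module ℂ (V x)] [∀ x, TopologicalSpace (V x)]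
  [∀ x, IsTopologicalAddGroup (V x)] [∀ x, ContinuousSMul ℂ (V x)]
  [FiberBundle (Fin q → ℂ) V] [VectorBundle ℂ (Fin q → ℂ) V]
  [ContMDiffVectorBundle ω (Fin q → ℂ) V 𝓘(ℂ, Fin (p * q) → ℂ)]
  (P : ParaconformalStructure p q U V)
  {covU : CovariantDerivative 𝓘(ℂ, Fin (p * q) → ℂ) (Fin p → ℂ) U}
  {covV : CovariantDerivative 𝓘(ℂ, Fin (p * q) → ℂ) (Fin q → ℂ) V}
  {x₀ x : M}

instance finiteDimensional_tangentSpace {E : Type*} [NormedAddCommGroup E] [NormedSpace ℂ E]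
    [FiniteDimensional ℂ E] {X : Type*} [TopologicalSpace X] [ChartedSpace E X] (z : X) :
    FiniteDimensional ℂ (TangentSpace 𝓘(ℂ, E) z) :=
  inferInstanceAs (FiniteDimensional ℂ E)

/-- The vectors spanning the twistor distribution, in coordinates, are tangent to the lifted
distribution. -/
lemma affLin_mfderiv_mem_range {z₀ : ProjBundle (p * q) q V} {i : Fin q} {s : ∀ y, V y}
    (hs : ∀ y, s y ≠ 0) (hhol : HolAt (p * q) q s x)
    (hz : projSection (p := p) (q := q) s hs x ∈ (ProjBundle.projChart z₀ i).source)
    (hU : x ∈ (trivializationAt (Fin p → ℂ) U z₀.base).baseSet)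
    (hcov : covV s x = 0) (u : U x) :
    (ContinuousLinearMap.id ℂ (Fin (p * q) → ℂ)).prodMap (affLin i)
      (mfderiv 𝓘(ℂ, (Fin (p * q) → ℂ) × (Fin (q - 1) → ℂ))
      𝓘(ℂ, (Fin (p * q) → ℂ) × (Fin (q - 1) → ℂ)) (ProjBundle.projChart z₀ i)
      (projSection (p := p) (q := q) s hs x) (mfderiv 𝓘(ℂ, Fin (p * q) → ℂ)
        𝓘(ℂ, (Fin (p * q) → ℂ) × (Fin (q - 1) → ℂ)) (projSection (p := p) (q := q) s hs) x
        (P.vec u (s x)))) ∈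
      LinearMap.range (liftField (P.coordVec z₀.base) (connForm covV z₀.base)
        (chartAt (Fin (p * q) → ℂ) z₀.base x,
          affVec i (affCoord i (fibCoord z₀.base x (s x))))).toLinearMap := by
  have hω : (ω : WithTop ℕ∞) ≠ 0 := by simp
  obtain ⟨h1, h2, h3⟩ := (ProjBundle.mk_mem_projChart_source (hs x)).1 hz
  rw [mfderiv_projChart_projSection hs hhol hz]
  set a := chartAt (Fin (p * q) → ℂ) z₀.base x with ha
  set w : Fin q → ℂ := fibCoord z₀.base x (s x) with hw
  set X := tanCoord z₀.base x (P.vec u (s x)) with hX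
  have hX' : X = P.coordVec z₀.base a (fibCoord z₀.base x u) w :=
    (P.coordVec_apply h1 hU h2 u (s x)).symm
  have hD : fderiv ℂ (secCoord z₀.base s : _ → Fin q → ℂ) a X = -connForm covV z₀.base a X w := by
    have := fibCoord_cov (cov := covV) h1 h2 hhol (P.vec u (s x))
    rw [hcov] at this
    simp only [zero_apply, map_zero] at this
    exact eq_neg_of_add_eq_zero_left this.symm
  rw [hD]
  -- the derivative of `w ↦ w / w_i`
  have hpr : HasFDerivAt (fun w : Fin q → ℂ => w i)
      (ContinuousLinearMap.proj (R := ℂ) (φ := fun _ : Fin q => ℂ) i) w :=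
    (ContinuousLinearMap.proj (R := ℂ) (φ := fun _ : Fin q => ℂ) i).hasFDerivAt
  have hd1 := ((hasDerivAt_inv h3).comp_hasFDerivAt w hpr).smul (hasFDerivAt_id w)
  have hd2 := (hasFDerivAt_affVec i (affCoord i w)).comp w
    ((contDiffAt_affCoord h3).differentiableAt hω).hasFDerivAt
  have heq : (affVec i ∘ affCoord i) =ᶠ[𝓝 w] (Inv.inv ∘ fun w : Fin q → ℂ => w i) • (id : (Fin q → ℂ) → Fin q → ℂ) := by
    filter_upwards [(continuous_apply i).continuousAt.eventually_ne h3] with y hy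
    exact affVec_affCoord i y hy
  have hd := congrArg (fun T : _ →L[ℂ] _ => T (-connForm covV z₀.base a X w))
    ((hd1.congr_of_eventuallyEq heq).unique hd2)
  simp only [add_apply, smul_apply, ContinuousLinearMap.smulRight_apply, id_eq, Function.comp_apply,
    ContinuousLinearMap.comp_apply, ContinuousLinearMap.id_apply] at hd
  rw [affVec_affCoord i w h3]
  change (X, affLin i (fderiv ℂ (affCoord i) w (-connForm covV z₀.base a X w))) ∈ _
  rw [← hd]
  -- The range is taken at the representative `w / w_i`, where `u ⊗ w` reads `(w_i u) ⊗ (w / w_i)`.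
  -- The Euler coefficient comes from differentiating the factor `1 / w_i`.
  refine ⟨(w i • fibCoord z₀.base x u,
    (-(w i ^ 2)⁻¹ * (-connForm covV z₀.base a X w) i) * w i), (liftField_apply _ _ _ _).trans ?_⟩
  dsimp only
  have e : (w i)⁻¹ • P.coordVec z₀.base a (w i • fibCoord z₀.base x u) w = X := by
    rw [(P.coordVec z₀.base a).map_smul]
    change (w i)⁻¹ • (w i • P.coordVec z₀.base a (fibCoord z₀.base x u) w) = X
    rw [smul_smul, inv_mul_cancel₀ h3, one_smul, hX']
  rw [map_smul, e, map_smul, smul_smul, mul_assoc, mul_inv_cancel₀ h3, mul_one, smul_neg]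
  rfl

lemma coordVec_apply_eq_zero (hx : x ∈ (chartAt (Fin (p * q) → ℂ) x₀).source)
    (hU : x ∈ (trivializationAt (Fin p → ℂ) U x₀).baseSet)
    (hV : x ∈ (trivializationAt (Fin q → ℂ) V x₀).baseSet) {u : Fin p → ℂ} {w : Fin q → ℂ}
    (hw : w ≠ 0) (h : P.coordVec x₀ (chartAt (Fin (p * q) → ℂ) x₀ x) u w = 0) : u = 0 := by
  rw [apply_eq_sum_single] at h
  have := P.coordVec_injective hx hU hV _ h
  funext i
  exact (smul_eq_zero.1 (congrFun this i)).resolve_right hw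

/-- One parallel section through `π` already gives an injective map of `U_x` into the span. The span
runs over all such sections, so this is only a lower bound; the upper bound comes from the first
integrals. -/
lemma finrank_le_twistorDistribution (hcV : IsHolomorphicConnection covV)
    (z : ProjBundle (p * q) q V) :
    p ≤ Module.finrank ℂ (twistorDistribution P covV z) := by
  obtain ⟨x, ℓ⟩ := z
  obtain ⟨s, hs, hhol, hsx, hcov⟩ := exists_parallel_section (covV := covV) hcV ℓ.rep ℓ.rep_nonzero
  have hℓ : ℓ = Projectivization.mk ℂ (s x) (hs x) := by
    simp only [hsx, Projectivization.mk_rep]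
  subst hℓ
  obtain ⟨i, hi⟩ := ProjBundle.exists_mem_chart_source (projSection (p := p) (q := q) s hs x)
  have hx := mem_chart_source (Fin (p * q) → ℂ) x
  have hU := FiberBundle.mem_baseSet_trivializationAt' (F := Fin p → ℂ) (E := U) x
  have hV := FiberBundle.mem_baseSet_trivializationAt' (F := Fin q → ℂ) (E := V) x
  let T : U x →ₗ[ℂ] TangentSpace 𝓘(ℂ, (Fin (p * q) → ℂ) × (Fin (q - 1) → ℂ))
      (projSection (p := p) (q := q) s hs x) :=
    (mfderiv 𝓘(ℂ, Fin (p * q) → ℂ) 𝓘(ℂ, (Fin (p * q) → ℂ) × (Fin (q - 1) → ℂ))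
      (projSection (p := p) (q := q) s hs) x).toLinearMap ∘ₗ (P.vecLin x).flip (s x)
  have hT : Function.Injective T := by
    rw [injective_iff_map_eq_zero]
    intro u hu
    have h1 := mfderiv_projChart_projSection hs hhol hi (P.vec u (s x))
    have h2 : mfderiv 𝓘(ℂ, Fin (p * q) → ℂ) 𝓘(ℂ, (Fin (p * q) → ℂ) × (Fin (q - 1) → ℂ))
      (projSection (p := p) (q := q) s hs) x (P.vec u (s x)) = 0 := hu
    have h0 := (chartDeriv_apply (ProjBundle.projChart_mem_atlas _ i) hi 0).symm.trans
      (map_zero (chartDeriv (ProjBundle.projChart_mem_atlas _ i) hi))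
    rw [h2] at h1
    have h3 : P.coordVec x (chartAt (Fin (p * q) → ℂ) x x) (fibCoord x x u) (fibCoord x x (s x)) = 0 :=
      (P.coordVec_apply hx hU hV u (s x)).trans ((congrArg Prod.fst h1).symm.trans
        (congrArg Prod.fst h0))
    exact (map_eq_zero_iff _ (fibCoord_injective (r := p) (W := U) hU)).1
      (coordVec_apply_eq_zero P hx hU hV
        (fun h => hs x ((map_eq_zero_iff _ (fibCoord_injective (r := q) (W := V) hV)).1 h)) h3)
  have hle : LinearMap.range T ≤
      twistorDistribution P covV (projSection (p := p) (q := q) s hs x) := by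
    rintro _ ⟨u, rfl⟩
    exact Submodule.subset_span ⟨s, hs, u, hhol, rfl, hcov, rfl⟩
  have hfin : Module.finrank ℂ (U x) = p := by
    rw [LinearEquiv.finrank_eq
      (VectorBundle.continuousLinearEquivAt ℂ (Fin p → ℂ) U x).toLinearEquiv, Module.finrank_fin_fun]
  calc p = Module.finrank ℂ (LinearMap.range T) := by
        rw [LinearMap.finrank_range_of_inj hT, hfin]
    _ ≤ _ := Submodule.finrank_mono hle

/-- `p q + q` is the dimension of the total space of `V`, and `p + 1` is the rank of the lifted
distribution including the Euler field. -/
lemma add_one_mul_sub_one (hq : 1 ≤ q) : p * q + q = p + 1 + (p + 1) * (q - 1) := by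
  obtain ⟨r, rfl⟩ := Nat.exists_eq_add_of_le hq
  simp only [add_tsub_cancel_left]
  ring

/-- The lifted distribution is involutive. -/
lemma eventually_involutive_liftField (hcU : IsHolomorphicConnection covU)
    (hcV : IsHolomorphicConnection covV) (hp : 2 ≤ p)
    (htr : P.TorsionTraceFree covU covV) (hflat : P.IsRightFlat covU covV)
    (hx : x ∈ (chartAt (Fin (p * q) → ℂ) x₀).source)
    (hU : x ∈ (trivializationAt (Fin p → ℂ) U x₀).baseSet)
    (hV : x ∈ (trivializationAt (Fin q → ℂ) V x₀).baseSet) (w : Fin q → ℂ)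
    (a b : (Fin p → ℂ) × ℂ) :
      fderiv ℂ (liftField (P.coordVec x₀) (connForm covV x₀)) (chartAt (Fin (p * q) → ℂ) x₀ x, w)
        (liftField (P.coordVec x₀) (connForm covV x₀) (chartAt (Fin (p * q) → ℂ) x₀ x, w) a) b -
      fderiv ℂ (liftField (P.coordVec x₀) (connForm covV x₀)) (chartAt (Fin (p * q) → ℂ) x₀ x, w)
        (liftField (P.coordVec x₀) (connForm covV x₀) (chartAt (Fin (p * q) → ℂ) x₀ x, w) b) a ∈
      LinearMap.range (liftField (P.coordVec x₀) (connForm covV x₀)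
        (chartAt (Fin (p * q) → ℂ) x₀ x, w)).toLinearMap :=
  involutive_liftField (θ := P.coordVec x₀) (A := connForm covV x₀) (B := connForm covU x₀)
    (z := (chartAt (Fin (p * q) → ℂ) x₀ x, w))
    (P.contDiffAt_coordVec hx hU hV) (contDiffAt_connForm hcV hx hV)
    (fun u u' => P.connTorsion_same_eq_zero hcU hcV hp htr hflat hx hU hV u u' w)
    (fun u u' => P.exists_connCurv_coordVec hcU hcV hp htr hflat hx hU hV u u' w) a b

/-- The first integrals of the lifted distribution. -/
lemma exists_firstIntegral_liftField (hcU : IsHolomorphicConnection covU)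
    (hcV : IsHolomorphicConnection covV) (hp : 2 ≤ p) (hq : 1 ≤ q)
    (htr : P.TorsionTraceFree covU covV) (hflat : P.IsRightFlat covU covV)
    (hx : x ∈ (chartAt (Fin (p * q) → ℂ) x₀).source)
    (hU : x ∈ (trivializationAt (Fin p → ℂ) U x₀).baseSet)
    (hV : x ∈ (trivializationAt (Fin q → ℂ) V x₀).baseSet) {w : Fin q → ℂ} (hw : w ≠ 0) :
    ∃ g : (Fin (p * q) → ℂ) × (Fin q → ℂ) → (Fin ((p + 1) * (q - 1)) → ℂ),
      ∀ᶠ y in 𝓝 (chartAt (Fin (p * q) → ℂ) x₀ x, w), ContDiffAt ℂ ω g y ∧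
      Function.Surjective (fderiv ℂ g y) ∧
      LinearMap.ker (fderiv ℂ g y).toLinearMap =
        LinearMap.range (liftField (P.coordVec x₀) (connForm covV x₀) y).toLinearMap := by
  set φ := chartAt (Fin (p * q) → ℂ) x₀ with hφ
  have hinj : Function.Injective
      (liftField (P.coordVec x₀) (connForm covV x₀) (φ x, w)) := by
    rw [injective_iff_map_eq_zero]
    rintro ⟨u, t⟩ h
    rw [liftField_apply] at h
    have h1 : u = 0 := coordVec_apply_eq_zero P hx hU hV hw (congrArg Prod.fst h)
    subst h1
    have h2 := congrArg Prod.snd h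
    simp only [map_zero, zero_apply, neg_zero, zero_add] at h2
    rw [(smul_eq_zero.1 h2).resolve_right hw]
    rfl
  have hfst : Tendsto (fun y : (Fin (p * q) → ℂ) × (Fin q → ℂ) => y.1) (𝓝 (φ x, w))
      (𝓝 (φ x)) := continuous_fst.tendsto _
  refine exists_firstIntegral
    (contDiffAt_liftField (P.contDiffAt_coordVec hx hU hV) (contDiffAt_connForm hcV hx hV)) hinj ?_
    (m := (p + 1) * (q - 1)) (by
      simp only [Module.finrank_prod, Module.finrank_fin_fun, Module.finrank_self]
      exact add_one_mul_sub_one hq)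
  filter_upwards [hfst.eventually (φ.open_target.mem_nhds (φ.map_source hx)),
    hfst.eventually ((tendsto_chart_symm hx).eventually
      ((trivializationAt (Fin p → ℂ) U x₀).open_baseSet.mem_nhds hU)),
    hfst.eventually ((tendsto_chart_symm hx).eventually
      ((trivializationAt (Fin q → ℂ) V x₀).open_baseSet.mem_nhds hV))] with y h1 h2 h3 a b
  have h5 : (φ (φ.symm y.1), y.2) = y := Prod.ext (φ.right_inv h1) rfl
  have := eventually_involutive_liftField P hcU hcV hp htr hflat (φ.map_target h1) h2 h3 y.2 a b
  rwa [← hφ, h5] at this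

/-- The twistor distribution is integrable. -/
theorem isIntegrableDistribution_twistorDistribution (hcU : IsHolomorphicConnection covU)
    (hcV : IsHolomorphicConnection covV) (hp : 2 ≤ p) (hq : 1 ≤ q)
    (htr : P.TorsionTraceFree covU covV) (hflat : P.IsRightFlat covU covV) :
    IsIntegrableDistribution p ((p + 1) * (q - 1)) (twistorDistribution P covV) := by
  have hω : (ω : WithTop ℕ∞) ≠ 0 := by simp
  intro z₀
  suffices h : ∃ f : ProjBundle (p * q) q V → (Fin ((p + 1) * (q - 1)) → ℂ), ∀ᶠ w in 𝓝 z₀,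
      (ContMDiffAt 𝓘(ℂ, (Fin (p * q) → ℂ) × (Fin (q - 1) → ℂ))
        𝓘(ℂ, Fin ((p + 1) * (q - 1)) → ℂ) ω f w ∧
      Function.Surjective (mfderiv 𝓘(ℂ, (Fin (p * q) → ℂ) × (Fin (q - 1) → ℂ))
        𝓘(ℂ, Fin ((p + 1) * (q - 1)) → ℂ) f w) ∧
      LinearMap.ker (mfderiv 𝓘(ℂ, (Fin (p * q) → ℂ) × (Fin (q - 1) → ℂ))
        𝓘(ℂ, Fin ((p + 1) * (q - 1)) → ℂ) f w).toLinearMap = twistorDistribution P covV w) ∧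
      Module.finrank ℂ (twistorDistribution P covV w) = p by
    obtain ⟨f, hf⟩ := h
    exact ⟨hf.self_of_nhds.2, f, hf.mono fun w hw => hw.1⟩
  obtain ⟨i, hi⟩ := ProjBundle.exists_mem_chart_source z₀
  change z₀ ∈ (ProjBundle.projChart z₀ i).source at hi
  have hx := mem_chart_source (Fin (p * q) → ℂ) z₀.base
  have hU := FiberBundle.mem_baseSet_trivializationAt' (F := Fin p → ℂ) (E := U) z₀.base
  have hV := FiberBundle.mem_baseSet_trivializationAt' (F := Fin q → ℂ) (E := V) z₀.base
  set φ := chartAt (Fin (p * q) → ℂ) z₀.base with hφ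
  set c := ProjBundle.projChart z₀ i with hc
  -- The slice `w_i = 1`, along which the first integral on the total space of `V` is pulled back to
  -- a chart of `P(V)`.
  let K (b : (Fin (p * q) → ℂ) × (Fin (q - 1) → ℂ)) : (Fin (p * q) → ℂ) × (Fin q → ℂ) :=
    (b.1, affVec i b.2)
  have hKd : ContDiff ℂ ω K := contDiff_fst.prodMk ((contDiff_affVec i).comp contDiff_snd)
  obtain ⟨g, hg⟩ := exists_firstIntegral_liftField P hcU hcV hp hq htr hflat hx hU hV
    (affVec_ne_zero i (c z₀).2)
  refine ⟨fun z => g (K (c z)), ?_⟩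
  have hcont : Tendsto (fun z => K (c z)) (𝓝 z₀) (𝓝 (K (c z₀))) :=
    hKd.continuous.continuousAt.tendsto.comp (c.continuousAt hi)
  have hbase : Tendsto (fun z : ProjBundle (p * q) q V => φ.symm (c z).1) (𝓝 z₀) (𝓝 z₀.base) :=
    (tendsto_chart_symm hx).comp ((continuous_fst.tendsto _).comp (c.continuousAt hi))
  filter_upwards [hcont.eventually hg, c.open_source.mem_nhds hi, hbase.eventually
    ((trivializationAt (Fin p → ℂ) U z₀.base).open_baseSet.mem_nhds hU)] with z hgz hz hUz
  obtain ⟨hg1, hg2, hg3⟩ := hgz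
  have hce := ProjBundle.projChart_mem_atlas z₀ i
  have hzb : φ.symm (c z).1 = z.base := φ.left_inv hz.1
  rw [hzb] at hUz
  have hFd := hasFDerivAt_comp_affVec (c := c z) (hg1.differentiableAt hω)
  have hF : DifferentiableAt ℂ (fun b => g (K b)) (c z) := hFd.differentiableAt
  have hmf (v) := mfderiv_apply_of_eventuallyEq_comp hce hz hF
    (Eventually.of_forall fun y => rfl) v
  have hFe : fderiv ℂ (fun b => g (K b)) (c z) = _ := hFd.fderiv
  rw [hFe] at hmf
  have hsurjF := surjective_fderiv_comp_affVec (c := c z) hg2 hg3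
  have hsurj : Function.Surjective (mfderiv 𝓘(ℂ, (Fin (p * q) → ℂ) × (Fin (q - 1) → ℂ))
        𝓘(ℂ, Fin ((p + 1) * (q - 1)) → ℂ) (fun z => g (K (c z))) z) := by
    intro t
    obtain ⟨v, hv⟩ := hsurjF t
    refine ⟨(chartDeriv hce hz).symm v, ?_⟩
    rw [hmf, ← chartDeriv_apply hce hz, LinearEquiv.apply_symm_apply]
    exact hv
  have hle : twistorDistribution P covV z ≤
      LinearMap.ker (mfderiv 𝓘(ℂ, (Fin (p * q) → ℂ) × (Fin (q - 1) → ℂ))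
        𝓘(ℂ, Fin ((p + 1) * (q - 1)) → ℂ) (fun z => g (K (c z))) z).toLinearMap := by
    refine Submodule.span_le.2 ?_
    rintro w ⟨s, hs, u, hhol, hsz, hcov, rfl⟩
    obtain ⟨x, ℓ⟩ := z
    obtain rfl : ℓ = Projectivization.mk ℂ (s x) (hs x) := hsz.symm
    have h1 := affLin_mfderiv_mem_range P (z₀ := z₀) (i := i) hs hhol hz hUz hcov u
    have h2 : c ⟨x, Projectivization.mk ℂ (s x) (hs x)⟩ = _ := ProjBundle.projChart_mk z₀ (hs x) i
    rw [h2] at hg3 hmf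
    rw [← hg3] at h1
    exact (hmf _).trans h1
  have hker : Module.finrank ℂ (LinearMap.ker
      (mfderiv 𝓘(ℂ, (Fin (p * q) → ℂ) × (Fin (q - 1) → ℂ))
        𝓘(ℂ, Fin ((p + 1) * (q - 1)) → ℂ) (fun z => g (K (c z))) z).toLinearMap) = p := by
    have h1 := LinearMap.finrank_range_add_finrank_ker
      (mfderiv 𝓘(ℂ, (Fin (p * q) → ℂ) × (Fin (q - 1) → ℂ))
        𝓘(ℂ, Fin ((p + 1) * (q - 1)) → ℂ) (fun z => g (K (c z))) z).toLinearMap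
    rw [LinearMap.range_eq_top.2 hsurj, finrank_top] at h1
    have h2 : Module.finrank ℂ (TangentSpace 𝓘(ℂ, (Fin (p * q) → ℂ) × (Fin (q - 1) → ℂ)) z) =
        p * q + (q - 1) := by
      rw [LinearEquiv.finrank_eq (chartDeriv hce hz)]
      simp
    have h3 : Module.finrank ℂ (TangentSpace 𝓘(ℂ, Fin ((p + 1) * (q - 1)) → ℂ) (g (K (c z)))) =
        (p + 1) * (q - 1) := Module.finrank_fin_fun ℂ
    rw [h2, h3] at h1
    have h4 := add_one_mul_sub_one (p := p) hq
    omega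
  -- The distribution lies in the kernel, the kernel has dimension `p` because the map is a
  -- submersion, and the distribution has dimension at least `p`.
  have heq := Submodule.eq_of_le_of_finrank_le hle
    (hker.trans_le (finrank_le_twistorDistribution P hcV z))
  refine ⟨⟨(contMDiffAt_iff_atlas hce hz).2 ?_, hsurj, heq.symm⟩, by rw [heq, hker]⟩
  refine (ContDiffAt.comp (g := g) (c z) hg1 hKd.contDiffAt).congr_of_eventuallyEq ?_
  filter_upwards [c.open_target.mem_nhds (c.map_source hz)] with b hb
  exact congrArg (fun b => g (K b)) (c.right_inv hb)

end Integrability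

/-! ### Local structure of integrable distributions -/

section LocalStructure

variable {E : Type*} [NormedAddCommGroup E] [NormedSpace ℂ E] [FiniteDimensional ℂ E]
  {X : Type*} [TopologicalSpace X] [ChartedSpace E X] [IsManifold 𝓘(ℂ, E) ω X] {m : ℕ}

/-- Near `w`, the map `f` is a holomorphic submersion, and at `w` the kernel of its differential is
the distribution `D`. -/
def IsFirstIntegralAt (D : ∀ z : X, Submodule ℂ (TangentSpace 𝓘(ℂ, E) z)) (f : X → (Fin m → ℂ))
    (w : X) : Prop :=
  ContMDiffAt 𝓘(ℂ, E) 𝓘(ℂ, Fin m → ℂ) ω f w ∧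
    Function.Surjective (mfderiv 𝓘(ℂ, E) 𝓘(ℂ, Fin m → ℂ) f w) ∧
    LinearMap.ker (mfderiv 𝓘(ℂ, E) 𝓘(ℂ, Fin m → ℂ) f w).toLinearMap = D w

variable {D : ∀ z : X, Submodule ℂ (TangentSpace 𝓘(ℂ, E) z)} {f : X → (Fin m → ℂ)} {z : X}

/-- Coordinates straightening a submersion. -/
lemma exists_straightening (hf : ContMDiffAt 𝓘(ℂ, E) 𝓘(ℂ, Fin m → ℂ) ω f z)
    (hs : Function.Surjective (mfderiv 𝓘(ℂ, E) 𝓘(ℂ, Fin m → ℂ) f z)) :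
    ∃ (K : Submodule ℂ E) (κ : X → K) (Φ : (Fin m → ℂ) × K → X), ContinuousAt κ z ∧
      (∀ᶠ y in 𝓝 z, Φ (f y, κ y) = y) ∧ Φ (f z, κ z) = z ∧
      ∀ᶠ a in 𝓝 (f z, κ z), ContMDiffAt 𝓘(ℂ, (Fin m → ℂ) × K) 𝓘(ℂ, E) ω Φ a ∧
        f (Φ a) = a.1 := by
  have hω : (ω : WithTop ℕ∞) ≠ 0 := by simp
  have : CompleteSpace E := FiniteDimensional.complete ℂ E
  have he := chart_mem_atlas E z
  have hz := mem_chart_source E z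
  set φ := chartAt E z with hφ
  have hg : ContDiffAt ℂ ω (f ∘ φ.symm) (φ z) := (contMDiffAt_iff_atlas he hz).1 hf
  have hfg : ∀ᶠ y in 𝓝 z, f y = (f ∘ φ.symm) (φ y) := by
    filter_upwards [φ.open_source.mem_nhds hz] with y hy
    simp [φ.left_inv hy]
  set g' := fderiv ℂ (f ∘ φ.symm) (φ z) with hg'
  have hs' : Function.Surjective g' := by
    intro t
    obtain ⟨v, hv⟩ := hs t
    rw [mfderiv_apply_of_eventuallyEq_comp he hz (hg.differentiableAt hω) hfg] at hv
    exact ⟨_, hv⟩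
  let K : Submodule ℂ E := LinearMap.ker g'.toLinearMap
  -- A linear projection onto the kernel of the differential completes `f` to a local coordinate
  -- system `(f, r)`, and `Φ` is its inverse.
  obtain ⟨r, hr⟩ := Submodule.ClosedComplemented.of_finiteDimensional K
  have hK (k : K) : g' k = 0 := k.2
  have hbij : Function.Bijective (g'.prod r) := by
    constructor
    · rw [injective_iff_map_eq_zero]
      intro v hv
      have h1 : g' v = 0 := congrArg Prod.fst hv
      have h2 : r v = 0 := congrArg Prod.snd hv
      have := hr ⟨v, h1⟩
      rw [h2] at this
      exact (congrArg Subtype.val this).symm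
    · rintro ⟨t, k⟩
      obtain ⟨v, rfl⟩ := hs' t
      refine ⟨v - r v + k, Prod.ext ?_ ?_⟩
      · change g' (v - r v + k) = g' v
        rw [map_add, map_sub, hK, hK, sub_zero, add_zero]
      · change r (v - r v + k) = k
        rw [map_add, map_sub, hr, hr, sub_self, zero_add]
  let L : E ≃L[ℂ] (Fin m → ℂ) × K :=
    (LinearEquiv.ofBijective (g'.prod r).toLinearMap hbij).toContinuousLinearEquiv
  have hG : ContDiffAt ℂ ω (fun y => ((f ∘ φ.symm) y, r y)) (φ z) := hg.prodMk r.contDiff.contDiffAt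
  have hG' : HasFDerivAt (fun y => ((f ∘ φ.symm) y, r y)) (L : E →L[ℂ] (Fin m → ℂ) × K) (φ z) :=
    (hg.differentiableAt hω).hasFDerivAt.prodMk r.hasFDerivAt
  let H := hG.toOpenPartialHomeomorph _ hG' hω
  have hH (y : E) : H y = (f (φ.symm y), r y) := rfl
  have hHs : φ z ∈ H.source := hG.mem_toOpenPartialHomeomorph_source hG' hω
  have hHz : H (φ z) = (f z, r (φ z)) := by rw [hH, φ.left_inv hz]
  have hHsymm : ContDiffAt ℂ ω H.symm (H (φ z)) :=
    H.contDiffAt_symm (H.map_source hHs) (by rw [H.left_inv hHs]; exact hG')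
      (by rw [H.left_inv hHs]; exact hG)
  rw [hHz] at hHsymm
  have hHt : (f z, r (φ z)) ∈ H.target := hHz ▸ H.map_source hHs
  have hHinv : H.symm (f z, r (φ z)) = φ z := by rw [← hHz, H.left_inv hHs]
  have hκ : ContinuousAt (fun y => r (φ y)) z := r.continuous.continuousAt.comp (φ.continuousAt hz)
  refine ⟨K, fun y => r (φ y), fun a => φ.symm (H.symm a), hκ, ?_, ?_, ?_⟩
  · filter_upwards [φ.open_source.mem_nhds hz, (φ.continuousAt hz).eventually
      (H.open_source.mem_nhds hHs)] with y h1 h2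
    have h3 : (f y, r (φ y)) = H (φ y) := by rw [hH, φ.left_inv h1]
    rw [h3, H.left_inv h2, φ.left_inv h1]
  · dsimp only
    rw [hHinv, φ.left_inv hz]
  · have h1 : ∀ᶠ a in 𝓝 (f z, r (φ z)), H.symm a ∈ φ.target :=
      (H.symm.continuousAt hHt).eventually
        (by rw [hHinv]; exact φ.open_target.mem_nhds (φ.map_source hz))
    filter_upwards [hHsymm.eventually (by simp), h1, H.open_target.mem_nhds hHt] with a ha hb hc
    refine ⟨ContMDiffAt.comp (g := φ.symm) a (contMDiffAt_symm_of_mem_atlas_target he hb) ha.contMDiffAt, ?_⟩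
    exact congrArg Prod.fst (H.right_inv hc)

/-- A first integral is constant along discs tangent to the distribution. -/
lemma IsFirstIntegralAt.const_on_disc {c : ℂ → X} {B : Set ℂ} (hB : IsOpen B)
    (hB' : IsPreconnected B)
    (hc : ∀ t ∈ B, ContMDiffAt 𝓘(ℂ, ℂ) 𝓘(ℂ, E) ω c t ∧
      mfderiv 𝓘(ℂ, ℂ) 𝓘(ℂ, E) c t (1 : ℂ) ∈ D (c t))
    (hf : ∀ t ∈ B, IsFirstIntegralAt D f (c t)) {a b : ℂ} (ha : a ∈ B) (hb : b ∈ B) :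
    f (c a) = f (c b) := by
  have hω : (ω : WithTop ℕ∞) ≠ 0 := by simp
  have hd (t) (ht : t ∈ B) : DifferentiableAt ℂ (f ∘ c) t :=
    (contMDiffAt_iff_contDiffAt.1 (ContMDiffAt.comp t (hf t ht).1 (hc t ht).1)).differentiableAt hω
  refine hB.is_const_of_fderiv_eq_zero (f := f ∘ c) (𝕜 := ℂ) hB'
    (fun t ht => (hd t ht).differentiableWithinAt) ?_ ha hb
  intro t ht
  have h1 := mfderiv_comp t ((hf t ht).1.mdifferentiableAt hω) ((hc t ht).1.mdifferentiableAt hω)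
  rw [mfderiv_eq_fderiv] at h1
  have h2 : mfderiv 𝓘(ℂ, E) 𝓘(ℂ, Fin m → ℂ) f (c t) (mfderiv 𝓘(ℂ, ℂ) 𝓘(ℂ, E) c t (1 : ℂ)) = 0 := by
    have := (hc t ht).2
    rw [← (hf t ht).2.2] at this
    exact this
  refine ContinuousLinearMap.ext_ring ?_
  rw [h1]
  exact h2

/-- The local structure of an integrable distribution: the level sets of a first integral are
discs tangent to the distribution, and it has sections through every point. -/
lemma exists_firstIntegral_box {p : ℕ} (hD : IsIntegrableDistribution p m D) (z : X) :
    ∃ (f : X → (Fin m → ℂ)) (O : Set X), IsOpen O ∧ z ∈ O ∧ (∀ w ∈ O, IsFirstIntegralAt D f w) ∧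
      (∀ a ∈ O, ∀ b ∈ O, f a = f b → OnTangentDisc D univ a b) ∧
      ∀ w ∈ O, ∃ σ : (Fin m → ℂ) → X, ContMDiffAt 𝓘(ℂ, Fin m → ℂ) 𝓘(ℂ, E) ω σ (f w) ∧
        σ (f w) = w ∧ ∀ᶠ t in 𝓝 (f w), f (σ t) = t := by
  have hω : (ω : WithTop ℕ∞) ≠ 0 := by simp
  obtain ⟨-, f, hf⟩ := hD z
  replace hf : ∀ᶠ w in 𝓝 z, IsFirstIntegralAt D f w := hf
  obtain ⟨K, κ, Φ, hκ, hΦ1, hΦz, hΦ2⟩ :=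
    exists_straightening hf.self_of_nhds.1 hf.self_of_nhds.2.1
  have hcont : ContinuousAt Φ (f z, κ z) := hΦ2.self_of_nhds.1.continuousAt
  have hpull : ∀ᶠ a in 𝓝 (f z, κ z), IsFirstIntegralAt D f (Φ a) :=
    hcont.eventually (by rw [hΦz]; exact hf)
  obtain ⟨r, hr, hball⟩ := Metric.eventually_nhds_iff_ball.1 (hΦ2.and hpull)
  -- The disc `γ` below needs the factor `6`: its points lie at distance less than `r/6 + (5/2)
  -- (r/3) = r` from the centre.
  have hr6 : 0 < r / 6 := by positivity
  have hev : ∀ᶠ y in 𝓝 z, Φ (f y, κ y) = y ∧ (f y, κ y) ∈ Metric.ball (f z, κ z) (r / 6) :=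
    hΦ1.and ((hf.self_of_nhds.1.continuousAt.prodMk hκ).eventually (Metric.ball_mem_nhds _ hr6))
  obtain ⟨O, hO, hOo, hzO⟩ := eventually_nhds_iff.1 hev
  have hO6 (w) (hw : w ∈ O) : (f w, κ w) ∈ Metric.ball (f z, κ z) r :=
    Metric.ball_subset_ball (by linarith) (hO w hw).2
  refine ⟨f, O, hOo, hzO, fun w hw => ?_, fun a ha b hb hab => ?_, fun w hw => ?_⟩
  · have := (hball _ (hO6 w hw)).2
    rwa [(hO w hw).1] at this
  -- The complex line through the coordinates of `a` and `b`, reached at `-1/4` and `1/4`; on the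
  -- unit disc `|1/2 + 2 s| ≤ 5/2`. Its first component is constant because `f a = f b`, so `Φ ∘ γ`
  -- stays in one level set.
  · let γ : ℂ → (Fin m → ℂ) × K := fun s => (f a, κ a) + (1 / 2 + 2 * s) • ((f b, κ b) - (f a, κ a))
    have hγ1 (s) : (γ s).1 = f a := by
      change f a + (1 / 2 + 2 * s) • (f b - f a) = f a
      rw [hab, sub_self, smul_zero, add_zero]
    have hγd : ContDiff ℂ ω γ :=
      contDiff_const.add ((contDiff_const.add (contDiff_const.mul contDiff_id)).smul contDiff_const)
    have hγ (s : ℂ) (hs : s ∈ Metric.ball (0 : ℂ) 1) : γ s ∈ Metric.ball (f z, κ z) r := by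
      rw [mem_ball_zero_iff] at hs
      have ha' := (hO a ha).2
      have hb' := (hO b hb).2
      rw [mem_ball_iff_norm] at ha' hb' ⊢
      have e : γ s - (f z, κ z) = ((f a, κ a) - (f z, κ z)) +
        (1 / 2 + 2 * s) • (((f b, κ b) - (f z, κ z)) - ((f a, κ a) - (f z, κ z))) := by
        simp only [γ]; module
      have h5 : ‖(1 / 2 + 2 * s : ℂ)‖ ≤ 5 / 2 := by
        refine (norm_add_le _ _).trans ?_
        rw [norm_mul]
        norm_num
        linarith
      have h6 := norm_sub_le ((f b, κ b) - (f z, κ z)) ((f a, κ a) - (f z, κ z))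
      rw [e]
      refine (norm_add_le _ _).trans_lt ?_
      rw [norm_smul]
      nlinarith [norm_nonneg (((f b, κ b) - (f z, κ z)) - ((f a, κ a) - (f z, κ z))),
        norm_nonneg (1 / 2 + 2 * s : ℂ)]
    have hc (s : ℂ) (hs : s ∈ Metric.ball (0 : ℂ) 1) :
        ContMDiffAt 𝓘(ℂ, ℂ) 𝓘(ℂ, E) ω (fun s => Φ (γ s)) s :=
      ContMDiffAt.comp (g := Φ) s (hball _ (hγ s hs)).1.1 hγd.contMDiff.contMDiffAt
    refine ⟨fun s => Φ (γ s), fun s hs => ⟨mem_univ _, hc s hs, ?_⟩, ⟨-1 / 4, by norm_num, ?_⟩,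
      ⟨1 / 4, by norm_num, ?_⟩⟩
    · obtain ⟨⟨h1, h2⟩, h3⟩ := hball _ (hγ s hs)
      rw [← h3.2.2]
      have h4 := mfderiv_comp (g := f) (f := fun s => Φ (γ s)) s (h3.1.mdifferentiableAt hω)
        ((hc s hs).mdifferentiableAt hω)
      have h5 : f ∘ (fun s => Φ (γ s)) =ᶠ[𝓝 s] fun _ => f a := by
        filter_upwards [Metric.isOpen_ball.mem_nhds hs] with y hy
        exact (hball _ (hγ y hy)).1.2.trans (hγ1 y)
      rw [h5.mfderiv_eq, mfderiv_const] at h4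
      exact (congrArg (fun T : ℂ →L[ℂ] (Fin m → ℂ) => T 1) h4).symm
    · have : γ (-1 / 4) = (f a, κ a) := by simp only [γ]; norm_num
      exact (congrArg Φ this).trans (hO a ha).1
    · have : γ (1 / 4) = (f b, κ b) := by simp only [γ]; norm_num
      exact (congrArg Φ this).trans (hO b hb).1
  · have hcs : ContMDiffAt 𝓘(ℂ, Fin m → ℂ) 𝓘(ℂ, E) ω (fun t => Φ (t, κ w)) (f w) :=
      ContMDiffAt.comp (g := Φ) (f w) (hball _ (hO6 w hw)).1.1
        (contDiff_id.prodMk contDiff_const).contMDiff.contMDiffAt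
    refine ⟨fun t => Φ (t, κ w), hcs, (hO w hw).1, ?_⟩
    have h1 : Tendsto (fun t : Fin m → ℂ => (t, κ w)) (𝓝 (f w)) (𝓝 (f w, κ w)) :=
      (continuous_id.prodMk continuous_const).tendsto _
    filter_upwards [h1.eventually (Metric.isOpen_ball.mem_nhds (hO6 w hw))] with t ht
    exact (hball _ ht).1.2

end LocalStructure

/-! ### Leaf spaces of regular foliations -/

section LeafSpaces

variable {E : Type*} [NormedAddCommGroup E] [NormedSpace ℂ E] [FiniteDimensional ℂ E]
  {X : Type*} [TopologicalSpace X] [ChartedSpace E X] [IsManifold 𝓘(ℂ, E) ω X] {m : ℕ}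
  {D : ∀ z : X, Submodule ℂ (TangentSpace 𝓘(ℂ, E) z)}

lemma leafOf_eq_of_onTangentDisc {S : Set X} {z w : X} (h : OnTangentDisc D S z w) :
    leafOf D z = leafOf D w := by
  obtain ⟨c, hc, ha, hb⟩ := h
  exact Quotient.sound (Relation.EqvGen.rel _ _
    ⟨c, fun t ht => ⟨mem_univ _, (hc t ht).2⟩, ha, hb⟩)

/-- A germ at `z` of a holomorphic map which sends `z` to `w` and preserves each leaf. -/
def Transports (D : ∀ z : X, Submodule ℂ (TangentSpace 𝓘(ℂ, E) z)) (z w : X) : Prop :=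
  ∃ τ : X → X, ContMDiffAt 𝓘(ℂ, E) 𝓘(ℂ, E) ω τ z ∧ τ z = w ∧
    ∀ᶠ y in 𝓝 z, leafOf D (τ y) = leafOf D y

lemma Transports.refl (z : X) : Transports D z z :=
  ⟨id, contMDiffAt_id, rfl, Eventually.of_forall fun _ => rfl⟩

lemma Transports.trans {x y z : X} (h : Transports D x y) (h' : Transports D y z) :
    Transports D x z := by
  obtain ⟨τ, hτ, rfl, hl⟩ := h
  obtain ⟨τ', hτ', rfl, hl'⟩ := h'
  refine ⟨τ' ∘ τ, ContMDiffAt.comp x hτ' hτ, rfl, ?_⟩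
  filter_upwards [hl, hτ.continuousAt.eventually hl'] with y h1 h2
  exact h2.trans h1

/-- The relation is transitive and the ball is connected, so a local statement along the disc
suffices. Inside a box, points on one level of `f` are related by `σ ∘ f`, where `σ` is a section of
`f` through the target: this map preserves the levels of `f`, hence the leaves. -/
lemma transports_of_onTangentDisc {p : ℕ} (hD : IsIntegrableDistribution p m D) {z w : X}
    (h : OnTangentDisc D univ z w) : Transports D z w := by
  obtain ⟨c, hc, ⟨a, ha, rfl⟩, ⟨b, hb, rfl⟩⟩ := h
  refine (convex_ball (0 : ℂ) 1).isPreconnected.induction₂' (fun a b => Transports D (c a) (c b))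
    ?_ (fun _ _ _ _ _ _ h h' => h.trans h') ha hb
  intro t ht
  obtain ⟨f, O, hOo, hzO, hO1, hO2, hO3⟩ := exists_firstIntegral_box hD (c t)
  have key (a b : X) (ha : a ∈ O) (hb : b ∈ O) (hab : f a = f b) : Transports D a b := by
    obtain ⟨σ, hσ1, hσ2, hσ3⟩ := hO3 b hb
    rw [← hab] at hσ1 hσ2 hσ3
    have hfa := (hO1 a ha).1
    refine ⟨fun y => σ (f y), ContMDiffAt.comp (g := σ) a hσ1 hfa, hσ2, ?_⟩
    have h1 : Tendsto (fun y => σ (f y)) (𝓝 a) (𝓝 b) := by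
      have := hσ1.continuousAt.tendsto.comp hfa.continuousAt.tendsto
      rwa [hσ2] at this
    filter_upwards [hOo.mem_nhds ha, h1.eventually (hOo.mem_nhds hb),
      hfa.continuousAt.eventually hσ3] with y h2 h3 h4
    exact leafOf_eq_of_onTangentDisc (hO2 _ h3 _ h2 h4)
  have hopen : ∀ᶠ s in 𝓝 t, s ∈ Metric.ball (0 : ℂ) 1 ∧ c s ∈ O :=
    (Metric.isOpen_ball.eventually_mem ht).and
      ((hc t ht).2.1.continuousAt.eventually (hOo.mem_nhds hzO))
  obtain ⟨r, hr, hball⟩ := Metric.eventually_nhds_iff_ball.1 hopen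
  refine eventually_nhdsWithin_of_eventually_nhds ?_
  filter_upwards [Metric.ball_mem_nhds t hr] with s hs
  have heq : f (c t) = f (c s) := IsFirstIntegralAt.const_on_disc Metric.isOpen_ball
    (convex_ball t r).isPreconnected (fun y hy => (hc y (hball y hy).1).2)
    (fun y hy => hO1 _ (hball y hy).2) (Metric.mem_ball_self hr) hs
  exact ⟨key _ _ hzO (hball s hs).2 heq, key _ _ (hball s hs).2 hzO heq.symm⟩

lemma OnTangentDisc.symm {S : Set X} {z w : X} (h : OnTangentDisc D S z w) :
    OnTangentDisc D S w z := by
  obtain ⟨c, hc, ha, hb⟩ := h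
  exact ⟨c, hc, hb, ha⟩

/-- The holonomy of an integrable distribution. -/
lemma transports_of_leafOf_eq {p : ℕ} (hD : IsIntegrableDistribution p m D) {z w : X}
    (h : leafOf D z = leafOf D w) : Transports D z w := by
  have h' : Relation.EqvGen (OnTangentDisc D univ) z w := Quotient.exact h
  -- Both directions are carried through the induction, since a transport need not be an invertible
  -- germ.
  suffices Transports D z w ∧ Transports D w z from this.1
  clear h
  induction h' with
  | rel x y h => exact ⟨transports_of_onTangentDisc hD h, transports_of_onTangentDisc hD h.symm⟩
  | refl x => exact ⟨.refl x, .refl x⟩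
  | symm x y _ ih => exact ih.symm
  | trans x y z _ _ ih1 ih2 => exact ⟨ih1.1.trans ih2.1, ih2.2.trans ih1.2⟩

lemma continuous_leafOf : Continuous (leafOf D) := continuous_quotient_mk'

/-- If the leaf through `z` meets the open set at `w`, a transport from `z` to `w` carries points
near `z` into the set without leaving their leaves. So the saturation of an open set is open. -/
lemma isOpenMap_leafOf {p : ℕ} (hD : IsIntegrableDistribution p m D) : IsOpenMap (leafOf D) := by
  intro O hO
  change IsOpen (Quotient.mk (leafSetoid D) ⁻¹' (leafOf D '' O))
  rw [isOpen_iff_mem_nhds]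
  rintro z ⟨w, hw, hwz⟩
  obtain ⟨τ, hτ, rfl, hl⟩ := transports_of_leafOf_eq hD hwz.symm
  filter_upwards [hl, hτ.continuousAt.eventually (hO.mem_nhds hw)] with y h1 h2
  exact ⟨_, h2, h1⟩

variable (D m) in
/-- An open set in which the leaves of `D` are the level sets of a first integral. -/
structure FlatBox where
  set : Set X
  isOpen : IsOpen set
  f : X → (Fin m → ℂ)
  isFirstIntegralAt : ∀ w ∈ set, IsFirstIntegralAt D f w
  eq_iff : ∀ a ∈ set, ∀ b ∈ set, f a = f b ↔ leafOf D a = leafOf D b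
  exists_section : ∀ w ∈ set, ∃ σ : (Fin m → ℂ) → X,
    ContMDiffAt 𝓘(ℂ, Fin m → ℂ) 𝓘(ℂ, E) ω σ (f w) ∧ σ (f w) = w ∧ ∀ᶠ t in 𝓝 (f w), f (σ t) = t

/-- Equal values of `f` give a tangent disc joining the points. Conversely, regularity joins two
points of `S` on one leaf by discs inside `S`, and `f` is constant on each of them. -/
lemma exists_flatBox {p : ℕ} (hD : IsIntegrableDistribution p m D) (hreg : IsRegularFoliation D)
    (z : X) : ∃ B : FlatBox m D, z ∈ B.set := by
  obtain ⟨f, O, hOo, hzO, hO1, hO2, hO3⟩ := exists_firstIntegral_box hD z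
  obtain ⟨S, hSO, hSo, hzS, hS⟩ := hreg z O (hOo.mem_nhds hzO)
  refine ⟨⟨S, hSo, f, fun w hw => hO1 w (hSO hw), fun a ha b hb => ⟨fun h =>
    leafOf_eq_of_onTangentDisc (hO2 a (hSO ha) b (hSO hb) h), fun h => ?_⟩,
    fun w hw => hO3 w (hSO hw)⟩, hzS⟩
  have h' := hS a ha b hb h
  clear ha hb h
  induction h' with
  | rel x y h =>
    obtain ⟨c, hc, ⟨a, ha, rfl⟩, ⟨b, hb, rfl⟩⟩ := h
    exact IsFirstIntegralAt.const_on_disc Metric.isOpen_ball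
      (convex_ball (0 : ℂ) 1).isPreconnected (fun y hy => (hc y hy).2)
      (fun y hy => hO1 _ (hSO (hc y hy).1)) ha hb
  | refl x => rfl
  | symm x y _ ih => exact ih.symm
  | trans x y z _ _ ih1 ih2 => exact ih1.trans ih2

namespace FlatBox

variable (B : FlatBox m D)

/-- Local sections make `f` an open map. -/
lemma map_nhds {w : X} (hw : w ∈ B.set) {N : Set X} (hN : N ∈ 𝓝 w) : B.f '' N ∈ 𝓝 (B.f w) := by
  obtain ⟨σ, hσ1, hσ2, hσ3⟩ := B.exists_section w hw
  have hN' : N ∈ 𝓝 (σ (B.f w)) := by rwa [hσ2]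
  filter_upwards [hσ3, hσ1.continuousAt.eventually hN'] with t h1 h2
  exact ⟨σ t, h2, h1⟩

lemma isOpen_image {N : Set X} (hN : IsOpen N) (hNB : N ⊆ B.set) : IsOpen (B.f '' N) := by
  rw [isOpen_iff_mem_nhds]
  rintro _ ⟨w, hw, rfl⟩
  exact B.map_nhds (hNB hw) (hN.mem_nhds hw)

variable {p : ℕ} (hD : IsIntegrableDistribution p m D)

open Classical in
/-- The function on the leaf space induced by the first integral of a box. -/
def coord (q : LeafSpace D) : Fin m → ℂ :=
  if h : ∃ a ∈ B.set, leafOf D a = q then B.f h.choose else 0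

lemma coord_leafOf {a : X} (ha : a ∈ B.set) : B.coord (leafOf D a) = B.f a := by
  have h : ∃ b ∈ B.set, leafOf D b = leafOf D a := ⟨a, ha, rfl⟩
  rw [coord, dif_pos h]
  exact (B.eq_iff _ h.choose_spec.1 _ ha).2 h.choose_spec.2

open Classical in
/-- The leaf on which the first integral of a box takes a given value. -/
def leaf (x : X) (t : Fin m → ℂ) : LeafSpace D :=
  -- The only role of `x` is to supply a value outside the image of the box.
  if h : ∃ a ∈ B.set, B.f a = t then leafOf D h.choose else leafOf D x

lemma leaf_f (x : X) {a : X} (ha : a ∈ B.set) : B.leaf x (B.f a) = leafOf D a := by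
  have h : ∃ b ∈ B.set, B.f b = B.f a := ⟨a, ha, rfl⟩
  rw [leaf, dif_pos h]
  exact (B.eq_iff _ h.choose_spec.1 _ ha).1 h.choose_spec.2

/-- The chart of the leaf space defined by a box. -/
def chart (x : X) : OpenPartialHomeomorph (LeafSpace D) (Fin m → ℂ) where
  toFun := B.coord
  invFun := B.leaf x
  source := leafOf D '' B.set
  target := B.f '' B.set
  map_source' := by
    rintro _ ⟨a, ha, rfl⟩
    exact ⟨a, ha, (B.coord_leafOf ha).symm⟩
  map_target' := by
    rintro _ ⟨a, ha, rfl⟩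
    exact ⟨a, ha, (B.leaf_f x ha).symm⟩
  left_inv' := by
    rintro _ ⟨a, ha, rfl⟩
    rw [B.coord_leafOf ha, B.leaf_f x ha]
  right_inv' := by
    rintro _ ⟨a, ha, rfl⟩
    rw [B.leaf_f x ha, B.coord_leafOf ha]
  open_source := isOpenMap_leafOf hD _ B.isOpen
  open_target := B.isOpen_image B.isOpen subset_rfl
  continuousOn_toFun := by
    rintro _ ⟨a, ha, rfl⟩
    refine ContinuousAt.continuousWithinAt fun N hN => ?_
    rw [B.coord_leafOf ha] at hN
    have h2 : B.f ⁻¹' N ∩ B.set ∈ 𝓝 a :=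
      inter_mem ((B.isFirstIntegralAt a ha).1.continuousAt hN) (B.isOpen.mem_nhds ha)
    refine mem_map.2 <| mem_of_superset ((isOpenMap_leafOf hD).image_mem_nhds h2) ?_
    rintro _ ⟨y, ⟨hyN, hyB⟩, rfl⟩
    rwa [mem_preimage, B.coord_leafOf hyB]
  continuousOn_invFun := by
    rintro _ ⟨a, ha, rfl⟩
    refine ContinuousAt.continuousWithinAt fun N hN => ?_
    rw [B.leaf_f x ha] at hN
    have h2 : leafOf D ⁻¹' N ∩ B.set ∈ 𝓝 a :=
      inter_mem (continuous_leafOf.continuousAt hN) (B.isOpen.mem_nhds ha)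
    refine mem_map.2 <| mem_of_superset (B.map_nhds ha h2) ?_
    rintro _ ⟨y, ⟨hyN, hyB⟩, rfl⟩
    rwa [mem_preimage, B.leaf_f x hyB]

lemma chart_leafOf (x : X) {a : X} (ha : a ∈ B.set) : B.chart hD x (leafOf D a) = B.f a :=
  B.coord_leafOf ha

lemma chart_symm_f (x : X) {a : X} (ha : a ∈ B.set) :
    (B.chart hD x).symm (B.f a) = leafOf D a :=
  B.leaf_f x ha

/-- Near `B.f a` the transition map is `B'.f ∘ τ ∘ σ`, with `σ` a section of `B.f` and `τ` a
transport along the leaf into the other box. -/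
lemma contDiffOn_chart_trans (B' : FlatBox m D) (x x' : X) :
    ContDiffOn ℂ ω ((B.chart hD x).symm.trans (B'.chart hD x'))
      ((B.chart hD x).symm.trans (B'.chart hD x')).source := by
  intro t ht
  refine ContDiffAt.contDiffWithinAt ?_
  rw [OpenPartialHomeomorph.trans_source] at ht
  obtain ⟨⟨a, ha, rfl⟩, ht2⟩ := ht
  rw [mem_preimage, B.chart_symm_f hD x ha] at ht2
  obtain ⟨a', ha', haa'⟩ := ht2
  obtain ⟨σ, hσ1, hσ2, hσ3⟩ := B.exists_section a ha
  obtain ⟨τ, hτ1, hτ2, hτ3⟩ := transports_of_leafOf_eq hD haa'.symm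
  rw [← hσ2] at hτ1 hτ3
  have h1 : ContMDiffAt 𝓘(ℂ, Fin m → ℂ) 𝓘(ℂ, E) ω (fun t => τ (σ t)) (B.f a) :=
    ContMDiffAt.comp (g := τ) (B.f a) hτ1 hσ1
  have h2 : τ (σ (B.f a)) = a' := by rw [hσ2, hτ2]
  have h3 : ContMDiffAt 𝓘(ℂ, Fin m → ℂ) 𝓘(ℂ, Fin m → ℂ) ω (fun t => B'.f (τ (σ t))) (B.f a) :=
    ContMDiffAt.comp (g := B'.f) (f := fun t => τ (σ t)) (B.f a)
      (by rw [h2]; exact (B'.isFirstIntegralAt a' ha').1) h1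
  refine h3.contDiffAt.congr_of_eventuallyEq ?_
  have hB : B.set ∈ 𝓝 (σ (B.f a)) := by rw [hσ2]; exact B.isOpen.mem_nhds ha
  have hB' : B'.set ∈ 𝓝 (τ (σ (B.f a))) := by rw [h2]; exact B'.isOpen.mem_nhds ha'
  filter_upwards [hσ3, hσ1.continuousAt.eventually hτ3, hσ1.continuousAt.eventually hB,
    h1.continuousAt.eventually hB'] with t k1 k2 k3 k4
  change B'.chart hD x' ((B.chart hD x).symm t) = _
  rw [← k1, B.chart_symm_f hD x k3, ← k2, B'.chart_leafOf hD x' k4, k1]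

end FlatBox

/-- The charts of the leaf space defined by boxes. -/
@[reducible]
def leafSpaceCharts {p : ℕ} (hD : IsIntegrableDistribution p m D) (hreg : IsRegularFoliation D) :
    ChartedSpace (Fin m → ℂ) (LeafSpace D) where
  atlas := {e | ∃ (B : FlatBox m D) (x : X), e = B.chart hD x}
  chartAt q := (exists_flatBox hD hreg q.out).choose.chart hD q.out
  mem_chart_source q :=
    ⟨q.out, (exists_flatBox hD hreg q.out).choose_spec, q.out_eq⟩
  chart_mem_atlas q := ⟨_, _, rfl⟩

lemma isManifold_leafSpace {p : ℕ} (hD : IsIntegrableDistribution p m D)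
    (hreg : IsRegularFoliation D) :
    let := leafSpaceCharts hD hreg
    IsManifold 𝓘(ℂ, Fin m → ℂ) ω (LeafSpace D) := by
  let := leafSpaceCharts hD hreg
  apply isManifold_of_contDiffOn
  rintro _ _ ⟨B, x, rfl⟩ ⟨B', x', rfl⟩
  have := B.contDiffOn_chart_trans hD B' x x'
  simp only [modelWithCornersSelf_coe, modelWithCornersSelf_coe_symm, range_id, inter_univ,
    preimage_id, Function.comp_id, Function.id_comp]
  exact this

/-- The projection to the leaf space is a holomorphic submersion whose differential has kernel
`D`. -/
lemma leafOf_submersion {p : ℕ} (hD : IsIntegrableDistribution p m D)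
    (hreg : IsRegularFoliation D) (z : X) :
    let := leafSpaceCharts hD hreg
    ContMDiffAt 𝓘(ℂ, E) 𝓘(ℂ, Fin m → ℂ) ω (leafOf D) z ∧
    Function.Surjective (mfderiv 𝓘(ℂ, E) 𝓘(ℂ, Fin m → ℂ) (leafOf D) z) ∧
    LinearMap.ker (mfderiv 𝓘(ℂ, E) 𝓘(ℂ, Fin m → ℂ) (leafOf D) z).toLinearMap = D z := by
  let := leafSpaceCharts hD hreg
  have := isManifold_leafSpace hD hreg
  have hω : (ω : WithTop ℕ∞) ≠ 0 := by simp
  obtain ⟨B, hz⟩ := exists_flatBox hD hreg z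
  have he : B.chart hD z ∈ atlas (Fin m → ℂ) (LeafSpace D) := ⟨B, z, rfl⟩
  have hs : leafOf D z ∈ (B.chart hD z).source := ⟨z, hz, rfl⟩
  obtain ⟨h1, h2, h3⟩ := B.isFirstIntegralAt z hz
  -- In the chart of a box the projection is the first integral itself.
  have hev : (B.chart hD z) ∘ leafOf D =ᶠ[𝓝 z] B.f := by
    filter_upwards [B.isOpen.mem_nhds hz] with y hy
    exact B.chart_leafOf hD z hy
  have hsm : ContMDiffAt 𝓘(ℂ, E) 𝓘(ℂ, Fin m → ℂ) ω (leafOf D) z := by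
    refine contMDiffAt_iff_comp_atlas he ?_ (h1.congr_of_eventuallyEq hev)
    exact continuous_leafOf.continuousAt.eventually ((B.chart hD z).open_source.mem_nhds hs)
  have hcomp := mfderiv_comp z (mdifferentiableAt_atlas (I := 𝓘(ℂ, Fin m → ℂ)) he hs)
    (hsm.mdifferentiableAt hω)
  rw [hev.mfderiv_eq] at hcomp
  have hv (v : TangentSpace 𝓘(ℂ, E) z) : mfderiv 𝓘(ℂ, E) 𝓘(ℂ, Fin m → ℂ) B.f z v =
      chartDeriv he hs (mfderiv 𝓘(ℂ, E) 𝓘(ℂ, Fin m → ℂ) (leafOf D) z v) :=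
    congrArg (fun T : E →L[ℂ] (Fin m → ℂ) => T v) hcomp
  refine ⟨hsm, fun t => ?_, ?_⟩
  · obtain ⟨v, h⟩ := h2 (chartDeriv he hs t)
    rw [hv] at h
    exact ⟨v, (chartDeriv he hs).injective h⟩
  · rw [← h3]
    ext v
    constructor
    · intro h
      have h' : mfderiv 𝓘(ℂ, E) 𝓘(ℂ, Fin m → ℂ) (leafOf D) z v = 0 := h
      have := hv v
      rw [h'] at this
      exact this.trans (map_zero (chartDeriv he hs))
    · intro h
      have h' : mfderiv 𝓘(ℂ, E) 𝓘(ℂ, Fin m → ℂ) B.f z v = 0 := h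
      rw [hv] at h'
      exact (chartDeriv he hs).injective (h'.trans (map_zero (chartDeriv he hs)).symm)

end LeafSpaces

/-! ### Immersions and compact embeddings -/

section Immersions

variable {m k : ℕ} {X : Type*} [TopologicalSpace X] [ChartedSpace (Fin m → ℂ) X]
  [IsManifold 𝓘(ℂ, Fin m → ℂ) ω X] {Y : Type*} [TopologicalSpace Y] [ChartedSpace (Fin k → ℂ) Y]
  [IsManifold 𝓘(ℂ, Fin k → ℂ) ω Y] {f : X → Y} {x : X}

/-- A partial homeomorphism which is biholomorphic at a point restricts to a chart. -/
lemma exists_restr_mem_maximalAtlas (Ψ : OpenPartialHomeomorph Y (Fin k → ℂ)) {y : Y}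
    (hy : y ∈ Ψ.source) (h1 : ContMDiffAt 𝓘(ℂ, Fin k → ℂ) 𝓘(ℂ, Fin k → ℂ) ω Ψ y)
    (h2 : ContMDiffAt 𝓘(ℂ, Fin k → ℂ) 𝓘(ℂ, Fin k → ℂ) ω Ψ.symm (Ψ y)) :
    ∃ s, y ∈ (Ψ.restr s).source ∧
      Ψ.restr s ∈ IsManifold.maximalAtlas 𝓘(ℂ, Fin k → ℂ) ω Y := by
  have hev : ∀ᶠ y' in 𝓝 y, ContMDiffAt 𝓘(ℂ, Fin k → ℂ) 𝓘(ℂ, Fin k → ℂ) ω Ψ y' ∧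
      ContMDiffAt 𝓘(ℂ, Fin k → ℂ) 𝓘(ℂ, Fin k → ℂ) ω Ψ.symm (Ψ y') :=
    ((contMDiffAt_iff_contMDiffAt_nhds (by simp)).1 h1).and
      ((Ψ.continuousAt hy).eventually ((contMDiffAt_iff_contMDiffAt_nhds (by simp)).1 h2))
  obtain ⟨s, hs, hso, hys⟩ := eventually_nhds_iff.1 hev
  have hsrc : (Ψ.restr s).source = Ψ.source ∩ s := Ψ.restr_source' s hso
  refine ⟨s, hsrc ▸ ⟨hy, hys⟩, OpenPartialHomeomorph.mem_maximalAtlas_of_contMDiffOn _ ?_ ?_⟩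
  · intro y' hy'
    rw [hsrc] at hy'
    exact (hs y' hy'.2).1.contMDiffWithinAt
  · intro t ht
    have h3 := (Ψ.restr s).map_target ht
    rw [hsrc] at h3
    have h4 := (hs _ h3.2).2
    have h5 : Ψ ((Ψ.restr s).symm t) = t := (Ψ.restr s).right_inv ht
    rw [h5] at h4
    exact h4.contMDiffWithinAt

/-- `L` parametrises a complement of the range of `g`, which has dimension `l`. -/
lemma exists_coprod_bijective {l : ℕ} (hl : m + l = k) (g : (Fin m → ℂ) →L[ℂ] (Fin k → ℂ))
    (hg : Function.Injective g) : ∃ (L : (Fin l → ℂ) →L[ℂ] (Fin k → ℂ))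
      (e : ((Fin m → ℂ) × (Fin l → ℂ)) ≃L[ℂ] (Fin k → ℂ)), ∀ u, e u = g u.1 + L u.2 := by
  obtain ⟨C, hC⟩ := Submodule.exists_isCompl (LinearMap.range g.toLinearMap)
  have h1 : Module.finrank ℂ (LinearMap.range g.toLinearMap) = m := by
    rw [LinearMap.finrank_range_of_inj hg, Module.finrank_fin_fun]
  have h2 : Module.finrank ℂ C = l := by
    have := Submodule.finrank_add_eq_of_isCompl hC
    rw [h1, Module.finrank_fin_fun] at this
    omega
  let e : (Fin l → ℂ) ≃ₗ[ℂ] C := LinearEquiv.ofFinrankEq _ _ (by rw [h2, Module.finrank_fin_fun])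
  let L : (Fin l → ℂ) →L[ℂ] (Fin k → ℂ) := LinearMap.toContinuousLinearMap (C.subtype ∘ₗ e.toLinearMap)
  have hL (v) : L v = e v := rfl
  have hinj : Function.Injective (g.coprod L).toLinearMap := by
    rw [injective_iff_map_eq_zero]
    rintro ⟨u, v⟩ h
    have h3 : g u + L v = 0 := h
    have h4 : g u ∈ (LinearMap.range g.toLinearMap ⊓ C : Submodule ℂ (Fin k → ℂ)) := by
      refine ⟨⟨u, rfl⟩, ?_⟩
      rw [eq_neg_of_add_eq_zero_left h3, hL]
      exact C.neg_mem (e v).2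
    rw [hC.inf_eq_bot, Submodule.mem_bot] at h4
    rw [h4, zero_add, hL] at h3
    have h5 : u = 0 := hg (h4.trans (map_zero g).symm)
    have h6 : v = 0 := e.map_eq_zero_iff.1 (Subtype.ext h3)
    rw [h5, h6]; rfl
  refine ⟨L, (LinearMap.linearEquivOfInjective _ hinj (by simp [hl])).toContinuousLinearEquiv,
    fun u => rfl⟩

/-- A holomorphic map with injective differential is an immersion. -/
theorem isImmersionAtOfComplement_of_mfderiv_injective {l : ℕ} (hl : m + l = k)
    (hf : ContMDiffAt 𝓘(ℂ, Fin m → ℂ) 𝓘(ℂ, Fin k → ℂ) ω f x)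
    (hinj : Function.Injective (mfderiv 𝓘(ℂ, Fin m → ℂ) 𝓘(ℂ, Fin k → ℂ) f x)) :
    Manifold.IsImmersionAtOfComplement (Fin l → ℂ) 𝓘(ℂ, Fin m → ℂ) 𝓘(ℂ, Fin k → ℂ) ω f x := by
  have hω : (ω : WithTop ℕ∞) ≠ 0 := by simp
  have hφa := chart_mem_atlas (Fin m → ℂ) x
  have hψa := chart_mem_atlas (Fin k → ℂ) (f x)
  have hx := mem_chart_source (Fin m → ℂ) x
  have hfx := mem_chart_source (Fin k → ℂ) (f x)
  set φ := chartAt (Fin m → ℂ) x with hφ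
  set ψ := chartAt (Fin k → ℂ) (f x) with hψ
  have hψf : ContMDiffAt 𝓘(ℂ, Fin m → ℂ) 𝓘(ℂ, Fin k → ℂ) ω (ψ ∘ f) x :=
    ContMDiffAt.comp x (contMDiffAt_of_mem_atlas_source hψa hfx) hf
  have hg : ContDiffAt ℂ ω ((ψ ∘ f) ∘ φ.symm) (φ x) := (contMDiffAt_iff_atlas hφa hx).1 hψf
  set g := (ψ ∘ f) ∘ φ.symm with hg_def
  have hev : ∀ᶠ y in 𝓝 x, (ψ ∘ f) y = g (φ y) := by
    filter_upwards [φ.open_source.mem_nhds hx] with y hy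
    simp [hg_def, φ.left_inv hy]
  have hg' : Function.Injective (fderiv ℂ g (φ x)) := by
    rw [injective_iff_map_eq_zero]
    intro v hv
    have h1 := mfderiv_apply_of_eventuallyEq_comp hφa hx (hg.differentiableAt hω) hev
      ((chartDeriv hφa hx).symm v)
    rw [← chartDeriv_apply hφa hx, LinearEquiv.apply_symm_apply, hv] at h1
    have h2 := mfderiv_comp x (mdifferentiableAt_atlas (I := 𝓘(ℂ, Fin k → ℂ)) hψa hfx)
      (hf.mdifferentiableAt hω)
    rw [h2] at h1
    have h3 : chartDeriv hψa hfx (mfderiv 𝓘(ℂ, Fin m → ℂ) 𝓘(ℂ, Fin k → ℂ) f x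
        ((chartDeriv hφa hx).symm v)) = 0 := h1
    rw [LinearEquiv.map_eq_zero_iff] at h3
    have h4 := hinj (h3.trans (map_zero (mfderiv 𝓘(ℂ, Fin m → ℂ) 𝓘(ℂ, Fin k → ℂ) f x).toLinearMap).symm)
    exact (chartDeriv hφa hx).symm.map_eq_zero_iff.1 h4
  obtain ⟨L, e, he⟩ := exists_coprod_bijective hl _ hg'
  -- This map extends `g` across the complement and is a local biholomorphism; its inverse flattens
  -- the image of `f`.
  have hG : ContDiffAt ℂ ω (fun u : (Fin m → ℂ) × (Fin l → ℂ) => g u.1 + L u.2) (φ x, 0) :=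
    (ContDiffAt.comp (g := g) (φ x, (0 : Fin l → ℂ)) hg contDiffAt_fst).add
      (L.contDiff.contDiffAt.comp _ contDiffAt_snd)
  have hG' : HasFDerivAt (fun u : (Fin m → ℂ) × (Fin l → ℂ) => g u.1 + L u.2)
      (e : ((Fin m → ℂ) × (Fin l → ℂ)) →L[ℂ] (Fin k → ℂ)) (φ x, 0) := by
    have h1 := (HasFDerivAt.comp (g := g) ((φ x, 0) : (Fin m → ℂ) × (Fin l → ℂ))
      (hg.differentiableAt hω).hasFDerivAt hasFDerivAt_fst).add
      (L.hasFDerivAt.comp ((φ x, 0) : (Fin m → ℂ) × (Fin l → ℂ)) hasFDerivAt_snd)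
    refine h1.congr_fderiv ?_
    exact ContinuousLinearMap.ext fun u => (he u).symm
  let H := hG.toOpenPartialHomeomorph _ hG' hω
  have hH (u) : H u = g u.1 + L u.2 := rfl
  have hHs : (φ x, 0) ∈ H.source := hG.mem_toOpenPartialHomeomorph_source hG' hω
  have hg0 : g (φ x) = ψ (f x) := by simp [hg_def, φ.left_inv hx]
  have hHx : H (φ x, 0) = ψ (f x) := by rw [hH, map_zero, add_zero, hg0]
  have hHsymm : ContDiffAt ℂ ω H.symm (H (φ x, 0)) :=
    H.contDiffAt_symm (H.map_source hHs) (by rw [H.left_inv hHs]; exact hG')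
      (by rw [H.left_inv hHs]; exact hG)
  -- In this chart of `Y` the map `f` becomes `u ↦ e (u, 0)`, the normal form of an immersion.
  let Ψ : OpenPartialHomeomorph Y (Fin k → ℂ) :=
    (ψ.trans H.symm).trans e.toHomeomorph.toOpenPartialHomeomorph
  have hΨ (y) : Ψ y = e (H.symm (ψ y)) := rfl
  have hΨs (t) : Ψ.symm t = ψ.symm (H (e.symm t)) := rfl
  have hΨx : Ψ (f x) = e (φ x, 0) := by rw [hΨ, ← hHx, H.left_inv hHs]
  have hfΨ : f x ∈ Ψ.source := by
    simp only [Ψ, OpenPartialHomeomorph.trans_source, mem_inter_iff, mem_preimage]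
    refine ⟨⟨hfx, ?_⟩, mem_univ _⟩
    rw [← hHx]
    exact H.map_source hHs
  have hΨ1 : ContMDiffAt 𝓘(ℂ, Fin k → ℂ) 𝓘(ℂ, Fin k → ℂ) ω (fun y => e (H.symm (ψ y))) (f x) := by
    have h1 : ContDiffAt ℂ ω (e ∘ H.symm) (ψ (f x)) :=
      e.contDiff.contDiffAt.comp (ψ (f x)) (by rw [← hHx]; exact hHsymm)
    exact ContMDiffAt.comp (g := e ∘ H.symm) (f x) h1.contMDiffAt (contMDiffAt_of_mem_atlas_source hψa hfx)
  obtain ⟨s, hs1, hs2⟩ := exists_restr_mem_maximalAtlas Ψ hfΨ hΨ1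
    (by
      rw [hΨx]
      have h2 : ContDiffAt ℂ ω (fun t => H (e.symm t)) (e (φ x, 0)) :=
        ContDiffAt.comp (g := H) _ (by rw [e.symm_apply_apply]; exact hG) e.symm.contDiff.contDiffAt
      refine ContMDiffAt.comp (g := ψ.symm) (f := fun t => H (e.symm t)) (e (φ x, 0)) ?_ h2.contMDiffAt
      rw [e.symm_apply_apply, hHx]
      exact contMDiffAt_symm_of_mem_atlas_target hψa (ψ.map_source hfx))
  -- the domain of the chart of the source
  have hdom : ∀ᶠ y in 𝓝 x, (ψ.symm (ψ (f y)) = f y) ∧ (φ y, (0 : Fin l → ℂ)) ∈ H.source := by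
    refine Filter.Eventually.and ?_ ?_
    · filter_upwards [hf.continuousAt.eventually (ψ.open_source.mem_nhds hfx)] with y hy
      exact ψ.left_inv hy
    · exact ((φ.continuousAt hx).prodMk continuousAt_const).eventually (H.open_source.mem_nhds hHs)
  obtain ⟨N, hN, hNo, hxN⟩ := eventually_nhds_iff.1 hdom
  refine Manifold.IsImmersionAtOfComplement.mk_of_continuousAt hf.continuousAt e (φ.restr N)
    (Ψ.restr s) ?_ hs1 (restr_mem_maximalAtlas _ (IsManifold.subset_maximalAtlas hφa) hNo) hs2 ?_
  · rw [φ.restr_source' N hNo]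
    exact ⟨hx, hxN⟩
  · intro u hu
    have hu' : u ∈ (φ.restr N).target := by simpa using hu
    have h1 := (φ.restr N).map_target hu'
    rw [φ.restr_source' N hNo] at h1
    obtain ⟨h2, h3⟩ := hN _ h1.2
    have h4 : φ (φ.symm u) = u := (φ.restr N).right_inv hu'
    change e (H.symm (ψ (f (φ.symm u)))) = e (u, 0)
    have h5 : ψ (f (φ.symm u)) = H (u, 0) := by rw [hH, map_zero, add_zero]; rfl
    have h6 : (u, (0 : Fin l → ℂ)) ∈ H.source := h4 ▸ h3
    rw [h5, H.left_inv h6]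

/-- An injective holomorphic immersion of a compact manifold is an embedding. -/
theorem isSmoothEmbedding_of_injective [CompactSpace X] [T2Space Y] {l : ℕ} (hl : m + l = k)
    (hf : ContMDiff 𝓘(ℂ, Fin m → ℂ) 𝓘(ℂ, Fin k → ℂ) ω f) (hinj : Function.Injective f)
    (hd : ∀ x, Function.Injective (mfderiv 𝓘(ℂ, Fin m → ℂ) 𝓘(ℂ, Fin k → ℂ) f x)) :
    Manifold.IsSmoothEmbedding 𝓘(ℂ, Fin m → ℂ) 𝓘(ℂ, Fin k → ℂ) ω f :=
  ⟨⟨Fin l → ℂ, inferInstance, inferInstance, fun x =>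
    isImmersionAtOfComplement_of_mfderiv_injective hl (hf x) (hd x)⟩,
    (hf.continuous.isClosedEmbedding hinj).isEmbedding⟩

/-- Holomorphy of a vector field along a map, in a chart of the target. -/
lemma contMDiffAt_tangent_iff {E : Type*} [NormedAddCommGroup E] [NormedSpace ℂ E] {W : Type*}
    [TopologicalSpace W] [ChartedSpace E W] {f : W → Y} {w : W}
    (hf : ContMDiffAt 𝓘(ℂ, E) 𝓘(ℂ, Fin k → ℂ) ω f w)
    (t : ∀ y, TangentSpace 𝓘(ℂ, Fin k → ℂ) (f y)) :
    ContMDiffAt 𝓘(ℂ, E) 𝓘(ℂ, Fin k → ℂ).tangent ω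
      (fun y => (⟨f y, t y⟩ : TangentBundle 𝓘(ℂ, Fin k → ℂ) Y)) w ↔
    ContMDiffAt 𝓘(ℂ, E) 𝓘(ℂ, Fin k → ℂ) ω (fun y => mfderiv 𝓘(ℂ, Fin k → ℂ) 𝓘(ℂ, Fin k → ℂ)
      (chartAt (Fin k → ℂ) (f w)) (f y) (t y)) w := by
  rw [contMDiffAt_totalSpace]
  have hev : ∀ᶠ y in 𝓝 w, (trivializationAt (Fin k → ℂ) (TangentSpace 𝓘(ℂ, Fin k → ℂ)) (f w)
      (⟨f y, t y⟩ : TangentBundle 𝓘(ℂ, Fin k → ℂ) Y)).2 = mfderiv 𝓘(ℂ, Fin k → ℂ)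
        𝓘(ℂ, Fin k → ℂ) (chartAt (Fin k → ℂ) (f w)) (f y) (t y) := by
    filter_upwards [hf.continuousAt.eventually
      ((chartAt (Fin k → ℂ) (f w)).open_source.mem_nhds (mem_chart_source _ _))] with y hy
    rw [← fibCoord_tangent hy, fibCoord_apply (W := TangentSpace 𝓘(ℂ, Fin k → ℂ)) hy]
  exact ⟨fun h => h.2.congr_of_eventuallyEq (hev.mono fun y hy => hy.symm),
    fun h => ⟨hf, h.congr_of_eventuallyEq hev⟩⟩

end Immersions

/-! ### The projectivised bundle is second countable -/

namespace ProjBundle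

variable {n q : ℕ} {M : Type*} [TopologicalSpace M] [ChartedSpace (Fin n → ℂ) M]
  [IsManifold 𝓘(ℂ, Fin n → ℂ) ω M]
  {V : M → Type*} [TopologicalSpace (TotalSpace (Fin q → ℂ) V)]
  [∀ x, AddCommGroup (V x)] [∀ x, Module ℂ (V x)] [∀ x, TopologicalSpace (V x)]
  [FiberBundle (Fin q → ℂ) V] [VectorBundle ℂ (Fin q → ℂ) V]
  [ContMDiffVectorBundle ω (Fin q → ℂ) V 𝓘(ℂ, Fin n → ℂ)]

/-- Countably many sets carrying both a chart of `M` and a trivialisation of `V` cover `M`, and over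
each of them `q` affine charts cover the bundle. -/
lemma secondCountableTopology [SecondCountableTopology M] (hq : 1 ≤ q) :
    SecondCountableTopology (ProjBundle n q V) := by
  have hV (x : M) := FiberBundle.mem_baseSet_trivializationAt' (F := Fin q → ℂ) (E := V) x
  -- Charts of `P(V)` are indexed by points of `P(V)`, so each base point needs some line over it;
  -- here `1 ≤ q` enters.
  have hne (x : M) : ∃ z : ProjBundle n q V, z.base = x :=
    ⟨⟨x, Projectivization.mk ℂ (fibVec x x (affVec (⟨0, hq⟩ : Fin q) 0)) fun h => affVec_ne_zero
      (⟨0, hq⟩ : Fin q) 0 (by rw [← fibCoord_fibVec (W := V) (hV x) (affVec _ _), h, map_zero])⟩, rfl⟩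
  choose z hz using hne
  obtain ⟨s, hs, hsu⟩ := TopologicalSpace.countable_cover_nhds (α := M)
    (f := fun x => (chartAt (Fin n → ℂ) x).source ∩ (trivializationAt (Fin q → ℂ) V x).baseSet)
    fun x => inter_mem ((chartAt (Fin n → ℂ) x).open_source.mem_nhds (mem_chart_source _ x))
      ((trivializationAt (Fin q → ℂ) V x).open_baseSet.mem_nhds (hV x))
  have : Countable s := hs.to_subtype
  let U : s × Fin q → Set (ProjBundle n q V) := fun a => (projChart (z a.1) a.2).source
  have hU2 (a : s × Fin q) : SecondCountableTopology (U a) := (projChart (z a.1) a.2).secondCountableTopology_source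
  refine TopologicalSpace.secondCountableTopology_of_countable_cover (U := U)
    (fun a => (projChart (z a.1) a.2).open_source) ?_
  rw [eq_univ_iff_forall]
  intro y
  obtain ⟨x, hxs, hx1, hx2⟩ : ∃ x ∈ s, y.base ∈ (chartAt (Fin n → ℂ) x).source ∧
      y.base ∈ (trivializationAt (Fin q → ℂ) V x).baseSet := by
    have := eq_univ_iff_forall.1 hsu y.base
    obtain ⟨x, hxs, hx⟩ := mem_iUnion₂.1 this
    exact ⟨x, hxs, hx⟩
  obtain ⟨i, hi⟩ := exists_coord_ne_zero (w := (fibCoord x y.base y.line.rep : Fin q → ℂ))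
    fun h => y.line.rep_nonzero ((map_eq_zero_iff _ (fibCoord_injective hx2)).1 h)
  refine mem_iUnion.2 ⟨(⟨x, hxs⟩, i), mem_projChart_source.2 ?_⟩
  rw [hz x]
  exact ⟨hx1, hx2, hi⟩

end ProjBundle

/-! ### Differentials of the affine coordinates -/

section AffineDerivatives

variable {q : ℕ} {i : Fin q} {w : Fin q → ℂ}

lemma affLin_injective (i : Fin q) : Function.Injective (affLin i) := by
  intro v v' h
  funext k
  have h1 := congrFun h (otherIndex i k)
  have h2 : ((otherIndex i k : {j : Fin q // j ≠ i}) : Fin q) ≠ i := (otherIndex i k).2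
  simpa [affLin, h2] using h1

lemma affLin_apply_self (i : Fin q) (v : Fin (q - 1) → ℂ) : affLin i v i = 0 := by
  simp [affLin]

/-- Differentiate `affVec i (affCoord i w) = w / w_i`; the last term is the derivative of `1 / w_i`.
-/
lemma affLin_fderiv_affCoord (hw : w i ≠ 0) (η : Fin q → ℂ) :
    affLin i (fderiv ℂ (affCoord i) w η) = (w i)⁻¹ • η + (-(w i ^ 2)⁻¹ * η i) • w := by
  have hpr : HasFDerivAt (fun w : Fin q → ℂ => w i)
      (ContinuousLinearMap.proj (R := ℂ) (φ := fun _ : Fin q => ℂ) i) w :=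
    (ContinuousLinearMap.proj (R := ℂ) (φ := fun _ : Fin q => ℂ) i).hasFDerivAt
  have hd1 := ((hasDerivAt_inv hw).comp_hasFDerivAt w hpr).smul (hasFDerivAt_id w)
  have hd2 := (hasFDerivAt_affVec i (affCoord i w)).comp w
    ((contDiffAt_affCoord hw).differentiableAt (by simp)).hasFDerivAt
  have heq : (affVec i ∘ affCoord i) =ᶠ[𝓝 w]
      (Inv.inv ∘ fun w : Fin q → ℂ => w i) • (id : (Fin q → ℂ) → Fin q → ℂ) := by
    filter_upwards [(continuous_apply i).continuousAt.eventually_ne hw] with y hy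
    exact affVec_affCoord i y hy
  exact (congrArg (fun T : _ →L[ℂ] _ => T η)
    ((hd1.congr_of_eventuallyEq heq).unique hd2)).symm

lemma fderiv_affCoord_smul_affLin (hw : w i ≠ 0) (v : Fin (q - 1) → ℂ) :
    fderiv ℂ (affCoord i) w (w i • affLin i v) = v := by
  apply affLin_injective i
  rw [affLin_fderiv_affCoord hw, Pi.smul_apply, affLin_apply_self, smul_zero, mul_zero, zero_smul,
    add_zero, smul_smul, inv_mul_cancel₀ hw, one_smul]

lemma fderiv_affCoord_eq_zero_iff (hw : w i ≠ 0) (η : Fin q → ℂ) :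
    fderiv ℂ (affCoord i) w η = 0 ↔ ∃ c : ℂ, η = c • w := by
  have h1 : fderiv ℂ (affCoord i) w η = 0 ↔ affLin i (fderiv ℂ (affCoord i) w η) = 0 :=
    (map_eq_zero_iff _ (affLin_injective i)).symm
  rw [h1, affLin_fderiv_affCoord hw]
  constructor
  · intro h
    refine ⟨η i / w i, ?_⟩
    have h2 := congrArg (fun v => w i • v) h
    simp only [smul_add, smul_smul, mul_inv_cancel₀ hw, one_smul, smul_zero] at h2
    have h3 : -(w i * (-(w i ^ 2)⁻¹ * η i)) = η i / w i := by field_simp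
    rw [← h3, neg_smul]
    exact eq_neg_of_add_eq_zero_left h2
  · rintro ⟨c, rfl⟩
    rw [Pi.smul_apply, smul_eq_mul, smul_smul, ← add_smul]
    have : (w i)⁻¹ * c + -(w i ^ 2)⁻¹ * (c * w i) = 0 := by field_simp; ring
    rw [this, zero_smul]

/-- `affCoord i` is homogeneous of degree zero. -/
lemma fderiv_affCoord_smul {c : ℂ} (hc : c ≠ 0) (hw : w i ≠ 0) (η : Fin q → ℂ) :
    fderiv ℂ (affCoord i) (c • w) (c • η) = fderiv ℂ (affCoord i) w η := by
  have hcw : (c • w) i ≠ 0 := mul_ne_zero hc hw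
  apply affLin_injective i
  rw [affLin_fderiv_affCoord hcw, affLin_fderiv_affCoord hw, smul_smul, smul_smul]
  simp only [Pi.smul_apply, smul_eq_mul]
  congr 2
  · field_simp
  · field_simp

end AffineDerivatives

/-! ### The projective space -/

section ProjectiveSpace

variable {q : ℕ}

/-- The affine chart of the projective space as an open partial homeomorphism. -/
def projSpaceChart (i : Fin q) : OpenPartialHomeomorph (ℙ ℂ (Fin q → ℂ)) (Fin (q - 1) → ℂ) :=
  (projSpaceCore q).openPartialHomeomorph (affChart i) ⟨i, rfl⟩

lemma projSpaceChart_mem_atlas (i : Fin q) :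
    projSpaceChart i ∈ atlas (Fin (q - 1) → ℂ) (ℙ ℂ (Fin q → ℂ)) := by
  change _ ∈ ⋃ (e) (he), _
  exact mem_iUnion₂.2 ⟨affChart i, ⟨i, rfl⟩, rfl⟩

lemma mk_mem_projSpaceChart_source {i : Fin q} {w : Fin q → ℂ} (hw : w ≠ 0) :
    Projectivization.mk ℂ w hw ∈ (projSpaceChart i).source ↔ w i ≠ 0 := by
  obtain ⟨c, hc, h⟩ := exists_smul_rep w hw
  change (Projectivization.mk ℂ w hw).rep i ≠ 0 ↔ _
  rw [h, Pi.smul_apply, smul_eq_mul, mul_ne_zero_iff_left hc]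

lemma projSpaceChart_mk (i : Fin q) {w : Fin q → ℂ} (hw : w ≠ 0) :
    projSpaceChart i (Projectivization.mk ℂ w hw) = affCoord i w := by
  obtain ⟨c, hc, h⟩ := exists_smul_rep w hw
  change affCoord i (Projectivization.mk ℂ w hw).rep = _
  rw [h, affCoord_smul _ _ hc]

lemma mk_affVec_projSpaceChart {i : Fin q} {c : ℙ ℂ (Fin q → ℂ)} (hc : c ∈ (projSpaceChart i).source) :
    Projectivization.mk ℂ (affVec i (projSpaceChart i c)) (affVec_ne_zero i _) = c :=
  (projSpaceChart i).left_inv hc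

lemma exists_mem_projSpaceChart_source (c : ℙ ℂ (Fin q → ℂ)) : ∃ i, c ∈ (projSpaceChart i).source :=
  exists_coord_ne_zero c.rep_nonzero

open Classical in
/-- The line spanned by a vector, with the value `c` at zero. -/
def projOf (c : ℙ ℂ (Fin q → ℂ)) (w : Fin q → ℂ) : ℙ ℂ (Fin q → ℂ) :=
  if h : w ≠ 0 then Projectivization.mk ℂ w h else c

lemma projOf_of_ne {c : ℙ ℂ (Fin q → ℂ)} {w : Fin q → ℂ} (hw : w ≠ 0) :
    projOf c w = Projectivization.mk ℂ w hw := dif_pos hw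

lemma eventually_ne_zero {w : Fin q → ℂ} {i : Fin q} (hw : w i ≠ 0) :
    ∀ᶠ y : Fin q → ℂ in 𝓝 w, y i ≠ 0 :=
  (continuous_apply i).continuousAt.eventually_ne hw

lemma ne_zero_of_apply {w : Fin q → ℂ} {i : Fin q} (hw : w i ≠ 0) : w ≠ 0 := by
  rintro rfl
  exact hw rfl

lemma contMDiffAt_projOf (c : ℙ ℂ (Fin q → ℂ)) {w : Fin q → ℂ} (hw : w ≠ 0) :
    ContMDiffAt 𝓘(ℂ, Fin q → ℂ) 𝓘(ℂ, Fin (q - 1) → ℂ) ω (projOf c) w := by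
  obtain ⟨i, hi⟩ := exists_coord_ne_zero hw
  refine contMDiffAt_iff_comp_atlas (projSpaceChart_mem_atlas i) ?_ ?_
  · filter_upwards [eventually_ne_zero hi] with y hy
    rw [projOf_of_ne (ne_zero_of_apply hy), mk_mem_projSpaceChart_source]
    exact hy
  · refine (contDiffAt_affCoord hi).contMDiffAt.congr_of_eventuallyEq ?_
    filter_upwards [eventually_ne_zero hi] with y hy
    rw [projOf_of_ne (ne_zero_of_apply hy), projSpaceChart_mk]

/-- The unit sphere maps continuously onto the projective space. -/
instance compactSpace_projectiveSpace : CompactSpace (ℙ ℂ (Fin q → ℂ)) := by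
  have : CompactSpace (Metric.sphere (0 : Fin q → ℂ) 1) :=
    isCompact_iff_compactSpace.1 (isCompact_sphere _ _)
  have hne (w : Metric.sphere (0 : Fin q → ℂ) 1) : (w : Fin q → ℂ) ≠ 0 := by
    intro h
    have := w.2
    rw [h] at this
    simp at this
  let φ : Metric.sphere (0 : Fin q → ℂ) 1 → ℙ ℂ (Fin q → ℂ) := fun w =>
    Projectivization.mk ℂ w.1 (hne w)
  have hφ : Continuous φ := by
    rw [continuous_iff_continuousAt]
    intro w
    have h1 := (contMDiffAt_projOf (φ w) (hne w)).continuousAt.comp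
      (continuous_subtype_val (p := fun x => x ∈ Metric.sphere (0 : Fin q → ℂ) 1)).continuousAt
    exact h1.congr (Eventually.of_forall fun y => projOf_of_ne (hne y))
  have hsurj : Function.Surjective φ := by
    intro c
    have hn : ‖c.rep‖ ≠ 0 := norm_ne_zero_iff.2 c.rep_nonzero
    refine ⟨⟨(‖c.rep‖⁻¹ : ℂ) • c.rep, ?_⟩, ?_⟩
    · rw [mem_sphere_zero_iff_norm, norm_smul, norm_inv, Complex.norm_real, norm_norm,
        inv_mul_cancel₀ hn]
    · conv_rhs => rw [← c.mk_rep]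
      exact (Projectivization.mk_eq_mk_iff' ℂ _ _ _ _).2 ⟨_, rfl⟩
  exact hsurj.compactSpace hφ

/-- The differential at `w` of the projection `ℂ^q ∖ 0 → P_{q-1}`, where `w` spans `c`. -/
def projDeriv (c : ℙ ℂ (Fin q → ℂ)) (w : Fin q → ℂ) :
    (Fin q → ℂ) →ₗ[ℂ] TangentSpace 𝓘(ℂ, Fin (q - 1) → ℂ) c :=
  (mfderiv 𝓘(ℂ, Fin q → ℂ) 𝓘(ℂ, Fin (q - 1) → ℂ) (projOf c) w).toLinearMap

variable {c : ℙ ℂ (Fin q → ℂ)} {w : Fin q → ℂ}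

/-- The differential of a map out of the projective space is determined by its lift to `ℂ^q`. -/
lemma mfderiv_projDeriv {F : Type*} [NormedAddCommGroup F] [NormedSpace ℂ F] {N : Type*}
    [TopologicalSpace N] [ChartedSpace F N] {g : ℙ ℂ (Fin q → ℂ) → N} (hw : w ≠ 0)
    (hc : Projectivization.mk ℂ w hw = c)
    (hg : MDifferentiableAt 𝓘(ℂ, Fin (q - 1) → ℂ) 𝓘(ℂ, F) g c) (η : Fin q → ℂ) :
    (mfderiv 𝓘(ℂ, Fin (q - 1) → ℂ) 𝓘(ℂ, F) g c (projDeriv c w η) : F) =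
      (mfderiv 𝓘(ℂ, Fin q → ℂ) 𝓘(ℂ, F) (g ∘ projOf c) w η : F) := by
  have h : projOf c w = c := (projOf_of_ne hw).trans hc
  have hg' : MDifferentiableAt 𝓘(ℂ, Fin (q - 1) → ℂ) 𝓘(ℂ, F) g (projOf c w) := by rwa [h]
  rw [mfderiv_comp w hg' ((contMDiffAt_projOf c hw).mdifferentiableAt (by simp))]
  have h2 (c' : ℙ ℂ (Fin q → ℂ)) (h : c' = c) (v : Fin (q - 1) → ℂ) :
      (mfderiv 𝓘(ℂ, Fin (q - 1) → ℂ) 𝓘(ℂ, F) g c v : F) =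
        (mfderiv 𝓘(ℂ, Fin (q - 1) → ℂ) 𝓘(ℂ, F) g c' v : F) := by
    subst h
    rfl
  exact h2 _ h _

lemma mfderiv_projSpaceChart_projDeriv {i : Fin q} (hi : w i ≠ 0)
    (hc : Projectivization.mk ℂ w (ne_zero_of_apply hi) = c) (η : Fin q → ℂ) :
    mfderiv 𝓘(ℂ, Fin (q - 1) → ℂ) 𝓘(ℂ, Fin (q - 1) → ℂ) (projSpaceChart i) c (projDeriv c w η) =
      fderiv ℂ (affCoord i) w η := by
  have hcs : c ∈ (projSpaceChart i).source := by
    rw [← hc, mk_mem_projSpaceChart_source]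
    exact hi
  refine (mfderiv_projDeriv (ne_zero_of_apply hi) hc
    (mdifferentiableAt_atlas (I := 𝓘(ℂ, Fin (q - 1) → ℂ)) (projSpaceChart_mem_atlas i) hcs) η).trans ?_
  have hev : projSpaceChart i ∘ projOf c =ᶠ[𝓝 w] affCoord i := by
    filter_upwards [eventually_ne_zero hi] with y hy
    rw [Function.comp_apply, projOf_of_ne (ne_zero_of_apply hy), projSpaceChart_mk]
  rw [hev.mfderiv_eq, mfderiv_eq_fderiv]
  rfl

lemma chartDeriv_projDeriv {i : Fin q} (hi : w i ≠ 0)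
    (hc : Projectivization.mk ℂ w (ne_zero_of_apply hi) = c) (hcs : c ∈ (projSpaceChart i).source)
    (η : Fin q → ℂ) : chartDeriv (projSpaceChart_mem_atlas i) hcs (projDeriv c w η) =
      fderiv ℂ (affCoord i) w η :=
  mfderiv_projSpaceChart_projDeriv hi hc η

lemma projDeriv_surjective (hw : w ≠ 0) (hc : Projectivization.mk ℂ w hw = c) :
    Function.Surjective (projDeriv c w) := by
  obtain ⟨i, hi⟩ := exists_coord_ne_zero hw
  have hcs : c ∈ (projSpaceChart i).source := by
    rw [← hc, mk_mem_projSpaceChart_source]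
    exact hi
  intro v
  refine ⟨w i • affLin i (chartDeriv (projSpaceChart_mem_atlas i) hcs v),
    (chartDeriv (projSpaceChart_mem_atlas i) hcs).injective ?_⟩
  rw [chartDeriv_projDeriv hi hc, fderiv_affCoord_smul_affLin hi]

lemma projDeriv_eq_zero_iff (hw : w ≠ 0) (hc : Projectivization.mk ℂ w hw = c) (η : Fin q → ℂ) :
    projDeriv c w η = 0 ↔ ∃ a : ℂ, η = a • w := by
  obtain ⟨i, hi⟩ := exists_coord_ne_zero hw
  have hcs : c ∈ (projSpaceChart i).source := by
    rw [← hc, mk_mem_projSpaceChart_source]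
    exact hi
  rw [← fderiv_affCoord_eq_zero_iff hi, ← chartDeriv_projDeriv hi hc hcs,
    LinearEquiv.map_eq_zero_iff]

/-- Scaling `w` and `η` together leaves the curve of lines through `w + t η` unchanged. So `dπ_w`
has degree `-1` in `w`, and `w ⊗ dπ_w(η)` depends only on the line: this is where the factor
`H^{-1}` of the normal bundle comes from. -/
lemma projDeriv_smul (hw : w ≠ 0) (hc : Projectivization.mk ℂ w hw = c) {a : ℂ} (ha : a ≠ 0)
    (η : Fin q → ℂ) : projDeriv c (a • w) (a • η) = projDeriv c w η := by
  obtain ⟨i, hi⟩ := exists_coord_ne_zero hw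
  have hcs : c ∈ (projSpaceChart i).source := by
    rw [← hc, mk_mem_projSpaceChart_source]
    exact hi
  have hi' : (a • w) i ≠ 0 := mul_ne_zero ha hi
  have hc' : Projectivization.mk ℂ (a • w) (ne_zero_of_apply hi') = c := by
    rw [← hc]
    exact (Projectivization.mk_eq_mk_iff' ℂ _ _ _ _).2 ⟨a, rfl⟩
  apply (chartDeriv (projSpaceChart_mem_atlas i) hcs).injective
  rw [chartDeriv_projDeriv hi' hc', chartDeriv_projDeriv hi hc, fderiv_affCoord_smul ha hi]

end ProjectiveSpace

/-! ### The fibres of the projectivised bundle -/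

namespace ProjBundle

section Fibres

variable {n q : ℕ} {M : Type*} [TopologicalSpace M] [ChartedSpace (Fin n → ℂ) M]
  [IsManifold 𝓘(ℂ, Fin n → ℂ) ω M]
  {V : M → Type*} [TopologicalSpace (TotalSpace (Fin q → ℂ) V)]
  [∀ x, AddCommGroup (V x)] [∀ x, Module ℂ (V x)] [∀ x, TopologicalSpace (V x)]
  [FiberBundle (Fin q → ℂ) V] [VectorBundle ℂ (Fin q → ℂ) V]
  [ContMDiffVectorBundle ω (Fin q → ℂ) V 𝓘(ℂ, Fin n → ℂ)]
  {x : M} (b : (Fin q → ℂ) ≃ₗ[ℂ] V x)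

variable (n) in
/-- The inclusion of the fibre over `x`. -/
def lineMap (c : ℙ ℂ (Fin q → ℂ)) : ProjBundle n q V :=
  ⟨x, Projectivization.map b.toLinearMap b.injective c⟩

lemma lineMap_injective : Function.Injective (lineMap n b) := by
  intro c c' h
  have h1 : HEq (lineMap n b c).line (lineMap n b c').line := by rw [h]
  exact Projectivization.map_injective _ b.injective (eq_of_heq h1)

/-- The isomorphism `b` in the preferred coordinates at `x₀`. -/
def fibMap (x₀ : M) : (Fin q → ℂ) →L[ℂ] (Fin q → ℂ) :=
  LinearMap.toContinuousLinearMap ((fibCoord x₀ x : V x →ₗ[ℂ] (Fin q → ℂ)) ∘ₗ b.toLinearMap)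

lemma fibMap_apply (x₀ : M) (w : Fin q → ℂ) : fibMap b x₀ w = fibCoord x₀ x (b w) := rfl

variable {b} {x₀ : M} {z₀ : ProjBundle n q V} {i : Fin q} {c : ℙ ℂ (Fin q → ℂ)} {w : Fin q → ℂ}

lemma fibMap_bijective (hx : x ∈ (trivializationAt (Fin q → ℂ) V x₀).baseSet) :
    Function.Bijective (fibMap b x₀) := by
  have h : Function.Injective (fibMap b x₀) := (fibCoord_injective hx).comp b.injective
  exact ⟨h, LinearMap.surjective_of_injective (f := (fibMap b x₀).toLinearMap) h⟩

lemma lineMap_mk (hw : w ≠ 0) : lineMap n b (Projectivization.mk ℂ w hw) =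
    ⟨x, Projectivization.mk ℂ (b w) (b.map_ne_zero_iff.2 hw)⟩ := rfl

lemma lineMap_mk_mem_source (hw : w ≠ 0) :
    lineMap n b (Projectivization.mk ℂ w hw) ∈ (projChart z₀ i).source ↔
      x ∈ (chartAt (Fin n → ℂ) z₀.base).source ∧
      x ∈ (trivializationAt (Fin q → ℂ) V z₀.base).baseSet ∧ fibMap b z₀.base w i ≠ 0 := by
  rw [lineMap_mk, mk_mem_projChart_source]
  rfl

lemma projChart_lineMap_mk (hw : w ≠ 0) :
    projChart z₀ i (lineMap n b (Projectivization.mk ℂ w hw)) =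
      (chartAt (Fin n → ℂ) z₀.base x, affCoord i (fibMap b z₀.base w)) := by
  rw [lineMap_mk, projChart_mk]
  rfl

lemma contMDiffAt_affVec_projSpaceChart {k : Fin q} (hc : c ∈ (projSpaceChart k).source) :
    ContMDiffAt 𝓘(ℂ, Fin (q - 1) → ℂ) 𝓘(ℂ, Fin q → ℂ) ω
      (fun y => affVec k (projSpaceChart k y)) c :=
  ContMDiffAt.comp c (contDiff_affVec k).contMDiff.contMDiffAt
    (contMDiffAt_of_mem_atlas_source (projSpaceChart_mem_atlas k) hc)

lemma eventually_lineMap_mem (hz : lineMap n b c ∈ (projChart z₀ i).source) :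
    ∀ᶠ y in 𝓝 c, lineMap n b y ∈ (projChart z₀ i).source := by
  obtain ⟨k, hk⟩ := exists_mem_projSpaceChart_source c
  rw [← mk_affVec_projSpaceChart hk, lineMap_mk_mem_source] at hz
  obtain ⟨h1, h2, h3⟩ := hz
  have h4 : ContinuousAt (fun y => fibMap b z₀.base (affVec k (projSpaceChart k y)) i) c :=
    (continuous_apply i).continuousAt.comp ((fibMap b z₀.base).continuous.continuousAt.comp
      (contMDiffAt_affVec_projSpaceChart hk).continuousAt)
  filter_upwards [(projSpaceChart k).open_source.mem_nhds hk, h4.eventually_ne h3] with y hy hy'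
  rw [← mk_affVec_projSpaceChart hy, lineMap_mk_mem_source]
  exact ⟨h1, h2, hy'⟩

lemma contMDiffAt_projChart_lineMap (hz : lineMap n b c ∈ (projChart z₀ i).source) :
    ContMDiffAt 𝓘(ℂ, Fin (q - 1) → ℂ) 𝓘(ℂ, (Fin n → ℂ) × (Fin (q - 1) → ℂ)) ω
      (fun y => projChart z₀ i (lineMap n b y)) c := by
  obtain ⟨k, hk⟩ := exists_mem_projSpaceChart_source c
  rw [← mk_affVec_projSpaceChart hk, lineMap_mk_mem_source] at hz
  have h1 : ContDiffAt ℂ ω (fun w => (chartAt (Fin n → ℂ) z₀.base x,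
      affCoord i (fibMap b z₀.base w))) (affVec k (projSpaceChart k c)) :=
    contDiffAt_const.prodMk (ContDiffAt.comp (g := affCoord i) _ (contDiffAt_affCoord hz.2.2)
      (fibMap b z₀.base).contDiff.contDiffAt)
  have h2 := ContMDiffAt.comp (g := fun w => (chartAt (Fin n → ℂ) z₀.base x,
      affCoord i (fibMap b z₀.base w))) c h1.contMDiffAt (contMDiffAt_affVec_projSpaceChart hk)
  refine h2.congr_of_eventuallyEq ?_
  filter_upwards [(projSpaceChart k).open_source.mem_nhds hk] with y hy
  conv_lhs => rw [← mk_affVec_projSpaceChart hy]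
  rw [projChart_lineMap_mk]
  rfl

lemma contMDiff_lineMap : ContMDiff 𝓘(ℂ, Fin (q - 1) → ℂ)
    𝓘(ℂ, (Fin n → ℂ) × (Fin (q - 1) → ℂ)) ω (lineMap n b) := by
  intro c
  obtain ⟨i, hi⟩ := exists_mem_chart_source (lineMap n b c)
  exact contMDiffAt_iff_comp_atlas (projChart_mem_atlas _ i) (eventually_lineMap_mem hi)
    (contMDiffAt_projChart_lineMap hi)

lemma mfderiv_projChart_lineMap (hw : w ≠ 0) (hc : Projectivization.mk ℂ w hw = c)
    (hz : lineMap n b c ∈ (projChart z₀ i).source) (η : Fin q → ℂ) :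
    mfderiv 𝓘(ℂ, (Fin n → ℂ) × (Fin (q - 1) → ℂ)) 𝓘(ℂ, (Fin n → ℂ) × (Fin (q - 1) → ℂ))
      (projChart z₀ i) (lineMap n b c) (mfderiv 𝓘(ℂ, Fin (q - 1) → ℂ)
        𝓘(ℂ, (Fin n → ℂ) × (Fin (q - 1) → ℂ)) (lineMap n b) c (projDeriv c w η)) =
      (0, fderiv ℂ (affCoord i) (fibMap b z₀.base w) (fibMap b z₀.base η)) := by
  have hω : (ω : WithTop ℕ∞) ≠ 0 := by simp
  have h1 := mfderiv_projDeriv hw hc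
    ((contMDiffAt_projChart_lineMap hz).mdifferentiableAt hω) η
  have h2 := mfderiv_comp c (mdifferentiableAt_atlas
    (I := 𝓘(ℂ, (Fin n → ℂ) × (Fin (q - 1) → ℂ))) (projChart_mem_atlas z₀ i) hz)
    (contMDiff_lineMap (n := n) (b := b) c |>.mdifferentiableAt hω)
  have h3 : (fun y => projChart z₀ i (lineMap n b y)) ∘ projOf c =ᶠ[𝓝 w] fun w =>
      (chartAt (Fin n → ℂ) z₀.base x, affCoord i (fibMap b z₀.base w)) := by
    filter_upwards [isOpen_ne.mem_nhds hw] with y hy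
    rw [Function.comp_apply, projOf_of_ne hy, projChart_lineMap_mk]
  have hi : fibMap b z₀.base w i ≠ 0 := by
    rw [← hc, lineMap_mk_mem_source] at hz
    exact hz.2.2
  have h4 : HasFDerivAt (fun w => (chartAt (Fin n → ℂ) z₀.base x, affCoord i (fibMap b z₀.base w)))
      ((0 : (Fin q → ℂ) →L[ℂ] (Fin n → ℂ)).prod
        (fderiv ℂ (affCoord i) (fibMap b z₀.base w) ∘L fibMap b z₀.base)) w :=
    (hasFDerivAt_const _ _).prodMk (HasFDerivAt.comp (g := affCoord i) w
      ((contDiffAt_affCoord hi).differentiableAt hω).hasFDerivAt (fibMap b z₀.base).hasFDerivAt)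
  rw [h3.mfderiv_eq, mfderiv_eq_fderiv, h4.fderiv] at h1
  exact (congrArg (fun T : (Fin (q - 1) → ℂ) →L[ℂ] (Fin n → ℂ) × (Fin (q - 1) → ℂ) =>
    T (projDeriv c w η)) h2).symm.trans h1

variable (n V) in
/-- The differential of the coordinates of the base point. -/
def baseCoord (x₀ : M) (z : ProjBundle n q V) :
    TangentSpace 𝓘(ℂ, (Fin n → ℂ) × (Fin (q - 1) → ℂ)) z →ₗ[ℂ] (Fin n → ℂ) :=
  (mfderiv 𝓘(ℂ, (Fin n → ℂ) × (Fin (q - 1) → ℂ)) 𝓘(ℂ, Fin n → ℂ)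
    (fun y : ProjBundle n q V => chartAt (Fin n → ℂ) x₀ y.base) z).toLinearMap

lemma fst_mfderiv_projChart {z : ProjBundle n q V} (hz : z ∈ (projChart z₀ i).source)
    (v : TangentSpace 𝓘(ℂ, (Fin n → ℂ) × (Fin (q - 1) → ℂ)) z) :
    Prod.fst (α := Fin n → ℂ) (β := Fin (q - 1) → ℂ)
      (mfderiv 𝓘(ℂ, (Fin n → ℂ) × (Fin (q - 1) → ℂ)) 𝓘(ℂ, (Fin n → ℂ) × (Fin (q - 1) → ℂ))
      (projChart z₀ i) z v) = baseCoord n V z₀.base z v := by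
  have h := mfderiv_apply_of_eventuallyEq_comp (projChart_mem_atlas z₀ i) hz
    (f := fun y : ProjBundle n q V => chartAt (Fin n → ℂ) z₀.base y.base)
    (g := Prod.fst) differentiableAt_fst (Eventually.of_forall fun y => rfl) v
  rw [fderiv_fst] at h
  exact h.symm

/-- The tangent space of a fibre is the kernel of the differential of the base point. -/
lemma range_mfderiv_lineMap (c : ℙ ℂ (Fin q → ℂ)) :
    LinearMap.range (mfderiv 𝓘(ℂ, Fin (q - 1) → ℂ)
        𝓘(ℂ, (Fin n → ℂ) × (Fin (q - 1) → ℂ)) (lineMap n b) c).toLinearMap =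
      LinearMap.ker (baseCoord n V x (lineMap n b c)) := by
  obtain ⟨i, hi⟩ := exists_mem_chart_source (lineMap n b c)
  change lineMap n b c ∈ (projChart (lineMap n b c) i).source at hi
  have hw := c.rep_nonzero
  have hc := c.mk_rep
  have hi' : fibMap b x c.rep i ≠ 0 := by
    have h := hi
    rw [← hc, lineMap_mk_mem_source] at h
    exact h.2.2
  have hV := FiberBundle.mem_baseSet_trivializationAt' (F := Fin q → ℂ) (E := V) x
  have key (η) := mfderiv_projChart_lineMap hw hc hi η
  ext v
  constructor
  · rintro ⟨t, rfl⟩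
    obtain ⟨η, rfl⟩ := projDeriv_surjective hw hc t
    exact (fst_mfderiv_projChart hi _).symm.trans (congrArg Prod.fst (key η))
  · intro hv
    have hv' : baseCoord n V x (lineMap n b c) v = 0 := hv
    set u := chartDeriv (projChart_mem_atlas (lineMap n b c) i) hi v with hu
    have hu1 : u.1 = 0 := (fst_mfderiv_projChart hi v).trans hv'
    obtain ⟨η, hη⟩ := (fibMap_bijective (b := b) hV).2
      (fibMap b x c.rep i • affLin i u.2)
    refine ⟨projDeriv c c.rep η, (chartDeriv (projChart_mem_atlas (lineMap n b c) i) hi).injective ?_⟩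
    refine (key η).trans ?_
    change (0, fderiv ℂ (affCoord i) (fibMap b x c.rep) (fibMap b x η)) = u
    rw [hη, fderiv_affCoord_smul_affLin hi', ← hu1]

lemma mfderiv_lineMap_injective (c : ℙ ℂ (Fin q → ℂ)) :
    Function.Injective (mfderiv 𝓘(ℂ, Fin (q - 1) → ℂ)
        𝓘(ℂ, (Fin n → ℂ) × (Fin (q - 1) → ℂ)) (lineMap n b) c) := by
  obtain ⟨i, hi⟩ := exists_mem_chart_source (lineMap n b c)
  change lineMap n b c ∈ (projChart (lineMap n b c) i).source at hi
  have hw := c.rep_nonzero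
  have hc := c.mk_rep
  have hi' : fibMap b x c.rep i ≠ 0 := by
    have h := hi
    rw [← hc, lineMap_mk_mem_source] at h
    exact h.2.2
  have hV := FiberBundle.mem_baseSet_trivializationAt' (F := Fin q → ℂ) (E := V) x
  rw [injective_iff_map_eq_zero]
  intro t ht
  obtain ⟨η, rfl⟩ := projDeriv_surjective hw hc t
  have h1 := mfderiv_projChart_lineMap hw hc hi η
  rw [ht] at h1
  have h2 := h1.symm.trans (map_zero (chartDeriv (projChart_mem_atlas (lineMap n b c) i) hi))
  have h3 : fderiv ℂ (affCoord i) (fibMap b x c.rep) (fibMap b x η) = 0 := congrArg Prod.snd h2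
  obtain ⟨a, ha⟩ := (fderiv_affCoord_eq_zero_iff hi' _).1 h3
  rw [projDeriv_eq_zero_iff hw hc]
  refine ⟨a, (fibMap_bijective (b := b) hV).1 ?_⟩
  rw [ha, map_smul]

end Fibres

end ProjBundle

/-! ### The twistor distribution along a fibre -/

section TwistorFibre

variable {p q : ℕ} {M : Type*} [TopologicalSpace M] [ChartedSpace (Fin (p * q) → ℂ) M]
  [IsManifold 𝓘(ℂ, Fin (p * q) → ℂ) ω M]
  {U V : M → Type*}
  [TopologicalSpace (TotalSpace (Fin p → ℂ) U)]
  [∀ x, AddCommGroup (U x)] [∀ x, Module ℂ (U x)] [∀ x, TopologicalSpace (U x)]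
  [∀ x, IsTopologicalAddGroup (U x)] [∀ x, ContinuousSMul ℂ (U x)]
  [FiberBundle (Fin p → ℂ) U] [VectorBundle ℂ (Fin p → ℂ) U]
  [ContMDiffVectorBundle ω (Fin p → ℂ) U 𝓘(ℂ, Fin (p * q) → ℂ)]
  [TopologicalSpace (TotalSpace (Fin q → ℂ) V)]
  [∀ x, AddCommGroup (V x)] [∀ x, Module ℂ (V x)] [∀ x, TopologicalSpace (V x)]
  [∀ x, IsTopologicalAddGroup (V x)] [∀ x, ContinuousSMul ℂ (V x)]
  [FiberBundle (Fin q → ℂ) V] [VectorBundle ℂ (Fin q → ℂ) V]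
  [ContMDiffVectorBundle ω (Fin q → ℂ) V 𝓘(ℂ, Fin (p * q) → ℂ)]
  (P : ParaconformalStructure p q U V)
  {covU : CovariantDerivative 𝓘(ℂ, Fin (p * q) → ℂ) (Fin p → ℂ) U}
  {covV : CovariantDerivative 𝓘(ℂ, Fin (p * q) → ℂ) (Fin q → ℂ) V}
  {x : M} (b : (Fin q → ℂ) ≃ₗ[ℂ] V x)

open ProjBundle

namespace ParaconformalStructure

/-- The isomorphism `ℂ^p ⊗ ℂ^q ≅ T_x M` in coordinates, for the basis `b` of `V_x` and the preferred
basis of `U_x`. -/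
def modelMap : (Fin p → Fin q → ℂ) →ₗ[ℂ] (Fin (p * q) → ℂ) :=
  ∑ i, (tanCoord x x ∘ₗ P.vecLin x (fibFrame x i x : U x) ∘ₗ b.toLinearMap) ∘ₗ LinearMap.proj i

variable {b}

lemma modelMap_apply (ξ : Fin p → Fin q → ℂ) :
    P.modelMap b ξ = ∑ i, tanCoord x x (P.vec (fibFrame x i x : U x) (b (ξ i))) := by
  simp only [modelMap, LinearMap.sum_apply]
  rfl

lemma modelMap_injective : Function.Injective (P.modelMap b) := by
  have hx := mem_chart_source (Fin (p * q) → ℂ) x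
  have hU := FiberBundle.mem_baseSet_trivializationAt' (F := Fin p → ℂ) (E := U) x
  have hV := FiberBundle.mem_baseSet_trivializationAt' (F := Fin q → ℂ) (E := V) x
  rw [injective_iff_map_eq_zero]
  intro ξ hξ
  rw [modelMap_apply] at hξ
  have h1 := P.coordVec_injective hx hU hV (fun i => fibMap b x (ξ i)) (by
    rw [← hξ]
    refine Finset.sum_congr rfl fun i _ => ?_
    rw [← P.coordVec_apply hx hU hV, fibFrame, fibCoord_fibVec hU, fibMap_apply])
  funext i
  exact (fibMap_bijective (b := b) hV).1 ((congrFun h1 i).trans (map_zero _).symm)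

variable (b) in
/-- `modelMap` as an equivalence. -/
def modelEquiv : (Fin p → Fin q → ℂ) ≃L[ℂ] (Fin (p * q) → ℂ) :=
  ((P.modelMap b).linearEquivOfInjective P.modelMap_injective
    (by simp [Module.finrank_pi_fintype])).toContinuousLinearEquiv

lemma modelEquiv_apply (ξ : Fin p → Fin q → ℂ) : P.modelEquiv b ξ = P.modelMap b ξ := rfl

lemma modelMap_smul (a : Fin p → ℂ) (w : Fin q → ℂ) :
    P.modelMap b (fun i => a i • w) =
      tanCoord x x (P.vec (∑ i, a i • (fibFrame x i x : U x)) (b w)) := by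
  rw [modelMap_apply, ← vecLin_apply]
  simp only [map_sum, map_smul, LinearMap.sum_apply, LinearMap.smul_apply, vecLin_apply]
  refine Finset.sum_congr rfl fun i _ => ?_
  rw [← vecLin_apply, map_smul, map_smul, vecLin_apply]

lemma exists_modelMap_eq (u : U x) (w : Fin q → ℂ) : ∃ a : Fin p → ℂ,
    tanCoord x x (P.vec u (b w)) = P.modelMap b (fun i => a i • w) := by
  have hU := FiberBundle.mem_baseSet_trivializationAt' (F := Fin p → ℂ) (E := U) x
  exact ⟨fibCoord x x u, by rw [modelMap_smul, sum_fibFrame hU]⟩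

end ParaconformalStructure

variable {b} {c : ℙ ℂ (Fin q → ℂ)} {w : Fin q → ℂ}

lemma baseCoord_mfderiv_projSection {s : ∀ y, V y} (hs : ∀ y, s y ≠ 0)
    (hhol : HolAt (p * q) q s x) (X : TangentSpace 𝓘(ℂ, Fin (p * q) → ℂ) x) :
    baseCoord (p * q) V x (projSection (p := p) (q := q) s hs x)
      (mfderiv 𝓘(ℂ, Fin (p * q) → ℂ) 𝓘(ℂ, (Fin (p * q) → ℂ) × (Fin (q - 1) → ℂ))
        (projSection (p := p) (q := q) s hs) x X) = tanCoord x x X := by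
  obtain ⟨i, hi⟩ := exists_mem_chart_source (projSection (p := p) (q := q) s hs x)
  change projSection (p := p) (q := q) s hs x ∈
    (projChart (projSection (p := p) (q := q) s hs x) i).source at hi
  exact (fst_mfderiv_projChart hi _).symm.trans
    (congrArg Prod.fst (mfderiv_projChart_projSection hs hhol hi X))

lemma baseCoord_congr {z z' : ProjBundle (p * q) q V} (h : z = z')
    (v : (Fin (p * q) → ℂ) × (Fin (q - 1) → ℂ)) :
    baseCoord (p * q) V x z v = baseCoord (p * q) V x z' v := by
  subst h; rfl

/-- On generators the base component is `u ⊗ s(x)` with `s(x)` a multiple of `b w`, and the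
condition passes to linear combinations. -/
lemma exists_modelMap_of_mem_twistorDistribution (hw : w ≠ 0)
    (hc : Projectivization.mk ℂ w hw = c)
    {v : TangentSpace 𝓘(ℂ, (Fin (p * q) → ℂ) × (Fin (q - 1) → ℂ)) (lineMap (p * q) b c)}
    (hv : v ∈ twistorDistribution P covV (lineMap (p * q) b c)) :
    ∃ a : Fin p → ℂ, baseCoord (p * q) V x (lineMap (p * q) b c) v =
      P.modelMap b (fun i => a i • w) := by
  subst hc
  refine Submodule.span_induction ?_ ?_ ?_ ?_ hv
  · rintro _ ⟨s, hs, u, hhol, hsz, hcov, rfl⟩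
    change Projectivization.mk ℂ (s x) (hs x) = Projectivization.mk ℂ (b w) _ at hsz
    obtain ⟨t, ht⟩ := (Projectivization.mk_eq_mk_iff' ℂ _ _ _ _).1 hsz
    obtain ⟨a, ha⟩ := P.exists_modelMap_eq (b := b) u (t • w)
    refine ⟨fun i => a i * t, ?_⟩
    have h1 := baseCoord_mfderiv_projSection (p := p) (x := x) hs hhol (P.vec (x := x) u (s x))
    have h2 : projSection (p := p) (q := q) s hs x =
        lineMap (p * q) b (Projectivization.mk ℂ w hw) := congrArg (ProjBundle.mk x) hsz
    refine ((baseCoord_congr h2 _).symm.trans h1).trans ?_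
    rw [← ht, ← map_smul, ha]
    simp only [smul_smul]
  · exact ⟨0, by simp only [map_zero, Pi.zero_apply, zero_smul]; exact (map_zero _).symm⟩
  · rintro v v' _ _ ⟨a, ha⟩ ⟨a', ha'⟩
    refine ⟨a + a', ?_⟩
    rw [map_add, ha, ha', ← map_add]
    congr 1
    funext i
    simp [add_smul]
  · rintro t v _ ⟨a, ha⟩
    refine ⟨t • a, ?_⟩
    rw [map_smul, ha, ← map_smul]
    congr 1
    funext i
    simp [mul_smul]

lemma exists_mem_twistorDistribution_modelMap (hcV : IsHolomorphicConnection covV) (hw : w ≠ 0)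
    (hc : Projectivization.mk ℂ w hw = c) (a : Fin p → ℂ) :
    ∃ v ∈ twistorDistribution P covV (lineMap (p * q) b c),
      baseCoord (p * q) V x (lineMap (p * q) b c) v = P.modelMap b (fun i => a i • w) := by
  subst hc
  obtain ⟨s, hs, hhol, hsx, hcov⟩ := exists_parallel_section (covV := covV) (x := x) hcV (b w)
    (b.map_ne_zero_iff.2 hw)
  have h2 : projSection (p := p) (q := q) s hs x =
      lineMap (p * q) b (Projectivization.mk ℂ w hw) := by
    refine congrArg (ProjBundle.mk x) ?_
    simp only [hsx]
    rfl
  refine ⟨_, Submodule.subset_span ⟨s, hs, ∑ i, a i • (fibFrame x i x : U x), hhol,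
    congrArg (fun z : ℙ ℂ (V x) => z) (ProjBundle.mk.inj h2).2.eq, hcov, rfl⟩, ?_⟩
  rw [P.modelMap_smul, ← hsx]
  exact (baseCoord_congr h2 _).symm.trans (baseCoord_mfderiv_projSection (x := x) hs hhol _)

/-- The twistor distribution is transverse to the fibres. -/
lemma eq_zero_of_mem_twistorDistribution (hcV : IsHolomorphicConnection covV)
    (hfin : Module.finrank ℂ (twistorDistribution P covV (lineMap (p * q) b c)) = p)
    {v : TangentSpace 𝓘(ℂ, (Fin (p * q) → ℂ) × (Fin (q - 1) → ℂ)) (lineMap (p * q) b c)}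
    (hv : v ∈ twistorDistribution P covV (lineMap (p * q) b c))
    (h0 : baseCoord (p * q) V x (lineMap (p * q) b c) v = 0) : v = 0 := by
  have hw := c.rep_nonzero
  have hc := c.mk_rep
  let T : (Fin p → ℂ) →ₗ[ℂ] (Fin (p * q) → ℂ) :=
    P.modelMap b ∘ₗ LinearMap.pi fun i => (LinearMap.proj i : (Fin p → ℂ) →ₗ[ℂ] ℂ).smulRight c.rep
  have hTa (a : Fin p → ℂ) : T a = P.modelMap b (fun i => a i • c.rep) := rfl
  have hT : Function.Injective T := by
    rw [injective_iff_map_eq_zero]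
    intro a ha
    rw [hTa] at ha
    have h1 := P.modelMap_injective (ha.trans (map_zero _).symm)
    funext i
    exact (smul_eq_zero.1 (congrFun h1 i)).resolve_right hw
  let τ := (baseCoord (p * q) V x (lineMap (p * q) b c)).domRestrict
    (twistorDistribution P covV (lineMap (p * q) b c))
  -- The image of the distribution under the projection contains the `p`-dimensional space of
  -- vectors `a ⊗ w`. As the distribution has rank `p`, the projection is injective on it.
  have hle : LinearMap.range T ≤ LinearMap.range τ := by
    rintro _ ⟨a, rfl⟩
    obtain ⟨v, hv, hva⟩ := exists_mem_twistorDistribution_modelMap P (b := b) hcV hw hc a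
    exact ⟨⟨v, hv⟩, hva⟩
  have h1 : p ≤ Module.finrank ℂ (LinearMap.range τ) := by
    have := Submodule.finrank_mono hle
    rwa [LinearMap.finrank_range_of_inj hT, Module.finrank_fin_fun] at this
  have h2 := LinearMap.finrank_range_add_finrank_ker τ
  rw [hfin] at h2
  have h3 : Module.finrank ℂ (LinearMap.ker τ) = 0 := by omega
  have h4 : (⟨v, hv⟩ : twistorDistribution P covV (lineMap (p * q) b c)) ∈ LinearMap.ker τ := h0
  rw [Submodule.finrank_eq_zero.1 h3, Submodule.mem_bot] at h4
  exact congrArg Subtype.val h4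

end TwistorFibre

/-! ### Presentations of families of vector spaces -/

namespace HolFamily

variable {m : ℕ} {X : Type*} [TopologicalSpace X] [ChartedSpace (Fin m → ℂ) X]
  {W : Type*} [NormedAddCommGroup W] [NormedSpace ℂ W]
  {A B : HolFamily X}

variable (m) in
/-- `Θ` presents `A` as a quotient of the trivial bundle with fibre `W`. -/
structure IsQuotientOf (A : HolFamily X) (Θ : ∀ x, W →ₗ[ℂ] A.fib x) : Prop where
  surjective : ∀ x, Function.Surjective (Θ x)
  holAt_iff : ∀ (s : ∀ x, A.fib x) (x : X), A.holAt s x ↔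
    ∃ ξ : X → W, ContMDiffAt 𝓘(ℂ, Fin m → ℂ) 𝓘(ℂ, W) ω ξ x ∧ ∀ᶠ y in 𝓝 x, s y = Θ y (ξ y)

variable (m) in
/-- `ι` presents `A` as a subbundle of the trivial bundle with fibre the dual of `W`. -/
structure IsSubOf (A : HolFamily X) (ι : ∀ x, A.fib x →ₗ[ℂ] Module.Dual ℂ W) : Prop where
  injective : ∀ x, Function.Injective (ι x)
  holAt_iff : ∀ (s : ∀ x, A.fib x) (x : X), A.holAt s x ↔
    ∀ ξ : W, ContMDiffAt 𝓘(ℂ, Fin m → ℂ) 𝓘(ℂ, ℂ) ω (fun y => ι y (s y) ξ) x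

/-- Both families are the same quotient of one trivial bundle, and a section of either is
holomorphic exactly when it lifts to a holomorphic function with values in `W`; the same lifts serve
both. -/
lemma IsQuotientOf.nonempty_iso {Θ : ∀ x, W →ₗ[ℂ] A.fib x} {Ψ : ∀ x, W →ₗ[ℂ] B.fib x}
    (hA : A.IsQuotientOf m Θ) (hB : B.IsQuotientOf m Ψ)
    (hker : ∀ x, LinearMap.ker (Θ x) = LinearMap.ker (Ψ x)) : Nonempty (HolFamily.Iso A B) := by
  let e x : A.fib x ≃ₗ[ℂ] B.fib x :=
    ((Θ x).quotKerEquivOfSurjective (hA.surjective x)).symm ≪≫ₗ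
      Submodule.quotEquivOfEq _ _ (hker x) ≪≫ₗ
        (Ψ x).quotKerEquivOfSurjective (hB.surjective x)
  have he (x : X) (ξ : W) : e x (Θ x ξ) = Ψ x ξ := by
    have h : ((Θ x).quotKerEquivOfSurjective (hA.surjective x)).symm (Θ x ξ) =
        Submodule.Quotient.mk ξ := by
      rw [LinearEquiv.symm_apply_eq]; rfl
    simp only [e, LinearEquiv.trans_apply, h]
    rfl
  refine ⟨⟨e, fun s x => ?_⟩⟩
  rw [hA.holAt_iff, hB.holAt_iff]
  refine exists_congr fun ξ => and_congr_right fun _ => Filter.eventually_congr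
    (Filter.Eventually.of_forall fun y => ?_)
  rw [← he, (e y).injective.eq_iff]

/-- Holomorphy is tested by pairing with constant vectors of `W`, so it depends only on the image of
a section in the trivial bundle. -/
lemma IsSubOf.nonempty_iso {ι : ∀ x, A.fib x →ₗ[ℂ] Module.Dual ℂ W}
    {κ : ∀ x, B.fib x →ₗ[ℂ] Module.Dual ℂ W} (hA : A.IsSubOf m ι) (hB : B.IsSubOf m κ)
    (hrange : ∀ x, LinearMap.range (ι x) = LinearMap.range (κ x)) :
    Nonempty (HolFamily.Iso A B) := by
  let e x : A.fib x ≃ₗ[ℂ] B.fib x :=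
    LinearEquiv.ofInjective (ι x) (hA.injective x) ≪≫ₗ
      LinearEquiv.ofEq _ _ (hrange x) ≪≫ₗ (LinearEquiv.ofInjective (κ x) (hB.injective x)).symm
  have he (x : X) (a : A.fib x) : κ x (e x a) = ι x a := by
    have h := (LinearEquiv.ofInjective (κ x) (hB.injective x)).apply_symm_apply
      (LinearEquiv.ofEq _ _ (hrange x) (LinearEquiv.ofInjective (ι x) (hA.injective x) a))
    exact congrArg Subtype.val h
  refine ⟨⟨e, fun s x => ?_⟩⟩
  rw [hA.holAt_iff, hB.holAt_iff]
  simp only [he]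

/-- The dual of a quotient of a trivial bundle is a subbundle of the dual trivial bundle. -/
lemma IsQuotientOf.dual [FiniteDimensional ℂ W] {Θ : ∀ x, W →ₗ[ℂ] A.fib x}
    (hA : A.IsQuotientOf m Θ) : (A.dual m).IsSubOf m (W := W) (fun x => (Θ x).dualMap) := by
  refine ⟨fun x => LinearMap.dualMap_injective_of_surjective (hA.surjective x),
    fun (s : ∀ y, Module.Dual ℂ (A.fib y)) x => ?_⟩
  change (∀ a : ∀ y, A.fib y, A.holAt a x → _) ↔
    ∀ ξ : W, ContMDiffAt 𝓘(ℂ, Fin m → ℂ) 𝓘(ℂ, ℂ) ω (fun y => s y (Θ y ξ)) x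
  constructor
  · intro h ξ
    exact h (fun y => Θ y ξ) ((hA.holAt_iff _ _).2
      ⟨fun _ => ξ, contMDiffAt_const, Filter.Eventually.of_forall fun _ => rfl⟩)
  · intro h a ha
    obtain ⟨ξ, hξ, haξ⟩ := (hA.holAt_iff _ _).1 ha
    -- Expanding the lift in a basis of `W` reduces the test to constant vectors.
    let B := Module.finBasis ℂ W
    have h1 : ContMDiffAt 𝓘(ℂ, Fin m → ℂ) 𝓘(ℂ, ℂ) ω
        (fun y => ∑ j, (LinearMap.toContinuousLinearMap (B.coord j)) (ξ y) * s y (Θ y (B j))) x := by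
      refine ContMDiffAt.sum fun j _ => ContMDiffAt.mul ?_ (h (B j))
      exact (LinearMap.toContinuousLinearMap (B.coord j)).contMDiff.contMDiffAt.comp x hξ
    refine h1.congr_of_eventuallyEq ?_
    filter_upwards [haξ] with y hy
    have h2 := congrArg (fun w => s y (Θ y w)) (B.sum_repr (ξ y))
    simp only [map_sum, map_smul, smul_eq_mul] at h2
    rw [hy]
    exact h2.symm

lemma mem_range_dualMap_iff {x : X} {Θ : W →ₗ[ℂ] A.fib x} (l : Module.Dual ℂ W)
    (hΘ : Function.Surjective Θ) :
    l ∈ LinearMap.range Θ.dualMap ↔ ∀ ξ, Θ ξ = 0 → l ξ = 0 := by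
  rw [LinearMap.range_dualMap_eq_dualAnnihilator_ker_of_surjective _ hΘ,
    Submodule.mem_dualAnnihilator]
  rfl

/-- A direct sum of subbundles of a trivial bundle. -/
lemma IsSubOf.directSum {ι : ∀ x, A.fib x →ₗ[ℂ] Module.Dual ℂ W} (hA : A.IsSubOf m ι) (p : ℕ) :
    (A.directSum p).IsSubOf m (W := Fin p → W) (fun x =>
      LinearMap.lsum ℂ (fun _ : Fin p => A.fib x) ℂ
        (fun i => (LinearMap.proj i : (Fin p → W) →ₗ[ℂ] W).dualMap ∘ₗ ι x)) := by
  have key (x : X) (a : Fin p → A.fib x) (ξ : Fin p → W) :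
      LinearMap.lsum ℂ (fun _ : Fin p => A.fib x) ℂ
        (fun i => (LinearMap.proj i : (Fin p → W) →ₗ[ℂ] W).dualMap ∘ₗ ι x) a ξ =
      ∑ i, ι x (a i) (ξ i) := by
    simp [LinearMap.lsum_apply]
  have key' (x : X) (a : Fin p → A.fib x) (i : Fin p) (ξ : W) :
      ∑ j, ι x (a j) ((Pi.single i ξ : Fin p → W) j) = ι x (a i) ξ := by
    rw [Finset.sum_eq_single i (fun j _ hj => by rw [Pi.single_eq_of_ne hj, map_zero])
      (fun h => absurd (Finset.mem_univ i) h), Pi.single_eq_same]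
  constructor
  · intro x a a' h
    funext i
    refine hA.injective x (LinearMap.ext fun ξ => ?_)
    have h1 := LinearMap.congr_fun h (Pi.single i ξ)
    erw [key, key, key', key'] at h1
    exact h1
  · intro s x
    change (∀ i, A.holAt (fun y => s y i) x) ↔ _
    simp only [hA.holAt_iff]
    constructor
    · intro h ξ
      refine (ContMDiffAt.sum (t := Finset.univ) fun i _ => h i (ξ i)).congr_of_eventuallyEq ?_
      exact Filter.Eventually.of_forall fun y => key y (s y) ξ
    · intro h i ξ
      refine (h (Pi.single i ξ)).congr_of_eventuallyEq (Filter.Eventually.of_forall fun y => ?_)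
      exact ((key y (s y) _).trans (key' y (s y) i ξ)).symm

lemma mem_range_lsum_iff {W V : Type*} [AddCommGroup W] [Module ℂ W] [AddCommGroup V] [Module ℂ V]
    {p : ℕ} (ι : V →ₗ[ℂ] Module.Dual ℂ W) (l : Module.Dual ℂ (Fin p → W)) :
    l ∈ LinearMap.range (LinearMap.lsum ℂ (fun _ : Fin p => V) ℂ
        (fun i => (LinearMap.proj i : (Fin p → W) →ₗ[ℂ] W).dualMap ∘ₗ ι)) ↔
      ∀ i, l ∘ₗ LinearMap.single ℂ (fun _ : Fin p => W) i ∈ LinearMap.range ι := by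
  have key (a : Fin p → V) (ξ : Fin p → W) :
      LinearMap.lsum ℂ (fun _ : Fin p => V) ℂ
        (fun i => (LinearMap.proj i : (Fin p → W) →ₗ[ℂ] W).dualMap ∘ₗ ι) a ξ =
      ∑ i, ι (a i) (ξ i) := by
    simp [LinearMap.lsum_apply]
  constructor
  · rintro ⟨a, rfl⟩ i
    refine ⟨a i, LinearMap.ext fun ξ => ?_⟩
    rw [LinearMap.comp_apply, key, Finset.sum_eq_single i (fun j _ hj => by
      rw [LinearMap.single_apply, Pi.single_eq_of_ne hj, map_zero])
      (fun h => absurd (Finset.mem_univ i) h), LinearMap.single_apply, Pi.single_eq_same]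
  · intro h
    choose a ha using h
    refine ⟨a, LinearMap.ext fun ξ => ?_⟩
    rw [key]
    conv_rhs => rw [← Finset.univ_sum_single ξ, map_sum]
    exact Finset.sum_congr rfl fun i _ => LinearMap.congr_fun (ha i) (ξ i)

end HolFamily

/-! ### Holomorphic vector bundles on projective spaces -/

section ProjectiveFamilies

variable {q : ℕ} {c : ℙ ℂ (Fin q → ℂ)} {i : Fin q}

lemma exists_chartAt_eq_projSpaceChart (c : ℙ ℂ (Fin q → ℂ)) :
    ∃ i, chartAt (Fin (q - 1) → ℂ) c = projSpaceChart i ∧ c ∈ (projSpaceChart i).source :=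
  ⟨(exists_coord_ne_zero c.rep_nonzero).choose, rfl, mem_chart_source (Fin (q - 1) → ℂ) c⟩

/-- The vector on the line `c` with `i`-th coordinate `1`. -/
def affRep (i : Fin q) (c : ℙ ℂ (Fin q → ℂ)) : Fin q → ℂ := affVec i (projSpaceChart i c)

lemma affRep_self (i : Fin q) (c : ℙ ℂ (Fin q → ℂ)) : affRep i c i = 1 := affVec_self i _

lemma affRep_apply_ne_zero (i : Fin q) (c : ℙ ℂ (Fin q → ℂ)) : affRep i c i ≠ 0 := by
  rw [affRep_self]; exact one_ne_zero

lemma mk_affRep (hc : c ∈ (projSpaceChart i).source) :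
    Projectivization.mk ℂ (affRep i c) (ne_zero_of_apply (affRep_apply_ne_zero i c)) = c :=
  mk_affVec_projSpaceChart hc

lemma contMDiffAt_affRep (hc : c ∈ (projSpaceChart i).source) :
    ContMDiffAt 𝓘(ℂ, Fin (q - 1) → ℂ) 𝓘(ℂ, Fin q → ℂ) ω (affRep i) c :=
  ProjBundle.contMDiffAt_affVec_projSpaceChart hc

lemma eventually_mem_projSpaceChart_source (hc : c ∈ (projSpaceChart i).source) :
    ∀ᶠ y in 𝓝 c, y ∈ (projSpaceChart i).source := (projSpaceChart i).open_source.mem_nhds hc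

lemma tangentFamily_holAt_iff (t : ∀ y : ℙ ℂ (Fin q → ℂ), TangentSpace 𝓘(ℂ, Fin (q - 1) → ℂ) y)
    (hi : chartAt (Fin (q - 1) → ℂ) c = projSpaceChart i) :
    (tangentFamily (q - 1) (ℙ ℂ (Fin q → ℂ))).holAt t c ↔
      ContMDiffAt 𝓘(ℂ, Fin (q - 1) → ℂ) 𝓘(ℂ, Fin (q - 1) → ℂ) ω
        (fun y => (mfderiv 𝓘(ℂ, Fin (q - 1) → ℂ) 𝓘(ℂ, Fin (q - 1) → ℂ)
          (projSpaceChart i) y (t y) : Fin (q - 1) → ℂ)) c := by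
  rw [← hi]
  exact contMDiffAt_tangent_iff (f := fun y : ℙ ℂ (Fin q → ℂ) => y) contMDiffAt_id t

/-- `projDeriv`, with values in the fibre of the tangent family. -/
def famDeriv (c : ℙ ℂ (Fin q → ℂ)) (w : Fin q → ℂ) :
    (Fin q → ℂ) →ₗ[ℂ] (tangentFamily (q - 1) (ℙ ℂ (Fin q → ℂ))).fib c := projDeriv c w

lemma holAt_famDeriv_affRep (hi : chartAt (Fin (q - 1) → ℂ) c = projSpaceChart i)
    (hc : c ∈ (projSpaceChart i).source) {ξ : ℙ ℂ (Fin q → ℂ) → Fin q → ℂ}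
    (hξ : ContMDiffAt 𝓘(ℂ, Fin (q - 1) → ℂ) 𝓘(ℂ, Fin q → ℂ) ω ξ c) :
    (tangentFamily (q - 1) (ℙ ℂ (Fin q → ℂ))).holAt
      (fun y => famDeriv y (affRep i y) (ξ y)) c := by
  refine (tangentFamily_holAt_iff (fun y => projDeriv y (affRep i y) (ξ y)) hi).2 ?_
  have h1 : ContDiffAt ℂ ω (fun w => fderiv ℂ (affCoord i) w) (affRep i c) :=
    (contDiffAt_affCoord (affRep_apply_ne_zero i c)).fderiv_right (by simp)
  have h2 : ContMDiffAt 𝓘(ℂ, Fin (q - 1) → ℂ) 𝓘(ℂ, (Fin q → ℂ) →L[ℂ] (Fin (q - 1) → ℂ)) ω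
      (fun y => fderiv ℂ (affCoord i) (affRep i y)) c :=
    ContMDiffAt.comp (g := fun w => fderiv ℂ (affCoord i) w) c h1.contMDiffAt
      (contMDiffAt_affRep hc)
  refine (h2.clm_apply hξ).congr_of_eventuallyEq ?_
  filter_upwards [eventually_mem_projSpaceChart_source hc] with y hy
  exact mfderiv_projSpaceChart_projDeriv (affRep_apply_ne_zero i y) (mk_affRep hy) (ξ y)

/-- The slice `w_i = 1` lifts tangent vectors: `affLin i` sends their affine components to vectors
of `ℂ^q` that project back to them. -/
lemma exists_famDeriv_affRep_eq (hi : chartAt (Fin (q - 1) → ℂ) c = projSpaceChart i)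
    (hc : c ∈ (projSpaceChart i).source)
    {t : ∀ y, (tangentFamily (q - 1) (ℙ ℂ (Fin q → ℂ))).fib y}
    (ht : (tangentFamily (q - 1) (ℙ ℂ (Fin q → ℂ))).holAt t c) :
    ∃ ξ : ℙ ℂ (Fin q → ℂ) → Fin q → ℂ,
      ContMDiffAt 𝓘(ℂ, Fin (q - 1) → ℂ) 𝓘(ℂ, Fin q → ℂ) ω ξ c ∧
      ∀ᶠ y in 𝓝 c, t y = famDeriv y (affRep i y) (ξ y) := by
  replace ht := (tangentFamily_holAt_iff t hi).1 ht
  refine ⟨fun y => affLin i (mfderiv 𝓘(ℂ, Fin (q - 1) → ℂ) 𝓘(ℂ, Fin (q - 1) → ℂ)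
    (projSpaceChart i) y (t y)), ContMDiffAt.comp (g := affLin i) c (affLin i).contMDiff.contMDiffAt ht, ?_⟩
  filter_upwards [eventually_mem_projSpaceChart_source hc] with y hy
  apply (chartDeriv (projSpaceChart_mem_atlas i) hy).injective
  refine Eq.trans ?_ (chartDeriv_projDeriv (affRep_apply_ne_zero i y) (mk_affRep hy) hy _).symm
  have h := fderiv_affCoord_smul_affLin (affRep_apply_ne_zero i y)
    (chartDeriv (projSpaceChart_mem_atlas i) hy (t y))
  rw [affRep_self, one_smul] at h
  exact h.symm

lemma submodule_eq_span_affRep (hc : c ∈ (projSpaceChart i).source) :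
    c.submodule = Submodule.span ℂ {affRep i c} := by
  have h := congrArg Projectivization.submodule (mk_affRep hc)
  rw [Projectivization.submodule_mk] at h
  exact h.symm

lemma affRep_mem (hc : c ∈ (projSpaceChart i).source) : affRep i c ∈ c.submodule := by
  rw [submodule_eq_span_affRep hc]
  exact Submodule.mem_span_singleton_self _

lemma eq_smul_affRep (hc : c ∈ (projSpaceChart i).source) {w : Fin q → ℂ} (hw : w ∈ c.submodule) :
    w = w i • affRep i c := by
  rw [submodule_eq_span_affRep hc, Submodule.mem_span_singleton] at hw
  obtain ⟨a, rfl⟩ := hw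
  simp [affRep_self]

lemma rep_eq_smul_affRep (hc : c ∈ (projSpaceChart i).source) :
    c.rep i ≠ 0 ∧ c.rep = c.rep i • affRep i c := by
  have h : c.rep ∈ c.submodule := by
    rw [Projectivization.submodule_eq]; exact Submodule.mem_span_singleton_self _
  have h1 := eq_smul_affRep hc h
  refine ⟨fun h0 => c.rep_nonzero ?_, h1⟩
  rw [h1, h0, zero_smul]

lemma famDeriv_smul_left (hc : c ∈ (projSpaceChart i).source) {a : ℂ} (ha : a ≠ 0)
    (η : Fin q → ℂ) : a • famDeriv c (a • affRep i c) η = famDeriv c (affRep i c) η := by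
  rw [← map_smul]
  exact projDeriv_smul _ (mk_affRep hc) ha η

lemma famDeriv_surjective (hc : c ∈ (projSpaceChart i).source) :
    Function.Surjective (famDeriv c (affRep i c)) := projDeriv_surjective _ (mk_affRep hc)

/-- Exactness in the middle of the Euler sequence; both model bundles rest on it. -/
lemma famDeriv_eq_zero_iff (hc : c ∈ (projSpaceChart i).source) (η : Fin q → ℂ) :
    famDeriv c (affRep i c) η = 0 ↔ η ∈ c.submodule := by
  rw [submodule_eq_span_affRep hc, Submodule.mem_span_singleton]
  exact (projDeriv_eq_zero_iff _ (mk_affRep hc) η).trans (exists_congr fun a => eq_comm)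

end ProjectiveFamilies

/-! ### The bundle `(⊕ H^{-1}) ⊗ T` as a quotient of a trivial bundle -/

section NormalModel

variable {p q : ℕ} {c : ℙ ℂ (Fin q → ℂ)} {i : Fin q}

variable (p q) in
/-- The bundle `(⊕_1^p H^{-1}) ⊗ T(P_{q-1})`. -/
abbrev normalModel : HolFamily (ℙ ℂ (Fin q → ℂ)) :=
  ((tautologicalFamily q).directSum p).tensor (tangentFamily (q - 1) (ℙ ℂ (Fin q → ℂ)))

/-- The element `a ⊗ w` of `⊕_1^p H^{-1}`, for `w` on the line. -/
def tautVec (c : ℙ ℂ (Fin q → ℂ)) (w : Fin q → ℂ) (a : Fin p → ℂ) :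
    ((tautologicalFamily q).directSum p).fib c :=
  fun j =>
    haveI : Decidable (w ∈ c.submodule) := Classical.propDecidable _
    if h : w ∈ c.submodule then (⟨a j • w, c.submodule.smul_mem _ h⟩ : c.submodule) else
    (0 : c.submodule)

/-- The value of an element of `⊕_1^p H^{-1}`. -/
def tautVal (c : ℙ ℂ (Fin q → ℂ)) (j : Fin p) :
    ((tautologicalFamily q).directSum p).fib c →ₗ[ℂ] (Fin q → ℂ) where
  toFun a := c.submodule.subtype (a j)
  map_add' _ _ := rfl
  map_smul' _ _ := rfl

lemma tautVal_tautVec {w : Fin q → ℂ} (hw : w ∈ c.submodule) (a : Fin p → ℂ) (j : Fin p) :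
    tautVal c j (tautVec c w a) = a j • w :=
  congrArg c.submodule.subtype (dif_pos hw)

lemma tautVal_ext {a a' : ((tautologicalFamily q).directSum p).fib c}
    (h : ∀ j, tautVal c j a = tautVal c j a') : a = a' :=
  funext fun j => Subtype.ext (h j)

lemma directSum_tautological_holAt_iff (a : ∀ y, ((tautologicalFamily q).directSum p).fib y) :
    ((tautologicalFamily q).directSum p).holAt a c ↔ ∀ j,
      ContMDiffAt 𝓘(ℂ, Fin (q - 1) → ℂ) 𝓘(ℂ, Fin q → ℂ) ω (fun y => tautVal y j (a y)) c :=
  Iff.rfl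

/-- The map `ξ ↦ ∑ j, (e_j ⊗ w) ⊗ dπ_w(ξ_j)`. -/
def normalModelMap (c : ℙ ℂ (Fin q → ℂ)) (w : Fin q → ℂ) :
    (Fin p → Fin q → ℂ) →ₗ[ℂ] (normalModel p q).fib c :=
  ∑ j, (TensorProduct.mk ℂ (((tautologicalFamily q).directSum p).fib c)
      ((tangentFamily (q - 1) (ℙ ℂ (Fin q → ℂ))).fib c) (tautVec c w (Pi.single j 1)) ∘ₗ
    famDeriv c w) ∘ₗ LinearMap.proj j

lemma normalModelMap_apply (c : ℙ ℂ (Fin q → ℂ)) (w : Fin q → ℂ) (ξ : Fin p → Fin q → ℂ) :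
    normalModelMap c w ξ = ∑ j, (TensorProduct.mk ℂ (((tautologicalFamily q).directSum p).fib c)
      ((tangentFamily (q - 1) (ℙ ℂ (Fin q → ℂ))).fib c) (tautVec c w (Pi.single j 1))
        (famDeriv c w (ξ j))) := by
  simp only [normalModelMap, LinearMap.sum_apply]
  rfl

/-- The factor `w` gains the scalar that `dπ_w` loses. -/
lemma normalModelMap_smul_affRep (hc : c ∈ (projSpaceChart i).source) {a : ℂ} (ha : a ≠ 0)
    (ξ : Fin p → Fin q → ℂ) :
    normalModelMap c (a • affRep i c) ξ = normalModelMap c (affRep i c) ξ := by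
  rw [normalModelMap_apply, normalModelMap_apply]
  refine Finset.sum_congr rfl fun j _ => ?_
  have h : tautVec c (a • affRep i c) (Pi.single j (1 : ℂ) : Fin p → ℂ) =
      a • tautVec c (affRep i c) (Pi.single j 1) := by
    refine tautVal_ext fun k => ?_
    rw [map_smul, tautVal_tautVec (affRep_mem hc),
      tautVal_tautVec (c.submodule.smul_mem _ (affRep_mem hc)), smul_comm]
  rw [h, map_smul, LinearMap.smul_apply, ← map_smul]
  rw [famDeriv_smul_left hc ha]

/-- `c.rep` is a pointwise choice, with no continuity in `c`. The holomorphic representative `affRep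
i c` gives the same map, and holomorphy is checked with it. -/
lemma normalModelMap_rep (hc : c ∈ (projSpaceChart i).source) (ξ : Fin p → Fin q → ℂ) :
    normalModelMap c c.rep ξ = normalModelMap c (affRep i c) ξ := by
  have h := rep_eq_smul_affRep hc
  conv_lhs => rw [h.2]
  exact normalModelMap_smul_affRep hc h.1 ξ

/-- The sum of elementary tensors in terms of `normalModelMap`. -/
lemma mk_tmul_famDeriv (hc : c ∈ (projSpaceChart i).source)
    (a : ((tautologicalFamily q).directSum p).fib c) (η : Fin q → ℂ) :
    TensorProduct.mk ℂ (((tautologicalFamily q).directSum p).fib c)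
      ((tangentFamily (q - 1) (ℙ ℂ (Fin q → ℂ))).fib c) a (famDeriv c (affRep i c) η) =
      normalModelMap c (affRep i c) (fun j => tautVal c j a i • η) := by
  rw [normalModelMap_apply]
  have h : a = ∑ j, tautVal c j a i • tautVec c (affRep i c) (Pi.single j 1) := by
    refine tautVal_ext fun k => ?_
    simp only [map_sum, map_smul, tautVal_tautVec (affRep_mem hc)]
    rw [Finset.sum_eq_single k (fun j _ hj => by rw [Pi.single_eq_of_ne hj.symm, zero_smul, smul_zero])
      (fun h => absurd (Finset.mem_univ k) h), Pi.single_eq_same, one_smul]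
    exact eq_smul_affRep hc (a k).2
  conv_lhs => rw [h]
  rw [map_sum, LinearMap.sum_apply]
  refine Finset.sum_congr rfl fun j _ => ?_
  rw [map_smul, LinearMap.smul_apply, map_smul]
  exact (map_smul _ _ _).symm

lemma normalModelMap_surjective (c : ℙ ℂ (Fin q → ℂ)) :
    Function.Surjective (normalModelMap (p := p) c c.rep) := by
  obtain ⟨i, hc⟩ := exists_mem_projSpaceChart_source c
  intro t
  induction t using TensorProduct.induction_on with
  | zero => exact ⟨0, map_zero _⟩
  | tmul a t =>
    obtain ⟨η, hη⟩ := famDeriv_surjective hc t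
    refine ⟨_, (normalModelMap_rep hc _).trans ((mk_tmul_famDeriv hc a η).symm.trans ?_)⟩
    rw [hη]
    rfl
  | add t t' h h' =>
    obtain ⟨ξ, rfl⟩ := h
    obtain ⟨ξ', rfl⟩ := h'
    exact ⟨ξ + ξ', map_add _ _ _⟩

/-- Contracting with the `i`-th coordinate of the `j`-th tautological factor isolates `dπ_w(ξ_j)`,
because `affRep i c` has `i`-th coordinate `1`. -/
lemma normalModelMap_eq_zero_iff (c : ℙ ℂ (Fin q → ℂ)) (ξ : Fin p → Fin q → ℂ) :
    normalModelMap c c.rep ξ = 0 ↔ ∀ j, ξ j ∈ c.submodule := by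
  obtain ⟨i, hc⟩ := exists_mem_projSpaceChart_source c
  rw [normalModelMap_rep hc]
  simp only [← famDeriv_eq_zero_iff hc]
  constructor
  · intro h j
    let φ : ((tautologicalFamily q).directSum p).fib c ⊗[ℂ]
        (tangentFamily (q - 1) (ℙ ℂ (Fin q → ℂ))).fib c →ₗ[ℂ] (tangentFamily (q - 1) (ℙ ℂ (Fin q → ℂ))).fib c :=
      TensorProduct.lift
        ((LinearMap.lsmul ℂ ((tangentFamily (q - 1) (ℙ ℂ (Fin q → ℂ))).fib c)) ∘ₗ
          (LinearMap.proj i : (Fin q → ℂ) →ₗ[ℂ] ℂ) ∘ₗ tautVal c j)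
    have hφ (a : ((tautologicalFamily q).directSum p).fib c)
        (t : (tangentFamily (q - 1) (ℙ ℂ (Fin q → ℂ))).fib c) :
        φ (TensorProduct.mk ℂ (((tautologicalFamily q).directSum p).fib c)
          ((tangentFamily (q - 1) (ℙ ℂ (Fin q → ℂ))).fib c) a t) = tautVal c j a i • t := rfl
    have h1 := congrArg φ h
    rw [normalModelMap_apply] at h1
    replace h1 := (map_sum φ _ _).symm.trans (h1.trans (map_zero φ))
    simp only [hφ, tautVal_tautVec (affRep_mem hc)] at h1
    rw [Finset.sum_eq_single j (fun k _ hk => by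
        rw [Pi.single_eq_of_ne hk.symm, zero_smul, Pi.zero_apply, zero_smul])
      (fun h => absurd (Finset.mem_univ j) h), Pi.single_eq_same, one_smul, affRep_self, one_smul]
      at h1
    exact h1
  · intro h
    rw [normalModelMap_apply]
    refine Finset.sum_eq_zero fun j _ => ?_
    rw [h j]
    exact map_zero _

lemma contMDiffAt_smul_vec {f : ℙ ℂ (Fin q → ℂ) → ℂ} {g : ℙ ℂ (Fin q → ℂ) → Fin q → ℂ}
    (hf : ContMDiffAt 𝓘(ℂ, Fin (q - 1) → ℂ) 𝓘(ℂ, ℂ) ω f c)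
    (hg : ContMDiffAt 𝓘(ℂ, Fin (q - 1) → ℂ) 𝓘(ℂ, Fin q → ℂ) ω g c) :
    ContMDiffAt 𝓘(ℂ, Fin (q - 1) → ℂ) 𝓘(ℂ, Fin q → ℂ) ω (fun y => f y • g y) c :=
  contMDiffAt_pi_space.2 fun i => hf.mul (contMDiffAt_pi_space.1 hg i)

/-- Given tensors `a_k ⊗ t_k`, each `t_k` is lifted to `ℂ^q` and the coefficients of `a_k` are moved
into the lift. In the other direction a function `ξ` gives `p` explicit elementary tensors. -/
lemma isQuotientOf_normalModel :
    (normalModel p q).IsQuotientOf (q - 1) (fun c => normalModelMap (p := p) c c.rep) := by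
  refine ⟨normalModelMap_surjective, fun s c => ?_⟩
  obtain ⟨i, hi, hc⟩ := exists_chartAt_eq_projSpaceChart c
  constructor
  · rintro ⟨N, a, t, ha, ht, hs⟩
    choose η hη htη using fun k => exists_famDeriv_affRep_eq hi hc (ht k)
    refine ⟨fun y j => ∑ k, tautVal y j (a k y) i • η k y, ?_, ?_⟩
    · rw [contMDiffAt_pi_space]
      intro j
      refine ContMDiffAt.sum fun k _ => contMDiffAt_smul_vec
        (contMDiffAt_pi_space.1 ((directSum_tautological_holAt_iff _).1 (ha k) j) i) (hη k)
    · filter_upwards [hs, eventually_all.2 htη, eventually_mem_projSpaceChart_source hc]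
        with y hy hyt hyc
      rw [hy, normalModelMap_rep hyc]
      have h1 : (fun j => ∑ k, tautVal y j (a k y) i • η k y) =
          ∑ k, fun j : Fin p => tautVal y j (a k y) i • η k y := by
        funext j; simp
      rw [h1, map_sum]
      refine Finset.sum_congr rfl fun k _ => ?_
      rw [← mk_tmul_famDeriv hyc, ← hyt k]
      rfl
  · rintro ⟨ξ, hξ, hs⟩
    refine ⟨p, fun j y => tautVec y (affRep i y) (Pi.single j 1),
      fun j y => famDeriv y (affRep i y) (ξ y j), fun j => ?_, fun j => ?_, ?_⟩
    · rw [directSum_tautological_holAt_iff]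
      intro k
      refine (contMDiffAt_smul_vec contMDiffAt_const
        (contMDiffAt_affRep hc)).congr_of_eventuallyEq (f := fun y =>
          (Pi.single j (1 : ℂ) : Fin p → ℂ) k • affRep i y) ?_
      filter_upwards [eventually_mem_projSpaceChart_source hc] with y hy
      exact tautVal_tautVec (affRep_mem hy) _ _
    · exact holAt_famDeriv_affRep hi hc (contMDiffAt_pi_space.1 hξ j)
    · filter_upwards [hs, eventually_mem_projSpaceChart_source hc] with y hy hyc
      rw [hy, normalModelMap_rep hyc, normalModelMap_apply]
      rfl

end NormalModel

/-! ### The bundle `Ω¹(1)` as a subbundle of a trivial bundle -/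

section ConormalModel

variable {q : ℕ} {c : ℙ ℂ (Fin q → ℂ)} {i : Fin q}

/-- The evaluation of a linear form on the line `c` at `w`, for `w` on the line. -/
def lineEval (c : ℙ ℂ (Fin q → ℂ)) (w : (tautologicalFamily q).fib c) :
    (hyperplaneFamily q).fib c →ₗ[ℂ] ℂ := LinearMap.applyₗ (M₂ := ℂ) w

/-- The `i`-th coordinate as a linear form on the line `c`. -/
def lineCoord (i : Fin q) (c : ℙ ℂ (Fin q → ℂ)) : (hyperplaneFamily q).fib c :=
  (LinearMap.proj i : (Fin q → ℂ) →ₗ[ℂ] ℂ) ∘ₗ c.submodule.subtype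

lemma rep_mem (c : ℙ ℂ (Fin q → ℂ)) : c.rep ∈ c.submodule := by
  rw [Projectivization.submodule_eq]; exact Submodule.mem_span_singleton_self _

/-- The map `φ ⊗ ℓ ↦ (η ↦ ℓ(w) φ(dπ_w(η)))`. -/
def conormalModelMap (c : ℙ ℂ (Fin q → ℂ)) (w : c.submodule) :
    (twistedCotangentFamily q).fib c →ₗ[ℂ] Module.Dual ℂ (Fin q → ℂ) :=
  TensorProduct.lift (M := ((tangentFamily (q - 1) (ℙ ℂ (Fin q → ℂ))).dual (q - 1)).fib c)
    (N := (hyperplaneFamily q).fib c)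
    (((LinearMap.lsmul ℂ (Module.Dual ℂ (Fin q → ℂ)) ∘ₗ lineEval c w).flip) ∘ₗ
      (famDeriv c (w : Fin q → ℂ)).dualMap)

/-- The elementary tensor `φ ⊗ ℓ`. -/
def cotTensor (c : ℙ ℂ (Fin q → ℂ))
    (φ : ((tangentFamily (q - 1) (ℙ ℂ (Fin q → ℂ))).dual (q - 1)).fib c)
    (l : (hyperplaneFamily q).fib c) : (twistedCotangentFamily q).fib c :=
  TensorProduct.mk ℂ (((tangentFamily (q - 1) (ℙ ℂ (Fin q → ℂ))).dual (q - 1)).fib c)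
    ((hyperplaneFamily q).fib c) φ l

lemma conormalModelMap_cotTensor (w : c.submodule)
    (φ : Module.Dual ℂ ((tangentFamily (q - 1) (ℙ ℂ (Fin q → ℂ))).fib c))
    (l : Module.Dual ℂ c.submodule) (η : Fin q → ℂ) :
    conormalModelMap c w (cotTensor c φ l) η = l w * φ (famDeriv c (w : Fin q → ℂ) η) := rfl

/-- The fibre of `H` is spanned by the `i`-th coordinate, which does not vanish on the line, so
every tensor is elementary with that factor. -/
lemma exists_eq_cotTensor_lineCoord (hc : c ∈ (projSpaceChart i).source)
    (t : (twistedCotangentFamily q).fib c) :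
    ∃ φ : Module.Dual ℂ ((tangentFamily (q - 1) (ℙ ℂ (Fin q → ℂ))).fib c),
      t = cotTensor c φ (lineCoord i c) := by
  induction t using TensorProduct.induction_on with
  | zero => exact ⟨0, (LinearMap.map_zero₂ (TensorProduct.mk ℂ _ _) _).symm⟩
  | tmul φ l =>
    let l' : Module.Dual ℂ c.submodule := l
    have hl : l = l' ⟨affRep i c, affRep_mem hc⟩ • lineCoord i c := by
      refine LinearMap.ext (f := l') fun w => ?_
      have h1 : w = (w : Fin q → ℂ) i • (⟨affRep i c, affRep_mem hc⟩ : c.submodule) :=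
        Subtype.ext (eq_smul_affRep hc w.2)
      conv_lhs => rw [h1, map_smul]
      exact mul_comm _ _
    refine ⟨l' ⟨affRep i c, affRep_mem hc⟩ • φ, ?_⟩
    conv_lhs => rw [hl]
    exact (TensorProduct.smul_tmul _ _ _).symm
  | add t t' h h' =>
    obtain ⟨φ, rfl⟩ := h
    obtain ⟨φ', rfl⟩ := h'
    exact ⟨φ + φ', (LinearMap.map_add₂ (TensorProduct.mk ℂ _ _) _ _ _).symm⟩

lemma conormalModelMap_rep (hc : c ∈ (projSpaceChart i).source)
    (t : (twistedCotangentFamily q).fib c) :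
    conormalModelMap c ⟨c.rep, rep_mem c⟩ t = conormalModelMap c ⟨affRep i c, affRep_mem hc⟩ t := by
  obtain ⟨φ, rfl⟩ := exists_eq_cotTensor_lineCoord hc t
  refine LinearMap.ext fun η => ?_
  have h := rep_eq_smul_affRep hc
  refine (conormalModelMap_cotTensor _ φ _ η).trans
    (Eq.trans ?_ (conormalModelMap_cotTensor _ φ _ η).symm)
  change c.rep i * φ (famDeriv c c.rep η) = affRep i c i * φ (famDeriv c (affRep i c) η)
  rw [affRep_self, one_mul, ← famDeriv_smul_left hc h.1, ← h.2, map_smul, smul_eq_mul]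

lemma conormalModelMap_lineCoord (hc : c ∈ (projSpaceChart i).source)
    (φ : Module.Dual ℂ ((tangentFamily (q - 1) (ℙ ℂ (Fin q → ℂ))).fib c)) (η : Fin q → ℂ) :
    conormalModelMap c ⟨c.rep, rep_mem c⟩ (cotTensor c φ (lineCoord i c)) η =
      φ (famDeriv c (affRep i c) η) := by
  rw [conormalModelMap_rep hc]
  refine (conormalModelMap_cotTensor _ φ _ η).trans ?_
  change affRep i c i * _ = _
  rw [affRep_self, one_mul]

lemma conormalModelMap_injective (c : ℙ ℂ (Fin q → ℂ)) :
    Function.Injective (conormalModelMap c ⟨c.rep, rep_mem c⟩) := by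
  obtain ⟨i, hc⟩ := exists_mem_projSpaceChart_source c
  rw [injective_iff_map_eq_zero]
  intro t ht
  obtain ⟨φ, rfl⟩ := exists_eq_cotTensor_lineCoord hc t
  have h : φ = 0 := by
    refine LinearMap.ext fun v => ?_
    obtain ⟨η, rfl⟩ := famDeriv_surjective hc v
    rw [← conormalModelMap_lineCoord hc, ht]
    rfl
  rw [h]
  exact LinearMap.map_zero₂ (TensorProduct.mk ℂ _ _) _

/-- The image of the dual of `dπ_w` is the annihilator of its kernel, and that kernel is the line.
-/
lemma mem_range_conormalModelMap_iff (c : ℙ ℂ (Fin q → ℂ)) (l : Module.Dual ℂ (Fin q → ℂ)) :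
    l ∈ LinearMap.range (conormalModelMap c ⟨c.rep, rep_mem c⟩) ↔ ∀ η ∈ c.submodule, l η = 0 := by
  obtain ⟨i, hc⟩ := exists_mem_projSpaceChart_source c
  have h1 := HolFamily.mem_range_dualMap_iff l (famDeriv_surjective hc)
  simp only [famDeriv_eq_zero_iff hc] at h1
  rw [← h1]
  constructor
  · rintro ⟨t, rfl⟩
    obtain ⟨φ, rfl⟩ := exists_eq_cotTensor_lineCoord hc t
    exact ⟨φ, (LinearMap.ext fun η => conormalModelMap_lineCoord hc φ η).symm⟩
  · rintro ⟨φ, rfl⟩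
    exact ⟨cotTensor c φ (lineCoord i c), LinearMap.ext fun η => conormalModelMap_lineCoord hc φ η⟩

/-- In one direction the pairings with constant vectors are sums of products of holomorphic
functions. In the other the section is locally a single tensor of a form `φ` with the `i`-th
coordinate, and the values of `φ` on a holomorphic field are combinations of the given pairings. -/
lemma isSubOf_twistedCotangentFamily :
    (twistedCotangentFamily q).IsSubOf (q - 1)
      (fun c => conormalModelMap c ⟨c.rep, rep_mem c⟩) := by
  classical
  refine ⟨conormalModelMap_injective, fun s c => ?_⟩
  obtain ⟨i, hi, hc⟩ := exists_chartAt_eq_projSpaceChart c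
  constructor
  · rintro ⟨N, φ, l, hφ, hl, hs⟩ η
    -- The value `0` off the chart does not affect holomorphy at `c`.
    let r (y : ℙ ℂ (Fin q → ℂ)) : y.submodule :=
      if h : y ∈ (projSpaceChart i).source then ⟨affRep i y, affRep_mem h⟩ else 0
    have hr : (tautologicalFamily q).holAt r c := by
      refine (contMDiffAt_affRep hc).congr_of_eventuallyEq ?_
      filter_upwards [eventually_mem_projSpaceChart_source hc] with y hy
      simp only [r, dif_pos hy]
    let l' (k : Fin N) (y : ℙ ℂ (Fin q → ℂ)) : Module.Dual ℂ y.submodule := l k y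
    let φ' (k : Fin N) (y : ℙ ℂ (Fin q → ℂ)) :
      Module.Dual ℂ ((tangentFamily (q - 1) (ℙ ℂ (Fin q → ℂ))).fib y) := φ k y
    have h1 (k : Fin N) : ContMDiffAt 𝓘(ℂ, Fin (q - 1) → ℂ) 𝓘(ℂ, ℂ) ω
        (fun y => l' k y (r y) * φ' k y (famDeriv y (affRep i y) η)) c :=
      ContMDiffAt.mul (hl k r hr) (hφ k _ (holAt_famDeriv_affRep hi hc contMDiffAt_const))
    refine (ContMDiffAt.sum (t := Finset.univ) fun k _ => h1 k).congr_of_eventuallyEq ?_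
    filter_upwards [hs, eventually_mem_projSpaceChart_source hc] with y hy hyc
    rw [conormalModelMap_rep hyc, hy]
    refine (LinearMap.congr_fun (map_sum (conormalModelMap y ⟨affRep i y, affRep_mem hyc⟩)
      (fun k => cotTensor y (φ k y) (l k y)) Finset.univ) η).trans ?_
    rw [LinearMap.sum_apply]
    refine Finset.sum_congr rfl fun k _ => ?_
    simp only [r, dif_pos hyc]
    exact conormalModelMap_cotTensor _ _ _ η
  · intro h
    let φ (y : ℙ ℂ (Fin q → ℂ)) :
        Module.Dual ℂ ((tangentFamily (q - 1) (ℙ ℂ (Fin q → ℂ))).fib y) :=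
      if hy : y ∈ (projSpaceChart i).source then (exists_eq_cotTensor_lineCoord hy (s y)).choose
      else 0
    have hφ {y : ℙ ℂ (Fin q → ℂ)} (hy : y ∈ (projSpaceChart i).source) :
        s y = cotTensor y (φ y) (lineCoord i y) := by
      simp only [φ, dif_pos hy]
      exact (exists_eq_cotTensor_lineCoord hy (s y)).choose_spec
    refine ⟨1, fun _ => φ, fun _ => lineCoord i, fun _ t ht => ?_, fun _ a ha => ?_, ?_⟩
    · obtain ⟨ξ, hξ, htξ⟩ := exists_famDeriv_affRep_eq hi hc ht
      have h1 : ContMDiffAt 𝓘(ℂ, Fin (q - 1) → ℂ) 𝓘(ℂ, ℂ) ω (fun y => ∑ j, ξ y j *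
          conormalModelMap y ⟨y.rep, rep_mem y⟩ (s y) (Pi.single j 1)) c :=
        ContMDiffAt.sum fun j _ => (contMDiffAt_pi_space.1 hξ j).mul (h (Pi.single j 1))
      refine h1.congr_of_eventuallyEq ?_
      filter_upwards [htξ, eventually_mem_projSpaceChart_source hc] with y hy hyc
      rw [hy]
      refine (conormalModelMap_lineCoord hyc (φ y) (ξ y)).symm.trans ?_
      rw [← hφ hyc]
      conv_lhs => rw [pi_eq_sum_univ' (ξ y), map_sum]
      refine Finset.sum_congr rfl fun j _ => ?_
      rw [map_smul, smul_eq_mul]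
    · exact contMDiffAt_pi_space.1 ha i
    · filter_upwards [eventually_mem_projSpaceChart_source hc] with y hyc
      rw [Fin.sum_univ_one]
      exact hφ hyc

end ConormalModel

/-! ### Analytic families of surjective linear maps -/

section AnalyticLifts

variable {E F G : Type*} [NormedAddCommGroup E] [NormedSpace ℂ E] [NormedAddCommGroup F]
  [NormedSpace ℂ F] [FiniteDimensional ℂ F] [NormedAddCommGroup G] [NormedSpace ℂ G]
  {X : Type*} [TopologicalSpace X] [ChartedSpace G X] {x : X}

/-- A right inverse `R` of `A x` works nearby after a correction: `A y R` stays invertible and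
inversion is analytic, so `u = R (A R)⁻¹ τ`. -/
lemma exists_contMDiffAt_lift {A : X → E →L[ℂ] F} {τ : X → F}
    (hA : ContMDiffAt 𝓘(ℂ, G) 𝓘(ℂ, E →L[ℂ] F) ω A x) (hs : Function.Surjective (A x))
    (hτ : ContMDiffAt 𝓘(ℂ, G) 𝓘(ℂ, F) ω τ x) :
    ∃ u : X → E, ContMDiffAt 𝓘(ℂ, G) 𝓘(ℂ, E) ω u x ∧ ∀ᶠ y in 𝓝 x, A y (u y) = τ y := by
  have : CompleteSpace F := FiniteDimensional.complete ℂ F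
  obtain ⟨R₀, hR₀⟩ := LinearMap.exists_rightInverse_of_surjective (A x).toLinearMap
    (LinearMap.range_eq_top.2 hs)
  let R : F →L[ℂ] E := LinearMap.toContinuousLinearMap R₀
  have hAR : A x ∘L R = ((ContinuousLinearEquiv.refl ℂ F : F ≃L[ℂ] F) : F →L[ℂ] F) :=
    ContinuousLinearMap.ext fun v => LinearMap.congr_fun hR₀ v
  have h1 : ContMDiffAt 𝓘(ℂ, G) 𝓘(ℂ, F →L[ℂ] F) ω (fun y => A y ∘L R) x :=
    hA.clm_comp contMDiffAt_const
  have h2 : ContMDiffAt 𝓘(ℂ, G) 𝓘(ℂ, F →L[ℂ] F) ω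
      (fun y => ContinuousLinearMap.inverse (A y ∘L R)) x := by
    refine ContMDiffAt.comp (g := ContinuousLinearMap.inverse) x ?_ h1
    rw [hAR]
    exact (contDiffAt_map_inverse _).contMDiffAt
  have h3 : ∀ᶠ y in 𝓝 x, ∃ e : F ≃L[ℂ] F, (e : F →L[ℂ] F) = A y ∘L R := by
    refine h1.continuousAt.eventually (p := fun T => ∃ e : F ≃L[ℂ] F, (e : F →L[ℂ] F) = T) ?_
    beta_reduce
    rw [hAR]
    exact ContinuousLinearEquiv.nhds _
  refine ⟨fun y => R (ContinuousLinearMap.inverse (A y ∘L R) (τ y)),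
    ContMDiffAt.comp (g := R) x R.contMDiff.contMDiffAt (h2.clm_apply hτ), ?_⟩
  filter_upwards [h3] with y hy
  obtain ⟨e, he⟩ := hy
  change (A y ∘L R) (ContinuousLinearMap.inverse (A y ∘L R) (τ y)) = τ y
  rw [← he, ContinuousLinearMap.inverse_equiv]
  exact e.apply_symm_apply _

end AnalyticLifts

/-! ### Differentials of maps in charts -/

section MapInCharts

variable {E F : Type*} [NormedAddCommGroup E] [NormedSpace ℂ E] [NormedAddCommGroup F]
  [NormedSpace ℂ F] {X : Type*} [TopologicalSpace X] [ChartedSpace E X] [IsManifold 𝓘(ℂ, E) ω X]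
  {Y : Type*} [TopologicalSpace Y] [ChartedSpace F Y] [IsManifold 𝓘(ℂ, F) ω Y]
  {e : OpenPartialHomeomorph X E} {e' : OpenPartialHomeomorph Y F} {f : X → Y} {z : X}

/-- The differential of a map in charts. -/
lemma eventually_mfderiv_chart_comp (he : e ∈ atlas E X) (hz : z ∈ e.source) (he' : e' ∈ atlas F Y)
    (hz' : f z ∈ e'.source) (hf : ContMDiff 𝓘(ℂ, E) 𝓘(ℂ, F) ω f) :
    ContDiffAt ℂ ω (e' ∘ f ∘ e.symm) (e z) ∧ ∀ᶠ w in 𝓝 z, w ∈ e.source ∧ f w ∈ e'.source ∧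
      ∀ v : TangentSpace 𝓘(ℂ, E) w,
        mfderiv 𝓘(ℂ, F) 𝓘(ℂ, F) e' (f w) (mfderiv 𝓘(ℂ, E) 𝓘(ℂ, F) f w v) =
          fderiv ℂ (e' ∘ f ∘ e.symm) (e w) (mfderiv 𝓘(ℂ, E) 𝓘(ℂ, E) e w v) := by
  have hω : (ω : WithTop ℕ∞) ≠ 0 := by simp
  have h1 {w : X} (hw : w ∈ e.source) (hw' : f w ∈ e'.source) :
      ContDiffAt ℂ ω (e' ∘ f ∘ e.symm) (e w) := by
    rw [← contMDiffAt_iff_contDiffAt]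
    refine ContMDiffAt.comp (g := e') (f := f ∘ e.symm) _ ?_ (ContMDiffAt.comp (g := f) _ (hf _)
      (contMDiffAt_symm_of_mem_atlas_target he (e.map_source hw)))
    rw [Function.comp_apply, e.left_inv hw]
    exact contMDiffAt_of_mem_atlas_source he' hw'
  have hev : ∀ᶠ w in 𝓝 z, w ∈ e.source ∧ f w ∈ e'.source :=
    Filter.Eventually.and (e.open_source.mem_nhds hz)
      (hf.continuous.continuousAt.eventually (e'.open_source.mem_nhds hz'))
  refine ⟨h1 hz hz', ?_⟩
  filter_upwards [hev, hev.eventually_nhds] with w hw hw'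
  refine ⟨hw.1, hw.2, fun v => ?_⟩
  have h2 := mfderiv_apply_of_eventuallyEq_comp he hw.1 (f := e' ∘ f) (g := e' ∘ f ∘ e.symm)
    ((h1 hw.1 hw.2).differentiableAt hω) (hw'.mono fun y hy => by
      simp only [Function.comp_apply, e.left_inv hy.1]) v
  have h3 := mfderiv_comp w (mdifferentiableAt_atlas (I := 𝓘(ℂ, F)) he' hw.2)
    ((hf w).mdifferentiableAt hω)
  rw [h3] at h2
  exact h2

end MapInCharts

/-! ### The normal bundle of a twistor line -/

section NormalBundle

variable {p q : ℕ} {M : Type*} [TopologicalSpace M] [ChartedSpace (Fin (p * q) → ℂ) M]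
  [IsManifold 𝓘(ℂ, Fin (p * q) → ℂ) ω M]
  {U V : M → Type*}
  [TopologicalSpace (TotalSpace (Fin p → ℂ) U)]
  [∀ x, AddCommGroup (U x)] [∀ x, Module ℂ (U x)] [∀ x, TopologicalSpace (U x)]
  [∀ x, IsTopologicalAddGroup (U x)] [∀ x, ContinuousSMul ℂ (U x)]
  [FiberBundle (Fin p → ℂ) U] [VectorBundle ℂ (Fin p → ℂ) U]
  [ContMDiffVectorBundle ω (Fin p → ℂ) U 𝓘(ℂ, Fin (p * q) → ℂ)]
  [TopologicalSpace (TotalSpace (Fin q → ℂ) V)]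
  [∀ x, AddCommGroup (V x)] [∀ x, Module ℂ (V x)] [∀ x, TopologicalSpace (V x)]
  [∀ x, IsTopologicalAddGroup (V x)] [∀ x, ContinuousSMul ℂ (V x)]
  [FiberBundle (Fin q → ℂ) V] [VectorBundle ℂ (Fin q → ℂ) V]
  [ContMDiffVectorBundle ω (Fin q → ℂ) V 𝓘(ℂ, Fin (p * q) → ℂ)]
  (P : ParaconformalStructure p q U V)
  {covV : CovariantDerivative 𝓘(ℂ, Fin (p * q) → ℂ) (Fin q → ℂ) V}
  {x : M} (b : (Fin q → ℂ) ≃ₗ[ℂ] V x)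
  {k : ℕ} {Y : Type*} [TopologicalSpace Y] [ChartedSpace (Fin k → ℂ) Y]
  [IsManifold 𝓘(ℂ, Fin k → ℂ) ω Y] {g : ProjBundle (p * q) q V → Y}

open ProjBundle

lemma baseCoord_surjective (c : ℙ ℂ (Fin q → ℂ)) :
    Function.Surjective (baseCoord (p * q) V x (lineMap (p * q) b c)) := by
  obtain ⟨i, hi⟩ := exists_mem_chart_source (lineMap (p * q) b c)
  change lineMap (p * q) b c ∈ (projChart (lineMap (p * q) b c) i).source at hi
  intro a
  refine ⟨(chartDeriv (projChart_mem_atlas _ i) hi).symm (a, 0),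
    (fst_mfderiv_projChart hi _).symm.trans ?_⟩
  exact congrArg Prod.fst
    ((chartDeriv (projChart_mem_atlas (lineMap (p * q) b c) i) hi).apply_symm_apply (a, 0))

lemma mfderiv_comp_lineMap (hg : ContMDiff 𝓘(ℂ, (Fin (p * q) → ℂ) × (Fin (q - 1) → ℂ))
    𝓘(ℂ, Fin k → ℂ) ω g) (c : ℙ ℂ (Fin q → ℂ)) (t : TangentSpace 𝓘(ℂ, Fin (q - 1) → ℂ) c) :
    mfderiv 𝓘(ℂ, Fin (q - 1) → ℂ) 𝓘(ℂ, Fin k → ℂ) (fun c => g (lineMap (p * q) b c)) c t =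
      mfderiv 𝓘(ℂ, (Fin (p * q) → ℂ) × (Fin (q - 1) → ℂ)) 𝓘(ℂ, Fin k → ℂ) g
        (lineMap (p * q) b c) (mfderiv 𝓘(ℂ, Fin (q - 1) → ℂ)
          𝓘(ℂ, (Fin (p * q) → ℂ) × (Fin (q - 1) → ℂ)) (lineMap (p * q) b) c t) := by
  have hω : (ω : WithTop ℕ∞) ≠ 0 := by simp
  have h := mfderiv_comp c ((hg _).mdifferentiableAt hω)
    ((contMDiff_lineMap (n := p * q) (b := b) c).mdifferentiableAt hω)
  exact congrArg (fun T : (Fin (q - 1) → ℂ) →L[ℂ] (Fin k → ℂ) => T t) h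

/-- A vector tangent to a fibre and killed by `dg` lies in the distribution, which is transverse to
the fibres. -/
lemma mfderiv_comp_lineMap_injective
    (hg : ContMDiff 𝓘(ℂ, (Fin (p * q) → ℂ) × (Fin (q - 1) → ℂ)) 𝓘(ℂ, Fin k → ℂ) ω g)
    (hker : ∀ z, LinearMap.ker (mfderiv 𝓘(ℂ, (Fin (p * q) → ℂ) × (Fin (q - 1) → ℂ))
      𝓘(ℂ, Fin k → ℂ) g z).toLinearMap = twistorDistribution P covV z)
    (hcV : IsHolomorphicConnection covV)
    (hfin : ∀ z, Module.finrank ℂ (twistorDistribution P covV z) = p) (c : ℙ ℂ (Fin q → ℂ)) :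
    Function.Injective (mfderiv 𝓘(ℂ, Fin (q - 1) → ℂ) 𝓘(ℂ, Fin k → ℂ)
      (fun c => g (lineMap (p * q) b c)) c) := by
  refine (injective_iff_map_eq_zero (mfderiv 𝓘(ℂ, Fin (q - 1) → ℂ) 𝓘(ℂ, Fin k → ℂ)
      (fun c => g (lineMap (p * q) b c)) c).toLinearMap).2 fun t ht => ?_
  have h1 : mfderiv 𝓘(ℂ, Fin (q - 1) → ℂ) 𝓘(ℂ, (Fin (p * q) → ℂ) × (Fin (q - 1) → ℂ))
      (lineMap (p * q) b) c t ∈ twistorDistribution P covV (lineMap (p * q) b c) := by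
    rw [← hker]
    exact (mfderiv_comp_lineMap b hg c t).symm.trans ht
  have h2 : mfderiv 𝓘(ℂ, Fin (q - 1) → ℂ) 𝓘(ℂ, (Fin (p * q) → ℂ) × (Fin (q - 1) → ℂ))
      (lineMap (p * q) b) c t ∈ LinearMap.ker (baseCoord (p * q) V x (lineMap (p * q) b c)) := by
    rw [← range_mfderiv_lineMap]
    exact ⟨t, rfl⟩
  have h3 := eq_zero_of_mem_twistorDistribution P hcV (hfin _) h1 h2
  refine mfderiv_lineMap_injective (n := p * q) (b := b) c (h3.trans ?_)
  exact (map_zero (mfderiv 𝓘(ℂ, Fin (q - 1) → ℂ) 𝓘(ℂ, (Fin (p * q) → ℂ) × (Fin (q - 1) → ℂ))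
    (lineMap (p * q) b) c).toLinearMap).symm

/-- A right inverse of the differential of the projection to `M`. -/
def baseLift (c : ℙ ℂ (Fin q → ℂ)) : (Fin (p * q) → ℂ) →ₗ[ℂ]
    TangentSpace 𝓘(ℂ, (Fin (p * q) → ℂ) × (Fin (q - 1) → ℂ)) (lineMap (p * q) b c) :=
  (LinearMap.exists_rightInverse_of_surjective _
    (LinearMap.range_eq_top.2 (baseCoord_surjective b c))).choose

lemma baseCoord_baseLift (c : ℙ ℂ (Fin q → ℂ)) (a : Fin (p * q) → ℂ) :
    baseCoord (p * q) V x (lineMap (p * q) b c) (baseLift b c a) = a :=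
  LinearMap.congr_fun (LinearMap.exists_rightInverse_of_surjective _
    (LinearMap.range_eq_top.2 (baseCoord_surjective b c))).choose_spec a

variable (g) in
/-- The presentation of the normal bundle of a twistor line as a quotient of the trivial bundle with
fibre `T_x M`. -/
def normalMap (c : ℙ ℂ (Fin q → ℂ)) : (Fin p → Fin q → ℂ) →ₗ[ℂ]
    (normalFamily (m := q - 1) (k := k) (fun c => g (lineMap (p * q) b c))).fib c :=
  Submodule.mkQ (LinearMap.range (mfderiv 𝓘(ℂ, Fin (q - 1) → ℂ) 𝓘(ℂ, Fin k → ℂ)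
      (fun c => g (lineMap (p * q) b c)) c).toLinearMap) ∘ₗ
    (mfderiv 𝓘(ℂ, (Fin (p * q) → ℂ) × (Fin (q - 1) → ℂ)) 𝓘(ℂ, Fin k → ℂ) g
      (lineMap (p * q) b c)).toLinearMap ∘ₗ baseLift b c ∘ₗ P.modelMap b

/-- `baseLift` is an arbitrary choice. Another vector with the same base component differs from it
by one tangent to the fibre, whose image is tangent to the twistor line and vanishes in the normal
space. -/
lemma mk_eq_normalMap (hg : ContMDiff 𝓘(ℂ, (Fin (p * q) → ℂ) × (Fin (q - 1) → ℂ))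
    𝓘(ℂ, Fin k → ℂ) ω g) {c : ℙ ℂ (Fin q → ℂ)} {ξ : Fin p → Fin q → ℂ}
    {v : TangentSpace 𝓘(ℂ, (Fin (p * q) → ℂ) × (Fin (q - 1) → ℂ)) (lineMap (p * q) b c)}
    (hv : baseCoord (p * q) V x (lineMap (p * q) b c) v = P.modelMap b ξ) :
    normalMap (k := k) P b g c ξ = Submodule.mkQ (LinearMap.range (mfderiv 𝓘(ℂ, Fin (q - 1) → ℂ)
      𝓘(ℂ, Fin k → ℂ) (fun c => g (lineMap (p * q) b c)) c).toLinearMap)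
        (mfderiv 𝓘(ℂ, (Fin (p * q) → ℂ) × (Fin (q - 1) → ℂ)) 𝓘(ℂ, Fin k → ℂ) g
          (lineMap (p * q) b c) v) := by
  have h1 : baseLift b c (P.modelMap b ξ) - v ∈
      LinearMap.ker (baseCoord (p * q) V x (lineMap (p * q) b c)) := by
    rw [LinearMap.mem_ker, map_sub, baseCoord_baseLift, hv, sub_self]
  rw [← range_mfderiv_lineMap] at h1
  obtain ⟨t, ht⟩ := h1
  refine (Submodule.Quotient.eq _).2 ⟨t, (mfderiv_comp_lineMap b hg c t).trans ?_⟩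
  refine (congrArg (mfderiv 𝓘(ℂ, (Fin (p * q) → ℂ) × (Fin (q - 1) → ℂ)) 𝓘(ℂ, Fin k → ℂ) g
    (lineMap (p * q) b c)) ht).trans ?_
  exact map_sub (mfderiv 𝓘(ℂ, (Fin (p * q) → ℂ) × (Fin (q - 1) → ℂ)) 𝓘(ℂ, Fin k → ℂ) g
    (lineMap (p * q) b c)).toLinearMap _ _

lemma normalMap_surjective (hg : ContMDiff 𝓘(ℂ, (Fin (p * q) → ℂ) × (Fin (q - 1) → ℂ))
    𝓘(ℂ, Fin k → ℂ) ω g)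
    (hsurj : ∀ z, Function.Surjective (mfderiv 𝓘(ℂ, (Fin (p * q) → ℂ) × (Fin (q - 1) → ℂ))
      𝓘(ℂ, Fin k → ℂ) g z)) (c : ℙ ℂ (Fin q → ℂ)) :
    Function.Surjective (normalMap (k := k) P b g c) := by
  intro t
  obtain ⟨t, rfl⟩ := Submodule.mkQ_surjective (LinearMap.range (mfderiv 𝓘(ℂ, Fin (q - 1) → ℂ)
      𝓘(ℂ, Fin k → ℂ) (fun c => g (lineMap (p * q) b c)) c).toLinearMap) t
  obtain ⟨v, rfl⟩ := hsurj _ t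
  refine ⟨(P.modelEquiv b).symm (baseCoord (p * q) V x (lineMap (p * q) b c) v),
    mk_eq_normalMap P b hg ?_⟩
  rw [← P.modelEquiv_apply, ContinuousLinearEquiv.apply_symm_apply]

/-- The normal space is `T_x M` modulo the projection of the distribution, that is modulo `U_x ⊗ π`.
If the class vanishes, subtracting a fibre vector from the lift brings it into the kernel of `dg`,
which is the distribution, without changing its base component. -/
lemma normalMap_eq_zero_iff (hg : ContMDiff 𝓘(ℂ, (Fin (p * q) → ℂ) × (Fin (q - 1) → ℂ))
    𝓘(ℂ, Fin k → ℂ) ω g)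
    (hker : ∀ z, LinearMap.ker (mfderiv 𝓘(ℂ, (Fin (p * q) → ℂ) × (Fin (q - 1) → ℂ))
      𝓘(ℂ, Fin k → ℂ) g z).toLinearMap = twistorDistribution P covV z)
    (hcV : IsHolomorphicConnection covV) (c : ℙ ℂ (Fin q → ℂ)) (ξ : Fin p → Fin q → ℂ) :
    normalMap (k := k) P b g c ξ = 0 ↔ ∀ j, ξ j ∈ c.submodule := by
  have hsub (j : Fin p) : ξ j ∈ c.submodule ↔ ∃ a : ℂ, a • c.rep = ξ j := by
    rw [Projectivization.submodule_eq, Submodule.mem_span_singleton]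
  simp only [hsub]
  constructor
  · intro h
    obtain ⟨t, ht⟩ := (Submodule.Quotient.mk_eq_zero _).1 h
    have h1 : baseLift b c (P.modelMap b ξ) - mfderiv 𝓘(ℂ, Fin (q - 1) → ℂ)
        𝓘(ℂ, (Fin (p * q) → ℂ) × (Fin (q - 1) → ℂ)) (lineMap (p * q) b) c t ∈
        twistorDistribution P covV (lineMap (p * q) b c) := by
      rw [← hker, LinearMap.mem_ker, map_sub, sub_eq_zero]
      exact ht.symm.trans (mfderiv_comp_lineMap b hg c t)
    have h2 : mfderiv 𝓘(ℂ, Fin (q - 1) → ℂ) 𝓘(ℂ, (Fin (p * q) → ℂ) × (Fin (q - 1) → ℂ))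
        (lineMap (p * q) b) c t ∈
        LinearMap.ker (baseCoord (p * q) V x (lineMap (p * q) b c)) := by
      rw [← range_mfderiv_lineMap]
      exact ⟨t, rfl⟩
    obtain ⟨a, ha⟩ := exists_modelMap_of_mem_twistorDistribution P c.rep_nonzero c.mk_rep h1
    rw [map_sub, LinearMap.mem_ker.1 h2, sub_zero, baseCoord_baseLift] at ha
    exact fun j => ⟨a j, (congrFun (P.modelMap_injective ha) j).symm⟩
  · intro h
    choose a ha using h
    obtain ⟨v, hv, hva⟩ := exists_mem_twistorDistribution_modelMap P hcV c.rep_nonzero c.mk_rep a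
    rw [← hker] at hv
    have h1 : (fun j => a j • c.rep) = ξ := funext ha
    rw [h1] at hva
    refine (mk_eq_normalMap P b hg hva).trans ?_
    exact (congrArg _ hv).trans (map_zero _)

/-- Holomorphic fields along the twistor line lift through the surjective analytic family `dg` to
fields along the fibre, and the base components of these give `ξ`. Conversely a function `ξ` is
lifted with zero vertical component in a chart of `P(V)`. -/
lemma isQuotientOf_normalFamily (hg : ContMDiff 𝓘(ℂ, (Fin (p * q) → ℂ) × (Fin (q - 1) → ℂ))
    𝓘(ℂ, Fin k → ℂ) ω g)
    (hsurj : ∀ z, Function.Surjective (mfderiv 𝓘(ℂ, (Fin (p * q) → ℂ) × (Fin (q - 1) → ℂ))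
      𝓘(ℂ, Fin k → ℂ) g z)) :
    (normalFamily (m := q - 1) (k := k) (fun c => g (lineMap (p * q) b c))).IsQuotientOf (q - 1)
      (normalMap (k := k) P b g) := by
  classical
  refine ⟨normalMap_surjective P b hg hsurj, fun s c => ?_⟩
  obtain ⟨i, hi⟩ := exists_mem_chart_source (lineMap (p * q) b c)
  change lineMap (p * q) b c ∈ (projChart (lineMap (p * q) b c) i).source at hi
  set φ := projChart (lineMap (p * q) b c) i with hφ
  have hφa : φ ∈ atlas _ _ := projChart_mem_atlas _ i
  have hf : ContMDiff 𝓘(ℂ, Fin (q - 1) → ℂ) 𝓘(ℂ, Fin k → ℂ) ω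
      (fun c => g (lineMap (p * q) b c)) := hg.comp contMDiff_lineMap
  set e := chartAt (Fin k → ℂ) (g (lineMap (p * q) b c)) with he
  have hea : e ∈ atlas (Fin k → ℂ) Y := chart_mem_atlas _ _
  have hes : g (lineMap (p * q) b c) ∈ e.source := mem_chart_source _ _
  obtain ⟨hG, hev⟩ := eventually_mfderiv_chart_comp hφa hi hea hes hg
  replace hev := (contMDiff_lineMap (n := p * q) (b := b) c).continuousAt.eventually hev
  let A (y : ℙ ℂ (Fin q → ℂ)) : (Fin (p * q) → ℂ) × (Fin (q - 1) → ℂ) →L[ℂ] (Fin k → ℂ) :=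
    fderiv ℂ (e ∘ g ∘ φ.symm) (φ (lineMap (p * q) b y))
  have hA : ContMDiffAt 𝓘(ℂ, Fin (q - 1) → ℂ)
      𝓘(ℂ, (Fin (p * q) → ℂ) × (Fin (q - 1) → ℂ) →L[ℂ] (Fin k → ℂ)) ω A c :=
    ContMDiffAt.comp (g := fderiv ℂ (e ∘ g ∘ φ.symm)) c
      (hG.fderiv_right (m := ω) (by simp)).contMDiffAt (contMDiffAt_projChart_lineMap hi)
  have hAv : ∀ᶠ y in 𝓝 c, ∃ (h : lineMap (p * q) b y ∈ φ.source)
      (h' : g (lineMap (p * q) b y) ∈ e.source), ∀ u : (Fin (p * q) → ℂ) × (Fin (q - 1) → ℂ),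
      chartDeriv hea h' (mfderiv 𝓘(ℂ, (Fin (p * q) → ℂ) × (Fin (q - 1) → ℂ)) 𝓘(ℂ, Fin k → ℂ) g
        (lineMap (p * q) b y) ((chartDeriv hφa h).symm u)) = A y u := by
    filter_upwards [hev] with y hy
    refine ⟨hy.1, hy.2.1, fun u => (hy.2.2 _).trans ?_⟩
    exact congrArg (A y) ((chartDeriv hφa hy.1).apply_symm_apply u)
  have hbase {y : ℙ ℂ (Fin q → ℂ)} (h : lineMap (p * q) b y ∈ φ.source)
      (u : (Fin (p * q) → ℂ) × (Fin (q - 1) → ℂ)) :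
      baseCoord (p * q) V x (lineMap (p * q) b y) ((chartDeriv hφa h).symm u) = u.1 :=
    (fst_mfderiv_projChart h _).symm.trans
      (congrArg Prod.fst ((chartDeriv hφa h).apply_symm_apply u))
  constructor
  · rintro ⟨t, ht, hs⟩
    have ht' := (contMDiffAt_tangent_iff (hf c) t).1 ht
    have hAc : Function.Surjective (A c) := by
      obtain ⟨h, h', hu⟩ := hAv.self_of_nhds
      intro a
      obtain ⟨v, hv⟩ := hsurj _ ((chartDeriv hea h').symm a)
      refine ⟨chartDeriv hφa h v, ?_⟩
      rw [← hu, LinearEquiv.symm_apply_apply]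
      exact (congrArg (chartDeriv hea h') hv).trans ((chartDeriv hea h').apply_symm_apply a)
    obtain ⟨u, hu, hAu⟩ := exists_contMDiffAt_lift hA hAc ht'
    refine ⟨fun y => (P.modelEquiv b).symm (u y).1, ?_, ?_⟩
    · exact ContMDiffAt.comp (g := (P.modelEquiv b).symm) c
        (P.modelEquiv b).symm.contDiff.contMDiff.contMDiffAt
        (ContMDiffAt.comp (g := Prod.fst) c contDiff_fst.contMDiff.contMDiffAt hu)
    · filter_upwards [hs, hAu, hAv] with y hsy huy hy
      obtain ⟨h, h', hy⟩ := hy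
      have h1 : baseCoord (p * q) V x (lineMap (p * q) b y) ((chartDeriv hφa h).symm (u y)) =
          P.modelMap b ((P.modelEquiv b).symm (u y).1) := by
        rw [hbase, ← P.modelEquiv_apply, ContinuousLinearEquiv.apply_symm_apply]
      rw [hsy, mk_eq_normalMap P b hg h1]
      have h2 : t y = mfderiv 𝓘(ℂ, (Fin (p * q) → ℂ) × (Fin (q - 1) → ℂ)) 𝓘(ℂ, Fin k → ℂ) g
          (lineMap (p * q) b y) ((chartDeriv hφa h).symm (u y)) :=
        (chartDeriv hea h').injective (((hy (u y)).trans huy).symm)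
      rw [h2]
      rfl
  · rintro ⟨ξ, hξ, hs⟩
    let t (y : ℙ ℂ (Fin q → ℂ)) : TangentSpace 𝓘(ℂ, Fin k → ℂ) (g (lineMap (p * q) b y)) :=
      if h : lineMap (p * q) b y ∈ φ.source then
        mfderiv 𝓘(ℂ, (Fin (p * q) → ℂ) × (Fin (q - 1) → ℂ)) 𝓘(ℂ, Fin k → ℂ) g
          (lineMap (p * q) b y) ((chartDeriv hφa h).symm (P.modelEquiv b (ξ y), 0))
      else 0
    refine ⟨t, (contMDiffAt_tangent_iff (hf c) t).2 ?_, ?_⟩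
    · have h1 : ContMDiffAt 𝓘(ℂ, Fin (q - 1) → ℂ)
          𝓘(ℂ, (Fin (p * q) → ℂ) × (Fin (q - 1) → ℂ)) ω
          (fun y => ((P.modelEquiv b (ξ y), 0) : (Fin (p * q) → ℂ) × (Fin (q - 1) → ℂ))) c :=
        ContMDiffAt.comp (g := fun a => ((P.modelEquiv b a, 0) :
            (Fin (p * q) → ℂ) × (Fin (q - 1) → ℂ))) c
          ((P.modelEquiv b).contDiff.prodMk contDiff_const).contMDiff.contMDiffAt hξ
      refine (hA.clm_apply h1).congr_of_eventuallyEq ?_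
      filter_upwards [hAv] with y hy
      obtain ⟨h, h', hy⟩ := hy
      simp only [t, dif_pos h]
      exact hy _
    · filter_upwards [hs, hAv] with y hsy hy
      obtain ⟨h, h', hy⟩ := hy
      rw [hsy]
      simp only [t, dif_pos h]
      exact mk_eq_normalMap P b hg (hbase h _)

end NormalBundle

/-! ### Twistor lines -/

section TwistorLine

variable {p q : ℕ} {M : Type*} [TopologicalSpace M] [ChartedSpace (Fin (p * q) → ℂ) M]
  [IsManifold 𝓘(ℂ, Fin (p * q) → ℂ) ω M]
  {U V : M → Type*}
  [TopologicalSpace (TotalSpace (Fin p → ℂ) U)]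
  [∀ x, AddCommGroup (U x)] [∀ x, Module ℂ (U x)] [∀ x, TopologicalSpace (U x)]
  [∀ x, IsTopologicalAddGroup (U x)] [∀ x, ContinuousSMul ℂ (U x)]
  [FiberBundle (Fin p → ℂ) U] [VectorBundle ℂ (Fin p → ℂ) U]
  [ContMDiffVectorBundle ω (Fin p → ℂ) U 𝓘(ℂ, Fin (p * q) → ℂ)]
  [TopologicalSpace (TotalSpace (Fin q → ℂ) V)]
  [∀ x, AddCommGroup (V x)] [∀ x, Module ℂ (V x)] [∀ x, TopologicalSpace (V x)]
  [∀ x, IsTopologicalAddGroup (V x)] [∀ x, ContinuousSMul ℂ (V x)]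
  [FiberBundle (Fin q → ℂ) V] [VectorBundle ℂ (Fin q → ℂ) V]
  [ContMDiffVectorBundle ω (Fin q → ℂ) V 𝓘(ℂ, Fin (p * q) → ℂ)]
  (P : ParaconformalStructure p q U V)
  {covV : CovariantDerivative 𝓘(ℂ, Fin (p * q) → ℂ) (Fin q → ℂ) V}
  {x : M} (b : (Fin q → ℂ) ≃ₗ[ℂ] V x)
  {k : ℕ} {Y : Type*} [TopologicalSpace Y] [ChartedSpace (Fin k → ℂ) Y]
  [IsManifold 𝓘(ℂ, Fin k → ℂ) ω Y] {g : ProjBundle (p * q) q V → Y}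

open ProjBundle

/-- The normal bundle of a twistor line is `(⊕_1^p H^{-1}) ⊗ T(P_{q-1})`. -/
theorem nonempty_iso_normalFamily
    (hg : ContMDiff 𝓘(ℂ, (Fin (p * q) → ℂ) × (Fin (q - 1) → ℂ)) 𝓘(ℂ, Fin k → ℂ) ω g)
    (hsurj : ∀ z, Function.Surjective (mfderiv 𝓘(ℂ, (Fin (p * q) → ℂ) × (Fin (q - 1) → ℂ))
      𝓘(ℂ, Fin k → ℂ) g z))
    (hker : ∀ z, LinearMap.ker (mfderiv 𝓘(ℂ, (Fin (p * q) → ℂ) × (Fin (q - 1) → ℂ))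
      𝓘(ℂ, Fin k → ℂ) g z).toLinearMap = twistorDistribution P covV z)
    (hcV : IsHolomorphicConnection covV) :
    Nonempty (HolFamily.Iso
      (normalFamily (m := q - 1) (k := k) (fun c => g (lineMap (p * q) b c)))
      (((tautologicalFamily q).directSum p).tensor (tangentFamily (q - 1) (ℙ ℂ (Fin q → ℂ))))) := by
  -- In both presentations the kernel consists of the `ξ` with every component on the line `c`.
  refine (isQuotientOf_normalFamily P b hg hsurj).nonempty_iso isQuotientOf_normalModel fun c => ?_
  ext ξ
  exact (normalMap_eq_zero_iff P b hg hker hcV c ξ).trans (normalModelMap_eq_zero_iff c ξ).symm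

/-- The conormal bundle of a twistor line is `⊕_1^p Ω¹(1)`. -/
theorem nonempty_iso_conormalFamily
    (hg : ContMDiff 𝓘(ℂ, (Fin (p * q) → ℂ) × (Fin (q - 1) → ℂ)) 𝓘(ℂ, Fin k → ℂ) ω g)
    (hsurj : ∀ z, Function.Surjective (mfderiv 𝓘(ℂ, (Fin (p * q) → ℂ) × (Fin (q - 1) → ℂ))
      𝓘(ℂ, Fin k → ℂ) g z))
    (hker : ∀ z, LinearMap.ker (mfderiv 𝓘(ℂ, (Fin (p * q) → ℂ) × (Fin (q - 1) → ℂ))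
      𝓘(ℂ, Fin k → ℂ) g z).toLinearMap = twistorDistribution P covV z)
    (hcV : IsHolomorphicConnection covV) :
    Nonempty (HolFamily.Iso
      ((normalFamily (m := q - 1) (k := k) (fun c => g (lineMap (p * q) b c))).dual (q - 1))
      ((twistedCotangentFamily q).directSum p)) := by
  have hA := isQuotientOf_normalFamily P b hg hsurj
  -- Both images consist of the linear forms that vanish on every `ξ` with all components on the
  -- line `c`.
  refine hA.dual.nonempty_iso (isSubOf_twistedCotangentFamily.directSum p) fun c => ?_
  ext l
  refine (HolFamily.mem_range_dualMap_iff l (hA.surjective c)).trans (Iff.trans ?_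
    (HolFamily.mem_range_lsum_iff (conormalModelMap c ⟨c.rep, rep_mem c⟩) l).symm)
  simp only [normalMap_eq_zero_iff P b hg hker hcV, mem_range_conormalModelMap_iff]
  constructor
  · intro h j η hη
    refine h _ fun j' => ?_
    rw [LinearMap.single_apply, Pi.single_apply]
    split_ifs
    exacts [hη, zero_mem _]
  · intro h ξ hξ
    rw [← Finset.univ_sum_single ξ, map_sum]
    exact Finset.sum_eq_zero fun j _ => h j (ξ j) (hξ j)

/-- Twistor lines are holomorphically embedded. -/
theorem isSmoothEmbedding_twistorLine [T2Space Y] (hk : k = (p + 1) * (q - 1))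
    (hg : ContMDiff 𝓘(ℂ, (Fin (p * q) → ℂ) × (Fin (q - 1) → ℂ)) 𝓘(ℂ, Fin k → ℂ) ω g)
    (hker : ∀ z, LinearMap.ker (mfderiv 𝓘(ℂ, (Fin (p * q) → ℂ) × (Fin (q - 1) → ℂ))
      𝓘(ℂ, Fin k → ℂ) g z).toLinearMap = twistorDistribution P covV z)
    (hcV : IsHolomorphicConnection covV)
    (hfin : ∀ z, Module.finrank ℂ (twistorDistribution P covV z) = p)
    (hinj : ∀ z w : ProjBundle (p * q) q V, g z = g w → z.base = w.base → z = w) :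
    Manifold.IsSmoothEmbedding 𝓘(ℂ, Fin (q - 1) → ℂ) 𝓘(ℂ, Fin k → ℂ) ω
      (fun c => g (lineMap (p * q) b c)) :=
  -- `p (q - 1)` is the rank of the normal bundle.
  isSmoothEmbedding_of_injective (l := p * (q - 1)) (by rw [hk]; ring)
    (hg.comp contMDiff_lineMap)
    (fun _ _ h => lineMap_injective b (hinj _ _ h rfl))
    (mfderiv_comp_lineMap_injective P b hg hker hcV hfin)

end TwistorLine

end

theorem mainTheorem3 {p q : ℕ} (hp : 2 ≤ p) (hq : 2 ≤ q)
    {M : Type*} [TopologicalSpace M] [T2Space M] [SecondCountableTopology M]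
    [ChartedSpace (Fin (p * q) → ℂ) M] [IsManifold 𝓘(ℂ, Fin (p * q) → ℂ) ω M]
    {U V : M → Type*}
    [TopologicalSpace (TotalSpace (Fin p → ℂ) U)]
    [∀ x, AddCommGroup (U x)] [∀ x, Module ℂ (U x)] [∀ x, TopologicalSpace (U x)]
    [∀ x, IsTopologicalAddGroup (U x)] [∀ x, ContinuousSMul ℂ (U x)]
    [FiberBundle (Fin p → ℂ) U] [VectorBundle ℂ (Fin p → ℂ) U]
    [ContMDiffVectorBundle ω (Fin p → ℂ) U 𝓘(ℂ, Fin (p * q) → ℂ)]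
    [TopologicalSpace (TotalSpace (Fin q → ℂ) V)]
    [∀ x, AddCommGroup (V x)] [∀ x, Module ℂ (V x)] [∀ x, TopologicalSpace (V x)]
    [∀ x, IsTopologicalAddGroup (V x)] [∀ x, ContinuousSMul ℂ (V x)]
    [FiberBundle (Fin q → ℂ) V] [VectorBundle ℂ (Fin q → ℂ) V]
    [ContMDiffVectorBundle ω (Fin q → ℂ) V 𝓘(ℂ, Fin (p * q) → ℂ)]
    (P : ParaconformalStructure p q U V) (S : Scale p q U V)
    (covU : CovariantDerivative 𝓘(ℂ, Fin (p * q) → ℂ) (Fin p → ℂ) U)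
    (covV : CovariantDerivative 𝓘(ℂ, Fin (p * q) → ℂ) (Fin q → ℂ) V)
    (hcov : P.IsScaleConnection covU covV S) (hflat : P.IsRightFlat covU covV) :
    IsIntegrableDistribution p ((p + 1) * (q - 1)) (twistorDistribution P covV) ∧
    (HasGoodQuotient (twistorDistribution P covV) →
      ∃ (_ : ChartedSpace (Fin ((p + 1) * (q - 1)) → ℂ) (LeafSpace (twistorDistribution P covV)))
        (_ : IsManifold 𝓘(ℂ, Fin ((p + 1) * (q - 1)) → ℂ) ω
          (LeafSpace (twistorDistribution P covV))),
        T2Space (LeafSpace (twistorDistribution P covV)) ∧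
        SecondCountableTopology (LeafSpace (twistorDistribution P covV)) ∧
        ContMDiff 𝓘(ℂ, (Fin (p * q) → ℂ) × (Fin (q - 1) → ℂ))
          𝓘(ℂ, Fin ((p + 1) * (q - 1)) → ℂ) ω (leafOf (twistorDistribution P covV)) ∧
        (∀ z : ProjBundle (p * q) q V,
          Function.Surjective (mfderiv 𝓘(ℂ, (Fin (p * q) → ℂ) × (Fin (q - 1) → ℂ))
            𝓘(ℂ, Fin ((p + 1) * (q - 1)) → ℂ) (leafOf (twistorDistribution P covV)) z) ∧
          LinearMap.ker (mfderiv 𝓘(ℂ, (Fin (p * q) → ℂ) × (Fin (q - 1) → ℂ))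
            𝓘(ℂ, Fin ((p + 1) * (q - 1)) → ℂ)
            (leafOf (twistorDistribution P covV)) z).toLinearMap =
            twistorDistribution P covV z) ∧
        ∀ (x : M) (b : (Fin q → ℂ) ≃ₗ[ℂ] V x),
          Manifold.IsSmoothEmbedding 𝓘(ℂ, Fin (q - 1) → ℂ) 𝓘(ℂ, Fin ((p + 1) * (q - 1)) → ℂ) ω
            (twistorLine (twistorDistribution P covV) x b) ∧
          Nonempty (HolFamily.Iso
            (normalFamily (m := q - 1) (k := (p + 1) * (q - 1))
              (twistorLine (twistorDistribution P covV) x b))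
            (((tautologicalFamily q).directSum p).tensor
              (tangentFamily (q - 1) (ℙ ℂ (Fin q → ℂ))))) ∧
          Nonempty (HolFamily.Iso
            ((normalFamily (m := q - 1) (k := (p + 1) * (q - 1))
              (twistorLine (twistorDistribution P covV) x b)).dual (q - 1))
            ((twistedCotangentFamily q).directSum p))) := by
  have hD := isIntegrableDistribution_twistorDistribution P hcov.holomorphic_U hcov.holomorphic_V hp
    (by omega) hcov.traceFree hflat
  refine ⟨hD, fun hQ => ?_⟩
  let := leafSpaceCharts hD hQ.regular
  have := isManifold_leafSpace hD hQ.regular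
  have := hQ.hausdorff
  have hsub := leafOf_submersion hD hQ.regular
  have hg : ContMDiff 𝓘(ℂ, (Fin (p * q) → ℂ) × (Fin (q - 1) → ℂ))
      𝓘(ℂ, Fin ((p + 1) * (q - 1)) → ℂ) ω (leafOf (twistorDistribution P covV)) :=
    fun z => (hsub z).1
  -- Second countability descends to the leaf space along the open quotient map.
  have := ProjBundle.secondCountableTopology (n := p * q) (q := q) (V := V) (by omega : 1 ≤ q)
  exact ⟨leafSpaceCharts hD hQ.regular, isManifold_leafSpace hD hQ.regular, hQ.hausdorff,
    Topology.IsQuotientMap.secondCountableTopology isQuotientMap_quotient_mk' (isOpenMap_leafOf hD),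
    hg, fun z => (hsub z).2, fun x b =>
    ⟨isSmoothEmbedding_twistorLine P b rfl hg (fun z => (hsub z).2.2) hcov.holomorphic_V
      (fun z => (hD z).1) hQ.fibre_injective,
    nonempty_iso_normalFamily P b hg (fun z => (hsub z).2.1) (fun z => (hsub z).2.2)
      hcov.holomorphic_V,
    nonempty_iso_conormalFamily P b hg (fun z => (hsub z).2.1) (fun z => (hsub z).2.2)
      hcov.holomorphic_V⟩⟩
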